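/- Work in intuitionistic higher-order logic, interpreted in an arbitrary elementary topos $\mathcal E$ with a natural numbers object $\mathbb N$ (no excluded middle and no choice are assumed; "set" means object of $\mathcal E$). Let $\Omega$ be the object of truth values and let $\Sigma\subseteq\Omega$ contain $\top$ and be closed under binary conjunction. A subset $V\subseteq X$ is *open* if the truth value of $x\in V$ is in $\Sigma$ for every $x\in X$. A subset $A\subseteq X$ is *subovert* in $X$ if for every open $V\subseteq X$ the truth value of $\exists x\in A.\ x\in V$ is in $\Sigma$; a set is *overt* if it is subovert in itself. Assume that $\emptyset$ (equivalently, $\bot\in\Sigma$) and $\mathbb N$ are overt. A subset $A\subseteq X$ is a *subspace* of $X$ if every $B\subseteq A$ which is open as a subset of $A$ has the form $A\cap V$ with $V\subseteq X$ open. *Real numbers.* $\mathbb R$ is the set of open Dedekind cuts $(L,U)$ of rational numbers: $L,U\subseteq\mathbb Q$ are inhabited, open and disjoint, $q\in L\iff\exists r\in L.\ q<r$, $q\in U\iff\exists r\in U.\ r<q$, and $q<r$ implies $q\in L\vee r\in U$. One has $a<b$ iff some rational number lies in $U_a\cap L_b$, and $a\le b$ iff $\neg(b<a)$. *Metric spaces.*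 Metrics and pseudometrics $d:X\times X\to\mathbb R$ are defined by the usual axioms, and $B(x,r)=\{y\in X\mid d(x,y)<r\}$ for $r\in\mathbb R$. A subset is *metrically dense* if it meets every ball of positive radius. $(X,d)$ is *metrically separable* if there is a map $s:\mathbb N\to X+1$ whose values in $X$ form a metrically dense subset. $(X,d)$ is *complete* if for every pseudometric space $Y$ and every isometry $f:X\to Y$ with metrically dense image there is a unique isometry $h:Y\to X$ with $h\circ f=\mathrm{id}_X$. The metric space $(X,d)$ is *metrized* if the balls $B(x,r)$ form a basis for its intrinsic topology: for every open $V\subseteq X$ there is a subovert subset $A\subseteq X\times\mathbb R$ with $V=\bigcup_{(x,r)\in A}B(x,r)$. *Located subsets.* A subset $A\subseteq X$ is *located* if for every $x\in X$ there is a real number $d(A,x)$ which is the strict infimum of the distances from points of $A$ to $x$, that is, for all $t\in\mathbb R$: $d(A,x)<t$ iff $d(a,x)<t$ for some $a\in A$. It is *strongly located* if moreover $A=\{x\in X\mid d(A,x)=0\}$. *Urysohn spaces.* A *Urysohn space* is a complete metric space $(U,d)$ together with a sequence $u:\mathbb N\to U$ with metrically dense image and a map $E:P\to U$, where $P$ is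 the set of all finite sequences $(x_i,\omega_i)_{i<n}$ in $U\times\mathbb R_{\ge0}$ with $\omega_i-\omega_j\le d(x_i,x_j)\le\omega_i+\omega_j$ for all $i,j<n$, such that $d\big(E((x_i,\omega_i)_{i<n}),x_k\big)=\omega_k$ for all $k<n$. **Theorem 4.56.** Assume that every strongly located subset of every metric space is a subspace. If some (no matter which) Urysohn space is metrized, then every complete metrically separable metric space is metrized. -/

import Mathlib

/-!
# Synthetic topology in an elementary topos

The ambient universe is an arbitrary elementary topos `E` (a category with finite limits,
exponentials and a subobject classifier) with a natural numbers object.  "Sets" are the objects of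
`E`, and mathematics inside `E` is intuitionistic: neither excluded middle nor any form of choice is
available.  The file first fixes the standard internal (Lambek-Scott) higher-order logic of `E`, and
then defines, in that logic, open subsets, overtness, the real numbers, metric spaces, completeness,
locatedness, metrization and Urysohn spaces.
-/

universe v u

open CategoryTheory MonoidalCategory CartesianMonoidalCategory

noncomputable section

namespace SynTop

/-! ## The internal logic of an elementary topos

At stage `Γ`, an element of `X` is a morphism `Γ ⟶ X` and a proposition is a morphism `Γ ⟶ Ω E`.
A variable of sort `X` is introduced by passing from the stage `Γ` to the stage `X ⊗ Γ`. -/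

section Logic

variable {E : Type u} [Category.{v} E] [CartesianMonoidalCategory E] [MonoidalClosed E]
  [Limits.HasFiniteLimits E] [HasSubobjectClassifier E]

/-- The object of truth values. -/
abbrev Om (E : Type u) [Category.{v} E] [HasSubobjectClassifier E] : E := HasSubobjectClassifier.Ω E

/-- Weakening: an element at stage `Γ`, regarded as an element at the stage `A ⊗ Γ` at which one
more variable has been introduced. -/
abbrev wk {A Γ X : E} (x : Γ ⟶ X) : A ⊗ Γ ⟶ X := snd A Γ ≫ x

local postfix:max "⇧" => wk

/-- Internal equality: the classifying map of the equalizer. -/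
def eqq {Γ X : E} (x y : Γ ⟶ X) : Γ ⟶ Om E :=
  HasSubobjectClassifier.χ (Limits.equalizer.ι x y)

local infix:45 " ≐ " => eqq

/-- Truth. -/
def tru (Γ : E) : Γ ⟶ Om E := HasSubobjectClassifier.χ (𝟙 Γ)

/-- Validity of a proposition at stage `Γ`. -/
def Holds {Γ : E} (p : Γ ⟶ Om E) : Prop := p = tru Γ

/-- Conjunction. -/
def and {Γ : E} (p q : Γ ⟶ Om E) : Γ ⟶ Om E := lift p q ≐ lift (tru Γ) (tru Γ)

local infixr:35 " ⋏ " => and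

/-- Implication. -/
def imp {Γ : E} (p q : Γ ⟶ Om E) : Γ ⟶ Om E := (p ⋏ q) ≐ p

local infixr:25 " ⇛ " => imp

/-- Logical equivalence. -/
def iff {Γ : E} (p q : Γ ⟶ Om E) : Γ ⟶ Om E := (p ⇛ q) ⋏ (q ⇛ p)

local infix:20 " ⟺ " => iff

/-- The power object. -/
abbrev Pow (X : E) : E := (ihom X).obj (Om E)

/-- The evaluation map, i.e. the membership relation. -/
abbrev memHom (X : E) : X ⊗ Pow X ⟶ Om E := MonoidalClosed.uncurry (𝟙 (Pow X))

/-- Membership. -/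
def mem {Γ X : E} (x : Γ ⟶ X) (A : Γ ⟶ Pow X) : Γ ⟶ Om E := lift x A ≫ memHom X

local infix:50 " ∊ " => mem

/-- The subset `{x ∈ X | φ x}`; the argument of `φ` is the new variable. -/
def sep {Γ : E} (X : E) (φ : (X ⊗ Γ ⟶ X) → (X ⊗ Γ ⟶ Om E)) : Γ ⟶ Pow X :=
  MonoidalClosed.curry (φ (fst X Γ))

/-- Universal quantification over `X`. -/
def all {Γ : E} (X : E) (φ : (X ⊗ Γ ⟶ X) → (X ⊗ Γ ⟶ Om E)) : Γ ⟶ Om E :=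
  sep X φ ≐ sep X fun _ => tru (X ⊗ Γ)

/-- Falsity. -/
def fls (Γ : E) : Γ ⟶ Om E := all (Om E) fun r => r

/-- Negation. -/
def neg {Γ : E} (p : Γ ⟶ Om E) : Γ ⟶ Om E := p ⇛ fls Γ

/-- Disjunction (the impredicative definition, valid in every topos). -/
def or {Γ : E} (p q : Γ ⟶ Om E) : Γ ⟶ Om E :=
  all (Om E) fun r => ((p⇧ ⇛ r) ⋏ (q⇧ ⇛ r)) ⇛ r

local infixr:30 " ⋎ " => or

/-- Existential quantification over `X` (the impredicative definition, valid in every topos). -/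
def ex {Γ : E} (X : E) (φ : (X ⊗ Γ ⟶ X) → (X ⊗ Γ ⟶ Om E)) : Γ ⟶ Om E :=
  all (Om E) fun r => (all X fun _ => (X ◁ snd (Om E) Γ ≫ φ (fst X Γ)) ⇛ r⇧) ⇛ r

/-- The object `{x ∈ X | φ x}` for a property `φ` of elements of `X`, ... -/
abbrev Compr {X : E} (φ : X ⟶ Om E) : E := Limits.equalizer φ (tru X)

/-- ... and its inclusion into `X`. -/
abbrev incl {X : E} (φ : X ⟶ Om E) : Compr φ ⟶ X := Limits.equalizer.ι φ (tru X)

/-- The inclusion of subsets of `X`. -/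
def sub {Γ X : E} (A B : Γ ⟶ Pow X) : Γ ⟶ Om E := all X fun x => x ∊ A⇧ ⇛ x ∊ B⇧

/-- The image of a map, as a subset of the codomain. -/
def image {X Y : E} (f : X ⟶ Y) : 𝟙_ E ⟶ Pow Y :=
  sep Y fun y => ex X fun x => (x ≫ f) ≐ y⇧

end Logic

/-! ## Natural numbers, open subsets -/

section Setting

variable (E : Type u) [Category.{v} E] [CartesianMonoidalCategory E] [MonoidalClosed E]
  [Limits.HasFiniteLimits E] [HasSubobjectClassifier E]

local postfix:max "⇧" => wk
local infix:45 " ≐ " => eqq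
local infixr:35 " ⋏ " => and
local infixr:25 " ⇛ " => imp
local infix:20 " ⟺ " => iff
local infix:50 " ∊ " => mem
local infixr:30 " ⋎ " => or

/-- A natural numbers object. -/
structure NNO where
  /-- the object of natural numbers -/
  N : E
  /-- zero -/
  zero : 𝟙_ E ⟶ N
  /-- the successor map -/
  succ : N ⟶ N
  /-- definition of sequences by recursion -/
  existsUnique_rec : ∀ {A : E} (a : 𝟙_ E ⟶ A) (f : A ⟶ A),
    ∃! h : N ⟶ A, zero ≫ h = a ∧ succ ≫ h = h ≫ f

/-- The setting of synthetic topology: a natural numbers object and a set `Σ` of truth values, given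
by its characteristic map `open_`, such that `Σ` contains `⊤`, is closed under binary conjunctions,
contains `⊥` (that is, the empty set is overt), and such that the set of natural numbers is overt. -/
structure SynthTopology extends NNO E where
  /-- the characteristic map of `Σ ⊆ Ω` -/
  open_ : Om E ⟶ Om E
  /-- `⊤ ∈ Σ` -/
  open_true : Holds (tru (𝟙_ E) ≫ open_)
  /-- `p, q ∈ Σ` implies `p ∧ q ∈ Σ` -/
  open_and : ∀ {Γ : E} (p q : Γ ⟶ Om E), Holds (p ≫ open_) → Holds (q ≫ open_) →
    Holds ((p ⋏ q) ≫ open_)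
  /-- `⊥ ∈ Σ` -/
  open_false : Holds (fls (𝟙_ E) ≫ open_)
  /-- `ℕ` is overt: `(∃ n, n ∈ V) ∈ Σ` for every open subset `V` of `ℕ` -/
  overt_nat : Holds (Γ := 𝟙_ E) (all (Pow N) fun V =>
    (all N fun n => (n ∊ V⇧) ≫ open_) ⇛ (ex N fun n => n ∊ V⇧) ≫ open_)

end Setting

section Topology

variable {E : Type u} [Category.{v} E] [CartesianMonoidalCategory E] [MonoidalClosed E]
  [Limits.HasFiniteLimits E] [HasSubobjectClassifier E]

local postfix:max "⇧" => wk
local infix:45 " ≐ " => eqq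
local infixr:35 " ⋏ " => and
local infixr:25 " ⇛ " => imp
local infix:20 " ⟺ " => iff
local infix:50 " ∊ " => mem
local infixr:30 " ⋎ " => or

namespace NNO

variable (T : NNO E)

/-- The map `N ⟶ A` defined by recursion from `a` and `f`. -/
def recur {A : E} (a : 𝟙_ E ⟶ A) (f : A ⟶ A) : T.N ⟶ A := (T.existsUnique_rec a f).choose

/-- Addition `(m, n) ↦ m + n`, by recursion on `n`. -/
def addHom : T.N ⊗ T.N ⟶ T.N :=
  MonoidalClosed.uncurry (T.recur (A := (ihom T.N).obj T.N)
    (MonoidalClosed.curry (fst T.N (𝟙_ E))) ((ihom T.N).map T.succ))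

/-- Addition of elements. -/
def natAdd {Γ : E} (m n : Γ ⟶ T.N) : Γ ⟶ T.N := lift m n ≫ T.addHom

/-- Multiplication `(m, n) ↦ m * n`, by recursion on `n`: one has `m * 0 = 0` and
`m * (n + 1) = m * n + m`. -/
def mulHom : T.N ⊗ T.N ⟶ T.N :=
  MonoidalClosed.uncurry (T.recur (A := (ihom T.N).obj T.N)
    (MonoidalClosed.curry (snd T.N (𝟙_ E) ≫ T.zero))
    (MonoidalClosed.curry
      (T.natAdd (MonoidalClosed.uncurry (𝟙 ((ihom T.N).obj T.N))) (fst T.N ((ihom T.N).obj T.N)))))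

/-- Multiplication of elements. -/
def natMul {Γ : E} (m n : Γ ⟶ T.N) : Γ ⟶ T.N := lift m n ≫ T.mulHom

/-- The strict order of `ℕ`: `m < n` when `m + k + 1 = n` for some `k`. -/
def natLt {Γ : E} (m n : Γ ⟶ T.N) : Γ ⟶ Om E := ex T.N fun k => (T.natAdd m⇧ k ≫ T.succ) ≐ n⇧

/-! ### Rational numbers

A rational number is presented by a formal fraction `(a - b) / (c + 1)` with natural `a`, `b`, `c`.
Different fractions may present the same rational number; the order is computed by
cross-multiplication and does not distinguish such fractions, so that cuts of formal fractions are the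
same as cuts of rational numbers. -/

/-- The object of formal fractions. -/
abbrev Q : E := T.N ⊗ (T.N ⊗ T.N)

/-- The natural number `a` in `(a - b) / (c + 1)`. -/
abbrev pos {Γ : E} (q : Γ ⟶ T.Q) : Γ ⟶ T.N := q ≫ fst _ _

/-- The natural number `b` in `(a - b) / (c + 1)`. -/
abbrev sbt {Γ : E} (q : Γ ⟶ T.Q) : Γ ⟶ T.N := (q ≫ snd _ _) ≫ fst _ _

/-- The natural number `c` in `(a - b) / (c + 1)`. -/
abbrev prd {Γ : E} (q : Γ ⟶ T.Q) : Γ ⟶ T.N := (q ≫ snd _ _) ≫ snd _ _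

/-- The denominator `c + 1` of `(a - b) / (c + 1)`. -/
abbrev den {Γ : E} (q : Γ ⟶ T.Q) : Γ ⟶ T.N := T.prd q ≫ T.succ

/-- The strict order of rational numbers: `(a - b) / c < (x - y) / z` when
`a * z + y * c < x * c + b * z`. -/
def qlt {Γ : E} (q r : Γ ⟶ T.Q) : Γ ⟶ Om E :=
  T.natLt (T.natAdd (T.natMul (T.pos q) (T.den r)) (T.natMul (T.sbt r) (T.den q)))
    (T.natAdd (T.natMul (T.pos r) (T.den q)) (T.natMul (T.sbt q) (T.den r)))

/-- The sum of rational numbers: `(a - b) / c + (x - y) / z` is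
`((a * z + x * c) - (b * z + y * c)) / (c * z)`; the predecessor of `(k + 1) * (l + 1)` is
`k * l + k + l`. -/
def qadd {Γ : E} (q r : Γ ⟶ T.Q) : Γ ⟶ T.Q :=
  lift (T.natAdd (T.natMul (T.pos q) (T.den r)) (T.natMul (T.pos r) (T.den q)))
    (lift (T.natAdd (T.natMul (T.sbt q) (T.den r)) (T.natMul (T.sbt r) (T.den q)))
      (T.natAdd (T.natAdd (T.natMul (T.prd q) (T.prd r)) (T.prd q)) (T.prd r)))

/-- The rational number zero, as `(0 - 0) / 1`. -/
def qzero (Γ : E) : Γ ⟶ T.Q :=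
  lift (toUnit Γ ≫ T.zero) (lift (toUnit Γ ≫ T.zero) (toUnit Γ ≫ T.zero))

end NNO

namespace SynthTopology

variable (T : SynthTopology E)

/-- The truth value `p` is open, i.e. belongs to `Σ`. -/
abbrev op {Γ : E} (p : Γ ⟶ Om E) : Γ ⟶ Om E := p ≫ T.open_

/-- `V` is an open subset of `X`: the truth value of `x ∈ V` is open for all `x ∈ X`. -/
def isOpen {Γ X : E} (V : Γ ⟶ Pow X) : Γ ⟶ Om E := all X fun x => T.op (x ∊ V⇧)

/-- `A` is subovert in `X`: for every open subset `V` of `X` the truth value of `∃ x ∈ A, x ∈ V` is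
open. -/
def isSubovert {Γ X : E} (A : Γ ⟶ Pow X) : Γ ⟶ Om E :=
  all (Pow X) fun V => T.isOpen V ⇛ T.op (ex X fun x => x ∊ A⇧⇧ ⋏ x ∊ V⇧)

/-- The subset `A` of `X` is a subspace of `X`: every open subset of `A` is the intersection of `A`
with an open subset of `X`.  An open subset of `A` is a `B ⊆ A` such that `x ∈ B` is open for all
`x ∈ A`. -/
def isSubspace {Γ X : E} (A : Γ ⟶ Pow X) : Γ ⟶ Om E :=
  all (Pow X) fun B => (sub B A⇧ ⋏ all X fun x => x ∊ A⇧⇧ ⇛ T.op (x ∊ B⇧)) ⇛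
    ex (Pow X) fun V => T.isOpen V ⋏ all X fun x => x ∊ B⇧⇧ ⟺ (x ∊ A⇧⇧⇧ ⋏ x ∊ V⇧)

/-! ### Real numbers: open Dedekind cuts of rational numbers -/

/-- The object of pairs of sets of rational numbers. -/
abbrev CutPair : E := Pow T.Q ⊗ Pow T.Q

/-- The first component of a pair `(L, U)`. -/
abbrev lo {Γ : E} (a : Γ ⟶ T.CutPair) : Γ ⟶ Pow T.Q := a ≫ fst _ _

/-- The second component of a pair `(L, U)`. -/
abbrev up {Γ : E} (a : Γ ⟶ T.CutPair) : Γ ⟶ Pow T.Q := a ≫ snd _ _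

/-- The pair `(L, U)` is an open Dedekind cut: `L` is an inhabited lower cut, `U` is an inhabited
upper cut, `L` and `U` are disjoint, `q < r` implies `q ∈ L` or `r ∈ U`, and `L`, `U` are open. -/
def isCut {Γ : E} (a : Γ ⟶ T.CutPair) : Γ ⟶ Om E :=
  (ex T.Q fun q => q ∊ (T.lo a)⇧) ⋏
  (ex T.Q fun q => q ∊ (T.up a)⇧) ⋏
  (all T.Q fun q => q ∊ (T.lo a)⇧ ⟺ ex T.Q fun r => r ∊ (T.lo a)⇧⇧ ⋏ T.qlt q⇧ r) ⋏
  (all T.Q fun q => q ∊ (T.up a)⇧ ⟺ ex T.Q fun r => r ∊ (T.up a)⇧⇧ ⋏ T.qlt r q⇧) ⋏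
  (all T.Q fun q => neg (q ∊ (T.lo a)⇧ ⋏ q ∊ (T.up a)⇧)) ⋏
  (all T.Q fun q => all T.Q fun r =>
    T.qlt q⇧ r ⇛ (q⇧ ∊ (T.lo a)⇧⇧ ⋎ r ∊ (T.up a)⇧⇧)) ⋏
  T.isOpen (T.lo a) ⋏
  T.isOpen (T.up a)

/-- The object of real numbers. -/
abbrev R : E := Compr (T.isCut (𝟙 T.CutPair))

/-- The pair `(L, U)` that constitutes a real number. -/
abbrev cut {Γ : E} (a : Γ ⟶ T.R) : Γ ⟶ T.CutPair := a ≫ incl (T.isCut (𝟙 T.CutPair))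

/-- The strict order: `a < b` when some rational number lies in the upper cut of `a` and in the lower
cut of `b`. -/
def lt {Γ : E} (a b : Γ ⟶ T.CutPair) : Γ ⟶ Om E :=
  ex T.Q fun q => q ∊ (T.up a)⇧ ⋏ q ∊ (T.lo b)⇧

/-- The order: `a ≤ b` when not `b < a`. -/
def le {Γ : E} (a b : Γ ⟶ T.CutPair) : Γ ⟶ Om E := neg (T.lt b a)

/-- The sum of two cuts: its lower cut consists of the rational numbers below some `l + k` with `l`,
`k` in the lower cuts of the summands, and likewise for the upper cut. -/
def add {Γ : E} (a b : Γ ⟶ T.CutPair) : Γ ⟶ T.CutPair :=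
  lift
    (sep T.Q fun q => ex T.Q fun l => ex T.Q fun k =>
      l⇧ ∊ (T.lo a)⇧⇧⇧ ⋏ k ∊ (T.lo b)⇧⇧⇧ ⋏ T.qlt q⇧⇧ (T.qadd l⇧ k))
    (sep T.Q fun q => ex T.Q fun l => ex T.Q fun k =>
      l⇧ ∊ (T.up a)⇧⇧⇧ ⋏ k ∊ (T.up b)⇧⇧⇧ ⋏ T.qlt (T.qadd l⇧ k) q⇧⇧)

/-- The cut of the real number zero. -/
def zeroCut (Γ : E) : Γ ⟶ T.CutPair :=
  lift (sep T.Q fun q => T.qlt q (T.qzero _)) (sep T.Q fun q => T.qlt (T.qzero _) q)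

/-! ### Metric spaces -/

/-- The distance of two elements, as a cut. -/
abbrev dist {Γ X : E} (d : X ⊗ X ⟶ T.R) (x y : Γ ⟶ X) : Γ ⟶ T.CutPair := T.cut (lift x y ≫ d)

/-- `d` is a pseudometric on `X`.  The axioms are stated for all elements at all stages. -/
structure IsPseudometric {X : E} (d : X ⊗ X ⟶ T.R) : Prop where
  dist_self : ∀ {Γ : E} (x : Γ ⟶ X), T.dist d x x = T.zeroCut Γ
  dist_comm : ∀ {Γ : E} (x y : Γ ⟶ X), T.dist d x y = T.dist d y x
  triangle : ∀ {Γ : E} (x y z : Γ ⟶ X),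
    Holds (T.le (T.dist d x z) (T.add (T.dist d x y) (T.dist d y z)))

/-- `d` is a metric on `X`. -/
structure IsMetric {X : E} (d : X ⊗ X ⟶ T.R) : Prop extends T.IsPseudometric d where
  eq_of_dist : ∀ {Γ : E} (x y : Γ ⟶ X), T.dist d x y = T.zeroCut Γ → x = y

/-- The subset `A` is metrically dense: it meets every ball of positive (real) radius. -/
def isDense {Γ X : E} (d : X ⊗ X ⟶ T.R) (A : Γ ⟶ Pow X) : Γ ⟶ Om E :=
  all X fun x => all T.R fun r => T.lt (T.zeroCut _) (T.cut r) ⇛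
    ex X fun a => a ∊ A⇧⇧⇧ ⋏ T.lt (T.dist d x⇧⇧ a) (T.cut r⇧)

/-- `f` is an isometry. -/
def IsIsometry {X Y : E} (dX : X ⊗ X ⟶ T.R) (dY : Y ⊗ Y ⟶ T.R) (f : X ⟶ Y) : Prop :=
  ∀ {Γ : E} (x y : Γ ⟶ X), lift (x ≫ f) (y ≫ f) ≫ dY = lift x y ≫ dX

/-- `(X, d)` is complete: every dense isometry from `(X, d)` into a pseudometric space `(Y, e)` has
a unique isometric left inverse. -/
def IsComplete {X : E} (d : X ⊗ X ⟶ T.R) : Prop :=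
  ∀ {Y : E} (e : Y ⊗ Y ⟶ T.R) (f : X ⟶ Y), T.IsPseudometric e → T.IsIsometry d e f →
    Holds (T.isDense e (image f)) → ∃! h : Y ⟶ X, T.IsIsometry e d h ∧ f ≫ h = 𝟙 X

/-- `s` witnesses metric separability of `(X, d)`.  A map `ℕ → X + 1` is given as a map `s` from `ℕ`
to subsets of `X` each of whose values is either empty or a singleton; the elements of these
singletons have to be metrically dense. -/
structure IsSeparating {X : E} (d : X ⊗ X ⟶ T.R) (s : T.N ⟶ Pow X) : Prop where
  empty_or_singleton : Holds (Γ := 𝟙_ E) (all T.N fun n =>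
    (all X fun x => neg (x ∊ (n ≫ s)⇧)) ⋎ (ex X fun x => all X fun y => y ∊ (n ≫ s)⇧⇧ ⟺ y ≐ x⇧))
  dense : Holds (Γ := 𝟙_ E) (T.isDense d (sep X fun x => ex T.N fun n => x⇧ ∊ (n ≫ s)))

/-- `r` is the distance `d(A, x)`, i.e. the strict infimum of the distances from points of `A` to
`x`: for all real `t` one has `r < t` if and only if `d(a, x) < t` for some `a ∈ A`. -/
def isDistTo {Γ X : E} (d : X ⊗ X ⟶ T.R) (A : Γ ⟶ Pow X) (x : Γ ⟶ X) (r : Γ ⟶ T.R) : Γ ⟶ Om E :=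
  all T.R fun t => T.lt (T.cut r⇧) (T.cut t) ⟺
    ex X fun a => a ∊ A⇧⇧ ⋏ T.lt (T.dist d a x⇧⇧) (T.cut t⇧)

/-- `A` is located: the distance `d(A, x)` is a real number for all `x`. -/
def isLocated {Γ X : E} (d : X ⊗ X ⟶ T.R) (A : Γ ⟶ Pow X) : Γ ⟶ Om E :=
  all X fun x => ex T.R fun r => T.isDistTo d A⇧⇧ x⇧ r

/-- `A` is strongly located: it is located and consists of the points `x` with `d(A, x) = 0`. -/
def isStronglyLocated {Γ X : E} (d : X ⊗ X ⟶ T.R) (A : Γ ⟶ Pow X) : Γ ⟶ Om E :=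
  T.isLocated d A ⋏
  all X fun x => x ∊ A⇧ ⟺ ex T.R fun r => T.isDistTo d A⇧⇧ x⇧ r ⋏ (T.cut r ≐ T.zeroCut _)

/-- `(X, d)` is metrized: the balls `B(x, r)`, with `(x, r) ∈ X × ℝ`, form a basis for the intrinsic
topology of `X`, i.e. for every open subset `V` of `X` there is a subovert subset `A` of `X × ℝ` such
that `V` is the union of the balls `B(x, r)` with `(x, r) ∈ A`. -/
def isMetrized {X : E} (d : X ⊗ X ⟶ T.R) : 𝟙_ E ⟶ Om E :=
  all (Pow X) fun V => T.isOpen V ⇛ ex (Pow (X ⊗ T.R)) fun A => T.isSubovert A ⋏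
    all X fun y => y ∊ V⇧⇧ ⟺ ex (X ⊗ T.R) fun p => p ∊ A⇧⇧ ⋏
      T.lt (T.dist d (p ≫ fst _ _) y⇧) (T.cut (p ≫ snd _ _))

/-- A complete metrically separable metric space. -/
structure CMS where
  /-- the underlying set -/
  carrier : E
  /-- the metric -/
  d : carrier ⊗ carrier ⟶ T.R
  isMetric : T.IsMetric d
  isComplete : T.IsComplete d
  /-- the sequence that witnesses separability -/
  s : T.N ⟶ Pow carrier
  isSeparating : T.IsSeparating d s

/-! ### Urysohn spaces -/

/-- `G` is a finite sequence of elements of `A`, given by its graph: for some natural number `n`, `G`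
is the graph of a map `{k ∈ ℕ | k < n} → A`. -/
def isFinSeq {Γ A : E} (G : Γ ⟶ Pow (T.N ⊗ A)) : Γ ⟶ Om E :=
  ex T.N fun n => all T.N fun k =>
    (T.natLt k n⇧ ⇛ ex A fun a => all A fun b => lift k⇧⇧ b ∊ G⇧⇧⇧⇧ ⟺ b ≐ a⇧) ⋏
    (all A fun a => lift k⇧ a ∊ G⇧⇧⇧ ⇛ T.natLt k⇧ n⇧⇧)

/-- `G` is a finite sequence `(x i, ω i)`, `i < n`, of elements of `X × ℝ` such that `0 ≤ ω i` and
`ω i - ω j ≤ d(x i, x j) ≤ ω i + ω j` for all `i, j < n`.  The first of the latter two inequalities is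
written as `ω i ≤ d(x i, x j) + ω j`. -/
def isPermissible {Γ X : E} (d : X ⊗ X ⟶ T.R) (G : Γ ⟶ Pow (T.N ⊗ (X ⊗ T.R))) : Γ ⟶ Om E :=
  T.isFinSeq G ⋏
  all (T.N ⊗ (X ⊗ T.R)) fun p => all (T.N ⊗ (X ⊗ T.R)) fun q => (p⇧ ∊ G⇧⇧ ⋏ q ∊ G⇧⇧) ⇛
    T.le (T.zeroCut _) (T.cut (p⇧ ≫ snd _ _ ≫ snd _ _)) ⋏
    T.le (T.cut (p⇧ ≫ snd _ _ ≫ snd _ _))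
      (T.add (T.dist d (p⇧ ≫ snd _ _ ≫ fst _ _) (q ≫ snd _ _ ≫ fst _ _))
        (T.cut (q ≫ snd _ _ ≫ snd _ _))) ⋏
    T.le (T.dist d (p⇧ ≫ snd _ _ ≫ fst _ _) (q ≫ snd _ _ ≫ fst _ _))
      (T.add (T.cut (p⇧ ≫ snd _ _ ≫ snd _ _)) (T.cut (q ≫ snd _ _ ≫ snd _ _)))

/-- The set of permissible finite sequences. -/
abbrev Perm {X : E} (d : X ⊗ X ⟶ T.R) : E :=
  Compr (T.isPermissible d (𝟙 (Pow (T.N ⊗ (X ⊗ T.R)))))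

/-- A Urysohn space: a complete metric space with a metrically dense sequence `u` and a map `ext` that
assigns to each permissible finite sequence `(x i, ω i)`, `i < n`, a point at the distance `ω i` from
`x i` for all `i < n`. -/
structure UrysohnSpace where
  /-- the underlying set -/
  carrier : E
  /-- the metric -/
  d : carrier ⊗ carrier ⟶ T.R
  isMetric : T.IsMetric d
  isComplete : T.IsComplete d
  /-- the dense sequence -/
  u : T.N ⟶ carrier
  isDense_u : Holds (T.isDense d (image u))
  /-- the extension map -/
  ext : T.Perm d ⟶ carrier
  dist_ext : ∀ {Γ : E} (p : Γ ⟶ T.Perm d) (k : Γ ⟶ T.N) (x : Γ ⟶ carrier) (ω : Γ ⟶ T.R),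
    Holds (lift k (lift x ω) ∊ (p ≫ incl (T.isPermissible d (𝟙 _)))) →
      lift (p ≫ ext) x ≫ d = ω

end SynthTopology

end Topology

end SynTop

end

noncomputable section

namespace SynTop

/-! ## Kripke-Joyal semantics of the internal logic -/

section Logic

variable {E : Type u} [Category.{v} E] [CartesianMonoidalCategory E] [MonoidalClosed E]
  [Limits.HasFiniteLimits E] [HasSubobjectClassifier E]

local postfix:max "⇧" => wk
local infix:45 " ≐ " => eqq
local infixr:35 " ⋏ " => and
local infixr:25 " ⇛ " => imp
local infix:20 " ⟺ " => iff
local infix:50 " ∊ " => mem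
local infixr:30 " ⋎ " => or

set_option linter.unusedSectionVars false

attribute [simp] comp_lift_assoc

/-! The space `X` is embedded isometrically into the Urysohn space `U` in such a way that open
subsets of `X` are, locally, traces of open subsets of `U`. An open subset of `U` is the union of a
subovert family of balls. Each of these balls is exhausted on `X` by smaller balls whose radius is
rational and whose center is a term of the sequence that witnesses separability. The smaller balls
are indexed by numbers, so they form a subovert family again (`exists_isSubovert`,
`isMetrized_of_isometry`).

Open subsets extend from `X` to `U` once `X` is found inside a strongly located subset of `U`. An
arbitrary isometric copy of a sequence need not be located, since the infimum of infinitely many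
distances need not be a real number. The remedy is to build the sequence `a` in `U` with care.
Besides having the prescribed distances from its predecessors, each new point is put as far as the
triangle inequality permits from the first points of the dense sequence `u`. Its distance from such
a point `y` is then at least the distance from `y` to the nearest earlier term. Therefore the
infimum of the distances of `u k` from all terms is already the minimum over the terms up to `k`,
and the resulting distance function extends from `u` to all of `U` (`exists_extension`,
`exists_next`, `SynthTopology.exists_embedding`, `exists_dist`). The extension map of `U` is a
function of the data, so the recursion needs no choice.

It is undecided whether `X` has a point, and terms of its sequence may be undefined. One additional
point is adjoined, at a distance of at least `b` from `X`, and it represents all undefined terms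
(`exists_constant`, `IsSeparating.exists_based`). The strongly located set `C` is the closure of the
sequence so obtained. For some `h < b`, completeness of `X` identifies the points of `C` farther
than `h` from the additional point with the points of `X` (`CMS.exists_embedding`). Every point of
`C` is farther than `h` or nearer than `b`. In the latter case it is not in `X`, and falsity is
open, so an open subset of `X` is open as a subset of `C`. The hypothesis on strongly located
subsets then extends it to `U` (`CMS.exists_isometry`).

All reasoning takes place at the stages of the internal logic. Internal existence is local existence
(`Cov`), and it yields an actual morphism only when the witness is unique (`exists_of_unique`). -/

theorem tru_eq (Γ : E) :
    tru Γ = Subobject.Classifier.χ₀ _ Γ ≫ HasSubobjectClassifier.truth E := by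
  have := HasSubobjectClassifier.comm (𝟙 Γ)
  rwa [Category.id_comp] at this

@[simp]
theorem comp_tru {Γ Δ : E} (f : Δ ⟶ Γ) : f ≫ tru Γ = tru Δ := by
  rw [tru_eq, tru_eq, ← Category.assoc]
  congr 1
  exact Subobject.Classifier.isTerminalΩ₀.hom_ext _ _

theorem holds_comp_χ {U X Γ : E} (m : U ⟶ X) [Mono m] (f : Γ ⟶ X) :
    Holds (f ≫ HasSubobjectClassifier.χ m) ↔ ∃ g, g ≫ m = f := by
  constructor
  · intro h
    have hp := HasSubobjectClassifier.isPullback_χ m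
    have h' : f ≫ HasSubobjectClassifier.χ m =
      Subobject.Classifier.χ₀ _ Γ ≫ HasSubobjectClassifier.truth E := h.trans (tru_eq Γ)
    exact ⟨hp.lift f _ h', hp.lift_fst _ _ _⟩
  · rintro ⟨g, rfl⟩
    rw [Holds, Category.assoc, HasSubobjectClassifier.comm, tru_eq, ← Category.assoc]
    congr 1
    exact Subobject.Classifier.isTerminalΩ₀.hom_ext _ _

/-- The universal property is tested on generalized elements. By uniqueness of classifying maps,
truth values that hold at the same stages are then equal, which is how `om_ext` is obtained. -/
theorem isPullback_of_factors {U X : E} (m : U ⟶ X) [Mono m] (p : X ⟶ Om E)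
    (h : ∀ {Δ : E} (f : Δ ⟶ X), Holds (f ≫ p) ↔ ∃ g, g ≫ m = f) :
    IsPullback m (Subobject.Classifier.χ₀ _ U) p (HasSubobjectClassifier.truth E) := by
  have key : ∀ s : Limits.PullbackCone p (HasSubobjectClassifier.truth E), ∃ g, g ≫ m = s.fst := by
    intro s
    rw [← h, Holds, s.condition, tru_eq]
    congr 1
    exact Subobject.Classifier.isTerminalΩ₀.hom_ext _ _
  refine ⟨⟨((h m).2 ⟨𝟙 _, by simp⟩).trans (tru_eq U)⟩, ⟨Limits.PullbackCone.IsLimit.mk _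
    (fun s => (key s).choose) (fun s => (key s).choose_spec)
    (fun s => Subobject.Classifier.isTerminalΩ₀.hom_ext _ _) fun s t h1 _ => ?_⟩⟩
  rw [← cancel_mono m, h1]
  exact (key s).choose_spec.symm

/-- Propositional extensionality. -/
theorem om_ext {Γ : E} {p q : Γ ⟶ Om E}
    (h : ∀ {Δ : E} (f : Δ ⟶ Γ), Holds (f ≫ p) ↔ Holds (f ≫ q)) : p = q := by
  have key : ∀ {Δ : E} (f : Δ ⟶ Γ), Holds (f ≫ p) ↔ ∃ g, g ≫ incl p = f := by
    intro Δ f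
    constructor
    · intro hf
      exact ⟨Limits.equalizer.lift f (by rw [hf, comp_tru]), Limits.equalizer.lift_ι _ _⟩
    · rintro ⟨g, rfl⟩
      rw [Holds, Category.assoc, Limits.equalizer.condition, comp_tru, comp_tru]
  rw [HasSubobjectClassifier.unique _ p (isPullback_of_factors (incl p) p key),
    HasSubobjectClassifier.unique _ q (isPullback_of_factors (incl p) q
      fun f => (h f).symm.trans (key f))]

theorem Holds.comp {Γ Δ : E} {p : Γ ⟶ Om E} (h : Holds p) (f : Δ ⟶ Γ) : Holds (f ≫ p) := by
  rw [Holds] at h ⊢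
  rw [h, comp_tru]

theorem holds_comp_eqq {Γ Δ X : E} (f : Δ ⟶ Γ) (x y : Γ ⟶ X) :
    Holds (f ≫ (x ≐ y)) ↔ f ≫ x = f ≫ y := by
  rw [eqq, holds_comp_χ]
  constructor
  · rintro ⟨g, rfl⟩
    rw [Category.assoc, Category.assoc, Limits.equalizer.condition]
  · intro h
    exact ⟨Limits.equalizer.lift f h, Limits.equalizer.lift_ι _ _⟩

@[simp]
theorem holds_eqq {Γ X : E} (x y : Γ ⟶ X) : Holds (x ≐ y) ↔ x = y := by
  simpa using holds_comp_eqq (𝟙 Γ) x y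

@[simp]
theorem comp_eqq {Γ Δ X : E} (f : Δ ⟶ Γ) (x y : Γ ⟶ X) :
    f ≫ (x ≐ y) = (f ≫ x ≐ f ≫ y) := by
  refine om_ext fun g => ?_
  rw [← Category.assoc, holds_comp_eqq, holds_comp_eqq, Category.assoc, Category.assoc]

@[simp]
theorem holds_and {Γ : E} (p q : Γ ⟶ Om E) : Holds (p ⋏ q) ↔ Holds p ∧ Holds q := by
  rw [and, holds_eqq]
  constructor
  · intro h
    exact ⟨by simpa [Holds] using congrArg (· ≫ fst _ _) h,
      by simpa [Holds] using congrArg (· ≫ snd _ _) h⟩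
  · rintro ⟨h1, h2⟩
    rw [h1, h2]

@[simp]
theorem comp_and {Γ Δ : E} (f : Δ ⟶ Γ) (p q : Γ ⟶ Om E) :
    f ≫ (p ⋏ q) = (f ≫ p ⋏ f ≫ q) := by
  simp [and]

/-- An implication is by definition an equation between truth values, and `om_ext` tests such an
equation at every later stage. This is where the quantifier over `f` comes from. -/
theorem holds_imp {Γ : E} {p q : Γ ⟶ Om E} :
    Holds (p ⇛ q) ↔ ∀ {Δ : E} (f : Δ ⟶ Γ), Holds (f ≫ p) → Holds (f ≫ q) := by
  rw [imp, holds_eqq]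
  constructor
  · intro h Δ f hp
    rw [← h, comp_and, holds_and] at hp
    exact hp.2
  · intro h
    refine om_ext fun f => ?_
    rw [comp_and, holds_and]
    exact ⟨fun h' => h'.1, fun h' => ⟨h', h f h'⟩⟩

@[simp]
theorem comp_imp {Γ Δ : E} (f : Δ ⟶ Γ) (p q : Γ ⟶ Om E) :
    f ≫ (p ⇛ q) = (f ≫ p ⇛ f ≫ q) := by
  simp [imp]

theorem Holds.mp {Γ : E} {p q : Γ ⟶ Om E} (h : Holds (p ⇛ q)) (hp : Holds p) : Holds q := by
  have := holds_imp.1 h (𝟙 Γ)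
  rw [Category.id_comp, Category.id_comp] at this
  exact this hp

theorem holds_iff {Γ : E} {p q : Γ ⟶ Om E} : Holds (p ⟺ q) ↔ p = q := by
  rw [iff, holds_and, holds_imp, holds_imp]
  constructor
  · rintro ⟨h1, h2⟩
    exact om_ext fun f => ⟨h1 f, h2 f⟩
  · rintro rfl
    exact ⟨fun _ h => h, fun _ h => h⟩

@[simp]
theorem comp_iff {Γ Δ : E} (f : Δ ⟶ Γ) (p q : Γ ⟶ Om E) :
    f ≫ (p ⟺ q) = (f ≫ p ⟺ f ≫ q) := by
  simp [iff]

@[simp]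
theorem comp_mem {Γ Δ X : E} (f : Δ ⟶ Γ) (x : Γ ⟶ X) (A : Γ ⟶ Pow X) :
    f ≫ (x ∊ A) = (f ≫ x ∊ f ≫ A) := by
  simp [mem]

theorem comp_mem_assoc {Γ Δ X Z : E} (f : Δ ⟶ Γ) (x : Γ ⟶ X) (A : Γ ⟶ Pow X) (h : Om E ⟶ Z) :
    f ≫ (x ∊ A) ≫ h = (f ≫ x ∊ f ≫ A) ≫ h := by
  rw [← Category.assoc, comp_mem]

/-- Application of an element of the exponential `X^A`. -/
def app {Γ A X : E} (g : Γ ⟶ (ihom A).obj X) (a : Γ ⟶ A) : Γ ⟶ X :=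
  lift a g ≫ MonoidalClosed.uncurry (𝟙 ((ihom A).obj X))

/-- Abstraction: the element of `X^A` given by a map depending on a parameter. -/
def lam {Γ A X : E} (g : A ⊗ Γ ⟶ X) : Γ ⟶ (ihom A).obj X := MonoidalClosed.curry g

@[simp]
theorem comp_app {Γ Δ A X : E} (f : Δ ⟶ Γ) (g : Γ ⟶ (ihom A).obj X) (a : Γ ⟶ A) :
    f ≫ app g a = app (f ≫ g) (f ≫ a) := by
  simp [app]

theorem lift_comp_uncurry {Γ A X Y : E} (g : Γ ⟶ Y) (a : Γ ⟶ A) (h : Y ⟶ (ihom A).obj X) :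
    lift a g ≫ MonoidalClosed.uncurry h = app (g ≫ h) a := by
  have : lift a (g ≫ h) = lift a g ≫ A ◁ h := by simp
  rw [app, this, Category.assoc, ← MonoidalClosed.uncurry_natural_left, Category.comp_id]

theorem comp_lam {Γ Δ A X : E} (f : Δ ⟶ Γ) (g : A ⊗ Γ ⟶ X) :
    f ≫ lam g = lam (A ◁ f ≫ g) := by
  rw [lam, lam, MonoidalClosed.curry_natural_left]

@[simp]
theorem app_lam {Γ Δ A X : E} (f : Δ ⟶ Γ) (g : A ⊗ Γ ⟶ X) (a : Δ ⟶ A) :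
    app (f ≫ lam g) a = lift a f ≫ g := by
  rw [← lift_comp_uncurry, lam, MonoidalClosed.uncurry_curry]

@[simp]
theorem app_lam' {Γ A X : E} (g : A ⊗ Γ ⟶ X) (a : Γ ⟶ A) :
    app (lam g) a = lift a (𝟙 Γ) ≫ g := by
  simpa using app_lam (𝟙 Γ) g a

theorem lam_ext {Γ A X : E} {g h : Γ ⟶ (ihom A).obj X}
    (H : ∀ {Δ : E} (f : Δ ⟶ Γ) (a : Δ ⟶ A), app (f ≫ g) a = app (f ≫ h) a) : g = h := by
  have := H (snd A Γ) (fst A Γ)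
  rw [← lift_comp_uncurry, ← lift_comp_uncurry, lift_fst_snd, Category.id_comp,
    Category.id_comp] at this
  exact (MonoidalClosed.uncurry_injective this)

theorem mem_eq_app {Γ X : E} (x : Γ ⟶ X) (A : Γ ⟶ Pow X) : (x ∊ A) = app A x := rfl

@[simp]
theorem mem_comp_sep {Γ Δ X : E} (f : Δ ⟶ Γ) (x : Δ ⟶ X) (φ : (X ⊗ Γ ⟶ X) → (X ⊗ Γ ⟶ Om E)) :
    (x ∊ f ≫ sep X φ) = lift x f ≫ φ (fst X Γ) :=
  app_lam f _ x

@[simp]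
theorem mem_sep {Γ X : E} (x : Γ ⟶ X) (φ : (X ⊗ Γ ⟶ X) → (X ⊗ Γ ⟶ Om E)) :
    (x ∊ sep X φ) = lift x (𝟙 Γ) ≫ φ (fst X Γ) :=
  app_lam' _ x

/-- Extensionality of subsets. -/
theorem pow_ext {Γ X : E} {A B : Γ ⟶ Pow X}
    (H : ∀ {Δ : E} (f : Δ ⟶ Γ) (x : Δ ⟶ X), Holds (x ∊ f ≫ A) ↔ Holds (x ∊ f ≫ B)) : A = B := by
  refine lam_ext fun f x => om_ext fun g => ?_
  rw [← mem_eq_app, ← mem_eq_app, comp_mem, comp_mem, ← Category.assoc, ← Category.assoc]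
  exact H _ _

theorem comp_sep {Γ Δ X : E} (f : Δ ⟶ Γ) (φ : (X ⊗ Γ ⟶ X) → (X ⊗ Γ ⟶ Om E)) :
    f ≫ sep X φ = sep X fun _ => X ◁ f ≫ φ (fst X Γ) :=
  comp_lam f _

/-- An equation of subsets is tested on generalized elements. The bound variable enters only through
`φ (fst X Γ)`, so every instance is a composite with some `lift x f`. -/
theorem holds_all {Γ X : E} {φ : (X ⊗ Γ ⟶ X) → (X ⊗ Γ ⟶ Om E)} :
    Holds (all X φ) ↔
      ∀ {Δ : E} (f : Δ ⟶ Γ) (x : Δ ⟶ X), Holds (lift x f ≫ φ (fst X Γ)) := by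
  rw [all, holds_eqq]
  constructor
  · intro h Δ f x
    rw [← mem_comp_sep, h, mem_comp_sep, comp_tru]
    rfl
  · intro h
    refine pow_ext fun f x => ?_
    rw [mem_comp_sep, mem_comp_sep, comp_tru]
    exact ⟨fun _ => rfl, fun _ => h f x⟩

theorem all_congr {Γ X : E} {φ ψ : (X ⊗ Γ ⟶ X) → (X ⊗ Γ ⟶ Om E)}
    (h : φ (fst X Γ) = ψ (fst X Γ)) : all X φ = all X ψ := by
  unfold all sep
  rw [h]

theorem comp_all {Γ Δ X : E} (f : Δ ⟶ Γ) (φ : (X ⊗ Γ ⟶ X) → (X ⊗ Γ ⟶ Om E)) :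
    f ≫ all X φ = all X fun _ => X ◁ f ≫ φ (fst X Γ) := by
  refine om_ext fun g => ?_
  simp only [all, comp_eqq, comp_sep, comp_tru]

theorem holds_comp_all {Γ Δ X : E} {f : Δ ⟶ Γ} {φ : (X ⊗ Γ ⟶ X) → (X ⊗ Γ ⟶ Om E)} :
    Holds (f ≫ all X φ) ↔
      ∀ {Θ : E} (g : Θ ⟶ Δ) (x : Θ ⟶ X), Holds (lift x (g ≫ f) ≫ φ (fst X Γ)) := by
  rw [comp_all, holds_all]
  simp only [lift_whiskerLeft_assoc]

theorem holds_comp_fls {Γ Δ : E} {f : Δ ⟶ Γ} (h : Holds (f ≫ fls Γ)) (p : Δ ⟶ Om E) : Holds p := by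
  simpa using holds_comp_all.1 h (𝟙 Δ) p

theorem holds_fls {Γ : E} (h : Holds (fls Γ)) (p : Γ ⟶ Om E) : Holds p :=
  holds_comp_fls (f := 𝟙 Γ) (by simpa using h) p

@[simp]
theorem comp_fls {Γ Δ : E} (f : Δ ⟶ Γ) : f ≫ fls Γ = fls Δ :=
  om_ext fun g => ⟨fun h => holds_comp_fls (f := g ≫ f) (by simpa using h) _,
    fun h => holds_comp_fls h _⟩

/-- At an inconsistent stage even morphisms into arbitrary objects coincide. Impossible cases in a
local proof of an equation are dismissed in this way. -/
theorem eq_of_fls {Γ X : E} (h : Holds (fls Γ)) (x y : Γ ⟶ X) : x = y :=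
  (holds_eqq x y).1 (holds_fls h _)

theorem holds_neg {Γ : E} {p : Γ ⟶ Om E} :
    Holds (neg p) ↔ ∀ {Δ : E} (f : Δ ⟶ Γ), Holds (f ≫ p) → Holds (fls Δ) := by
  rw [neg, holds_imp]
  simp only [comp_fls]

theorem Holds.absurd {Γ : E} {p : Γ ⟶ Om E} (h : Holds (neg p)) (hp : Holds p) : Holds (fls Γ) :=
  h.mp hp

@[simp]
theorem comp_neg {Γ Δ : E} (f : Δ ⟶ Γ) (p : Γ ⟶ Om E) : f ≫ neg p = neg (f ≫ p) := by
  simp [neg]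

/-- The impredicative definition quantifies over all possible conclusions, and elimination is its
instance at `r`. The same holds for `holds_ex_elim`. -/
theorem holds_or_elim {Γ : E} {p q r : Γ ⟶ Om E} (h : Holds (p ⋎ q))
    (hp : ∀ {Δ : E} (f : Δ ⟶ Γ), Holds (f ≫ p) → Holds (f ≫ r))
    (hq : ∀ {Δ : E} (f : Δ ⟶ Γ), Holds (f ≫ q) → Holds (f ≫ r)) : Holds r := by
  have := holds_all.1 h (𝟙 Γ) r
  simp only [comp_imp, comp_and, lift_snd_assoc, lift_fst, Category.id_comp] at this
  exact this.mp ((holds_and _ _).2 ⟨holds_imp.2 hp, holds_imp.2 hq⟩)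

theorem holds_or_left {Γ : E} {p q : Γ ⟶ Om E} (h : Holds p) : Holds (p ⋎ q) := by
  refine holds_all.2 fun f r => ?_
  simp only [comp_imp, comp_and, lift_snd_assoc, lift_fst]
  refine holds_imp.2 fun g hg => ?_
  simp only [comp_imp, comp_and, holds_and] at hg
  exact hg.1.mp ((h.comp f).comp g)

theorem holds_or_right {Γ : E} {p q : Γ ⟶ Om E} (h : Holds q) : Holds (p ⋎ q) := by
  refine holds_all.2 fun f r => ?_
  simp only [comp_imp, comp_and, lift_snd_assoc, lift_fst]
  refine holds_imp.2 fun g hg => ?_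
  simp only [comp_imp, comp_and, holds_and] at hg
  exact hg.2.mp ((h.comp f).comp g)

@[simp]
theorem comp_or {Γ Δ : E} (f : Δ ⟶ Γ) (p q : Γ ⟶ Om E) : f ≫ (p ⋎ q) = (f ≫ p ⋎ f ≫ q) := by
  rw [or, comp_all, or]
  refine all_congr ?_
  simp only [comp_imp, comp_and, whiskerLeft_fst, whiskerLeft_snd_assoc]

theorem holds_ex_elim {Γ X : E} {φ : (X ⊗ Γ ⟶ X) → (X ⊗ Γ ⟶ Om E)} {r : Γ ⟶ Om E}
    (h : Holds (ex X φ))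
    (H : ∀ {Δ : E} (f : Δ ⟶ Γ) (x : Δ ⟶ X), Holds (lift x f ≫ φ (fst X Γ)) → Holds (f ≫ r)) :
    Holds r := by
  have := holds_all.1 h (𝟙 Γ) r
  rw [comp_imp] at this
  rw [← lift_fst r (𝟙 Γ)]
  refine this.mp (holds_comp_all.2 fun g x => ?_)
  simp only [comp_imp, lift_snd_assoc, lift_whiskerLeft_assoc, Category.assoc, lift_fst,
    lift_snd, Category.comp_id]
  refine holds_imp.2 fun k hk => ?_
  rw [← Category.assoc]
  refine H _ (k ≫ x) ?_
  simpa only [comp_lift_assoc] using hk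

theorem ex_congr {Γ X : E} {φ ψ : (X ⊗ Γ ⟶ X) → (X ⊗ Γ ⟶ Om E)}
    (h : φ (fst X Γ) = ψ (fst X Γ)) : ex X φ = ex X ψ := by
  unfold ex
  rw [h]

theorem comp_ex {Γ Δ X : E} (f : Δ ⟶ Γ) (φ : (X ⊗ Γ ⟶ X) → (X ⊗ Γ ⟶ Om E)) :
    f ≫ ex X φ = ex X fun _ => X ◁ f ≫ φ (fst X Γ) := by
  have h : X ◁ (Om E ◁ f) ≫ X ◁ snd (Om E) Γ = X ◁ snd (Om E) Δ ≫ X ◁ f := by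
    rw [← MonoidalCategory.whiskerLeft_comp, whiskerLeft_snd, MonoidalCategory.whiskerLeft_comp]
  rw [ex, comp_all, ex]
  refine all_congr ?_
  rw [comp_imp, comp_all, whiskerLeft_fst]
  congr 1
  refine all_congr ?_
  rw [comp_imp, ← Category.assoc, h, Category.assoc, whiskerLeft_snd_assoc, whiskerLeft_fst]

theorem comp_ex_assoc {Γ Δ X Z : E} (f : Δ ⟶ Γ) (φ : (X ⊗ Γ ⟶ X) → (X ⊗ Γ ⟶ Om E)) (h : Om E ⟶ Z) :
    f ≫ ex X φ ≫ h = (ex X fun _ => X ◁ f ≫ φ (fst X Γ)) ≫ h := by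
  rw [← Category.assoc, comp_ex]

theorem holds_ex_intro {Γ X : E} {φ : (X ⊗ Γ ⟶ X) → (X ⊗ Γ ⟶ Om E)} (x : Γ ⟶ X)
    (h : Holds (lift x (𝟙 Γ) ≫ φ (fst X Γ))) : Holds (ex X φ) := by
  refine holds_all.2 fun f r => ?_
  rw [comp_imp]
  refine holds_imp.2 fun g hg => ?_
  rw [← Category.assoc] at hg
  have := holds_comp_all.1 hg (𝟙 _) (g ≫ f ≫ x)
  simp only [comp_imp, comp_lift, lift_whiskerLeft_assoc, lift_fst,
    lift_snd, lift_snd_assoc, Category.id_comp] at this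
  rw [lift_fst]
  refine this.mp ?_
  have := (h.comp f).comp g
  simpa using this

theorem holds_comp_ex_intro {Γ Δ X : E} {φ : (X ⊗ Γ ⟶ X) → (X ⊗ Γ ⟶ Om E)} {f : Δ ⟶ Γ} (x : Δ ⟶ X)
    (h : Holds (lift x f ≫ φ (fst X Γ))) : Holds (f ≫ ex X φ) := by
  rw [comp_ex]
  exact holds_ex_intro x (by simpa using h)

end Logic

end SynTop

end

/-! ### Local existence, comprehension and unique choice -/

noncomputable section

namespace SynTop

section LocalExistence

variable {E : Type u} [Category.{v} E] [CartesianMonoidalCategory E] [MonoidalClosed E]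
  [Limits.HasFiniteLimits E] [HasSubobjectClassifier E]

local postfix:max "⇧" => wk
local infix:45 " ≐ " => eqq
local infixr:35 " ⋏ " => and
local infixr:25 " ⇛ " => imp
local infix:20 " ⟺ " => iff
local infix:50 " ∊ " => mem
local infixr:30 " ⋎ " => or

set_option linter.unusedSectionVars false

/-- `P` holds locally: to prove an internal proposition at the stage `Γ` it suffices to prove it at
all later stages at which `P` holds. -/
def Cov {Γ : E} (P : ∀ {Δ : E}, (Δ ⟶ Γ) → Prop) : Prop :=
  ∀ r : Γ ⟶ Om E, (∀ {Δ : E} (f : Δ ⟶ Γ), P f → Holds (f ≫ r)) → Holds r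

theorem Cov.pure {Γ : E} {P : ∀ {Δ : E}, (Δ ⟶ Γ) → Prop} (h : P (𝟙 Γ)) : Cov P :=
  fun _ H => by simpa using H (𝟙 Γ) h

/-- Since `Cov` is given by its elimination rule, it behaves like a continuation monad: witnesses
found locally may be used to find further witnesses locally. -/
theorem Cov.bind {Γ : E} {P Q : ∀ {Δ : E}, (Δ ⟶ Γ) → Prop} (h : Cov P)
    (H : ∀ {Δ : E} (f : Δ ⟶ Γ), P f → Cov fun {Θ} (g : Θ ⟶ Δ) => Q (g ≫ f)) : Cov Q :=
  fun r hr => h r fun f hf => H f hf _ fun g hg => by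
    rw [← Category.assoc]; exact hr _ hg

theorem Cov.mono {Γ : E} {P Q : ∀ {Δ : E}, (Δ ⟶ Γ) → Prop} (h : Cov P)
    (H : ∀ {Δ : E} (f : Δ ⟶ Γ), P f → Q f) : Cov Q :=
  fun r hr => h r fun f hf => hr f (H f hf)

theorem Cov.holds {Γ : E} {P : ∀ {Δ : E}, (Δ ⟶ Γ) → Prop} (h : Cov P) {r : Γ ⟶ Om E}
    (H : ∀ {Δ : E} (f : Δ ⟶ Γ), P f → Holds (f ≫ r)) : Holds r :=
  h r H

/-- Equality is an internal proposition, so it may be verified locally. Thus local case distinctions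
prove equations between morphisms. -/
theorem Cov.eq {Γ X : E} {P : ∀ {Δ : E}, (Δ ⟶ Γ) → Prop} (h : Cov P) {x y : Γ ⟶ X}
    (H : ∀ {Δ : E} (f : Δ ⟶ Γ), P f → f ≫ x = f ≫ y) : x = y :=
  (holds_eqq x y).1 (h _ fun f hf => (holds_comp_eqq f x y).2 (H f hf))

theorem cov_of_ex {Γ X : E} {φ : (X ⊗ Γ ⟶ X) → (X ⊗ Γ ⟶ Om E)} (h : Holds (ex X φ)) :
    Cov fun {Δ} (f : Δ ⟶ Γ) => ∃ x : Δ ⟶ X, Holds (lift x f ≫ φ (fst X Γ)) :=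
  fun _ hr => holds_ex_elim h fun f x hx => hr f ⟨x, hx⟩

theorem cov_of_comp_ex {Γ Γ' X : E} {f' : Γ' ⟶ Γ} {φ : (X ⊗ Γ ⟶ X) → (X ⊗ Γ ⟶ Om E)}
    (h : Holds (f' ≫ ex X φ)) :
    Cov fun {Δ} (f : Δ ⟶ Γ') => ∃ x : Δ ⟶ X, Holds (lift x (f ≫ f') ≫ φ (fst X Γ)) := by
  rw [comp_ex] at h
  exact (cov_of_ex h).mono fun f ⟨x, hx⟩ => ⟨x, by simpa using hx⟩

theorem Cov.ex {Γ X : E} {φ : (X ⊗ Γ ⟶ X) → (X ⊗ Γ ⟶ Om E)}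
    (h : Cov fun {Δ} (f : Δ ⟶ Γ) => ∃ x : Δ ⟶ X, Holds (lift x f ≫ φ (fst X Γ))) :
    Holds (ex X φ) :=
  h _ fun _ ⟨x, hx⟩ => holds_comp_ex_intro x hx

theorem cov_of_or {Γ : E} {p q : Γ ⟶ Om E} (h : Holds (p ⋎ q)) :
    Cov fun {Δ} (f : Δ ⟶ Γ) => Holds (f ≫ p) ∨ Holds (f ≫ q) :=
  fun _ hr => holds_or_elim h (fun f hf => hr f (Or.inl hf)) fun f hf => hr f (Or.inr hf)

/-! ### Comprehension -/

/-- The element of `{x ∈ X | φ x}` given by an element of `X`. -/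
def Compr.mk {Γ X : E} {φ : X ⟶ Om E} (x : Γ ⟶ X) (h : Holds (x ≫ φ)) : Γ ⟶ Compr φ :=
  Limits.equalizer.lift x (by rw [h, comp_tru])

@[simp]
theorem Compr.mk_incl {Γ X : E} {φ : X ⟶ Om E} (x : Γ ⟶ X) (h : Holds (x ≫ φ)) :
    Compr.mk x h ≫ incl φ = x :=
  Limits.equalizer.lift_ι _ _

@[simp]
theorem Compr.mk_incl_assoc {Γ X Y : E} {φ : X ⟶ Om E} (x : Γ ⟶ X) (h : Holds (x ≫ φ))
    (k : X ⟶ Y) : Compr.mk x h ≫ incl φ ≫ k = x ≫ k := by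
  rw [← Category.assoc, Compr.mk_incl]

theorem Compr.prop {Γ X : E} {φ : X ⟶ Om E} (a : Γ ⟶ Compr φ) : Holds ((a ≫ incl φ) ≫ φ) := by
  rw [Holds, Category.assoc, Limits.equalizer.condition, comp_tru, comp_tru]

theorem Compr.ext {Γ X : E} {φ : X ⟶ Om E} {a b : Γ ⟶ Compr φ} (h : a ≫ incl φ = b ≫ incl φ) :
    a = b :=
  (cancel_mono (incl φ)).1 h

/-! ### Unique choice -/

/-- The map sending `x` to the singleton `{x}`. -/
def singleton (X : E) : X ⟶ Pow X := sep X fun y => y ≐ (𝟙 X)⇧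

theorem mem_singleton {Γ X : E} (x y : Γ ⟶ X) : Holds (y ∊ x ≫ singleton X) ↔ y = x := by
  rw [singleton, mem_comp_sep]
  simp

instance (X : E) : Mono (singleton X) :=
  ⟨fun x y h => by rw [← mem_singleton y x, ← h, mem_singleton]⟩

/-- Unique choice for subsets. -/
theorem exists_mem_of_unique {Γ X : E} (S : Γ ⟶ Pow X)
    (h : Cov fun {Δ} (f : Δ ⟶ Γ) => ∃ x : Δ ⟶ X, Holds (x ∊ f ≫ S))
    (huniq : ∀ {Δ : E} (f : Δ ⟶ Γ) (x y : Δ ⟶ X), Holds (x ∊ f ≫ S) → Holds (y ∊ f ≫ S) → x = y) :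
    ∃ x : Γ ⟶ X, Holds (x ∊ S) := by
  -- To be a singleton is to factor through the monomorphism `singleton X`. This is a truth value,
  -- so it may be checked where an element of `S` is available.
  obtain ⟨x, rfl⟩ : ∃ x, x ≫ singleton X = S := by
    rw [← holds_comp_χ]
    refine h _ fun f ⟨x, hx⟩ => ?_
    rw [← Category.assoc, holds_comp_χ]
    refine ⟨x, pow_ext fun g y => ?_⟩
    have hx' := hx.comp g
    rw [comp_mem, ← Category.assoc] at hx'
    rw [← Category.assoc, ← Category.assoc, mem_singleton]
    constructor
    · rintro rfl
      exact hx'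
    · exact fun hy => huniq _ _ _ hy hx'
  exact ⟨x, (mem_singleton x x).2 rfl⟩

/-- Unique choice. -/
theorem exists_of_unique {Γ X : E} (φ : X ⊗ Γ ⟶ Om E)
    (h : Cov fun {Δ} (f : Δ ⟶ Γ) => ∃ x : Δ ⟶ X, Holds (lift x f ≫ φ))
    (huniq : ∀ {Δ : E} (f : Δ ⟶ Γ) (x y : Δ ⟶ X),
      Holds (lift x f ≫ φ) → Holds (lift y f ≫ φ) → x = y) :
    ∃ x : Γ ⟶ X, Holds (lift x (𝟙 Γ) ≫ φ) := by
  simpa using exists_mem_of_unique (sep X fun _ => φ) (h.mono fun f ⟨x, hx⟩ => ⟨x, by simpa using hx⟩)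
    fun f x y hx hy => huniq f x y (by simpa using hx) (by simpa using hy)

/-- Definition by cases. -/
theorem exists_ite {Γ X : E} {p q : Γ ⟶ Om E} (x y : Γ ⟶ X)
    (h : Holds (p ⋎ q))
    (hpq : ∀ {Δ : E} (f : Δ ⟶ Γ), Holds (f ≫ p) → Holds (f ≫ q) → Holds (fls Δ)) :
    ∃ z : Γ ⟶ X, ∀ {Δ : E} (f : Δ ⟶ Γ),
      (Holds (f ≫ p) → f ≫ z = f ≫ x) ∧ (Holds (f ≫ q) → f ≫ z = f ≫ y) := by
  -- The value is pinned down by two implications. Where one disjunct holds, the other implication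
  -- is vacuous by `hpq`; the disjunction `p ⋎ q` makes the value unique.
  have key : ∃ z : Γ ⟶ X, Holds (lift z (𝟙 Γ) ≫ ((p⇧ ⇛ fst X Γ ≐ x⇧) ⋏ (q⇧ ⇛ fst X Γ ≐ y⇧))) := by
    refine exists_of_unique _ ?_ ?_
    · refine (cov_of_or h).mono fun f hf => ?_
      rcases hf with hf | hf
      · refine ⟨f ≫ x, ?_⟩
        simp only [comp_and, comp_imp, comp_eqq, lift_fst, lift_snd_assoc, holds_and]
        refine ⟨holds_imp.2 fun g _ => by simp, holds_imp.2 fun g hg => ?_⟩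
        exact holds_fls (hpq (g ≫ f) (by simpa using hf.comp g) (by simpa using hg)) _
      · refine ⟨f ≫ y, ?_⟩
        simp only [comp_and, comp_imp, comp_eqq, lift_fst, lift_snd_assoc, holds_and]
        refine ⟨holds_imp.2 fun g hg => ?_, holds_imp.2 fun g _ => by simp⟩
        exact holds_fls (hpq (g ≫ f) (by simpa using hg) (by simpa using hf.comp g)) _
    · intro Δ f x' y' hx hy
      simp only [comp_and, comp_imp, comp_eqq, lift_fst, lift_snd_assoc, holds_and] at hx hy
      have h' := h.comp f
      rw [comp_or] at h'
      refine (cov_of_or h').eq ?_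
      · rintro Θ g (hg | hg)
        · have h1 := (hx.1.comp g)
          have h2 := (hy.1.comp g)
          rw [comp_imp] at h1 h2
          simpa using ((holds_eqq _ _).1 (by simpa using h1.mp hg)).trans
            ((holds_eqq _ _).1 (by simpa using h2.mp hg)).symm
        · have h1 := (hx.2.comp g)
          have h2 := (hy.2.comp g)
          rw [comp_imp] at h1 h2
          simpa using ((holds_eqq _ _).1 (by simpa using h1.mp hg)).trans
            ((holds_eqq _ _).1 (by simpa using h2.mp hg)).symm
  obtain ⟨z, hz⟩ := key
  refine ⟨z, fun f => ?_⟩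
  have := hz.comp f
  simp only [comp_and, comp_imp, comp_eqq, lift_fst, lift_snd_assoc, holds_and,
    Category.id_comp] at this
  exact ⟨fun h1 => (holds_eqq _ _).1 (this.1.mp h1), fun h1 => (holds_eqq _ _).1 (this.2.mp h1)⟩

end LocalExistence

end SynTop

end

/-! ### Arithmetic and order of the natural numbers object -/

noncomputable section

namespace SynTop

section NaturalNumbers

variable {E : Type u} [Category.{v} E] [CartesianMonoidalCategory E] [MonoidalClosed E]
  [Limits.HasFiniteLimits E] [HasSubobjectClassifier E]

local postfix:max "⇧" => wk
local infix:45 " ≐ " => eqq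
local infixr:35 " ⋏ " => and
local infixr:25 " ⇛ " => imp
local infix:20 " ⟺ " => iff
local infix:50 " ∊ " => mem
local infixr:30 " ⋎ " => or

set_option linter.unusedSectionVars false
set_option linter.unusedSimpArgs false

namespace NNO

variable (T : NNO E)

@[simp]
theorem zero_recur {A : E} (a : 𝟙_ E ⟶ A) (f : A ⟶ A) : T.zero ≫ T.recur a f = a :=
  (T.existsUnique_rec a f).choose_spec.1.1

theorem zero_recur_assoc {A Z : E} (a : 𝟙_ E ⟶ A) (f : A ⟶ A) (h : A ⟶ Z) :
    T.zero ≫ T.recur a f ≫ h = a ≫ h := by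
  rw [← Category.assoc, zero_recur]

@[simp]
theorem succ_recur {A : E} (a : 𝟙_ E ⟶ A) (f : A ⟶ A) :
    T.succ ≫ T.recur a f = T.recur a f ≫ f :=
  (T.existsUnique_rec a f).choose_spec.1.2

theorem succ_recur_assoc {A Z : E} (a : 𝟙_ E ⟶ A) (f : A ⟶ A) (h : A ⟶ Z) :
    T.succ ≫ T.recur a f ≫ h = T.recur a f ≫ f ≫ h := by
  rw [← Category.assoc, succ_recur, Category.assoc]

theorem hom_ext {A : E} {h k : T.N ⟶ A} (f : A ⟶ A) (h0 : T.zero ≫ h = T.zero ≫ k)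
    (hh : T.succ ≫ h = h ≫ f) (hk : T.succ ≫ k = k ≫ f) : h = k :=
  (T.existsUnique_rec (T.zero ≫ k) f).unique ⟨h0, hh⟩ ⟨rfl, hk⟩

instance {Γ : E} : Zero (Γ ⟶ T.N) := ⟨toUnit Γ ≫ T.zero⟩
instance {Γ : E} : One (Γ ⟶ T.N) := ⟨(toUnit Γ ≫ T.zero) ≫ T.succ⟩
instance {Γ : E} : Add (Γ ⟶ T.N) := ⟨T.natAdd⟩
instance {Γ : E} : Mul (Γ ⟶ T.N) := ⟨T.natMul⟩

variable {T}

theorem zero_def (Γ : E) : toUnit Γ ≫ T.zero = 0 := rfl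

theorem natAdd_eq {Γ : E} (m n : Γ ⟶ T.N) : T.natAdd m n = m + n := rfl

theorem natMul_eq {Γ : E} (m n : Γ ⟶ T.N) : T.natMul m n = m * n := rfl

@[simp]
theorem comp_zero {Γ Δ : E} (f : Δ ⟶ Γ) : f ≫ (0 : Γ ⟶ T.N) = 0 := by
  rw [← zero_def, ← zero_def, ← Category.assoc, comp_toUnit]

theorem comp_zero_assoc {Γ Δ Z : E} (f : Δ ⟶ Γ) (h : T.N ⟶ Z) :
    f ≫ (0 : Γ ⟶ T.N) ≫ h = 0 ≫ h := by
  rw [← Category.assoc, comp_zero]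

@[simp]
theorem comp_one {Γ Δ : E} (f : Δ ⟶ Γ) : f ≫ (1 : Γ ⟶ T.N) = 1 := by
  change f ≫ 0 ≫ T.succ = 0 ≫ T.succ
  rw [comp_zero_assoc]

@[simp]
theorem comp_natAdd {Γ Δ : E} (f : Δ ⟶ Γ) (m n : Γ ⟶ T.N) : f ≫ (m + n) = f ≫ m + f ≫ n := by
  rw [← natAdd_eq, ← natAdd_eq]
  simp [natAdd]

@[simp]
theorem comp_natMul {Γ Δ : E} (f : Δ ⟶ Γ) (m n : Γ ⟶ T.N) :
    f ≫ (m * n) = (f ≫ m) * (f ≫ n) := by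
  rw [← natMul_eq, ← natMul_eq]
  simp [natMul]

theorem zero_eq_comp {Γ A : E} (h : T.N ⟶ A) : (0 : Γ ⟶ T.N) ≫ h = toUnit Γ ≫ T.zero ≫ h := by
  rw [← zero_def, Category.assoc]

theorem natAdd_zero' {Γ : E} (m : Γ ⟶ T.N) : m + 0 = m := by
  rw [← natAdd_eq, natAdd, addHom, lift_comp_uncurry, zero_eq_comp, zero_recur]
  have := app_lam (toUnit Γ) (fst T.N (𝟙_ E)) m
  rwa [lift_fst] at this

theorem app_map {Γ A X Y : E} (g : Γ ⟶ (ihom A).obj X) (s : X ⟶ Y) (a : Γ ⟶ A) :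
    app (g ≫ (ihom A).map s) a = app g a ≫ s := by
  rw [← lift_comp_uncurry, ← Category.id_comp ((ihom A).map s),
    MonoidalClosed.uncurry_natural_right, app, Category.assoc]

theorem natAdd_succ {Γ : E} (m n : Γ ⟶ T.N) : m + n ≫ T.succ = (m + n) ≫ T.succ := by
  rw [← natAdd_eq, natAdd, addHom, lift_comp_uncurry, Category.assoc, succ_recur,
    ← Category.assoc, app_map, ← lift_comp_uncurry]
  rfl

@[simp]
theorem comp_succ {Γ : E} (m : Γ ⟶ T.N) : m ≫ T.succ = m + 1 := by
  rw [show (1 : Γ ⟶ T.N) = 0 ≫ T.succ from rfl, natAdd_succ, natAdd_zero']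

theorem natAdd_add_one {Γ : E} (m n : Γ ⟶ T.N) : m + (n + 1) = m + n + 1 := by
  rw [← comp_succ, natAdd_succ, comp_succ]

theorem natMul_zero' {Γ : E} (m : Γ ⟶ T.N) : m * 0 = 0 := by
  rw [← natMul_eq, natMul, mulHom, lift_comp_uncurry, zero_eq_comp, zero_recur]
  have := app_lam (toUnit Γ) (snd T.N (𝟙_ E) ≫ T.zero) m
  rw [lift_snd_assoc] at this
  exact this

theorem natMul_add_one {Γ : E} (m n : Γ ⟶ T.N) : m * (n + 1) = m * n + m := by
  rw [← comp_succ, ← natMul_eq, natMul, mulHom, lift_comp_uncurry, Category.assoc, succ_recur,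
    ← Category.assoc]
  set h := n ≫ T.recur (MonoidalClosed.curry (snd T.N (𝟙_ E) ≫ T.zero)) (MonoidalClosed.curry
    (T.natAdd (MonoidalClosed.uncurry (𝟙 ((ihom T.N).obj T.N))) (fst T.N ((ihom T.N).obj T.N))))
    with hh
  have := app_lam h (T.natAdd (MonoidalClosed.uncurry (𝟙 ((ihom T.N).obj T.N)))
    (fst T.N ((ihom T.N).obj T.N))) m
  rw [natAdd_eq, comp_natAdd, lift_fst] at this
  refine this.trans ?_
  rw [← natMul_eq, natMul, mulHom, lift_comp_uncurry, lift_comp_uncurry, Category.comp_id]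

/-- Induction on natural numbers. -/
theorem induction {Γ : E} (φ : T.N ⊗ Γ ⟶ Om E)
    (h0 : ∀ {Δ : E} (f : Δ ⟶ Γ), Holds (lift 0 f ≫ φ))
    (hs : ∀ {Δ : E} (f : Δ ⟶ Γ) (n : Δ ⟶ T.N), Holds (lift n f ≫ φ) → Holds (lift (n + 1) f ≫ φ))
    {Δ : E} (f : Δ ⟶ Γ) (n : Δ ⟶ T.N) : Holds (lift n f ≫ φ) := by
  -- The universal property of `T.N` has no parameters, so the parameter in `Γ` is quantified away.
  let ψ : T.N ⟶ Om E := all Γ fun γ => lift (snd Γ T.N) γ ≫ φ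
  have hψ : ∀ {Δ : E} (n : Δ ⟶ T.N), Holds (n ≫ ψ) ↔
      ∀ {Θ : E} (g : Θ ⟶ Δ) (γ : Θ ⟶ Γ), Holds (lift (g ≫ n) γ ≫ φ) := by
    intro Δ n
    simp only [ψ, holds_comp_all, comp_lift_assoc, lift_snd, lift_fst]
  have z : Holds (T.zero ≫ ψ) := by
    rw [hψ]
    intro Θ g γ
    rw [toUnit_unique g (toUnit Θ)]
    exact h0 γ
  have s : Holds ((incl ψ ≫ T.succ) ≫ ψ) := by
    rw [hψ]
    intro Θ g γ
    rw [← Category.assoc, comp_succ]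
    refine hs _ _ ?_
    have : Holds ((g ≫ incl ψ) ≫ ψ) := Compr.prop g
    rw [hψ] at this
    simpa using this (𝟙 Θ) γ
  -- Zero and successor restrict to the subobject cut out by `ψ`. The recursive map into it is a
  -- section of the inclusion, so `ψ` holds for every number.
  have key : T.recur (Compr.mk T.zero z) (Compr.mk _ s) ≫ incl ψ = 𝟙 T.N := by
    refine T.hom_ext T.succ ?_ ?_ ?_
    · simp only [zero_recur_assoc, Compr.mk_incl, Category.comp_id]
    · simp only [succ_recur_assoc, Compr.mk_incl, Category.assoc]
    · simp only [Category.comp_id, Category.id_comp]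
  have := Compr.prop (T.recur (Compr.mk T.zero z) (Compr.mk _ s))
  rw [key, hψ] at this
  simpa using this n f

/-- Induction for equality of two sequences. -/
theorem induction_eq {Γ A : E} (g h : T.N ⊗ Γ ⟶ A)
    (h0 : ∀ {Δ : E} (f : Δ ⟶ Γ), lift 0 f ≫ g = lift 0 f ≫ h)
    (hs : ∀ {Δ : E} (f : Δ ⟶ Γ) (n : Δ ⟶ T.N), lift n f ≫ g = lift n f ≫ h →
      lift (n + 1) f ≫ g = lift (n + 1) f ≫ h)
    {Δ : E} (f : Δ ⟶ Γ) (n : Δ ⟶ T.N) : lift n f ≫ g = lift n f ≫ h := by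
  rw [← holds_comp_eqq]
  refine induction (eqq g h) ?_ ?_ f n
  · exact fun f => (holds_comp_eqq _ _ _).2 (h0 f)
  · exact fun f n hn => (holds_comp_eqq _ _ _).2 (hs f n ((holds_comp_eqq _ _ _).1 hn))

theorem zero_natAdd {Γ : E} (n : Γ ⟶ T.N) : 0 + n = n := by
  have := induction_eq (T := T) (Γ := Γ) (0 + fst _ _) (fst _ _) ?_ ?_ (𝟙 Γ) n
  · simpa using this
  · intro Δ f
    simp [natAdd_zero']
  · intro Δ f n hn
    simp only [comp_natAdd, lift_fst, comp_zero, natAdd_add_one] at hn ⊢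
    rw [hn]

theorem natAdd_assoc {Γ : E} (m k n : Γ ⟶ T.N) : m + k + n = m + (k + n) := by
  have := induction_eq (T := T) (Γ := Γ) (snd _ _ ≫ m + snd _ _ ≫ k + fst _ _)
    (snd _ _ ≫ m + (snd _ _ ≫ k + fst _ _)) ?_ ?_ (𝟙 Γ) n
  · simpa using this
  · intro Δ f
    simp [natAdd_zero']
  · intro Δ f n hn
    simp only [comp_natAdd, lift_fst, lift_snd_assoc, natAdd_add_one] at hn ⊢
    rw [hn]

theorem one_natAdd {Γ : E} (n : Γ ⟶ T.N) : 1 + n = n + 1 := by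
  have := induction_eq (T := T) (Γ := Γ) (1 + fst _ _) (fst _ _ + 1) ?_ ?_ (𝟙 Γ) n
  · simpa using this
  · intro Δ f
    simp [natAdd_zero', zero_natAdd]
  · intro Δ f n hn
    simp only [comp_natAdd, lift_fst, comp_one, natAdd_add_one] at hn ⊢
    rw [hn]

theorem natAdd_comm {Γ : E} (m n : Γ ⟶ T.N) : m + n = n + m := by
  have := induction_eq (T := T) (Γ := Γ) (snd _ _ ≫ m + fst _ _)
    (fst _ _ + snd _ _ ≫ m) ?_ ?_ (𝟙 Γ) n
  · simpa using this
  · intro Δ f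
    simp [natAdd_zero', zero_natAdd]
  · intro Δ f n hn
    simp only [comp_natAdd, lift_fst, lift_snd_assoc, natAdd_add_one] at hn ⊢
    rw [hn, natAdd_assoc, natAdd_assoc, one_natAdd]

instance {Γ : E} : AddCommMonoid (Γ ⟶ T.N) where
  add_assoc := natAdd_assoc
  zero_add := zero_natAdd
  add_zero := natAdd_zero'
  add_comm := natAdd_comm
  nsmul := nsmulRec

theorem zero_natMul {Γ : E} (n : Γ ⟶ T.N) : 0 * n = 0 := by
  have := induction_eq (T := T) (Γ := Γ) (0 * fst _ _) 0 ?_ ?_ (𝟙 Γ) n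
  · simpa using this
  · intro Δ f
    simp [natMul_zero']
  · intro Δ f n hn
    simp only [comp_natMul, lift_fst, comp_zero, natMul_add_one] at hn ⊢
    rw [hn, add_zero]

theorem natAdd_natMul {Γ : E} (m k n : Γ ⟶ T.N) : (m + k) * n = m * n + k * n := by
  have := induction_eq (T := T) (Γ := Γ) ((snd _ _ ≫ m + snd _ _ ≫ k) * fst _ _)
    (snd _ _ ≫ m * fst _ _ + snd _ _ ≫ k * fst _ _) ?_ ?_ (𝟙 Γ) n
  · simpa using this
  · intro Δ f
    simp [natMul_zero']
  · intro Δ f n hn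
    simp only [comp_natAdd, comp_natMul, lift_fst, lift_snd_assoc, natMul_add_one] at hn ⊢
    rw [hn]
    abel

theorem one_natMul {Γ : E} (n : Γ ⟶ T.N) : 1 * n = n := by
  have := induction_eq (T := T) (Γ := Γ) (1 * fst _ _) (fst _ _) ?_ ?_ (𝟙 Γ) n
  · simpa using this
  · intro Δ f
    simp [natMul_zero']
  · intro Δ f n hn
    simp only [comp_natMul, lift_fst, comp_one, natMul_add_one] at hn ⊢
    rw [hn]

theorem natMul_comm {Γ : E} (m n : Γ ⟶ T.N) : m * n = n * m := by
  have := induction_eq (T := T) (Γ := Γ) (snd _ _ ≫ m * fst _ _)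
    (fst _ _ * snd _ _ ≫ m) ?_ ?_ (𝟙 Γ) n
  · simpa using this
  · intro Δ f
    simp [natMul_zero', zero_natMul]
  · intro Δ f n hn
    simp only [comp_natMul, lift_fst, lift_snd_assoc, natMul_add_one, natAdd_natMul,
      one_natMul] at hn ⊢
    rw [hn]

theorem natMul_natAdd {Γ : E} (m k n : Γ ⟶ T.N) : m * (k + n) = m * k + m * n := by
  rw [natMul_comm, natAdd_natMul, natMul_comm, natMul_comm n]

theorem natMul_assoc {Γ : E} (m k n : Γ ⟶ T.N) : m * k * n = m * (k * n) := by
  have := induction_eq (T := T) (Γ := Γ) (snd _ _ ≫ m * snd _ _ ≫ k * fst _ _)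
    (snd _ _ ≫ m * (snd _ _ ≫ k * fst _ _)) ?_ ?_ (𝟙 Γ) n
  · simpa using this
  · intro Δ f
    simp [natMul_zero']
  · intro Δ f n hn
    simp only [comp_natMul, lift_fst, lift_snd_assoc, natMul_add_one] at hn ⊢
    rw [hn, natMul_natAdd]

instance {Γ : E} : CommSemiring (Γ ⟶ T.N) where
  mul_assoc := natMul_assoc
  one_mul := one_natMul
  mul_one n := (natMul_comm n 1).trans (one_natMul n)
  zero_mul := zero_natMul
  mul_zero := natMul_zero'
  left_distrib := natMul_natAdd
  right_distrib := natAdd_natMul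
  mul_comm := natMul_comm

/-! ### Peano axioms -/

/-- The predecessor is computed by a recursion on pairs that consist of the previous and the current
value of a counter. -/
theorem add_one_injective {Γ : E} {m n : Γ ⟶ T.N} (h : m + 1 = n + 1) : m = n := by
  let p : T.N ⟶ T.N ⊗ T.N := T.recur (lift T.zero T.zero) (lift (snd _ _) (snd _ _ + 1))
  have hp : p ≫ snd _ _ = 𝟙 T.N := by
    refine T.hom_ext T.succ ?_ ?_ ?_
    · simp only [p, zero_recur_assoc, lift_snd, Category.comp_id]
    · simp only [p, succ_recur_assoc, lift_snd, comp_succ, comp_natAdd, comp_one]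
    · simp only [Category.comp_id, Category.id_comp]
  have key : ∀ k : Γ ⟶ T.N, (k + 1) ≫ p ≫ fst _ _ = k := by
    intro k
    rw [← comp_succ, Category.assoc]
    simp only [p, succ_recur_assoc, lift_fst]
    change k ≫ p ≫ snd _ _ = k
    rw [hp, Category.comp_id]
  rw [← key m, h, key n]

/-- The recursively defined sequence `⊥, ⊤, ⊤, …` of truth values tells zero from successors. -/
theorem fls_of_add_one_eq_zero {Γ : E} {m : Γ ⟶ T.N} (h : m + 1 = 0) : Holds (fls Γ) := by
  have h1 : (0 : Γ ⟶ T.N) ≫ T.recur (fls _) (tru _) = fls Γ := by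
    rw [zero_eq_comp, zero_recur, comp_fls]
  have h2 : (m + 1) ≫ T.recur (fls _) (tru _) = tru Γ := by
    rw [← comp_succ, Category.assoc, succ_recur, comp_tru, comp_tru]
  rw [← h1, ← h, h2]
  rfl

instance {Γ : E} : IsRightCancelAdd (Γ ⟶ T.N) where
  add_right_cancel n m k h := by
    have := induction (T := T) (Γ := Γ)
      ((snd _ _ ≫ m + fst _ _ ≐ snd _ _ ≫ k + fst _ _) ⇛ (snd _ _ ≫ m ≐ snd _ _ ≫ k)) ?_ ?_ (𝟙 Γ) n
    · simp only [comp_imp, comp_eqq, comp_natAdd, lift_fst, lift_snd_assoc, Category.id_comp] at this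
      exact (holds_eqq _ _).1 (this.mp ((holds_eqq _ _).2 h))
    · intro Δ f
      simp only [comp_imp, comp_eqq, comp_natAdd, lift_fst, lift_snd_assoc, add_zero]
      exact holds_imp.2 fun _ h => h
    · intro Δ f n hn
      simp only [comp_imp, comp_eqq, comp_natAdd, lift_fst, lift_snd_assoc] at hn ⊢
      refine holds_imp.2 fun g hg => holds_imp.1 hn g ?_
      simp only [holds_comp_eqq, comp_natAdd, comp_one, ← add_assoc] at hg ⊢
      exact add_one_injective hg

instance {Γ : E} : IsCancelAdd (Γ ⟶ T.N) where
  toIsLeftCancelAdd := AddCommMagma.IsRightCancelAdd.toIsLeftCancelAdd (Γ ⟶ T.N)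

/-! ### The order -/

@[simp]
theorem comp_natLt {Γ Δ : E} (f : Δ ⟶ Γ) (m n : Γ ⟶ T.N) :
    f ≫ T.natLt m n = T.natLt (f ≫ m) (f ≫ n) := by
  rw [natLt, comp_ex, natLt]
  refine congrArg (fun φ => SynTop.ex T.N fun _ => φ) ?_
  simp [natAdd_eq]

/-- By cancellation the difference is unique, so unique choice produces it at the stage itself.
Inequalities thereby become equations in a commutative semiring. -/
theorem holds_natLt {Γ : E} {m n : Γ ⟶ T.N} :
    Holds (T.natLt m n) ↔ ∃ k : Γ ⟶ T.N, m + k + 1 = n := by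
  constructor
  · intro h
    have key : ∃ k : Γ ⟶ T.N, Holds (lift k (𝟙 Γ) ≫ (T.natAdd m⇧ (fst _ _) ≫ T.succ ≐ n⇧)) := by
      refine exists_of_unique _ (cov_of_ex h) ?_
      intro Δ f x y hx hy
      simp only [natAdd_eq, comp_eqq, comp_natAdd, comp_succ, lift_fst, lift_snd_assoc, comp_one,
        holds_eqq] at hx hy
      exact add_left_cancel (add_right_cancel (hx.trans hy.symm))
    obtain ⟨k, hk⟩ := key
    refine ⟨k, ?_⟩
    simpa [natAdd_eq] using hk
  · rintro ⟨k, rfl⟩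
    exact holds_ex_intro k (by simp [natAdd_eq])

theorem eq_zero_or_pos {Γ : E} (m : Γ ⟶ T.N) : Holds (m ≐ 0 ⋎ T.natLt 0 m) := by
  have := induction (T := T) (Γ := Γ) (fst _ _ ≐ 0 ⋎ T.natLt 0 (fst _ _)) ?_ ?_ (𝟙 Γ) m
  · simpa using this
  · intro Δ f
    rw [comp_or]
    exact holds_or_left (by simp)
  · intro Δ f n _
    rw [comp_or]
    refine holds_or_right ?_
    rw [comp_natLt, lift_fst, comp_zero, holds_natLt]
    exact ⟨n, by rw [zero_add]⟩

theorem holds_lt_succ_or_lt {Γ : E} (m n : Γ ⟶ T.N) :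
    Holds (T.natLt m (n + 1) ⋎ T.natLt n m) := by
  have := induction (T := T) (Γ := Γ)
    (T.natLt (snd _ _ ≫ m) (fst _ _ + 1) ⋎ T.natLt (fst _ _) (snd _ _ ≫ m)) ?_ ?_ (𝟙 Γ) n
  · simpa using this
  · intro Δ f
    refine holds_or_elim (eq_zero_or_pos (f ≫ m)) (fun g hg => ?_) fun g hg => ?_
    · rw [holds_comp_eqq, comp_zero] at hg
      simp only [comp_or, comp_natLt, comp_natAdd, comp_one, lift_fst, lift_snd_assoc, hg, comp_zero]
      exact holds_or_left (holds_natLt.2 ⟨0, by rw [add_zero]⟩)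
    · simp only [comp_or, comp_natLt, comp_natAdd, comp_one, lift_fst, lift_snd_assoc, comp_zero] at hg ⊢
      exact holds_or_right hg
  · intro Δ f n hn
    simp only [comp_or, comp_natLt, comp_natAdd, comp_one, lift_fst, lift_snd_assoc] at hn ⊢
    refine holds_or_elim hn (fun g hg => ?_) fun g hg => ?_
    · simp only [comp_or, comp_natLt, comp_natAdd, comp_one, holds_natLt] at hg ⊢
      obtain ⟨k, hk⟩ := hg
      exact holds_or_left (holds_natLt.2 ⟨k + 1, by rw [← hk]; ring⟩)
    · simp only [comp_or, comp_natLt, comp_natAdd, comp_one, holds_natLt] at hg ⊢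
      obtain ⟨k, hk⟩ := hg
      refine holds_or_elim (eq_zero_or_pos k) (fun l hl => ?_) fun l hl => ?_
      · rw [holds_comp_eqq, comp_zero] at hl
        have := congrArg (l ≫ ·) hk
        simp only [comp_natAdd, hl, comp_one] at this
        simp only [comp_or, comp_natLt, comp_natAdd, comp_one]
        exact holds_or_left (holds_natLt.2 ⟨0, by rw [← this]; ring⟩)
      · rw [comp_natLt, comp_zero, holds_natLt] at hl
        obtain ⟨j, hj⟩ := hl
        have := congrArg (l ≫ ·) hk
        simp only [comp_natAdd, ← hj, comp_one] at this
        simp only [comp_or, comp_natLt, comp_natAdd, comp_one]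
        exact holds_or_right (holds_natLt.2 ⟨j, by rw [← this]; ring⟩)

theorem le_or_lt {Γ : E} (m n : Γ ⟶ T.N) : Cov fun {Δ} (f : Δ ⟶ Γ) =>
    (∃ k : Δ ⟶ T.N, f ≫ m + k = f ≫ n) ∨ ∃ k : Δ ⟶ T.N, f ≫ n + k + 1 = f ≫ m :=
  (cov_of_or (holds_lt_succ_or_lt m n)).mono fun f hf => by
    simp only [comp_natLt, comp_natAdd, comp_one, holds_natLt] at hf
    exact hf.imp (fun ⟨k, hk⟩ => ⟨k, add_right_cancel hk⟩) id

theorem fls_of_add_add_one_eq {Γ : E} {m k : Γ ⟶ T.N} (h : m + k + 1 = m) : Holds (fls Γ) :=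
  fls_of_add_one_eq_zero (m := k) (add_left_cancel (a := m) (by rw [← add_assoc, h, add_zero]))

/-- Cancellation of a positive factor in a strict inequality. -/
theorem lt_of_mul_lt {Γ : E} {m n c k : Γ ⟶ T.N} (h : m * (c + 1) + k + 1 = n * (c + 1)) :
    ∃ j : Γ ⟶ T.N, m + j + 1 = n := by
  rw [← holds_natLt]
  refine (le_or_lt n m).holds fun f hf => ?_
  have h' := congrArg (f ≫ ·) h
  simp only [comp_natAdd, comp_natMul, comp_one] at h'
  rw [comp_natLt]
  rcases hf with ⟨j, hj⟩ | ⟨j, hj⟩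
  · refine holds_fls (fls_of_add_add_one_eq (m := (f ≫ n) * (f ≫ c + 1))
      (k := j * (f ≫ c + 1) + f ≫ k) ?_) _
    rw [← hj] at h'
    linear_combination h'
  · exact holds_natLt.2 ⟨j, hj⟩

/-- Definition of functions by primitive recursion. -/
theorem exists_primrec {Γ A : E} (a : Γ ⟶ A) (s : A ⊗ (T.N ⊗ Γ) ⟶ A) : ∃ h : T.N ⊗ Γ ⟶ A,
    (∀ {Δ : E} (γ : Δ ⟶ Γ), lift 0 γ ≫ h = γ ≫ a) ∧
    ∀ {Δ : E} (n : Δ ⟶ T.N) (γ : Δ ⟶ Γ),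
      lift (n + 1) γ ≫ h = lift (lift n γ ≫ h) (lift n γ) ≫ s := by
  -- The universal property offers neither parameters nor access to the index, so the state consists
  -- of a counter and a function of the parameter.
  let B : E := T.N ⊗ (ihom Γ).obj A
  let st : B ⟶ B := lift (fst _ _ + 1) (lam (lift (app (snd _ _ ≫ snd _ _) (fst _ _))
    (lift (snd _ _ ≫ fst _ _) (fst _ _)) ≫ s))
  let r : T.N ⟶ B := T.recur (lift T.zero (lam (fst Γ (𝟙_ E) ≫ a))) st
  have hr0 : T.zero ≫ r = lift T.zero (lam (fst Γ (𝟙_ E) ≫ a)) := zero_recur _ _ _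
  have hrs : T.succ ≫ r = r ≫ st := succ_recur _ _ _
  have h1 : r ≫ fst _ _ = 𝟙 T.N := by
    refine T.hom_ext T.succ ?_ ?_ ?_
    · rw [← Category.assoc, hr0, lift_fst, Category.comp_id]
    · rw [← Category.assoc, hrs, Category.assoc, lift_fst, comp_natAdd, comp_one, comp_succ]
    · rw [Category.comp_id, Category.id_comp]
  refine ⟨app (fst T.N Γ ≫ r ≫ snd _ _) (snd T.N Γ), fun γ => ?_, fun n γ => ?_⟩
  · rw [comp_app, lift_fst_assoc, lift_snd, zero_eq_comp, ← Category.assoc T.zero, hr0, lift_snd,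
      app_lam, lift_fst_assoc]
  · have h2 : (n + 1) ≫ r ≫ snd _ _ = (n ≫ r) ≫ st ≫ snd _ _ := by
      rw [← comp_succ, Category.assoc, ← Category.assoc T.succ, hrs, Category.assoc, Category.assoc]
    have h3 : n ≫ r ≫ fst _ _ = n := by rw [h1, Category.comp_id]
    rw [comp_app, lift_fst_assoc, lift_snd, h2, lift_snd, app_lam]
    simp only [comp_lift_assoc, comp_lift, comp_app, lift_snd_assoc, lift_fst, lift_snd,
      Category.assoc, h3, lift_fst_assoc]

end NNO

end NaturalNumbers

end SynTop

end

/-! ### Formal fractions: order, density and the archimedean property -/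

noncomputable section

namespace SynTop

section Rationals

variable {E : Type u} [Category.{v} E] [CartesianMonoidalCategory E] [MonoidalClosed E]
  [Limits.HasFiniteLimits E] [HasSubobjectClassifier E]

local postfix:max "⇧" => wk
local infix:45 " ≐ " => eqq
local infixr:35 " ⋏ " => and
local infixr:25 " ⇛ " => imp
local infix:20 " ⟺ " => iff
local infix:50 " ∊ " => mem
local infixr:30 " ⋎ " => or

set_option linter.unusedSectionVars false
set_option linter.unusedSimpArgs false

namespace NNO

variable {T : NNO E}

/-! ### Rational numbers -/

/-- A positive natural number. -/
def IsPos {Γ : E} (p : Γ ⟶ T.N) : Prop := ∃ k : Γ ⟶ T.N, p = k + 1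

theorem isPos_add_one {Γ : E} (k : Γ ⟶ T.N) : IsPos (k + 1) := ⟨k, rfl⟩

theorem IsPos.add {Γ : E} {p q : Γ ⟶ T.N} (hp : IsPos p) : IsPos (p + q) := by
  obtain ⟨k, rfl⟩ := hp
  exact ⟨k + q, by ring⟩

theorem IsPos.mul {Γ : E} {p q : Γ ⟶ T.N} (hp : IsPos p) (hq : IsPos q) : IsPos (p * q) := by
  obtain ⟨k, rfl⟩ := hp
  obtain ⟨l, rfl⟩ := hq
  exact ⟨k * l + k + l, by ring⟩

theorem IsPos.fls {Γ : E} {p m : Γ ⟶ T.N} (hp : IsPos p) (h : m + p = m) : Holds (fls Γ) := by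
  obtain ⟨k, rfl⟩ := hp
  exact fls_of_add_add_one_eq (m := m) (k := k) (by rw [add_assoc, h])

theorem exists_pos_of_mul {Γ : E} {m n c p : Γ ⟶ T.N} (hc : IsPos c) (hp : IsPos p)
    (h : m * c + p = n * c) : ∃ j : Γ ⟶ T.N, IsPos j ∧ m + j = n := by
  obtain ⟨c, rfl⟩ := hc
  obtain ⟨p, rfl⟩ := hp
  obtain ⟨j, hj⟩ := lt_of_mul_lt (by rwa [← add_assoc] at h)
  exact ⟨j + 1, ⟨j, rfl⟩, by rw [← hj, add_assoc]⟩

/-- The order of rational numbers. -/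
def QLt {Γ : E} (q r : Γ ⟶ T.Q) : Prop :=
  ∃ p : Γ ⟶ T.N, IsPos p ∧ T.pos q * (T.prd r + 1) + T.sbt r * (T.prd q + 1) + p =
    T.pos r * (T.prd q + 1) + T.sbt q * (T.prd r + 1)

/-- The weak order of rational numbers. -/
def QLe {Γ : E} (q r : Γ ⟶ T.Q) : Prop :=
  ∃ p : Γ ⟶ T.N, T.pos q * (T.prd r + 1) + T.sbt r * (T.prd q + 1) + p =
    T.pos r * (T.prd q + 1) + T.sbt q * (T.prd r + 1)

@[simp]
theorem comp_qlt {Γ Δ : E} (f : Δ ⟶ Γ) (q r : Γ ⟶ T.Q) :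
    f ≫ T.qlt q r = T.qlt (f ≫ q) (f ≫ r) := by
  simp [qlt, natAdd_eq, natMul_eq]

@[simp]
theorem comp_qadd {Γ Δ : E} (f : Δ ⟶ Γ) (q r : Γ ⟶ T.Q) :
    f ≫ T.qadd q r = T.qadd (f ≫ q) (f ≫ r) := by
  simp [qadd, natAdd_eq, natMul_eq]

@[simp]
theorem comp_qzero {Γ Δ : E} (f : Δ ⟶ Γ) : f ≫ T.qzero Γ = T.qzero Δ := by
  simp [qzero, zero_def]

theorem holds_qlt {Γ : E} {q r : Γ ⟶ T.Q} : Holds (T.qlt q r) ↔ QLt q r := by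
  rw [qlt, holds_natLt]
  simp only [natAdd_eq, natMul_eq, comp_succ]
  constructor
  · rintro ⟨k, hk⟩
    exact ⟨k + 1, ⟨k, rfl⟩, by rw [← hk, ← add_assoc]⟩
  · rintro ⟨_, ⟨k, rfl⟩, hk⟩
    exact ⟨k, by rw [← hk, add_assoc]⟩

theorem QLt.comp {Γ Δ : E} {q r : Γ ⟶ T.Q} (h : QLt q r) (f : Δ ⟶ Γ) : QLt (f ≫ q) (f ≫ r) := by
  rw [← holds_qlt] at h ⊢
  simpa using h.comp f

theorem QLe.comp {Γ Δ : E} {q r : Γ ⟶ T.Q} (h : QLe q r) (f : Δ ⟶ Γ) : QLe (f ≫ q) (f ≫ r) := by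
  obtain ⟨p, hp⟩ := h
  refine ⟨f ≫ p, ?_⟩
  simpa using congrArg (f ≫ ·) hp

/-- The rational number `(a - b) / (c + 1)`. -/
def mkQ {Γ : E} (a b c : Γ ⟶ T.N) : Γ ⟶ T.Q := lift a (lift b c)

@[simp] theorem pos_mkQ {Γ : E} (a b c : Γ ⟶ T.N) : mkQ a b c ≫ fst _ _ = a := by simp [mkQ]

@[simp] theorem sbt_mkQ {Γ : E} (a b c : Γ ⟶ T.N) :
    mkQ a b c ≫ snd _ _ ≫ fst _ _ = b := by simp [mkQ]

@[simp] theorem prd_mkQ {Γ : E} (a b c : Γ ⟶ T.N) :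
    mkQ a b c ≫ snd _ _ ≫ snd _ _ = c := by simp [mkQ]

@[simp]
theorem comp_mkQ {Γ Δ : E} (f : Δ ⟶ Γ) (a b c : Γ ⟶ T.N) :
    f ≫ mkQ a b c = mkQ (f ≫ a) (f ≫ b) (f ≫ c) := by
  simp [mkQ]

theorem qadd_eq {Γ : E} (q r : Γ ⟶ T.Q) : T.qadd q r =
    mkQ (T.pos q * (T.prd r + 1) + T.pos r * (T.prd q + 1))
      (T.sbt q * (T.prd r + 1) + T.sbt r * (T.prd q + 1))
      (T.prd q * T.prd r + T.prd q + T.prd r) := by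
  simp only [qadd, natAdd_eq, natMul_eq, comp_succ, mkQ]

theorem qzero_eq (Γ : E) : T.qzero Γ = mkQ 0 0 0 := rfl

/-- The opposite of a rational number. -/
def qneg {Γ : E} (q : Γ ⟶ T.Q) : Γ ⟶ T.Q := mkQ (T.sbt q) (T.pos q) (T.prd q)

@[simp]
theorem comp_qneg {Γ Δ : E} (f : Δ ⟶ Γ) (q : Γ ⟶ T.Q) : f ≫ qneg q = qneg (f ≫ q) := by
  simp [qneg]

theorem exists_mkQ {Γ : E} (q : Γ ⟶ T.Q) : ∃ a b c, q = mkQ a b c :=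
  ⟨T.pos q, T.sbt q, T.prd q, by
    rw [mkQ, lift_comp_fst_snd, lift_comp_fst_snd]⟩

theorem qlt_mkQ {Γ : E} {a b c x y z : Γ ⟶ T.N} : QLt (mkQ a b c) (mkQ x y z) ↔
    ∃ p : Γ ⟶ T.N, IsPos p ∧ a * (z + 1) + y * (c + 1) + p = x * (c + 1) + b * (z + 1) := by
  simp [QLt]

theorem qle_mkQ {Γ : E} {a b c x y z : Γ ⟶ T.N} : QLe (mkQ a b c) (mkQ x y z) ↔
    ∃ p : Γ ⟶ T.N, a * (z + 1) + y * (c + 1) + p = x * (c + 1) + b * (z + 1) := by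
  simp [QLe]

theorem qadd_mkQ {Γ : E} (a b c x y z : Γ ⟶ T.N) : T.qadd (mkQ a b c) (mkQ x y z) =
    mkQ (a * (z + 1) + x * (c + 1)) (b * (z + 1) + y * (c + 1)) (c * z + c + z) := by
  simp [qadd_eq]

theorem qneg_mkQ {Γ : E} (a b c : Γ ⟶ T.N) : qneg (mkQ a b c) = mkQ b a c := by
  simp [qneg]

theorem QLt.qle {Γ : E} {q r : Γ ⟶ T.Q} (h : QLt q r) : QLe q r :=
  let ⟨p, _, h⟩ := h
  ⟨p, h⟩

theorem QLt.fls {Γ : E} {q : Γ ⟶ T.Q} (h : QLt q q) : Holds (fls Γ) := by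
  obtain ⟨p, hp, h⟩ := h
  exact hp.fls h

/-- After scaling and adding the cross-multiplied relations, the denominator of `r` is a common
factor, and `exists_pos_of_mul` cancels it. -/
theorem QLt.trans_qle {Γ : E} {q r s : Γ ⟶ T.Q} (h : QLt q r) (h' : QLe r s) : QLt q s := by
  obtain ⟨a, b, c, rfl⟩ := exists_mkQ q
  obtain ⟨a', b', c', rfl⟩ := exists_mkQ r
  obtain ⟨x, y, z, rfl⟩ := exists_mkQ s
  rw [qlt_mkQ] at h ⊢
  rw [qle_mkQ] at h'
  obtain ⟨p, hp, h⟩ := h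
  obtain ⟨p', h'⟩ := h'
  refine exists_pos_of_mul (isPos_add_one c') (p := p * (z + 1) + p' * (c + 1))
    (hp.mul (isPos_add_one z)).add ?_
  linear_combination (z + 1) * h + (c + 1) * h'

theorem QLe.trans_qlt {Γ : E} {q r s : Γ ⟶ T.Q} (h : QLe q r) (h' : QLt r s) : QLt q s := by
  obtain ⟨a, b, c, rfl⟩ := exists_mkQ q
  obtain ⟨a', b', c', rfl⟩ := exists_mkQ r
  obtain ⟨x, y, z, rfl⟩ := exists_mkQ s
  rw [qlt_mkQ] at h' ⊢
  rw [qle_mkQ] at h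
  obtain ⟨p', h⟩ := h
  obtain ⟨p, hp, h'⟩ := h'
  refine exists_pos_of_mul (isPos_add_one c') (p := p * (c + 1) + p' * (z + 1))
    (hp.mul (isPos_add_one c)).add ?_
  linear_combination (z + 1) * h + (c + 1) * h'

theorem QLt.trans {Γ : E} {q r s : Γ ⟶ T.Q} (h : QLt q r) (h' : QLt r s) : QLt q s :=
  h.trans_qle h'.qle

theorem qle_or_qlt {Γ : E} (q r : Γ ⟶ T.Q) :
    Cov fun {Δ} (f : Δ ⟶ Γ) => QLe (f ≫ q) (f ≫ r) ∨ QLt (f ≫ r) (f ≫ q) := by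
  obtain ⟨a, b, c, rfl⟩ := exists_mkQ q
  obtain ⟨x, y, z, rfl⟩ := exists_mkQ r
  refine (le_or_lt (a * (z + 1) + y * (c + 1)) (x * (c + 1) + b * (z + 1))).mono fun f hf => ?_
  simp only [comp_natAdd, comp_natMul, comp_one, comp_mkQ] at hf ⊢
  rcases hf with ⟨k, hk⟩ | ⟨k, hk⟩
  · exact Or.inl (qle_mkQ.2 ⟨k, hk⟩)
  · exact Or.inr (qlt_mkQ.2 ⟨k + 1, ⟨k, rfl⟩, by linear_combination hk⟩)

theorem QLt.add {Γ : E} {q r s t : Γ ⟶ T.Q} (h : QLt q r) (h' : QLe s t) :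
    QLt (T.qadd q s) (T.qadd r t) := by
  obtain ⟨a, b, c, rfl⟩ := exists_mkQ q
  obtain ⟨a', b', c', rfl⟩ := exists_mkQ r
  obtain ⟨x, y, z, rfl⟩ := exists_mkQ s
  obtain ⟨x', y', z', rfl⟩ := exists_mkQ t
  rw [qlt_mkQ] at h
  rw [qle_mkQ] at h'
  rw [qadd_mkQ, qadd_mkQ, qlt_mkQ]
  obtain ⟨p, hp, h⟩ := h
  obtain ⟨p', h'⟩ := h'
  refine ⟨p * ((z + 1) * (z' + 1)) + p' * ((c + 1) * (c' + 1)),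
    (hp.mul ((isPos_add_one z).mul (isPos_add_one z'))).add, ?_⟩
  linear_combination (z + 1) * (z' + 1) * h + (c + 1) * (c' + 1) * h'

theorem QLe.refl {Γ : E} (q : Γ ⟶ T.Q) : QLe q q := ⟨0, by rw [add_zero]⟩

theorem qadd_comm {Γ : E} (q r : Γ ⟶ T.Q) : T.qadd q r = T.qadd r q := by
  obtain ⟨a, b, c, rfl⟩ := exists_mkQ q
  obtain ⟨x, y, z, rfl⟩ := exists_mkQ r
  rw [qadd_mkQ, qadd_mkQ]
  congr 1 <;> ring

theorem qadd_assoc {Γ : E} (q r s : Γ ⟶ T.Q) :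
    T.qadd (T.qadd q r) s = T.qadd q (T.qadd r s) := by
  obtain ⟨a, b, c, rfl⟩ := exists_mkQ q
  obtain ⟨x, y, z, rfl⟩ := exists_mkQ r
  obtain ⟨x', y', z', rfl⟩ := exists_mkQ s
  simp only [qadd_mkQ]
  congr 1 <;> ring

theorem qzero_qadd {Γ : E} (q : Γ ⟶ T.Q) : T.qadd (T.qzero Γ) q = q := by
  obtain ⟨a, b, c, rfl⟩ := exists_mkQ q
  rw [qzero_eq, qadd_mkQ]
  congr 1 <;> ring

theorem qneg_qadd_qle {Γ : E} (q : Γ ⟶ T.Q) : QLe (T.qadd (qneg q) q) (T.qzero Γ) := by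
  obtain ⟨a, b, c, rfl⟩ := exists_mkQ q
  rw [qzero_eq, qneg_mkQ, qadd_mkQ, qle_mkQ]
  exact ⟨0, by ring⟩

theorem qle_qneg_qadd {Γ : E} (q : Γ ⟶ T.Q) : QLe (T.qzero Γ) (T.qadd (qneg q) q) := by
  obtain ⟨a, b, c, rfl⟩ := exists_mkQ q
  rw [qzero_eq, qneg_mkQ, qadd_mkQ, qle_mkQ]
  exact ⟨0, by ring⟩

theorem qneg_qneg {Γ : E} (q : Γ ⟶ T.Q) : qneg (qneg q) = q := by
  obtain ⟨a, b, c, rfl⟩ := exists_mkQ q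
  rw [qneg_mkQ, qneg_mkQ]

theorem QLt.qneg {Γ : E} {q r : Γ ⟶ T.Q} (h : QLt q r) : QLt (qneg r) (qneg q) := by
  obtain ⟨a, b, c, rfl⟩ := exists_mkQ q
  obtain ⟨x, y, z, rfl⟩ := exists_mkQ r
  rw [qneg_mkQ, qneg_mkQ]
  rw [qlt_mkQ] at h ⊢
  obtain ⟨p, hp, h⟩ := h
  exact ⟨p, hp, by linear_combination h⟩

/-- The order of rational numbers is dense. -/
theorem QLt.exists_between {Γ : E} {q r : Γ ⟶ T.Q} (h : QLt q r) : ∃ s, QLt q s ∧ QLt s r := by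
  obtain ⟨a, b, c, rfl⟩ := exists_mkQ q
  obtain ⟨x, y, z, rfl⟩ := exists_mkQ r
  rw [qlt_mkQ] at h
  obtain ⟨p, hp, h⟩ := h
  -- The arithmetic mean. The last entry is one less than the denominator `2 * (c + 1) * (z + 1)`.
  refine ⟨mkQ (a * (z + 1) + x * (c + 1)) (b * (z + 1) + y * (c + 1))
    ((c + 1) * (z + 1) + (c + 1) * z + c), qlt_mkQ.2 ⟨p * (c + 1), hp.mul (isPos_add_one c), ?_⟩,
    qlt_mkQ.2 ⟨p * (z + 1), hp.mul (isPos_add_one z), ?_⟩⟩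
  · linear_combination (c + 1) * h
  · linear_combination (z + 1) * h

theorem exists_qgt {Γ : E} (q : Γ ⟶ T.Q) : ∃ r, QLt q r := by
  obtain ⟨a, b, c, rfl⟩ := exists_mkQ q
  exact ⟨mkQ (a + 1) b c, qlt_mkQ.2 ⟨c + 1, isPos_add_one c, by ring⟩⟩

theorem exists_qlt {Γ : E} (q : Γ ⟶ T.Q) : ∃ r, QLt r q := by
  obtain ⟨a, b, c, rfl⟩ := exists_mkQ q
  exact ⟨mkQ a (b + 1) c, qlt_mkQ.2 ⟨c + 1, isPos_add_one c, by ring⟩⟩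

/-- Every gap contains twice a positive number. -/
theorem QLt.exists_half {Γ : E} {q r : Γ ⟶ T.Q} (h : QLt q r) :
    ∃ e, QLt (T.qzero Γ) e ∧ QLe (T.qadd q (T.qadd e e)) r := by
  obtain ⟨a, b, c, rfl⟩ := exists_mkQ q
  obtain ⟨x, y, z, rfl⟩ := exists_mkQ r
  rw [qlt_mkQ] at h
  obtain ⟨p, hp, h⟩ := h
  -- Here `p` is the numerator of `r - q` over the denominator `(c + 1) * (z + 1)`, so this is half
  -- of the gap.
  refine ⟨mkQ p 0 ((c + 1) * (z + 1) + (c + 1) * z + c), ?_, ?_⟩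
  · rw [qzero_eq, qlt_mkQ]
    exact ⟨p, hp, by ring⟩
  · rw [qadd_mkQ, qadd_mkQ, qle_mkQ]
    refine ⟨0, ?_⟩
    linear_combination (c + 1) * (2 * (c + 1) * (z + 1)) * (2 * (z + 1)) * h

/-- The multiple `n * q`. -/
def qnsmul {Γ : E} (n : Γ ⟶ T.N) (q : Γ ⟶ T.Q) : Γ ⟶ T.Q :=
  mkQ (n * T.pos q) (n * T.sbt q) (T.prd q)

@[simp]
theorem comp_qnsmul {Γ Δ : E} (f : Δ ⟶ Γ) (n : Γ ⟶ T.N) (q : Γ ⟶ T.Q) :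
    f ≫ qnsmul n q = qnsmul (f ≫ n) (f ≫ q) := by
  simp [qnsmul]

theorem qadd_zero_qnsmul_qle {Γ : E} (q r : Γ ⟶ T.Q) : QLe (T.qadd q (qnsmul 0 r)) q := by
  obtain ⟨a, b, c, rfl⟩ := exists_mkQ q
  obtain ⟨x, y, z, rfl⟩ := exists_mkQ r
  simp only [qnsmul, Category.assoc, pos_mkQ, sbt_mkQ, prd_mkQ, qadd_mkQ]
  rw [qle_mkQ]
  exact ⟨0, by ring⟩

theorem qadd_succ_qnsmul_qle {Γ : E} (q r : Γ ⟶ T.Q) (n : Γ ⟶ T.N) :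
    QLe (T.qadd q (qnsmul (n + 1) r)) (T.qadd (T.qadd q (qnsmul n r)) r) := by
  obtain ⟨a, b, c, rfl⟩ := exists_mkQ q
  obtain ⟨x, y, z, rfl⟩ := exists_mkQ r
  simp only [qnsmul, Category.assoc, pos_mkQ, sbt_mkQ, prd_mkQ, qadd_mkQ]
  rw [qle_mkQ]
  exact ⟨0, by ring⟩

/-- The rational numbers are archimedean. -/
theorem exists_qnsmul {Γ : E} {e : Γ ⟶ T.Q} (he : QLt (T.qzero Γ) e) (q r : Γ ⟶ T.Q) :
    ∃ n : Γ ⟶ T.N, QLt r (T.qadd q (qnsmul n e)) := by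
  obtain ⟨a, b, c, rfl⟩ := exists_mkQ q
  obtain ⟨x, y, z, rfl⟩ := exists_mkQ r
  obtain ⟨x', y', z', rfl⟩ := exists_mkQ e
  rw [qzero_eq, qlt_mkQ] at he
  obtain ⟨p, ⟨k, rfl⟩, he⟩ := he
  -- Since `e ≥ 1 / (z' + 1)`, this multiple of `e` is at least `x * (c + 1) + b * (z + 1) + 1`,
  -- which exceeds `r - q`.
  refine ⟨(x * (c + 1) + b * (z + 1) + 1) * (z' + 1), ?_⟩
  simp only [qnsmul, Category.assoc, pos_mkQ, sbt_mkQ, prd_mkQ, qadd_mkQ]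
  rw [qlt_mkQ]
  refine ⟨(k * (c + 1) * (z + 1) * (z' + 1) * (x * (c + 1) + b * (z + 1) + 1)
    + (z' + 1) * ((x * (c + 1) + b * (z + 1)) * (c * z + c + z) + (a * (z + 1) + y * (c + 1))
      + (c * z + c + z))) + (z' + 1), ?_, ?_⟩
  · rw [add_comm]
    exact (isPos_add_one _).add
  · linear_combination (c + 1) * (z + 1) * (z' + 1) * (x * (c + 1) + b * (z + 1) + 1) * he

end NNO

end Rationals

end SynTop

end

/-! ### Closure properties of the open truth values -/

noncomputable section

namespace SynTop

section OpenTruth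

variable {E : Type u} [Category.{v} E] [CartesianMonoidalCategory E] [MonoidalClosed E]
  [Limits.HasFiniteLimits E] [HasSubobjectClassifier E]

local postfix:max "⇧" => wk
local infix:45 " ≐ " => eqq
local infixr:35 " ⋏ " => and
local infixr:25 " ⇛ " => imp
local infix:20 " ⟺ " => iff
local infix:50 " ∊ " => mem
local infixr:30 " ⋎ " => or

set_option linter.unusedSectionVars false
set_option linter.unusedSimpArgs false

namespace SynthTopology

variable {T : SynthTopology E}

/-! ### Open truth values -/

theorem op_tru (Γ : E) : Holds (T.op (tru Γ)) := by
  have := T.open_true.comp (toUnit Γ)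
  rwa [← Category.assoc, comp_tru] at this

theorem op_of_holds {Γ : E} {p : Γ ⟶ Om E} (h : Holds p) : Holds (T.op p) := by
  rw [Holds] at h
  rw [h]
  exact op_tru Γ

theorem op_fls (Γ : E) : Holds (T.op (fls Γ)) := by
  have := T.open_false.comp (toUnit Γ)
  rwa [← Category.assoc, comp_fls] at this

theorem eq_fls_of_neg {Γ : E} {p : Γ ⟶ Om E} (h : Holds (neg p)) : p = fls Γ :=
  om_ext fun f => ⟨fun hp => by rw [comp_fls]; exact holds_neg.1 h f hp, fun hf =>
    holds_comp_fls hf _⟩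

theorem op_of_neg {Γ : E} {p : Γ ⟶ Om E} (h : Holds (neg p)) : Holds (T.op p) := by
  rw [eq_fls_of_neg h]
  exact op_fls Γ

/-- In each case `p` equals `⊤` or `⊥`, both of which are open; being open is a proposition, so
local cases suffice. -/
theorem op_of_dec {Γ : E} {p : Γ ⟶ Om E} (h : Holds (p ⋎ neg p)) : Holds (T.op p) := by
  refine holds_or_elim h (fun f hf => ?_) fun f hf => ?_
  · rw [← Category.assoc]
    exact op_of_holds hf
  · rw [← Category.assoc]
    exact op_of_neg (by simpa using hf)

/-- The overtness axiom quantifies internally over subsets, so it may be instantiated with a subset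
that depends on a parameter in `Γ`. -/
theorem op_ex_nat {Γ : E} {φ : (T.N ⊗ Γ ⟶ T.N) → (T.N ⊗ Γ ⟶ Om E)}
    (h : Holds (T.op (φ (fst T.N Γ)))) : Holds (T.op (ex T.N φ)) := by
  have := holds_all.1 T.overt_nat (toUnit Γ) (sep T.N φ)
  simp only [comp_imp, comp_all, comp_mem, lift_fst, whiskerLeft_fst, whiskerLeft_snd_assoc,
    comp_mem_assoc, comp_ex_assoc, mem_comp_sep, lift_fst_snd, Category.id_comp] at this
  refine this.mp (holds_all.2 fun f x => ?_)
  exact h.comp _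

theorem op_ex_prod {Γ A B : E} {φ : ((A ⊗ B) ⊗ Γ ⟶ A ⊗ B) → ((A ⊗ B) ⊗ Γ ⟶ Om E)}
    (h : Holds (T.op (ex A fun a => ex B fun b => lift (lift (a⇧) b) (snd _ _ ≫ snd _ _) ≫ φ (fst _ _)))) :
    Holds (T.op (ex (A ⊗ B) φ)) := by
  refine Eq.mp (congrArg (fun p => Holds (T.op p)) (om_ext fun f => ⟨fun hf => ?_, fun hf => ?_⟩)) h
  · refine (cov_of_comp_ex hf).holds fun g ⟨a, ha⟩ => (cov_of_comp_ex ha).holds fun k ⟨b, hb⟩ => ?_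
    rw [← Category.assoc, ← Category.assoc]
    refine holds_comp_ex_intro (lift (k ≫ a) b) ?_
    simpa using hb
  · refine (cov_of_comp_ex hf).holds fun g ⟨x, hx⟩ => ?_
    rw [← Category.assoc]
    refine holds_comp_ex_intro (x ≫ fst _ _) (holds_comp_ex_intro (x ≫ snd _ _) ?_)
    simpa using hx

/-- Formal fractions are triples of natural numbers, so three applications of overtness of `T.N`
suffice. -/
theorem op_ex_rat {Γ : E} {φ : (T.Q ⊗ Γ ⟶ T.Q) → (T.Q ⊗ Γ ⟶ Om E)}
    (h : Holds (T.op (φ (fst T.Q Γ)))) : Holds (T.op (ex T.Q φ)) := by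
  refine op_ex_prod (op_ex_nat (op_ex_prod (op_ex_nat (op_ex_nat ?_))))
  simpa using h.comp _

theorem op_natLt {Γ : E} (m n : Γ ⟶ T.N) : Holds (T.op (T.natLt m n)) := by
  refine op_of_dec ((NNO.le_or_lt n m).holds fun f hf => ?_)
  rw [comp_or, comp_neg, NNO.comp_natLt]
  rcases hf with ⟨k, hk⟩ | ⟨k, hk⟩
  · refine holds_or_right (holds_neg.2 fun g hg => ?_)
    rw [NNO.comp_natLt, NNO.holds_natLt] at hg
    obtain ⟨j, hj⟩ := hg
    refine NNO.fls_of_add_add_one_eq (m := g ≫ f ≫ n) (k := g ≫ k + j) ?_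
    rw [← hk] at hj
    simp only [NNO.comp_natAdd] at hj
    linear_combination hj
  · exact holds_or_left (NNO.holds_natLt.2 ⟨k, hk⟩)

theorem op_qlt {Γ : E} (q r : Γ ⟶ T.Q) : Holds (T.op (T.qlt q r)) := op_natLt _ _

/-- Closure under disjunction is not an axiom. The disjunction is the existential quantification
over `T.N` of the sequence which is `p` at zero and `q` afterwards. -/
theorem op_or {Γ : E} {p q : Γ ⟶ Om E} (hp : Holds (T.op p)) (hq : Holds (T.op q)) :
    Holds (T.op (p ⋎ q)) := by
  have hd : Holds ((fst T.N Γ ≐ 0) ⋎ T.natLt 0 (fst T.N Γ)) := NNO.eq_zero_or_pos _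
  obtain ⟨z, hz⟩ := exists_ite (p⇧) (q⇧) hd fun f h1 h2 => by
    rw [holds_comp_eqq, NNO.comp_zero] at h1
    rw [NNO.comp_natLt, h1, NNO.comp_zero, NNO.holds_natLt] at h2
    obtain ⟨k, hk⟩ := h2
    exact NNO.fls_of_add_add_one_eq hk
  have e : (p ⋎ q) = ex T.N fun _ => z := by
    refine om_ext fun f => ⟨fun hf => ?_, fun hf => ?_⟩
    · rw [comp_or] at hf
      refine holds_or_elim hf (fun g hg => ?_) fun g hg => ?_
      · rw [← Category.assoc]
        refine holds_comp_ex_intro 0 ?_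
        rw [(hz _).1 (by simp)]
        simpa using hg
      · rw [← Category.assoc]
        refine holds_comp_ex_intro 1 ?_
        rw [(hz _).2 (by simp [NNO.holds_natLt])]
        simpa using hg
    · refine (cov_of_comp_ex hf).holds fun g ⟨n, hn⟩ => ?_
      have hd' := hd.comp (lift n (g ≫ f))
      rw [comp_or] at hd' ⊢
      refine holds_or_elim hd' (fun k hk => ?_) fun k hk => ?_
      · have := hn.comp k
        rw [← Category.assoc] at hk this
        rw [(hz _).1 hk] at this
        simp only [comp_or]
        exact holds_or_left (by simpa using this)
      · have := hn.comp k
        rw [← Category.assoc] at hk this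
        rw [(hz _).2 hk] at this
        simp only [comp_or]
        exact holds_or_right (by simpa using this)
  rw [e]
  refine op_ex_nat (holds_or_elim hd (fun f hf => ?_) fun f hf => ?_)
  · rw [← Category.assoc, (hz f).1 hf]
    simpa using (hp.comp (f ≫ snd _ _))
  · rw [← Category.assoc, (hz f).2 hf]
    simpa using (hq.comp (f ≫ snd _ _))

end SynthTopology

end OpenTruth

end SynTop

end

/-! ### Dedekind cuts in terms of elements at stages -/

noncomputable section

namespace SynTop

section Reals

variable {E : Type u} [Category.{v} E] [CartesianMonoidalCategory E] [MonoidalClosed E]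
  [Limits.HasFiniteLimits E] [HasSubobjectClassifier E]

local postfix:max "⇧" => wk
local infix:45 " ≐ " => eqq
local infixr:35 " ⋏ " => and
local infixr:25 " ⇛ " => imp
local infix:20 " ⟺ " => iff
local infix:50 " ∊ " => mem
local infixr:30 " ⋎ " => or

set_option linter.unusedSectionVars false
set_option linter.unusedSimpArgs false

open NNO

namespace SynthTopology

variable {T : SynthTopology E}

/-! ### Real numbers -/

/-- The proposition `q < a` for a rational number `q` and a real number `a`. -/
def below {Γ : E} (q : Γ ⟶ T.Q) (a : Γ ⟶ T.R) : Γ ⟶ Om E := q ∊ T.lo (T.cut a)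

/-- The proposition `a < q` for a rational number `q` and a real number `a`. -/
def above {Γ : E} (q : Γ ⟶ T.Q) (a : Γ ⟶ T.R) : Γ ⟶ Om E := q ∊ T.up (T.cut a)

@[simp]
theorem comp_below {Γ Δ : E} (f : Δ ⟶ Γ) (q : Γ ⟶ T.Q) (a : Γ ⟶ T.R) :
    f ≫ below q a = below (f ≫ q) (f ≫ a) := by
  simp [below]

@[simp]
theorem comp_above {Γ Δ : E} (f : Δ ⟶ Γ) (q : Γ ⟶ T.Q) (a : Γ ⟶ T.R) :
    f ≫ above q a = above (f ≫ q) (f ≫ a) := by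
  simp [above]

/-- The defining properties of cuts, at all stages. -/
structure CutData {Γ : E} (L U : Γ ⟶ Pow T.Q) : Prop where
  lo_inh : Cov fun {Δ} (f : Δ ⟶ Γ) => ∃ q : Δ ⟶ T.Q, Holds (q ∊ f ≫ L)
  up_inh : Cov fun {Δ} (f : Δ ⟶ Γ) => ∃ q : Δ ⟶ T.Q, Holds (q ∊ f ≫ U)
  lo_lt : ∀ {Δ : E} (f : Δ ⟶ Γ) (q r : Δ ⟶ T.Q), QLt q r → Holds (r ∊ f ≫ L) → Holds (q ∊ f ≫ L)
  lo_round : ∀ {Δ : E} (f : Δ ⟶ Γ) (q : Δ ⟶ T.Q), Holds (q ∊ f ≫ L) →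
    Cov fun {Θ} (g : Θ ⟶ Δ) => ∃ r : Θ ⟶ T.Q, QLt (g ≫ q) r ∧ Holds (r ∊ (g ≫ f) ≫ L)
  up_lt : ∀ {Δ : E} (f : Δ ⟶ Γ) (q r : Δ ⟶ T.Q), QLt q r → Holds (q ∊ f ≫ U) → Holds (r ∊ f ≫ U)
  up_round : ∀ {Δ : E} (f : Δ ⟶ Γ) (q : Δ ⟶ T.Q), Holds (q ∊ f ≫ U) →
    Cov fun {Θ} (g : Θ ⟶ Δ) => ∃ r : Θ ⟶ T.Q, QLt r (g ≫ q) ∧ Holds (r ∊ (g ≫ f) ≫ U)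
  disj : ∀ {Δ : E} (f : Δ ⟶ Γ) (q : Δ ⟶ T.Q), Holds (q ∊ f ≫ L) → Holds (q ∊ f ≫ U) →
    Holds (fls Δ)
  located : ∀ {Δ : E} (f : Δ ⟶ Γ) (q r : Δ ⟶ T.Q), QLt q r → Holds (q ∊ f ≫ L ⋎ r ∊ f ≫ U)
  lo_open : ∀ {Δ : E} (f : Δ ⟶ Γ) (q : Δ ⟶ T.Q), Holds (T.op (q ∊ f ≫ L))
  up_open : ∀ {Δ : E} (f : Δ ⟶ Γ) (q : Δ ⟶ T.Q), Holds (T.op (q ∊ f ≫ U))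

/-- The internal definition is unfolded clause by clause, once and for all; cuts are handled through
`CutData` from here on. -/
theorem holds_isCut {Γ : E} (a : Γ ⟶ T.CutPair) :
    Holds (T.isCut a) ↔ CutData (T.lo a) (T.up a) := by
  simp only [isCut, holds_and]
  constructor
  · rintro ⟨h1, h2, h3, h4, h5, h6, h7, h8⟩
    have h3' : ∀ {Δ : E} (f : Δ ⟶ Γ) (q : Δ ⟶ T.Q), (q ∊ f ≫ T.lo a) =
        ex T.Q fun r => r ∊ (f ≫ T.lo a)⇧ ⋏ T.qlt q⇧ r := by
      intro Δ f q
      have := holds_all.1 h3 f q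
      rw [comp_iff, holds_iff, comp_ex] at this
      rw [comp_mem, lift_fst, lift_snd_assoc] at this
      rw [this]
      refine ex_congr ?_
      simp only [comp_and, comp_mem, comp_qlt, whiskerLeft_fst, whiskerLeft_snd_assoc, lift_fst,
        lift_snd_assoc]
    have h4' : ∀ {Δ : E} (f : Δ ⟶ Γ) (q : Δ ⟶ T.Q), (q ∊ f ≫ T.up a) =
        ex T.Q fun r => r ∊ (f ≫ T.up a)⇧ ⋏ T.qlt r q⇧ := by
      intro Δ f q
      have := holds_all.1 h4 f q
      rw [comp_iff, holds_iff, comp_ex] at this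
      rw [comp_mem, lift_fst, lift_snd_assoc] at this
      rw [this]
      refine ex_congr ?_
      simp only [comp_and, comp_mem, comp_qlt, whiskerLeft_fst, whiskerLeft_snd_assoc, lift_fst,
        lift_snd_assoc]
    refine ⟨(cov_of_ex h1).mono fun f ⟨q, hq⟩ => ⟨q, by simpa using hq⟩,
      (cov_of_ex h2).mono fun f ⟨q, hq⟩ => ⟨q, by simpa using hq⟩, ?_, ?_, ?_, ?_, ?_, ?_, ?_, ?_⟩
    · intro Δ f q r hqr hr
      rw [h3']
      exact holds_ex_intro r (by simpa using ⟨hr, holds_qlt.2 hqr⟩)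
    · intro Δ f q hq
      rw [h3'] at hq
      refine (cov_of_ex hq).mono fun g ⟨r, hr⟩ => ⟨r, ?_⟩
      simp only [comp_and, comp_mem, lift_fst, lift_snd_assoc, comp_qlt, holds_and, holds_qlt] at hr
      exact ⟨hr.2, by simpa using hr.1⟩
    · intro Δ f q r hqr hr
      rw [h4']
      exact holds_ex_intro q (by simpa using ⟨hr, holds_qlt.2 hqr⟩)
    · intro Δ f q hq
      rw [h4'] at hq
      refine (cov_of_ex hq).mono fun g ⟨r, hr⟩ => ⟨r, ?_⟩
      simp only [comp_and, comp_mem, lift_fst, lift_snd_assoc, comp_qlt, holds_and, holds_qlt] at hr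
      exact ⟨hr.2, by simpa using hr.1⟩
    · intro Δ f q hl hu
      have := holds_all.1 h5 f q
      rw [comp_neg] at this
      exact this.absurd (by simpa using ⟨hl, hu⟩)
    · intro Δ f q r hqr
      have := holds_comp_all.1 (holds_all.1 h6 f q) (𝟙 Δ) r
      simp only [comp_imp, comp_qlt, lift_fst, lift_snd_assoc, comp_or, comp_mem] at this
      simp only [comp_lift_assoc, lift_snd_assoc, lift_fst, Category.id_comp, Category.assoc,
        comp_lift] at this
      exact this.mp (holds_qlt.2 hqr)
    · intro Δ f q
      have := holds_all.1 h7 f q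
      simpa [comp_mem_assoc] using this
    · intro Δ f q
      have := holds_all.1 h8 f q
      simpa [comp_mem_assoc] using this
  · intro h
    refine ⟨Cov.ex (h.lo_inh.mono fun f ⟨q, hq⟩ => ⟨q, by simpa using hq⟩),
      Cov.ex (h.up_inh.mono fun f ⟨q, hq⟩ => ⟨q, by simpa using hq⟩), ?_, ?_, ?_, ?_, ?_, ?_⟩
    · refine holds_all.2 fun f q => ?_
      rw [comp_iff, holds_iff]
      refine om_ext fun g => ⟨fun hg => ?_, fun hg => ?_⟩
      · refine (h.lo_round (g ≫ f) (g ≫ q) (by simpa using hg)).holds fun k ⟨r, hr, hr'⟩ => ?_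
        rw [← Category.assoc, ← Category.assoc]
        refine holds_comp_ex_intro r ?_
        simpa [holds_qlt] using And.intro hr' hr
      · rw [← Category.assoc] at hg
        refine (cov_of_comp_ex hg).holds fun k ⟨r, hr⟩ => ?_
        simp only [comp_and, comp_mem, lift_fst, lift_snd_assoc, comp_qlt, holds_and, holds_qlt,
          comp_lift, Category.assoc] at hr
        have := h.lo_lt (k ≫ g ≫ f) _ _ hr.2 (by simpa using hr.1)
        simpa using this
    · refine holds_all.2 fun f q => ?_
      rw [comp_iff, holds_iff]
      refine om_ext fun g => ⟨fun hg => ?_, fun hg => ?_⟩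
      · refine (h.up_round (g ≫ f) (g ≫ q) (by simpa using hg)).holds fun k ⟨r, hr, hr'⟩ => ?_
        rw [← Category.assoc, ← Category.assoc]
        refine holds_comp_ex_intro r ?_
        simpa [holds_qlt] using And.intro hr' hr
      · rw [← Category.assoc] at hg
        refine (cov_of_comp_ex hg).holds fun k ⟨r, hr⟩ => ?_
        simp only [comp_and, comp_mem, lift_fst, lift_snd_assoc, comp_qlt, holds_and, holds_qlt,
          comp_lift, Category.assoc] at hr
        have := h.up_lt (k ≫ g ≫ f) _ _ hr.2 (by simpa using hr.1)
        simpa using this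
    · refine holds_all.2 fun f q => ?_
      rw [comp_neg]
      refine holds_neg.2 fun g hg => ?_
      simp only [comp_and, comp_mem, lift_fst, lift_snd_assoc, holds_and] at hg
      exact h.disj (g ≫ f) (g ≫ q) (by simpa using hg.1) (by simpa using hg.2)
    · refine holds_all.2 fun f q => holds_comp_all.2 fun g r => ?_
      rw [comp_imp]
      refine holds_imp.2 fun k hk => ?_
      simp only [comp_qlt, comp_or, comp_mem, comp_lift, comp_lift_assoc, lift_fst, lift_snd_assoc,
        Category.assoc, holds_qlt, lift_snd] at hk ⊢
      simpa using h.located (k ≫ g ≫ f) _ _ hk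
    · refine holds_all.2 fun f q => ?_
      simpa [comp_mem_assoc] using h.lo_open f q
    · refine holds_all.2 fun f q => ?_
      simpa [comp_mem_assoc] using h.up_open f q

@[simp]
theorem comp_isCut {Γ Δ : E} (f : Δ ⟶ Γ) (a : Γ ⟶ T.CutPair) :
    f ≫ T.isCut a = T.isCut (f ≫ a) := by
  simp only [isCut, isOpen, comp_and]
  refine congrArg₂ _ ?_ (congrArg₂ _ ?_ (congrArg₂ _ ?_ (congrArg₂ _ ?_ (congrArg₂ _ ?_
    (congrArg₂ _ ?_ (congrArg₂ _ ?_ ?_))))))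
  · rw [comp_ex]
    exact ex_congr (by simp only [comp_mem, whiskerLeft_fst, whiskerLeft_snd_assoc, Category.assoc])
  · rw [comp_ex]
    exact ex_congr (by simp only [comp_mem, whiskerLeft_fst, whiskerLeft_snd_assoc, Category.assoc])
  · rw [comp_all]
    refine all_congr ?_
    rw [comp_iff, comp_ex]
    refine congrArg₂ _ (by
      simp only [comp_mem, whiskerLeft_fst, whiskerLeft_snd_assoc, Category.assoc]) (ex_congr ?_)
    simp only [comp_and, comp_qlt, comp_mem, whiskerLeft_fst, whiskerLeft_snd_assoc, Category.assoc]
  · rw [comp_all]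
    refine all_congr ?_
    rw [comp_iff, comp_ex]
    refine congrArg₂ _ (by
      simp only [comp_mem, whiskerLeft_fst, whiskerLeft_snd_assoc, Category.assoc]) (ex_congr ?_)
    simp only [comp_and, comp_qlt, comp_mem, whiskerLeft_fst, whiskerLeft_snd_assoc, Category.assoc]
  · rw [comp_all]
    refine all_congr ?_
    simp only [comp_neg, comp_and, comp_mem, whiskerLeft_fst, whiskerLeft_snd_assoc, Category.assoc]
  · rw [comp_all]
    refine all_congr ?_
    rw [comp_all]
    refine all_congr ?_
    simp only [comp_imp, comp_or, comp_qlt, comp_mem, whiskerLeft_fst, whiskerLeft_snd_assoc,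
      Category.assoc]
  · rw [comp_all]
    refine all_congr ?_
    simp only [comp_mem_assoc, whiskerLeft_fst, whiskerLeft_snd_assoc, Category.assoc]
  · rw [comp_all]
    refine all_congr ?_
    simp only [comp_mem_assoc, whiskerLeft_fst, whiskerLeft_snd_assoc, Category.assoc]

theorem cutData_cut {Γ : E} (a : Γ ⟶ T.R) : CutData (T.lo (T.cut a)) (T.up (T.cut a)) := by
  have := Compr.prop a
  rw [comp_isCut, holds_isCut] at this
  simpa using this

theorem exists_real {Γ : E} {L U : Γ ⟶ Pow T.Q} (h : CutData L U) :
    ∃ a : Γ ⟶ T.R, T.lo (T.cut a) = L ∧ T.up (T.cut a) = U := by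
  have h' : Holds (lift L U ≫ T.isCut (𝟙 T.CutPair)) := by
    rw [comp_isCut, holds_isCut]
    simpa using h
  exact ⟨Compr.mk _ h', by simp, by simp⟩

end SynthTopology

end Reals

end SynTop

end

/-! ### The order of the real numbers and the embedding of the rationals -/

noncomputable section

namespace SynTop

section RealOrder

variable {E : Type u} [Category.{v} E] [CartesianMonoidalCategory E] [MonoidalClosed E]
  [Limits.HasFiniteLimits E] [HasSubobjectClassifier E]

local postfix:max "⇧" => wk
local infix:45 " ≐ " => eqq
local infixr:35 " ⋏ " => and
local infixr:25 " ⇛ " => imp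
local infix:20 " ⟺ " => iff
local infix:50 " ∊ " => mem
local infixr:30 " ⋎ " => or

set_option linter.unusedSectionVars false
set_option linter.unusedSimpArgs false

open NNO

namespace NNO

variable {T : NNO E}

/-- The order is decidable and `s < q` is refuted. Adding one turns the weak inequality into a
strict inequality of natural numbers, which can be proved locally because its witness is unique. -/
theorem QLe.trans {Γ : E} {q r s : Γ ⟶ T.Q} (h : QLe q r) (h' : QLe r s) : QLe q s := by
  have key : Holds (neg (T.qlt s q)) := holds_neg.2 fun f hf => by
    rw [comp_qlt, holds_qlt] at hf
    exact ((hf.trans_qle (h.comp f)).trans_qle (h'.comp f)).fls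
  obtain ⟨a, b, c, rfl⟩ := exists_mkQ q
  obtain ⟨x, y, z, rfl⟩ := exists_mkQ s
  rw [qle_mkQ]
  suffices h : Holds (T.natLt (a * (z + 1) + y * (c + 1)) (x * (c + 1) + b * (z + 1) + 1)) by
    obtain ⟨k, hk⟩ := holds_natLt.1 h
    exact ⟨k, add_right_cancel hk⟩
  refine (qle_or_qlt (mkQ a b c) (mkQ x y z)).holds fun f hf => ?_
  rcases hf with hf | hf
  · simp only [comp_mkQ] at hf
    obtain ⟨p, hp⟩ := qle_mkQ.1 hf
    simp only [comp_natLt, comp_natAdd, comp_natMul, comp_one]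
    exact holds_natLt.2 ⟨p, by rw [hp]⟩
  · exact holds_fls (holds_neg.1 key f (by rw [comp_qlt]; exact holds_qlt.2 hf)) _

theorem QLt.add_left {Γ : E} {q r : Γ ⟶ T.Q} (h : QLt q r) (s : Γ ⟶ T.Q) :
    QLt (T.qadd s q) (T.qadd s r) := by
  rw [qadd_comm s, qadd_comm s]
  exact h.add (QLe.refl s)

theorem QLe.add_left {Γ : E} {q r : Γ ⟶ T.Q} (h : QLe q r) (s : Γ ⟶ T.Q) :
    QLe (T.qadd s q) (T.qadd s r) := by
  obtain ⟨a, b, c, rfl⟩ := exists_mkQ q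
  obtain ⟨a', b', c', rfl⟩ := exists_mkQ r
  obtain ⟨x, y, z, rfl⟩ := exists_mkQ s
  rw [qle_mkQ] at h
  rw [qadd_mkQ, qadd_mkQ, qle_mkQ]
  obtain ⟨p, h⟩ := h
  refine ⟨p * ((z + 1) * (z + 1)), ?_⟩
  linear_combination (z + 1) * (z + 1) * h

theorem qadd_qzero {Γ : E} (q : Γ ⟶ T.Q) : T.qadd q (T.qzero Γ) = q := by
  rw [qadd_comm, qzero_qadd]

/-- Subtraction moves a summand to the other side. -/
theorem QLt.qneg_add {Γ : E} {m l e : Γ ⟶ T.Q} (h : QLt m (T.qadd l e)) :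
    QLt (NNO.qneg e) (T.qadd (NNO.qneg m) l) := by
  obtain ⟨a, b, c, rfl⟩ := exists_mkQ m
  obtain ⟨a', b', c', rfl⟩ := exists_mkQ l
  obtain ⟨x, y, z, rfl⟩ := exists_mkQ e
  rw [qadd_mkQ, qlt_mkQ] at h
  rw [qneg_mkQ, qneg_mkQ, qadd_mkQ, qlt_mkQ]
  obtain ⟨p, hp, h⟩ := h
  exact ⟨p, hp, by linear_combination h⟩

end NNO

namespace SynthTopology

variable {T : SynthTopology E} {Γ : E}

theorem below_comp_eq {Δ : E} (f : Δ ⟶ Γ) (q : Δ ⟶ T.Q) (a : Γ ⟶ T.R) :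
    below q (f ≫ a) = (q ∊ f ≫ T.lo (T.cut a)) := by
  simp [below]

theorem above_comp_eq {Δ : E} (f : Δ ⟶ Γ) (q : Δ ⟶ T.Q) (a : Γ ⟶ T.R) :
    above q (f ≫ a) = (q ∊ f ≫ T.up (T.cut a)) := by
  simp [above]

theorem below_of_qlt {q r : Γ ⟶ T.Q} {a : Γ ⟶ T.R} (h : QLt q r) (hr : Holds (below r a)) :
    Holds (below q a) := by
  simpa [below] using (cutData_cut a).lo_lt (𝟙 Γ) q r h (by simpa [below] using hr)

theorem above_of_qlt {q r : Γ ⟶ T.Q} {a : Γ ⟶ T.R} (h : QLt q r) (hr : Holds (above q a)) :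
    Holds (above r a) := by
  simpa [above] using (cutData_cut a).up_lt (𝟙 Γ) q r h (by simpa [above] using hr)

theorem below_round {q : Γ ⟶ T.Q} {a : Γ ⟶ T.R} (h : Holds (below q a)) :
    Cov fun {Δ} (f : Δ ⟶ Γ) => ∃ r : Δ ⟶ T.Q, QLt (f ≫ q) r ∧ Holds (below r (f ≫ a)) :=
  ((cutData_cut a).lo_round (𝟙 Γ) q (by simpa [below] using h)).mono fun f ⟨r, hr, hr'⟩ =>
    ⟨r, hr, by simpa [below] using hr'⟩

theorem above_round {q : Γ ⟶ T.Q} {a : Γ ⟶ T.R} (h : Holds (above q a)) :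
    Cov fun {Δ} (f : Δ ⟶ Γ) => ∃ r : Δ ⟶ T.Q, QLt r (f ≫ q) ∧ Holds (above r (f ≫ a)) :=
  ((cutData_cut a).up_round (𝟙 Γ) q (by simpa [above] using h)).mono fun f ⟨r, hr, hr'⟩ =>
    ⟨r, hr, by simpa [above] using hr'⟩

theorem exists_below (a : Γ ⟶ T.R) :
    Cov fun {Δ} (f : Δ ⟶ Γ) => ∃ r : Δ ⟶ T.Q, Holds (below r (f ≫ a)) :=
  (cutData_cut a).lo_inh.mono fun f ⟨r, hr⟩ => ⟨r, by simpa [below] using hr⟩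

theorem exists_above (a : Γ ⟶ T.R) :
    Cov fun {Δ} (f : Δ ⟶ Γ) => ∃ r : Δ ⟶ T.Q, Holds (above r (f ≫ a)) :=
  (cutData_cut a).up_inh.mono fun f ⟨r, hr⟩ => ⟨r, by simpa [above] using hr⟩

theorem fls_of_below_above {q : Γ ⟶ T.Q} {a : Γ ⟶ T.R} (h : Holds (below q a))
    (h' : Holds (above q a)) : Holds (fls Γ) :=
  (cutData_cut a).disj (𝟙 Γ) q (by simpa [below] using h) (by simpa [above] using h')

theorem below_or_above {q r : Γ ⟶ T.Q} (h : QLt q r) (a : Γ ⟶ T.R) :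
    Holds (below q a ⋎ above r a) := by
  simpa [below, above] using (cutData_cut a).located (𝟙 Γ) q r h

theorem op_below (q : Γ ⟶ T.Q) (a : Γ ⟶ T.R) : Holds (T.op (below q a)) := by
  simpa [below] using (cutData_cut a).lo_open (𝟙 Γ) q

theorem op_above (q : Γ ⟶ T.Q) (a : Γ ⟶ T.R) : Holds (T.op (above q a)) := by
  simpa [above] using (cutData_cut a).up_open (𝟙 Γ) q

/-- Roundness replaces `r` by a strictly larger rational number. In particular, cuts do not
distinguish fractions of equal value. -/
theorem below_of_qle {q r : Γ ⟶ T.Q} {a : Γ ⟶ T.R} (h : QLe q r) (hr : Holds (below r a)) :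
    Holds (below q a) :=
  (below_round hr).holds fun f ⟨s, hs, hs'⟩ => by
    rw [comp_below]
    exact below_of_qlt ((h.comp f).trans_qlt hs) hs'

theorem above_of_qle {q r : Γ ⟶ T.Q} {a : Γ ⟶ T.R} (h : QLe q r) (hr : Holds (above q a)) :
    Holds (above r a) :=
  (above_round hr).holds fun f ⟨s, hs, hs'⟩ => by
    rw [comp_above]
    exact above_of_qlt (hs.trans_qle (h.comp f)) hs'

/-- Rational numbers can be compared, and `r ≤ q` would put `q` into both halves of the cut. -/
theorem qlt_of_below_above {q r : Γ ⟶ T.Q} {a : Γ ⟶ T.R} (h : Holds (below q a))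
    (h' : Holds (above r a)) : QLt q r := by
  rw [← holds_qlt]
  refine (qle_or_qlt r q).holds fun f hf => ?_
  rw [comp_qlt]
  rcases hf with hf | hf
  · refine holds_fls (fls_of_below_above (q := f ≫ q) (a := f ≫ a) ?_ ?_) _
    · simpa using h.comp f
    · exact above_of_qle hf (by simpa using h'.comp f)
  · exact holds_qlt.2 hf

/-- A real number is determined by its lower cut. -/
theorem real_ext {a b : Γ ⟶ T.R}
    (h : ∀ {Δ : E} (f : Δ ⟶ Γ) (q : Δ ⟶ T.Q), Holds (below q (f ≫ a)) ↔ Holds (below q (f ≫ b))) :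
    a = b := by
  -- Some `r < q` is still above `a`. If `r` were below `b` it would be below `a`, so locatedness of
  -- `b` puts `q` above `b`.
  have key : ∀ {Δ : E} (f : Δ ⟶ Γ) (a b : Γ ⟶ T.R) (q : Δ ⟶ T.Q),
      (∀ {Δ : E} (f : Δ ⟶ Γ) (q : Δ ⟶ T.Q), Holds (below q (f ≫ a)) ↔ Holds (below q (f ≫ b))) →
      Holds (above q (f ≫ a)) → Holds (above q (f ≫ b)) := by
    intro Δ f a b q h hq
    refine (above_round hq).holds fun g ⟨r, hr, hr'⟩ => ?_
    refine holds_or_elim (below_or_above hr (g ≫ f ≫ b)) (fun k hk => ?_) fun k hk => ?_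
    · rw [comp_below] at hk
      have := (h (k ≫ g ≫ f) _).2 (by simpa using hk)
      exact holds_fls (fls_of_below_above this (by simpa using hr'.comp k)) _
    · simpa using hk
  refine Compr.ext (CartesianMonoidalCategory.hom_ext _ _ (pow_ext fun f q => ?_)
    (pow_ext fun f q => ?_))
  · simpa [below] using h f q
  · have h1 := key f a b q h
    have h2 := key f b a q fun f q => (h f q).symm
    simpa [above] using Iff.intro h1 h2

/-! ### Rational numbers as real numbers -/

theorem exists_rat (q : Γ ⟶ T.Q) : ∃ a : Γ ⟶ T.R,
    T.lo (T.cut a) = (sep T.Q fun r => T.qlt r q⇧) ∧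
    T.up (T.cut a) = (sep T.Q fun r => T.qlt q⇧ r) := by
  refine exists_real ⟨?_, ?_, ?_, ?_, ?_, ?_, ?_, ?_, ?_, ?_⟩
  · obtain ⟨r, hr⟩ := exists_qlt q
    exact Cov.pure ⟨r, by simpa [holds_qlt] using hr⟩
  · obtain ⟨r, hr⟩ := exists_qgt q
    exact Cov.pure ⟨r, by simpa [holds_qlt] using hr⟩
  · intro Δ f r s h h'
    simp only [mem_comp_sep, comp_qlt, lift_fst, lift_snd_assoc, holds_qlt] at h' ⊢
    exact h.trans h'
  · intro Δ f r h
    simp only [mem_comp_sep, comp_qlt, lift_fst, lift_snd_assoc, holds_qlt] at h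
    obtain ⟨s, h1, h2⟩ := h.exists_between
    refine Cov.pure ⟨s, by simpa using h1, ?_⟩
    simpa [holds_qlt] using h2
  · intro Δ f r s h h'
    simp only [mem_comp_sep, comp_qlt, lift_fst, lift_snd_assoc, holds_qlt] at h' ⊢
    exact h'.trans h
  · intro Δ f r h
    simp only [mem_comp_sep, comp_qlt, lift_fst, lift_snd_assoc, holds_qlt] at h
    obtain ⟨s, h1, h2⟩ := h.exists_between
    refine Cov.pure ⟨s, by simpa using h2, ?_⟩
    simpa [holds_qlt] using h1
  · intro Δ f r h h'
    simp only [mem_comp_sep, comp_qlt, lift_fst, lift_snd_assoc, holds_qlt] at h h'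
    exact (h.trans h').fls
  · intro Δ f r s h
    refine (qle_or_qlt (f ≫ q) r).holds fun g hg => ?_
    simp only [mem_comp_sep, comp_qlt, lift_fst, lift_snd_assoc, comp_or]
    rcases hg with hg | hg
    · exact holds_or_right (holds_qlt.2 (hg.trans_qlt (h.comp g)))
    · exact holds_or_left (holds_qlt.2 hg)
  · intro Δ f r
    simp only [mem_comp_sep, comp_qlt]
    exact op_qlt _ _
  · intro Δ f r
    simp only [mem_comp_sep, comp_qlt]
    exact op_qlt _ _

/-- A rational number as a real number. -/
def rat (q : Γ ⟶ T.Q) : Γ ⟶ T.R := (exists_rat q).choose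

theorem below_rat {Δ : E} (f : Δ ⟶ Γ) (q : Γ ⟶ T.Q) (r : Δ ⟶ T.Q) :
    Holds (below r (f ≫ rat q)) ↔ QLt r (f ≫ q) := by
  rw [below_comp_eq, rat, (exists_rat q).choose_spec.1, mem_comp_sep, ← holds_qlt]
  simp

theorem above_rat {Δ : E} (f : Δ ⟶ Γ) (q : Γ ⟶ T.Q) (r : Δ ⟶ T.Q) :
    Holds (above r (f ≫ rat q)) ↔ QLt (f ≫ q) r := by
  rw [above_comp_eq, rat, (exists_rat q).choose_spec.2, mem_comp_sep, ← holds_qlt]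
  simp

@[simp]
theorem comp_rat {Δ : E} (f : Δ ⟶ Γ) (q : Γ ⟶ T.Q) : f ≫ (rat q : Γ ⟶ T.R) = rat (f ≫ q) :=
  real_ext fun g r => by rw [← Category.assoc, below_rat, below_rat, Category.assoc]

@[simp]
theorem holds_below_rat (q r : Γ ⟶ T.Q) : Holds (below r (rat q)) ↔ QLt r q := by
  simpa using below_rat (𝟙 Γ) q r

@[simp]
theorem holds_above_rat (q r : Γ ⟶ T.Q) : Holds (above r (rat q)) ↔ QLt q r := by
  simpa using above_rat (𝟙 Γ) q r

instance : Zero (Γ ⟶ T.R) := ⟨rat (T.qzero Γ)⟩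

theorem rat_zero : rat (T.qzero Γ) = (0 : Γ ⟶ T.R) := rfl

@[simp]
theorem comp_real_zero {Δ : E} (f : Δ ⟶ Γ) : f ≫ (0 : Γ ⟶ T.R) = 0 := by
  rw [← rat_zero, comp_rat, comp_qzero, rat_zero]

@[simp]
theorem cut_zero : T.cut (0 : Γ ⟶ T.R) = T.zeroCut Γ := by
  refine CartesianMonoidalCategory.hom_ext _ _ ?_ ?_
  · refine (exists_rat (T.qzero Γ)).choose_spec.1.trans ?_
    simp [zeroCut]
  · refine (exists_rat (T.qzero Γ)).choose_spec.2.trans ?_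
    simp [zeroCut]

/-! ### The order of the real numbers -/

/-- The strict order of real numbers. -/
def rlt (a b : Γ ⟶ T.R) : Γ ⟶ Om E := T.lt (T.cut a) (T.cut b)

theorem comp_lt {Δ : E} (f : Δ ⟶ Γ) (a b : Γ ⟶ T.CutPair) :
    f ≫ T.lt a b = T.lt (f ≫ a) (f ≫ b) := by
  rw [lt, comp_ex, lt]
  refine ex_congr ?_
  simp only [comp_and, comp_mem, whiskerLeft_fst, whiskerLeft_snd_assoc, Category.assoc]

@[simp]
theorem comp_rlt {Δ : E} (f : Δ ⟶ Γ) (a b : Γ ⟶ T.R) : f ≫ rlt a b = rlt (f ≫ a) (f ≫ b) := by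
  rw [rlt, comp_lt, rlt]
  simp only [cut, Category.assoc]

/-- The strict order of real numbers, as a proposition at the stage `Γ`. -/
def Slt (a b : Γ ⟶ T.R) : Prop := Holds (rlt a b)

local infix:50 " ≪ " => Slt

theorem Slt.comp {a b : Γ ⟶ T.R} (h : a ≪ b) {Δ : E} (f : Δ ⟶ Γ) : f ≫ a ≪ f ≫ b := by
  have := Holds.comp h f
  rwa [comp_rlt] at this

theorem slt_iff {a b : Γ ⟶ T.R} : a ≪ b ↔ Cov fun {Δ} (f : Δ ⟶ Γ) => ∃ q : Δ ⟶ T.Q,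
    Holds (above q (f ≫ a)) ∧ Holds (below q (f ≫ b)) := by
  constructor
  · intro h
    rw [Slt, rlt, lt] at h
    refine (cov_of_ex h).mono fun f ⟨q, hq⟩ => ⟨q, ?_⟩
    simpa [below, above] using hq
  · intro h
    rw [Slt, rlt, lt]
    exact Cov.ex (h.mono fun f ⟨q, hq⟩ => ⟨q, by simpa [below, above] using hq⟩)

theorem slt_of {a b : Γ ⟶ T.R} (q : Γ ⟶ T.Q) (h : Holds (above q a)) (h' : Holds (below q b)) :
    a ≪ b :=
  slt_iff.2 (Cov.pure ⟨q, by simpa using h, by simpa using h'⟩)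

/-- The cuts are open and the rational numbers are overt. This makes the condition on centers and
radii in `exists_isSubovert` open. -/
theorem op_rlt (a b : Γ ⟶ T.R) : Holds (T.op (rlt a b)) := by
  rw [rlt, lt]
  refine op_ex_rat (T.open_and _ _ ?_ ?_)
  · have := op_above (fst T.Q Γ) (snd T.Q Γ ≫ a)
    simpa [above] using this
  · have := op_below (fst T.Q Γ) (snd T.Q Γ ≫ b)
    simpa [below] using this

theorem rat_slt_iff {q : Γ ⟶ T.Q} {a : Γ ⟶ T.R} : rat q ≪ a ↔ Holds (below q a) := by
  rw [slt_iff]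
  constructor
  · refine fun h => h.holds fun f ⟨r, hr, hr'⟩ => ?_
    rw [comp_rat, holds_above_rat] at hr
    rw [comp_below]
    exact below_of_qlt hr hr'
  · intro h
    refine (below_round h).mono fun f ⟨r, hr, hr'⟩ => ⟨r, ?_, hr'⟩
    rwa [comp_rat, holds_above_rat]

theorem slt_rat_iff {q : Γ ⟶ T.Q} {a : Γ ⟶ T.R} : a ≪ rat q ↔ Holds (above q a) := by
  rw [slt_iff]
  constructor
  · refine fun h => h.holds fun f ⟨r, hr, hr'⟩ => ?_
    rw [comp_rat, holds_below_rat] at hr'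
    rw [comp_above]
    exact above_of_qlt hr' hr
  · intro h
    refine (above_round h).mono fun f ⟨r, hr, hr'⟩ => ⟨r, hr', ?_⟩
    rwa [comp_rat, holds_below_rat]

theorem Slt.fls {a : Γ ⟶ T.R} (h : a ≪ a) : Holds (fls Γ) :=
  (slt_iff.1 h).holds fun f ⟨q, h1, h2⟩ => by
    rw [comp_fls]
    exact fls_of_below_above h2 h1

instance : LE (Γ ⟶ T.R) := ⟨fun a b => Holds (neg (rlt b a))⟩

theorem le_def {a b : Γ ⟶ T.R} : a ≤ b ↔ Holds (T.le (T.cut a) (T.cut b)) := Iff.rfl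

theorem le_iff {a b : Γ ⟶ T.R} :
    a ≤ b ↔ ∀ {Δ : E} (f : Δ ⟶ Γ), f ≫ b ≪ f ≫ a → Holds (SynTop.fls Δ) := by
  refine holds_neg.trans ?_
  simp only [comp_rlt]
  rfl

theorem comp_le {a b : Γ ⟶ T.R} (h : a ≤ b) {Δ : E} (f : Δ ⟶ Γ) : f ≫ a ≤ f ≫ b := by
  have := Holds.comp h f
  rwa [comp_neg, comp_rlt] at this

/-- The order is defined negatively. To place `q` below `b`, one takes a slightly larger `r` below
`a` and applies locatedness of `b` to `q < r`; the alternative `b < r < a` is refuted. -/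
theorem le_iff_below {a b : Γ ⟶ T.R} : a ≤ b ↔
    ∀ {Δ : E} (f : Δ ⟶ Γ) (q : Δ ⟶ T.Q), Holds (below q (f ≫ a)) → Holds (below q (f ≫ b)) := by
  rw [le_iff]
  constructor
  · intro h Δ f q hq
    refine (below_round hq).holds fun g ⟨r, hr, hr'⟩ => ?_
    rw [comp_below]
    refine holds_or_elim (below_or_above hr (g ≫ f ≫ b)) (fun k hk => hk) fun k hk => ?_
    refine holds_fls (h (k ≫ g ≫ f) ?_) _
    rw [comp_above] at hk
    exact slt_of (k ≫ r) (by simpa using hk) (by simpa using hr'.comp k)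
  · intro h Δ f hf
    refine (slt_iff.1 hf).holds fun g ⟨q, h1, h2⟩ => ?_
    rw [← Category.assoc] at h1 h2
    rw [comp_fls]
    exact fls_of_below_above (h _ _ h2) h1

theorem le_iff_above {a b : Γ ⟶ T.R} : a ≤ b ↔
    ∀ {Δ : E} (f : Δ ⟶ Γ) (q : Δ ⟶ T.Q), Holds (above q (f ≫ b)) → Holds (above q (f ≫ a)) := by
  rw [le_iff]
  constructor
  · intro h Δ f q hq
    refine (above_round hq).holds fun g ⟨r, hr, hr'⟩ => ?_
    rw [comp_above]
    refine holds_or_elim (below_or_above hr (g ≫ f ≫ a)) (fun k hk => ?_) fun k hk => hk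
    refine holds_fls (h (k ≫ g ≫ f) ?_) _
    rw [comp_below] at hk
    exact slt_of (k ≫ r) (by simpa using hr'.comp k) (by simpa using hk)
  · intro h Δ f hf
    refine (slt_iff.1 hf).holds fun g ⟨q, h1, h2⟩ => ?_
    rw [← Category.assoc] at h1 h2
    rw [comp_fls]
    exact fls_of_below_above h2 (h _ _ h1)

instance : PartialOrder (Γ ⟶ T.R) where
  le_refl a := le_iff_below.2 fun _ _ h => h
  le_trans a b c h h' := le_iff_below.2 fun f q hq => le_iff_below.1 h' f q (le_iff_below.1 h f q hq)
  le_antisymm a b h h' := real_ext fun f q => ⟨le_iff_below.1 h f q, le_iff_below.1 h' f q⟩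

theorem le_of_cov {P : ∀ {Δ : E}, (Δ ⟶ Γ) → Prop} (h : Cov P) {a b : Γ ⟶ T.R}
    (H : ∀ {Δ : E} (f : Δ ⟶ Γ), P f → f ≫ a ≤ f ≫ b) : a ≤ b :=
  Cov.holds (r := neg (rlt b a)) h fun f hf => by
    rw [comp_neg, comp_rlt]
    exact H f hf

theorem slt_of_cov {P : ∀ {Δ : E}, (Δ ⟶ Γ) → Prop} (h : Cov P) {a b : Γ ⟶ T.R}
    (H : ∀ {Δ : E} (f : Δ ⟶ Γ), P f → f ≫ a ≪ f ≫ b) : a ≪ b :=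
  Cov.holds (r := rlt a b) h fun f hf => by
    rw [comp_rlt]
    exact H f hf

theorem Slt.trans_le {a b c : Γ ⟶ T.R} (h : a ≪ b) (h' : b ≤ c) : a ≪ c :=
  slt_iff.2 ((slt_iff.1 h).mono fun f ⟨q, h1, h2⟩ => ⟨q, h1, le_iff_below.1 h' f q h2⟩)

theorem slt_of_le_of_slt {a b c : Γ ⟶ T.R} (h : a ≤ b) (h' : b ≪ c) : a ≪ c :=
  slt_iff.2 ((slt_iff.1 h').mono fun f ⟨q, h1, h2⟩ => ⟨q, le_iff_above.1 h f q h1, h2⟩)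

theorem Slt.le {a b : Γ ⟶ T.R} (h : a ≪ b) : a ≤ b := by
  refine le_iff.2 fun f hf => ?_
  refine (slt_iff.1 hf).holds fun g ⟨q, h1, h2⟩ =>
    (slt_iff.1 ((h.comp f).comp g)).holds fun k ⟨r, h3, h4⟩ => ?_
  rw [comp_fls, comp_fls]
  have h5 : QLt (k ≫ q) r := qlt_of_below_above (a := k ≫ g ≫ f ≫ a) (by simpa using h2.comp k) h3
  have h6 : QLt r (k ≫ q) := qlt_of_below_above (a := k ≫ g ≫ f ≫ b) h4 (by simpa using h1.comp k)
  exact (h5.trans h6).fls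

theorem Slt.trans {a b c : Γ ⟶ T.R} (h : a ≪ b) (h' : b ≪ c) : a ≪ c := h.trans_le h'.le

/-- The strict order is cotransitive. -/
theorem Slt.cotrans {a b : Γ ⟶ T.R} (h : a ≪ b) (c : Γ ⟶ T.R) : Holds (rlt a c ⋎ rlt c b) := by
  refine (slt_iff.1 h).holds fun f ⟨q, h1, h2⟩ => (below_round h2).holds fun g ⟨r, hr, hr'⟩ => ?_
  refine holds_or_elim (below_or_above hr (g ≫ f ≫ c)) (fun k hk => ?_) fun k hk => ?_
  · rw [comp_below] at hk
    simp only [comp_or, comp_rlt]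
    refine holds_or_left (slt_of (k ≫ g ≫ q) ?_ hk)
    simpa using (h1.comp g).comp k
  · rw [comp_above] at hk
    simp only [comp_or, comp_rlt]
    refine holds_or_right (slt_of (k ≫ r) hk ?_)
    simpa using hr'.comp k

theorem Slt.cov_cotrans {a b : Γ ⟶ T.R} (h : a ≪ b) (c : Γ ⟶ T.R) :
    Cov fun {Δ} (f : Δ ⟶ Γ) => f ≫ a ≪ f ≫ c ∨ f ≫ c ≪ f ≫ b :=
  (cov_of_or (h.cotrans c)).mono fun f hf => by
    simp only [comp_rlt] at hf
    exact hf

end SynthTopology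

end RealOrder

end SynTop

end

/-! ### The ordered group of real numbers, and binary minima -/

noncomputable section

namespace SynTop

section RealGroup

variable {E : Type u} [Category.{v} E] [CartesianMonoidalCategory E] [MonoidalClosed E]
  [Limits.HasFiniteLimits E] [HasSubobjectClassifier E]

local postfix:max "⇧" => wk
local infix:45 " ≐ " => eqq
local infixr:35 " ⋏ " => and
local infixr:25 " ⇛ " => imp
local infix:20 " ⟺ " => iff
local infix:50 " ∊ " => mem
local infixr:30 " ⋎ " => or

set_option linter.unusedSectionVars false
set_option linter.unusedSimpArgs false

open NNO

namespace NNO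

variable {T : NNO E} {Γ : E}

instance : Zero (Γ ⟶ T.Q) := ⟨T.qzero Γ⟩

instance : Add (Γ ⟶ T.Q) := ⟨T.qadd⟩

@[simp]
theorem qadd_def (q r : Γ ⟶ T.Q) : T.qadd q r = q + r := rfl

@[simp]
theorem qzero_def : T.qzero Γ = 0 := rfl

instance : AddCommMonoid (Γ ⟶ T.Q) where
  add_assoc := qadd_assoc
  zero_add := qzero_qadd
  add_zero := qadd_qzero
  add_comm := qadd_comm
  nsmul := nsmulRec

@[simp]
theorem comp_add_rat {Δ : E} (f : Δ ⟶ Γ) (q r : Γ ⟶ T.Q) : f ≫ (q + r) = f ≫ q + f ≫ r :=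
  comp_qadd f q r

@[simp]
theorem comp_zero_rat {Δ : E} (f : Δ ⟶ Γ) : f ≫ (0 : Γ ⟶ T.Q) = 0 := comp_qzero f

theorem qle_add_neg_add (s t : Γ ⟶ T.Q) : QLe s ((s + NNO.qneg t) + t) := by
  have := (qle_qneg_qadd t).add_left s
  simp only [qadd_def, qzero_def, add_zero] at this
  rwa [add_assoc]

theorem QLe.add {q r s t : Γ ⟶ T.Q} (h : QLe q r) (h' : QLe s t) : QLe (q + s) (r + t) := by
  have h1 := h'.add_left q
  have h2 := h.add_left t
  rw [qadd_comm t, qadd_comm t] at h2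
  exact h1.trans h2

theorem QLt.add_neg_lt {t : Γ ⟶ T.Q} (h : QLt 0 t) (s : Γ ⟶ T.Q) : QLt (s + NNO.qneg t) s := by
  have h5 : QLe (NNO.qneg (0 : Γ ⟶ T.Q)) 0 := by
    have := qneg_qadd_qle (0 : Γ ⟶ T.Q)
    simpa using this
  have := (h.qneg.trans_qle h5).add_left s
  simpa using this

end NNO

namespace SynthTopology

variable {T : SynthTopology E} {Γ : E}

local infix:50 " ≪ " => Slt

/-- A real number has rational bounds at an arbitrarily small distance from each other. -/
theorem exists_approx (a : Γ ⟶ T.R) {e : Γ ⟶ T.Q} (he : QLt 0 e) :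
    Cov fun {Δ} (f : Δ ⟶ Γ) => ∃ l m : Δ ⟶ T.Q, Holds (below l (f ≫ a)) ∧
      Holds (above m (f ≫ a)) ∧ QLt m (l + f ≫ e) := by
  intro r H
  obtain ⟨e', he', hee⟩ := QLt.exists_half he
  simp only [qzero_def, qadd_def, zero_add] at he' hee
  refine (exists_below a).holds fun f ⟨l, hl⟩ => (exists_above (f ≫ a)).holds fun g ⟨m, hm⟩ => ?_
  have he'' : QLt (T.qzero _) ((g ≫ f) ≫ e') := by simpa using he'.comp (g ≫ f)
  obtain ⟨n, hn⟩ := exists_qnsmul he'' (g ≫ l) m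
  -- `Cov` is not a formula, so the induction proves that the goal `r` follows if `l + n * e'` is
  -- above `a`. At a successor put `s = l + n * e'` and let `m < s + e'` be above `a`. Locatedness
  -- at `s - e' < s` gives either the bounds `s - e'` and `m`, whose distance is less than `2 * e' ≤
  -- e`, or the induction hypothesis.
  have key := induction (T := T.toNNO) (Γ := _) (above
    ((snd _ _ ≫ g ≫ l) + qnsmul (fst _ _) (snd _ _ ≫ g ≫ f ≫ e')) (snd _ _ ≫ g ≫ f ≫ a) ⇛
      snd _ _ ≫ g ≫ f ≫ r) ?_ ?_ (𝟙 _) n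
  · simp only [comp_imp, comp_above, comp_add_rat, comp_qnsmul, lift_fst, lift_snd_assoc,
      Category.id_comp] at key
    exact key.mp (above_of_qlt (by simpa using hn) (by simpa using hm))
  · intro Δ k
    simp only [comp_imp, comp_above, comp_add_rat, comp_qnsmul, lift_fst, lift_snd_assoc]
    refine holds_imp.2 fun k' hk' => ?_
    simp only [comp_above, comp_add_rat, comp_qnsmul, comp_zero] at hk'
    have h1 := above_of_qle (qadd_zero_qnsmul_qle _ _) hk'
    have h2 : Holds (below (k' ≫ k ≫ g ≫ l) (k' ≫ k ≫ g ≫ f ≫ a)) := by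
      simpa using ((hl.comp g).comp k).comp k'
    exact holds_fls (fls_of_below_above h2 h1) _
  · intro Δ k n hn
    simp only [comp_imp, comp_above, comp_add_rat, comp_qnsmul, lift_fst, lift_snd_assoc] at hn ⊢
    refine holds_imp.2 fun k' hk' => ?_
    simp only [comp_above, comp_add_rat, comp_qnsmul, comp_natAdd, comp_one] at hk'
    have h1 := above_of_qle (qadd_succ_qnsmul_qle _ _ _) hk'
    have hn' := hn.comp k'
    simp only [comp_imp, comp_above, comp_add_rat, comp_qnsmul] at hn'
    simp only [qadd_def] at h1
    refine (above_round h1).holds fun i ⟨m, hm, hm'⟩ => ?_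
    have hn'' := hn'.comp i
    simp only [comp_imp, comp_above, comp_add_rat, comp_qnsmul] at hn'' hm
    generalize i ≫ k' ≫ k ≫ g ≫ l + qnsmul (i ≫ k' ≫ n) (i ≫ k' ≫ k ≫ g ≫ f ≫ e') = s at hn'' hm
    have hpos : QLt 0 (i ≫ k' ≫ k ≫ g ≫ f ≫ e') := by
      simpa using he'.comp (i ≫ k' ≫ k ≫ g ≫ f)
    refine holds_or_elim (below_or_above (hpos.add_neg_lt s) (i ≫ k' ≫ k ≫ g ≫ f ≫ a))
      (fun j hj => ?_) fun j hj => ?_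
    · refine (congrArg Holds ?_).mp (H ((j ≫ i ≫ k' ≫ k ≫ g) ≫ f)
        ⟨j ≫ (s + NNO.qneg (i ≫ k' ≫ k ≫ g ≫ f ≫ e')), j ≫ m, ?_, ?_, ?_⟩)
      · simp only [Category.assoc]
      · simpa only [comp_below, Category.assoc] using hj
      · simpa only [comp_above, Category.assoc] using hm'.comp j
      · have h2 := hm.trans_qle ((qle_add_neg_add s (i ≫ k' ≫ k ≫ g ≫ f ≫ e')).add (QLe.refl _))
        rw [add_assoc] at h2
        have h3 := h2.trans_qle ((QLe.refl _).add (by simpa using hee.comp (i ≫ k' ≫ k ≫ g ≫ f)))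
        simpa using h3.comp j
    · have h2 := hn''.comp j
      rw [comp_imp] at h2
      simpa using h2.mp (by simpa using hj)

/-! ### Addition -/

theorem mem_lo_add {Δ : E} (f : Δ ⟶ Γ) (a b : Γ ⟶ T.R) (q : Δ ⟶ T.Q) :
    Holds (q ∊ f ≫ T.lo (T.add (T.cut a) (T.cut b))) ↔ Cov fun {Θ} (g : Θ ⟶ Δ) => ∃ l k : Θ ⟶ T.Q,
      Holds (below l (g ≫ f ≫ a)) ∧ Holds (below k (g ≫ f ≫ b)) ∧ QLt (g ≫ q) (l + k) := by
  rw [add, lo, lift_fst, mem_comp_sep]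
  constructor
  · intro h
    refine (cov_of_comp_ex h).bind fun g ⟨l, hl⟩ => (cov_of_comp_ex hl).mono fun g' ⟨k, hk⟩ => ?_
    refine ⟨g' ≫ l, k, ?_⟩
    simpa [below, holds_qlt, comp_lift] using hk
  · intro h
    refine h.holds fun g ⟨l, k, h1, h2, h3⟩ => ?_
    rw [← Category.assoc]
    refine holds_comp_ex_intro l (holds_comp_ex_intro k ?_)
    simp only [below] at h1 h2
    simpa [holds_qlt, comp_lift] using And.intro h1 (And.intro h2 h3)

theorem mem_up_add {Δ : E} (f : Δ ⟶ Γ) (a b : Γ ⟶ T.R) (q : Δ ⟶ T.Q) :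
    Holds (q ∊ f ≫ T.up (T.add (T.cut a) (T.cut b))) ↔ Cov fun {Θ} (g : Θ ⟶ Δ) => ∃ l k : Θ ⟶ T.Q,
      Holds (above l (g ≫ f ≫ a)) ∧ Holds (above k (g ≫ f ≫ b)) ∧ QLt (l + k) (g ≫ q) := by
  rw [add, up, lift_snd, mem_comp_sep]
  constructor
  · intro h
    refine (cov_of_comp_ex h).bind fun g ⟨l, hl⟩ => (cov_of_comp_ex hl).mono fun g' ⟨k, hk⟩ => ?_
    refine ⟨g' ≫ l, k, ?_⟩
    simpa [above, holds_qlt, comp_lift] using hk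
  · intro h
    refine h.holds fun g ⟨l, k, h1, h2, h3⟩ => ?_
    rw [← Category.assoc]
    refine holds_comp_ex_intro l (holds_comp_ex_intro k ?_)
    simp only [above] at h1 h2
    simpa [holds_qlt, comp_lift] using And.intro h1 (And.intro h2 h3)

theorem op_comp_ex_rat {Δ : E} {f : Δ ⟶ Γ} {φ : (T.Q ⊗ Γ ⟶ T.Q) → (T.Q ⊗ Γ ⟶ Om E)}
    (h : ∀ {Θ : E} (g : Θ ⟶ Δ) (q : Θ ⟶ T.Q), Holds (T.op (lift q (g ≫ f) ≫ φ (fst T.Q Γ)))) :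
    Holds (T.op (f ≫ ex T.Q φ)) := by
  rw [comp_ex]
  refine op_ex_rat ?_
  have := h (snd T.Q Δ) (fst T.Q Δ)
  rwa [show lift (fst T.Q Δ) (snd T.Q Δ ≫ f) = T.Q ◁ f from
    CartesianMonoidalCategory.hom_ext _ _ (by rw [lift_fst, whiskerLeft_fst])
      (by rw [lift_snd, whiskerLeft_snd])] at this

theorem cutData_add (a b : Γ ⟶ T.R) :
    CutData (T.lo (T.add (T.cut a) (T.cut b))) (T.up (T.add (T.cut a) (T.cut b))) where
  lo_inh := (exists_below a).bind fun f ⟨l, hl⟩ => (exists_below (f ≫ b)).mono fun g ⟨k, hk⟩ => by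
    obtain ⟨q, hq⟩ := exists_qlt (g ≫ l + k)
    refine ⟨q, (mem_lo_add _ _ _ _).2 (Cov.pure ⟨g ≫ l, k, ?_, ?_, ?_⟩)⟩
    · simpa using hl.comp g
    · simpa using hk
    · simpa using hq
  up_inh := (exists_above a).bind fun f ⟨l, hl⟩ => (exists_above (f ≫ b)).mono fun g ⟨k, hk⟩ => by
    obtain ⟨q, hq⟩ := exists_qgt (g ≫ l + k)
    refine ⟨q, (mem_up_add _ _ _ _).2 (Cov.pure ⟨g ≫ l, k, ?_, ?_, ?_⟩)⟩
    · simpa using hl.comp g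
    · simpa using hk
    · simpa using hq
  lo_lt f q r hqr hr := by
    rw [mem_lo_add] at hr ⊢
    exact hr.mono fun g ⟨l, k, h1, h2, h3⟩ => ⟨l, k, h1, h2, (hqr.comp g).trans h3⟩
  up_lt f q r hqr hr := by
    rw [mem_up_add] at hr ⊢
    exact hr.mono fun g ⟨l, k, h1, h2, h3⟩ => ⟨l, k, h1, h2, h3.trans (hqr.comp g)⟩
  lo_round f q hq := by
    rw [mem_lo_add] at hq
    refine hq.mono fun g ⟨l, k, h1, h2, h3⟩ => ?_
    obtain ⟨r, hr, hr'⟩ := h3.exists_between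
    exact ⟨r, hr, (mem_lo_add _ _ _ _).2 (Cov.pure ⟨l, k, by simpa using h1, by simpa using h2,
      by simpa using hr'⟩)⟩
  up_round f q hq := by
    rw [mem_up_add] at hq
    refine hq.mono fun g ⟨l, k, h1, h2, h3⟩ => ?_
    obtain ⟨r, hr, hr'⟩ := h3.exists_between
    exact ⟨r, hr', (mem_up_add _ _ _ _).2 (Cov.pure ⟨l, k, by simpa using h1, by simpa using h2,
      by simpa using hr⟩)⟩
  disj f q h h' := by
    rw [mem_lo_add] at h
    refine h.holds fun g ⟨l, k, h1, h2, h3⟩ => ?_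
    have h'' := h'.comp g
    rw [comp_mem, ← Category.assoc, mem_up_add] at h''
    refine h''.holds fun i ⟨m, n, h4, h5, h6⟩ => ?_
    rw [comp_fls, comp_fls]
    have h7 : QLt (i ≫ l) m := qlt_of_below_above (by simpa using h1.comp i) h4
    have h8 : QLt (i ≫ k) n := qlt_of_below_above (by simpa using h2.comp i) h5
    have h9 := (by simpa using h3.comp i : QLt _ (i ≫ l + i ≫ k)).trans ((h7.add h8.qle).trans h6)
    exact h9.fls
  located f q r h := by
    -- Both summands are enclosed in rational intervals, from `l` to `m` and from `k` to `n`,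
    -- shorter than `e`, where `q + 2 * e ≤ r`. Comparing `l + k` with `q` gives `q < l + k` or `m +
    -- n < l + k + 2 * e ≤ r`.
    obtain ⟨e, he, hqr⟩ := h.exists_half
    simp only [qadd_def, qzero_def] at he hqr
    refine (exists_approx (f ≫ a) he).holds fun g ⟨l, m, hl, hm, hlm⟩ =>
      (exists_approx (g ≫ f ≫ b) (by simpa using he.comp g : QLt 0 (g ≫ e))).holds fun i ⟨k, n, hk, hn, hkn⟩ =>
      (qle_or_qlt (i ≫ l + k) (i ≫ g ≫ q)).holds fun j hj => ?_
    simp only [comp_or, comp_mem]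
    rcases hj with hj | hj
    · refine holds_or_right ?_
      rw [show j ≫ i ≫ g ≫ f ≫ T.up (T.add (T.cut a) (T.cut b)) =
        (j ≫ i ≫ g ≫ f) ≫ T.up (T.add (T.cut a) (T.cut b)) by simp only [Category.assoc],
        mem_up_add]
      refine Cov.pure ⟨j ≫ i ≫ m, j ≫ n, ?_, ?_, ?_⟩
      · simpa using (hm.comp i).comp j
      · simpa using hn.comp j
      · have h1 := ((hlm.comp i).add hkn.qle).comp j
        simp only [comp_add_rat, qadd_def] at h1 hj
        have h2 := hj.add (QLe.refl (j ≫ i ≫ g ≫ e + j ≫ i ≫ g ≫ e))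
        have h3 : QLe (j ≫ i ≫ g ≫ q + (j ≫ i ≫ g ≫ e + j ≫ i ≫ g ≫ e)) (j ≫ i ≫ g ≫ r) := by
          simpa using hqr.comp (j ≫ i ≫ g)
        rw [Category.id_comp]
        refine h1.trans_qle (QLe.trans ?_ (h2.trans h3))
        rw [add_add_add_comm]
        exact QLe.refl _
    · refine holds_or_left ?_
      rw [show j ≫ i ≫ g ≫ f ≫ T.lo (T.add (T.cut a) (T.cut b)) =
        (j ≫ i ≫ g ≫ f) ≫ T.lo (T.add (T.cut a) (T.cut b)) by simp only [Category.assoc],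
        mem_lo_add]
      refine Cov.pure ⟨j ≫ i ≫ l, j ≫ k, ?_, ?_, ?_⟩
      · simpa using (hl.comp i).comp j
      · simpa using hk.comp j
      · simpa using hj
  lo_open {Δ} f q := by
    rw [add, lo, lift_fst, mem_comp_sep]
    refine op_comp_ex_rat fun g l => op_comp_ex_rat fun i k => ?_
    simp only [comp_and, comp_qlt]
    refine T.open_and _ _ ?_ (T.open_and _ _ ?_ (op_qlt _ _))
    · have := op_below (i ≫ l) (i ≫ g ≫ f ≫ a)
      simpa [below, comp_lift] using this
    · have := op_below k (i ≫ g ≫ f ≫ b)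
      simpa [below, comp_lift] using this
  up_open {Δ} f q := by
    rw [add, up, lift_snd, mem_comp_sep]
    refine op_comp_ex_rat fun g l => op_comp_ex_rat fun i k => ?_
    simp only [comp_and, comp_qlt]
    refine T.open_and _ _ ?_ (T.open_and _ _ ?_ (op_qlt _ _))
    · have := op_above (i ≫ l) (i ≫ g ≫ f ≫ a)
      simpa [above, comp_lift] using this
    · have := op_above k (i ≫ g ≫ f ≫ b)
      simpa [above, comp_lift] using this

theorem exists_radd (a b : Γ ⟶ T.R) : ∃ c : Γ ⟶ T.R, T.cut c = T.add (T.cut a) (T.cut b) := by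
  obtain ⟨c, h1, h2⟩ := exists_real (cutData_add a b)
  exact ⟨c, CartesianMonoidalCategory.hom_ext _ _ h1 h2⟩

instance : Add (Γ ⟶ T.R) := ⟨fun a b => (exists_radd a b).choose⟩

theorem cut_add (a b : Γ ⟶ T.R) : T.cut (a + b) = T.add (T.cut a) (T.cut b) :=
  (exists_radd a b).choose_spec

theorem below_add_iff {a b : Γ ⟶ T.R} {Δ : E} {f : Δ ⟶ Γ} {q : Δ ⟶ T.Q} :
    Holds (below q (f ≫ (a + b))) ↔ Cov fun {Θ} (g : Θ ⟶ Δ) => ∃ l k : Θ ⟶ T.Q,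
      Holds (below l (g ≫ f ≫ a)) ∧ Holds (below k (g ≫ f ≫ b)) ∧ QLt (g ≫ q) (l + k) := by
  rw [below_comp_eq, cut_add, mem_lo_add]

@[simp]
theorem comp_radd {Δ : E} (f : Δ ⟶ Γ) (a b : Γ ⟶ T.R) : f ≫ (a + b) = f ≫ a + f ≫ b :=
  real_ext fun g q => by
    rw [← Category.assoc, below_add_iff, below_add_iff]
    simp only [Category.assoc]

theorem exists_rneg (a : Γ ⟶ T.R) : ∃ c : Γ ⟶ T.R,
    T.lo (T.cut c) = (sep T.Q fun q => above (NNO.qneg q) a⇧) ∧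
    T.up (T.cut c) = (sep T.Q fun q => below (NNO.qneg q) a⇧) := by
  refine exists_real ⟨?_, ?_, ?_, ?_, ?_, ?_, ?_, ?_, ?_, ?_⟩
  · exact (exists_above a).mono fun f ⟨q, hq⟩ => ⟨NNO.qneg q, by simpa [qneg_qneg] using hq⟩
  · exact (exists_below a).mono fun f ⟨q, hq⟩ => ⟨NNO.qneg q, by simpa [qneg_qneg] using hq⟩
  · intro Δ f q r h hr
    simp only [mem_comp_sep, comp_above, lift_snd_assoc, comp_qneg, lift_fst] at hr ⊢
    exact above_of_qlt h.qneg hr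
  · intro Δ f q hq
    simp only [mem_comp_sep, comp_above, lift_snd_assoc, comp_qneg, lift_fst] at hq ⊢
    refine (above_round hq).mono fun g ⟨r, hr, hr'⟩ => ⟨NNO.qneg r, ?_, ?_⟩
    · have := hr.qneg
      rwa [comp_qneg, qneg_qneg] at this
    · simpa [qneg_qneg] using hr'
  · intro Δ f q r h hr
    simp only [mem_comp_sep, comp_below, lift_snd_assoc, comp_qneg, lift_fst] at hr ⊢
    exact below_of_qlt h.qneg hr
  · intro Δ f q hq
    simp only [mem_comp_sep, comp_below, lift_snd_assoc, comp_qneg, lift_fst] at hq ⊢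
    refine (below_round hq).mono fun g ⟨r, hr, hr'⟩ => ⟨NNO.qneg r, ?_, ?_⟩
    · have := hr.qneg
      rwa [comp_qneg, qneg_qneg] at this
    · simpa [qneg_qneg] using hr'
  · intro Δ f q h h'
    simp only [mem_comp_sep, comp_below, comp_above, lift_snd_assoc, comp_qneg, lift_fst] at h h'
    exact fls_of_below_above h' h
  · intro Δ f q r h
    simp only [mem_comp_sep, comp_below, comp_above, lift_snd_assoc, comp_qneg, lift_fst]
    refine holds_or_elim (below_or_above h.qneg (f ≫ a)) (fun g hg => ?_) fun g hg => ?_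
    · rw [comp_or]
      exact holds_or_right hg
    · rw [comp_or]
      exact holds_or_left hg
  · intro Δ f q
    simp only [mem_comp_sep, comp_above]
    exact op_above _ _
  · intro Δ f q
    simp only [mem_comp_sep, comp_below]
    exact op_below _ _

instance : Neg (Γ ⟶ T.R) := ⟨fun a => (exists_rneg a).choose⟩

theorem below_neg_iff {a : Γ ⟶ T.R} {Δ : E} {f : Δ ⟶ Γ} {q : Δ ⟶ T.Q} :
    Holds (below q (f ≫ (-a))) ↔ Holds (above (NNO.qneg q) (f ≫ a)) := by
  rw [below_comp_eq]
  have := (exists_rneg a).choose_spec.1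
  simp only [Neg.neg]
  rw [this, mem_comp_sep, comp_above, comp_qneg, lift_fst, lift_snd_assoc]

@[simp]
theorem comp_rneg {Δ : E} (f : Δ ⟶ Γ) (a : Γ ⟶ T.R) : f ≫ (-a) = -(f ≫ a) :=
  real_ext fun g q => by
    rw [← Category.assoc, below_neg_iff, below_neg_iff, Category.assoc]

theorem radd_comm (a b : Γ ⟶ T.R) : a + b = b + a :=
  real_ext fun f q => by
    rw [below_add_iff, below_add_iff]
    constructor <;> exact fun h => h.mono fun g ⟨l, k, h1, h2, h3⟩ =>
      ⟨k, l, h2, h1, by rwa [add_comm]⟩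

theorem radd_assoc (a b c : Γ ⟶ T.R) : a + b + c = a + (b + c) := by
  refine real_ext fun f q => ⟨fun h => ?_, fun h => ?_⟩
  · refine (below_add_iff.1 h).holds fun g ⟨l, k, h1, h2, h3⟩ => ?_
    rw [← Category.assoc, below_add_iff] at h1
    refine h1.holds fun i ⟨m, n, h4, h5, h6⟩ => ?_
    rw [comp_below, comp_below, show i ≫ g ≫ f ≫ (a + (b + c)) = (i ≫ g ≫ f) ≫ (a + (b + c)) by
      simp only [Category.assoc], below_add_iff]
    refine (below_round h5).mono fun j ⟨n', hn, hn'⟩ => ?_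
    refine ⟨j ≫ m, j ≫ (n + i ≫ k), ?_, ?_, ?_⟩
    · simpa using h4.comp j
    · rw [← Category.assoc, below_add_iff]
      refine Cov.pure ⟨n', j ≫ i ≫ k, by simpa using hn', by simpa using (h2.comp i).comp j, ?_⟩
      simpa using hn.add (QLe.refl (j ≫ i ≫ k))
    · have h7 := (h3.comp i).trans (by simpa using h6.add (QLe.refl (i ≫ k)))
      simpa [add_assoc] using h7.comp j
  · refine (below_add_iff.1 h).holds fun g ⟨l, k, h1, h2, h3⟩ => ?_
    rw [← Category.assoc, below_add_iff] at h2
    refine h2.holds fun i ⟨m, n, h4, h5, h6⟩ => ?_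
    rw [comp_below, comp_below, show i ≫ g ≫ f ≫ (a + b + c) = (i ≫ g ≫ f) ≫ (a + b + c) by
      simp only [Category.assoc], below_add_iff]
    refine (below_round h4).mono fun j ⟨m', hm, hm'⟩ => ?_
    refine ⟨j ≫ (i ≫ l + m), j ≫ n, ?_, ?_, ?_⟩
    · rw [← Category.assoc, below_add_iff]
      refine Cov.pure ⟨j ≫ i ≫ l, m', by simpa using (h1.comp i).comp j, by simpa using hm', ?_⟩
      simpa using hm.add_left (j ≫ i ≫ l)
    · simpa using h5.comp j
    · have h7 := (h3.comp i).trans (by simpa using h6.add_left (i ≫ l))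
      simpa [add_assoc] using h7.comp j

theorem rzero_add (a : Γ ⟶ T.R) : 0 + a = a := by
  refine real_ext fun f q => ⟨fun h => ?_, fun h => ?_⟩
  · refine (below_add_iff.1 h).holds fun g ⟨l, k, h1, h2, h3⟩ => ?_
    rw [comp_below]
    refine below_of_qlt (h3.trans_qle ?_) h2
    rw [comp_real_zero, comp_real_zero, ← rat_zero, holds_below_rat] at h1
    simpa using h1.qle.add (QLe.refl k)
  · rw [below_add_iff]
    refine (below_round h).mono fun g ⟨r, hr, hr'⟩ => ?_
    obtain ⟨s, hs, hs'⟩ := hr.exists_between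
    refine ⟨g ≫ q + NNO.qneg s, r, ?_, hr', ?_⟩
    · rw [comp_real_zero, comp_real_zero, ← rat_zero, holds_below_rat]
      have h1 := (hs.add (QLe.refl (NNO.qneg s))).trans_qle (by
        simpa [add_comm] using qneg_qadd_qle s)
      simpa using h1
    · have h1 := (qle_qneg_qadd s).add_left (g ≫ q)
      have h2 := hs'.add_left (g ≫ q + NNO.qneg s)
      simp only [qadd_def, qzero_def, add_zero] at h1 h2
      rw [← add_assoc] at h1
      exact h1.trans_qlt h2

/-- A rational `q < 0` is shown to be below the sum by means of rational bounds of `a` that are less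
than `-q` apart, as supplied by `exists_approx`. -/
theorem rneg_add (a : Γ ⟶ T.R) : -a + a = 0 := by
  refine real_ext fun f q => ⟨fun h => ?_, fun h => ?_⟩
  · refine (below_add_iff.1 h).holds fun g ⟨l, k, h1, h2, h3⟩ => ?_
    rw [← Category.assoc, below_neg_iff] at h1
    rw [comp_real_zero, ← rat_zero, comp_below, comp_rat, holds_below_rat]
    have h4 : QLt k (NNO.qneg l) := qlt_of_below_above h2 (by simpa using h1)
    have h5 := (h4.add_left l).trans_qle (by simpa [add_comm] using qneg_qadd_qle l)
    simpa using h3.trans (by simpa using h5)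
  · rw [comp_real_zero, ← rat_zero, holds_below_rat] at h
    rw [below_add_iff]
    have h0 : QLt 0 (NNO.qneg q) := by
      have h1 := h.add_left (NNO.qneg q)
      exact (qle_qneg_qadd q).trans_qlt (by simpa using h1)
    refine (exists_approx (f ≫ a) h0).mono fun g ⟨l, m, h1, h2, h3⟩ => ?_
    refine ⟨NNO.qneg m, l, ?_, h1, ?_⟩
    · rw [← Category.assoc, below_neg_iff, qneg_qneg]
      simpa using h2
    · have h4 := QLt.qneg_add h3
      rwa [comp_qneg, qneg_qneg] at h4

instance : AddCommGroup (Γ ⟶ T.R) where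
  add_assoc := radd_assoc
  zero_add := rzero_add
  add_zero a := by rw [radd_comm, rzero_add]
  nsmul := nsmulRec
  zsmul := zsmulRec
  neg_add_cancel := rneg_add
  add_comm := radd_comm

instance : IsOrderedAddMonoid (Γ ⟶ T.R) where
  add_le_add_left a b h c := le_iff_below.2 fun f q hq => by
    rw [below_add_iff] at hq ⊢
    exact hq.mono fun g ⟨l, k, h1, h2, h3⟩ =>
      ⟨l, k, by simpa using le_iff_below.1 h (g ≫ f) l (by simpa using h1), h2, h3⟩

@[simp]
theorem comp_rsub {Δ : E} (f : Δ ⟶ Γ) (a b : Γ ⟶ T.R) : f ≫ (a - b) = f ≫ a - f ≫ b := by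
  rw [sub_eq_add_neg, comp_radd, comp_rneg, ← sub_eq_add_neg]

theorem rat_add_le (q r : Γ ⟶ T.Q) : (rat q + rat r : Γ ⟶ T.R) ≤ rat (q + r) :=
  le_iff_below.2 fun f s h => by
    rw [below_add_iff] at h
    simp only [comp_rat, holds_below_rat, comp_add_rat] at h ⊢
    rw [← holds_qlt]
    refine h.holds fun g ⟨l, k, h1, h2, h3⟩ => ?_
    rw [comp_qlt, holds_qlt]
    simpa using h3.trans (h1.add h2.qle)

theorem slt_iff_sub_pos {a b : Γ ⟶ T.R} : a ≪ b ↔ 0 ≪ b - a := by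
  rw [← rat_zero, rat_slt_iff, sub_eq_add_neg, ← Category.id_comp (b + -a), below_add_iff]
  constructor
  · intro h
    refine (slt_iff.1 h).bind fun f ⟨q, h1, h2⟩ => (below_round h2).mono fun g ⟨r, hr, hr'⟩ => ?_
    refine ⟨r, g ≫ NNO.qneg q, by simpa using hr', ?_, ?_⟩
    · rw [← Category.assoc, below_neg_iff]
      simpa [qneg_qneg] using h1.comp g
    · have h3 := hr.add (QLe.refl (NNO.qneg (g ≫ q)))
      refine (by simpa using (qle_qneg_qadd (g ≫ q)) : QLe _ _).trans_qlt (s := _) ?_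
      simpa [add_comm] using h3
  · intro h
    refine slt_iff.2 (h.mono fun f ⟨l, k, h1, h2, h3⟩ => ?_)
    rw [← Category.assoc, below_neg_iff] at h2
    refine ⟨l, above_of_qlt ?_ (by simpa using h2), by simpa using h1⟩
    have h4 := h3.add_left (NNO.qneg k)
    simp only [qadd_def, qzero_def, comp_zero_rat, add_zero] at h4
    refine h4.trans_qle ?_
    have h5 := (qneg_qadd_qle k).add_left l
    simp only [qadd_def, qzero_def, add_zero] at h5
    rwa [add_left_comm]

/-- A strict inequality follows from another one if the difference of the first is at least the
difference of the second. -/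
theorem Slt.lin {a b c d : Γ ⟶ T.R} (h : c ≪ d) (h' : a + d ≤ b + c) : a ≪ b := by
  rw [slt_iff_sub_pos] at h ⊢
  refine h.trans_le ?_
  rw [sub_le_sub_iff, add_comm]
  exact h'

theorem rat_pos {q : Γ ⟶ T.Q} : (0 : Γ ⟶ T.R) ≪ rat q ↔ QLt 0 q := by
  rw [← rat_zero, rat_slt_iff, holds_below_rat, qzero_def]

/-- A positive rational below `b - a` is halved, so that the gap has room for two errors in later
estimates. -/
theorem Slt.exists_gap {a b : Γ ⟶ T.R} (h : a ≪ b) : Cov fun {Δ} (f : Δ ⟶ Γ) => ∃ q : Δ ⟶ T.Q,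
    0 ≪ rat q ∧ f ≫ a + (rat q + rat q) ≪ f ≫ b := by
  rw [slt_iff_sub_pos, slt_iff] at h
  refine h.mono fun f ⟨q, h1, h2⟩ => ?_
  rw [comp_real_zero, ← rat_zero, holds_above_rat] at h1
  obtain ⟨e, he, he'⟩ := h1.exists_half
  refine ⟨e, rat_pos.2 he, ?_⟩
  simp only [qzero_def, qadd_def, zero_add] at he'
  have h3 : rat (e + e) ≪ f ≫ (b - a) := rat_slt_iff.2 (below_of_qle he' h2)
  refine (slt_of_le_of_slt (rat_add_le e e) h3).lin ?_
  rw [comp_rsub]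
  exact le_of_eq (by abel)

/-- A gap `b + 2 * q < a` is incompatible with `a ≤ b + q`. -/
theorem le_of_forall_pos {a b : Γ ⟶ T.R}
    (h : ∀ {Δ : E} (f : Δ ⟶ Γ) (e : Δ ⟶ T.R), 0 ≪ e → f ≫ a ≤ f ≫ b + e) : a ≤ b := by
  refine le_iff.2 fun f hf => hf.exists_gap.holds fun g ⟨q, hq, hq'⟩ => ?_
  rw [comp_fls]
  have h1 := h (g ≫ f) (rat q) hq
  simp only [Category.assoc] at h1
  exact ((hq'.trans_le h1).trans (hq.lin (b := g ≫ f ≫ b + (rat q + rat q))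
    (le_of_eq (by abel)))).fls

/-! ### Minima -/

/-- The upper cut of a minimum is a union, and it is open because of `op_or`. That the intersection
of the lower cuts is inhabited and round follows by comparing rational numbers. -/
theorem exists_rmin (a b : Γ ⟶ T.R) : ∃ c : Γ ⟶ T.R,
    T.lo (T.cut c) = (sep T.Q fun q => below q a⇧ ⋏ below q b⇧) ∧
    T.up (T.cut c) = (sep T.Q fun q => above q a⇧ ⋎ above q b⇧) := by
  have hl : ∀ {Δ : E} (f : Δ ⟶ Γ) (q : Δ ⟶ T.Q),
      Holds (q ∊ f ≫ sep T.Q fun q => below q a⇧ ⋏ below q b⇧) ↔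
        Holds (below q (f ≫ a)) ∧ Holds (below q (f ≫ b)) := by
    intro Δ f q
    simp
  have hu : ∀ {Δ : E} (f : Δ ⟶ Γ) (q : Δ ⟶ T.Q),
      (q ∊ f ≫ sep T.Q fun q => above q a⇧ ⋎ above q b⇧) =
        (above q (f ≫ a) ⋎ above q (f ≫ b)) := by
    intro Δ f q
    simp
  have hmono : ∀ {Δ : E} (q r c : Δ ⟶ T.Q) (a b : Δ ⟶ T.R), QLt q r →
      Holds (above q a ⋎ above q b) → Holds (above r a ⋎ above r b) := by
    intro Δ q r c a b h h'
    refine holds_or_elim h' (fun g hg => ?_) fun g hg => ?_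
    · rw [comp_or]
      simp only [comp_above] at hg ⊢
      exact holds_or_left (above_of_qlt (h.comp g) hg)
    · rw [comp_or]
      simp only [comp_above] at hg ⊢
      exact holds_or_right (above_of_qlt (h.comp g) hg)
  refine exists_real ⟨?_, ?_, ?_, ?_, ?_, ?_, ?_, ?_, ?_, ?_⟩
  · refine (exists_below a).bind fun f ⟨q, hq⟩ => (exists_below (f ≫ b)).bind fun g ⟨r, hr⟩ =>
      (qle_or_qlt (g ≫ q) r).mono fun i hi => ?_
    simp only [hl]
    rcases hi with hi | hi
    · exact ⟨i ≫ g ≫ q, by simpa using (hq.comp g).comp i,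
        by simpa using below_of_qle hi (hr.comp i |> fun h => by rwa [comp_below] at h)⟩
    · exact ⟨i ≫ r, by
        have := (hq.comp g).comp i
        simp only [comp_below] at this
        simpa using below_of_qlt hi this, by simpa using hr.comp i⟩
  · refine (exists_above a).mono fun f ⟨q, hq⟩ => ⟨q, ?_⟩
    rw [hu]
    exact holds_or_left hq
  · intro Δ f q r h hr
    rw [hl] at hr ⊢
    exact hr.imp (below_of_qlt h) (below_of_qlt h)
  · intro Δ f q hq
    rw [hl] at hq
    simp only [hl]
    have hq2 := fun {Θ : E} (g : Θ ⟶ Δ) => hq.2.comp g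
    simp only [comp_below] at hq2
    refine (below_round hq.1).bind fun g ⟨r, hr, hr'⟩ => (below_round (hq2 g)).bind fun i ⟨s, hs, hs'⟩ =>
      (qle_or_qlt (i ≫ r) s).mono fun j hj => ?_
    rcases hj with hj | hj
    · refine ⟨j ≫ i ≫ r, by simpa using (hr.comp i).comp j, by simpa using (hr'.comp i).comp j, ?_⟩
      have := hs'.comp j
      rw [comp_below] at this
      simpa using below_of_qle hj this
    · refine ⟨j ≫ s, by simpa using hs.comp j, ?_, by simpa using hs'.comp j⟩
      have := (hr'.comp i).comp j
      rw [comp_below, comp_below] at this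
      simpa using below_of_qlt hj this
  · intro Δ f q r h hr
    rw [hu] at hr ⊢
    exact hmono q r q _ _ h hr
  · intro Δ f q hq
    rw [hu] at hq
    simp only [hu]
    refine (cov_of_or hq).bind fun g hg => ?_
    rcases hg with hg | hg
    · rw [comp_above] at hg
      exact (above_round hg).mono fun i ⟨r, hr, hr'⟩ =>
        ⟨r, by simpa using hr, holds_or_left (by simpa using hr')⟩
    · rw [comp_above] at hg
      exact (above_round hg).mono fun i ⟨r, hr, hr'⟩ =>
        ⟨r, by simpa using hr, holds_or_right (by simpa using hr')⟩
  · intro Δ f q h h'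
    rw [hl] at h
    rw [hu] at h'
    refine (cov_of_or h').holds fun g hg => ?_
    rw [comp_fls]
    rw [comp_above, comp_above] at hg
    have h1 := h.1.comp g
    have h2 := h.2.comp g
    rw [comp_below] at h1 h2
    exact hg.elim (fls_of_below_above h1) (fls_of_below_above h2)
  · intro Δ f q r h
    rw [hu]
    refine (cov_of_or (below_or_above h (f ≫ a))).holds fun g hg =>
      (cov_of_or ((below_or_above h (f ≫ b)).comp g |> fun h => by rwa [comp_or] at h)).holds
      fun i hi => ?_
    rw [← Category.assoc, comp_or, comp_mem, ← Category.assoc]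
    rcases hg with hg | hg
    · rcases hi with hi | hi
      · refine holds_or_left ((hl _ _).2 ⟨?_, ?_⟩)
        · simpa using hg.comp i
        · simpa using hi
      · rw [comp_or]
        exact holds_or_right (holds_or_right (by simpa using hi))
    · rw [comp_or]
      exact holds_or_right (holds_or_left (by simpa using hg.comp i))
  · intro Δ f q
    simp only [mem_comp_sep, comp_and]
    refine T.open_and _ _ ?_ ?_ <;> simp only [comp_below] <;> exact op_below _ _
  · intro Δ f q
    rw [hu]
    exact op_or (op_above _ _) (op_above _ _)

/-- The minimum of real numbers. -/
def rmin (a b : Γ ⟶ T.R) : Γ ⟶ T.R := (exists_rmin a b).choose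

theorem below_rmin {a b : Γ ⟶ T.R} {Δ : E} {f : Δ ⟶ Γ} {q : Δ ⟶ T.Q} :
    Holds (below q (f ≫ rmin a b)) ↔ Holds (below q (f ≫ a)) ∧ Holds (below q (f ≫ b)) := by
  rw [below_comp_eq, rmin, (exists_rmin a b).choose_spec.1]
  simp

theorem above_rmin {a b : Γ ⟶ T.R} {Δ : E} {f : Δ ⟶ Γ} {q : Δ ⟶ T.Q} :
    Holds (above q (f ≫ rmin a b)) ↔ Holds (above q (f ≫ a) ⋎ above q (f ≫ b)) := by
  rw [above_comp_eq, rmin, (exists_rmin a b).choose_spec.2]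
  simp

@[simp]
theorem comp_rmin {Δ : E} (f : Δ ⟶ Γ) (a b : Γ ⟶ T.R) :
    f ≫ rmin a b = rmin (f ≫ a) (f ≫ b) :=
  real_ext fun g q => by
    rw [← Category.assoc, below_rmin, below_rmin]
    simp only [Category.assoc]

theorem rmin_le_left (a b : Γ ⟶ T.R) : rmin a b ≤ a :=
  le_iff_below.2 fun _ _ h => (below_rmin.1 h).1

theorem rmin_le_right (a b : Γ ⟶ T.R) : rmin a b ≤ b :=
  le_iff_below.2 fun _ _ h => (below_rmin.1 h).2

theorem le_rmin {a b c : Γ ⟶ T.R} (h : c ≤ a) (h' : c ≤ b) : c ≤ rmin a b :=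
  le_iff_below.2 fun f q hq =>
    below_rmin.2 ⟨le_iff_below.1 h f q hq, le_iff_below.1 h' f q hq⟩

/-- The order is not decidable, so the smaller argument cannot be selected. A rational between the
minimum and `c` lies in the union of the two upper cuts, which suffices. -/
theorem cov_of_rmin_slt {a b c : Γ ⟶ T.R} (h : rmin a b ≪ c) :
    Cov fun {Δ} (f : Δ ⟶ Γ) => f ≫ a ≪ f ≫ c ∨ f ≫ b ≪ f ≫ c :=
  (slt_iff.1 h).bind fun f ⟨q, h1, h2⟩ => (cov_of_or (above_rmin.1 h1)).mono fun g hg => by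
    rw [comp_above, comp_above] at hg
    have h3 := h2.comp g
    rw [comp_below] at h3
    simp only [Category.assoc]
    exact hg.imp (fun h => slt_of _ h h3) fun h => slt_of _ h h3

end SynthTopology

end RealGroup

end SynTop

end

/-! ### Limits of sequences of real numbers, and finite minima -/

noncomputable section

namespace SynTop

section Limits

variable {E : Type u} [Category.{v} E] [CartesianMonoidalCategory E] [MonoidalClosed E]
  [Limits.HasFiniteLimits E] [HasSubobjectClassifier E]

local postfix:max "⇧" => wk
local infix:45 " ≐ " => eqq
local infixr:35 " ⋏ " => and
local infixr:25 " ⇛ " => imp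
local infix:20 " ⟺ " => iff
local infix:50 " ∊ " => mem
local infixr:30 " ⋎ " => or

set_option linter.unusedSectionVars false
set_option linter.unusedSimpArgs false

open NNO

namespace SynthTopology

variable {T : SynthTopology E} {Γ : E}

local infix:50 " ≪ " => Slt

theorem lift_fst_snd_comp {Γ Δ X : E} (f : Δ ⟶ Γ) : lift (fst X Δ) (snd X Δ ≫ f) = X ◁ f :=
  CartesianMonoidalCategory.hom_ext _ _ (by rw [lift_fst, whiskerLeft_fst])
    (by rw [lift_snd, whiskerLeft_snd])

theorem op_comp_ex_nat {Δ : E} {f : Δ ⟶ Γ} {φ : (T.N ⊗ Γ ⟶ T.N) → (T.N ⊗ Γ ⟶ Om E)}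
    (h : ∀ {Θ : E} (g : Θ ⟶ Δ) (n : Θ ⟶ T.N), Holds (T.op (lift n (g ≫ f) ≫ φ (fst T.N Γ)))) :
    Holds (T.op (f ≫ ex T.N φ)) := by
  rw [comp_ex]
  refine op_ex_nat ?_
  have := h (snd T.N Δ) (fst T.N Δ)
  rwa [lift_fst_snd_comp] at this

@[simp]
theorem holds_rlt {a b : Γ ⟶ T.R} : Holds (rlt a b) ↔ a ≪ b := Iff.rfl

/-- A substitute for linear arithmetic: `h` is the sum of the known inequalities, and `h'` is an
identity in the group that `abel` checks. -/
theorem le_lin {a b c d : Γ ⟶ T.R} (h : c ≤ d) (h' : a + d = b + c) : a ≤ b := by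
  have := add_le_add_right h a
  rw [h'] at this
  exact le_of_add_le_add_right this

theorem exists_pos (Γ : E) : ∃ q : Γ ⟶ T.Q, (0 : Γ ⟶ T.R) ≪ rat q := by
  obtain ⟨q, hq⟩ := exists_qgt (0 : Γ ⟶ T.Q)
  exact ⟨q, rat_pos.2 hq⟩

/-- The sequence of real numbers has infimum zero. -/
def Vanishing (δ : T.N ⊗ Γ ⟶ T.R) : Prop :=
  ∀ {Δ : E} (f : Δ ⟶ Γ) (e : Δ ⟶ T.R), 0 ≪ e →
    Cov fun {Θ} (g : Θ ⟶ Δ) => ∃ k : Θ ⟶ T.N, lift k (g ≫ f) ≫ δ ≪ g ≫ e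

/-- The error is allowed twice because a comparison through a common approximation incurs it twice.
-/
theorem le_of_vanishing {δ : T.N ⊗ Γ ⟶ T.R} (hδ : Vanishing δ) {a b : Γ ⟶ T.R}
    (h : ∀ {Δ : E} (f : Δ ⟶ Γ) (k : Δ ⟶ T.N),
      f ≫ a ≤ f ≫ b + (lift k f ≫ δ + lift k f ≫ δ)) : a ≤ b := by
  refine le_of_forall_pos fun f e he => le_of_cov he.exists_gap fun g ⟨q, hq, hqe⟩ => ?_
  refine le_of_cov (hδ (g ≫ f) (rat q) hq) fun i ⟨k, hk⟩ => ?_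
  have h1 := h ((i ≫ g) ≫ f) k
  have h2 := comp_le hqe.le i
  simp only [Category.assoc, comp_radd, comp_real_zero, zero_add] at h1 h2 hk ⊢
  refine h1.trans (add_le_add_right (le_trans ?_ h2) _)
  exact add_le_add hk.le hk.le

/-- A Cauchy sequence of real numbers, with explicit error bounds, has a limit. -/
theorem exists_limit (r δ : T.N ⊗ Γ ⟶ T.R)
    (hr : ∀ {Δ : E} (f : Δ ⟶ Γ) (k l : Δ ⟶ T.N),
      lift k f ≫ r ≤ lift l f ≫ r + (lift k f ≫ δ + lift l f ≫ δ)) (hδ : Vanishing δ) :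
    ∃ z : Γ ⟶ T.R, ∀ {Δ : E} (f : Δ ⟶ Γ) (k : Δ ⟶ T.N),
      f ≫ z ≤ lift k f ≫ r + lift k f ≫ δ ∧ lift k f ≫ r ≤ f ≫ z + lift k f ≫ δ := by
  -- The limit is to lie within `δ k` of `r k`, so `q` is below it once `q + δ k < r k` for some
  -- `k`. Overtness of `T.N` makes the cut open.
  let L : Γ ⟶ Pow T.Q := sep T.Q fun q => ex T.N fun k =>
    rlt (rat q⇧ + lift k (snd _ _ ≫ snd _ _) ≫ δ) (lift k (snd _ _ ≫ snd _ _) ≫ r)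
  let U : Γ ⟶ Pow T.Q := sep T.Q fun q => ex T.N fun k =>
    rlt (lift k (snd _ _ ≫ snd _ _) ≫ r + lift k (snd _ _ ≫ snd _ _) ≫ δ) (rat q⇧)
  have hL : ∀ {Δ : E} (f : Δ ⟶ Γ) (q : Δ ⟶ T.Q), Holds (q ∊ f ≫ L) ↔
      Cov fun {Θ} (g : Θ ⟶ Δ) => ∃ k : Θ ⟶ T.N,
        rat (g ≫ q) + lift k (g ≫ f) ≫ δ ≪ lift k (g ≫ f) ≫ r := by
    intro Δ f q
    rw [mem_comp_sep]
    constructor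
    · exact fun h => (cov_of_comp_ex h).mono fun g ⟨k, hk⟩ => ⟨k, by simpa [comp_lift] using hk⟩
    · exact fun h => h.holds fun g ⟨k, hk⟩ => by
        rw [← Category.assoc]
        exact holds_comp_ex_intro k (by simpa [comp_lift] using hk)
  have hU : ∀ {Δ : E} (f : Δ ⟶ Γ) (q : Δ ⟶ T.Q), Holds (q ∊ f ≫ U) ↔
      Cov fun {Θ} (g : Θ ⟶ Δ) => ∃ k : Θ ⟶ T.N,
        lift k (g ≫ f) ≫ r + lift k (g ≫ f) ≫ δ ≪ rat (g ≫ q) := by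
    intro Δ f q
    rw [mem_comp_sep]
    constructor
    · exact fun h => (cov_of_comp_ex h).mono fun g ⟨k, hk⟩ => ⟨k, by simpa [comp_lift] using hk⟩
    · exact fun h => h.holds fun g ⟨k, hk⟩ => by
        rw [← Category.assoc]
        exact holds_comp_ex_intro k (by simpa [comp_lift] using hk)
  have data : CutData L U := by
    constructor
    · obtain ⟨e, he⟩ := exists_pos (T := T) Γ
      refine (hδ (𝟙 Γ) (rat e) he).bind fun f ⟨k, _⟩ =>
        (exists_below (lift k f ≫ r - lift k f ≫ δ)).mono fun g ⟨q, hq⟩ => ⟨q, ?_⟩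
      refine (hL _ _).2 (Cov.pure ⟨g ≫ k, ?_⟩)
      refine (rat_slt_iff.2 hq).lin (le_of_eq ?_)
      simp only [comp_rsub, comp_lift_assoc, Category.id_comp]
      abel
    · obtain ⟨e, he⟩ := exists_pos (T := T) Γ
      refine (hδ (𝟙 Γ) (rat e) he).bind fun f ⟨k, _⟩ =>
        (exists_above (lift k f ≫ r + lift k f ≫ δ)).mono fun g ⟨q, hq⟩ => ⟨q, ?_⟩
      refine (hU _ _).2 (Cov.pure ⟨g ≫ k, ?_⟩)
      simpa using slt_rat_iff.2 hq
    · intro Δ f q s hqs hs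
      rw [hL] at hs ⊢
      refine hs.mono fun g ⟨k, hk⟩ => ⟨k, ?_⟩
      have h1 : rat (g ≫ q) ≪ rat (g ≫ s) := rat_slt_iff.2 (holds_below_rat _ _ |>.2 (hqs.comp g))
      exact hk.lin (le_lin h1.le (by abel))
    · intro Δ f q hq
      rw [hL] at hq
      refine hq.bind fun g ⟨k, hk⟩ => ?_
      have h1 : rat (g ≫ q) ≪ lift k (g ≫ f) ≫ r - lift k (g ≫ f) ≫ δ :=
        hk.lin (le_of_eq (by abel))
      refine (below_round (rat_slt_iff.1 h1)).mono fun i ⟨s, hs, hs'⟩ => ⟨s, by simpa using hs, ?_⟩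
      refine (hL _ _).2 (Cov.pure ⟨i ≫ k, ?_⟩)
      refine (rat_slt_iff.2 hs').lin (le_of_eq ?_)
      simp only [comp_rsub, comp_lift_assoc, Category.id_comp, Category.assoc]
      abel
    · intro Δ f q s hqs hs
      rw [hU] at hs ⊢
      refine hs.mono fun g ⟨k, hk⟩ => ⟨k, ?_⟩
      exact hk.trans (rat_slt_iff.2 (holds_below_rat _ _ |>.2 (hqs.comp g)))
    · intro Δ f q hq
      rw [hU] at hq
      refine hq.bind fun g ⟨k, hk⟩ => ?_
      refine (above_round (slt_rat_iff.1 hk)).mono fun i ⟨s, hs, hs'⟩ => ⟨s, by simpa using hs, ?_⟩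
      refine (hU _ _).2 (Cov.pure ⟨i ≫ k, ?_⟩)
      simpa using slt_rat_iff.2 hs'
    · intro Δ f q h h'
      rw [hL] at h
      refine h.holds fun g ⟨k, hk⟩ => ?_
      have h'' := h'.comp g
      rw [comp_mem, ← Category.assoc, hU] at h''
      refine h''.holds fun i ⟨l, hl⟩ => ?_
      have hk' := hk.comp i
      have h1 := hr (i ≫ g ≫ f) (i ≫ k) l
      simp only [comp_radd, comp_rat, comp_lift_assoc, Category.assoc, comp_fls] at hk' hl ⊢
      refine (hk'.trans (hl.lin (a := lift (i ≫ k) (i ≫ g ≫ f) ≫ r) (b := rat (i ≫ g ≫ q) +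
        lift (i ≫ k) (i ≫ g ≫ f) ≫ δ) ?_)).fls
      exact le_lin h1 (by abel)
    · intro Δ f q s h
      have h1 : rat q ≪ rat s := rat_slt_iff.2 (holds_below_rat _ _ |>.2 h)
      -- If `q + 2 * e < s` and `δ k < e`, then `q + δ k < s - δ k`. By cotransitivity, `r k`
      -- exceeds the former number or lies below the latter.
      refine h1.exists_gap.holds fun g ⟨e, he, he'⟩ => (hδ (g ≫ f) (rat e) he).holds fun i ⟨k, hk⟩ => ?_
      have h2 : i ≫ g ≫ rat q + lift k (i ≫ g ≫ f) ≫ δ ≪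
          i ≫ g ≫ rat s - lift k (i ≫ g ≫ f) ≫ δ := by
        refine (he'.comp i).lin ?_
        simp only [comp_radd, comp_rat]
        have := hk.le
        simp only [comp_rat] at this
        exact le_lin (add_le_add this this) (by abel)
      refine (h2.cov_cotrans (lift k (i ≫ g ≫ f) ≫ r)).holds fun j hj => ?_
      simp only [comp_or, comp_mem]
      rcases hj with hj | hj
      · refine holds_or_left ?_
        rw [show j ≫ i ≫ g ≫ f ≫ L = (j ≫ i ≫ g ≫ f) ≫ L by simp only [Category.assoc], hL]
        refine Cov.pure ⟨j ≫ k, ?_⟩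
        simpa using hj
      · refine holds_or_right ?_
        rw [show j ≫ i ≫ g ≫ f ≫ U = (j ≫ i ≫ g ≫ f) ≫ U by simp only [Category.assoc], hU]
        refine Cov.pure ⟨j ≫ k, hj.lin ?_⟩
        simp only [comp_radd, comp_rsub, comp_rat, comp_lift_assoc, Category.id_comp]
        exact le_of_eq (by abel)
    · intro Δ f q
      rw [mem_comp_sep]
      refine op_comp_ex_nat fun g k => ?_
      rw [comp_rlt]
      exact op_rlt _ _
    · intro Δ f q
      rw [mem_comp_sep]
      refine op_comp_ex_nat fun g k => ?_
      rw [comp_rlt]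
      exact op_rlt _ _
  obtain ⟨z, hz1, hz2⟩ := exists_real data
  refine ⟨z, fun f k => ⟨le_iff_above.2 fun g q hq => ?_, ?_⟩⟩
  · rw [← Category.assoc, above_comp_eq, hz2, hU]
    refine Cov.pure ⟨g ≫ k, ?_⟩
    simpa using slt_rat_iff.2 hq
  · have : lift k f ≫ r - lift k f ≫ δ ≤ f ≫ z := by
      refine le_iff_below.2 fun g q hq => ?_
      rw [← Category.assoc, below_comp_eq, hz1, hL]
      refine Cov.pure ⟨g ≫ k, (rat_slt_iff.2 hq).lin ?_⟩
      simp only [comp_rsub, comp_lift_assoc, Category.id_comp]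
      exact le_of_eq (by abel)
    exact le_lin this (by abel)

/-! ### Finite minima -/

theorem exists_minimum (g : T.N ⊗ Γ ⟶ T.R) : ∃ m : T.N ⊗ Γ ⟶ T.R,
    (∀ {Δ : E} (f : Δ ⟶ Γ), lift 0 f ≫ m = lift 0 f ≫ g) ∧
    ∀ {Δ : E} (n : Δ ⟶ T.N) (f : Δ ⟶ Γ),
      lift (n + 1) f ≫ m = rmin (lift n f ≫ m) (lift (n + 1) f ≫ g) := by
  obtain ⟨m, h0, hs⟩ := exists_primrec (T := T.toNNO) (lift 0 (𝟙 Γ) ≫ g)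
    (rmin (fst T.R (T.N ⊗ Γ)) (lift (snd _ _ ≫ fst _ _ + 1) (snd _ _ ≫ snd _ _) ≫ g))
  refine ⟨m, fun f => ?_, fun n f => ?_⟩
  · rw [h0]
    simp
  · rw [hs]
    simp

/-- The minimum of the numbers `g 0, …, g n`. -/
def minimum (g : T.N ⊗ Γ ⟶ T.R) : T.N ⊗ Γ ⟶ T.R := (exists_minimum g).choose

theorem minimum_zero (g : T.N ⊗ Γ ⟶ T.R) {Δ : E} (f : Δ ⟶ Γ) :
    lift 0 f ≫ minimum g = lift 0 f ≫ g :=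
  (exists_minimum g).choose_spec.1 f

theorem minimum_succ (g : T.N ⊗ Γ ⟶ T.R) {Δ : E} (n : Δ ⟶ T.N) (f : Δ ⟶ Γ) :
    lift (n + 1) f ≫ minimum g = rmin (lift n f ≫ minimum g) (lift (n + 1) f ≫ g) :=
  (exists_minimum g).choose_spec.2 n f

theorem holds_comp_neg_rlt {Δ : E} {f : Δ ⟶ Γ} {a b : Γ ⟶ T.R} :
    Holds (f ≫ neg (rlt b a)) ↔ f ≫ a ≤ f ≫ b := by
  rw [comp_neg, comp_rlt]
  rfl

theorem minimum_le_self (g : T.N ⊗ Γ ⟶ T.R) {Δ : E} (f : Δ ⟶ Γ) (n : Δ ⟶ T.N) :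
    lift n f ≫ minimum g ≤ lift n f ≫ g := by
  rw [← holds_comp_neg_rlt]
  refine induction _ (fun f => ?_) (fun f n _ => ?_) f n
  · rw [holds_comp_neg_rlt, minimum_zero]
  · rw [holds_comp_neg_rlt, minimum_succ]
    exact rmin_le_right _ _

/-- The bound on the index is expressed by a sum, here and in the sequel, so that it remains an
equation. -/
theorem minimum_le (g : T.N ⊗ Γ ⟶ T.R) {Δ : E} (f : Δ ⟶ Γ) (i k : Δ ⟶ T.N) :
    lift (i + k) f ≫ minimum g ≤ lift i f ≫ g := by
  have key := induction (T := T.toNNO) (Γ := Δ)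
    (neg (rlt (snd _ _ ≫ lift i f ≫ g) (lift (snd _ _ ≫ i + fst _ _) (snd _ _ ≫ f) ≫ minimum g)))
    (fun f' => ?_) (fun f' n hn => ?_) (𝟙 Δ) k
  · rw [holds_comp_neg_rlt] at key
    simpa using key
  · rw [holds_comp_neg_rlt]
    simpa using minimum_le_self g (f' ≫ f) (f' ≫ i)
  · rw [holds_comp_neg_rlt] at hn ⊢
    simp only [comp_lift_assoc, comp_natAdd, lift_fst, lift_snd_assoc] at hn ⊢
    rw [← add_assoc, minimum_succ]
    exact (rmin_le_left _ _).trans hn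

/-- An index at which the minimum is attained cannot be found, as the order is undecidable. A strict
upper bound of the minimum is nevertheless undercut by one of the values, locally. -/
theorem exists_of_minimum_slt {g : T.N ⊗ Γ ⟶ T.R} {Δ : E} {f : Δ ⟶ Γ} {n : Δ ⟶ T.N} {t : Δ ⟶ T.R}
    (h : lift n f ≫ minimum g ≪ t) : Cov fun {Θ} (j : Θ ⟶ Δ) => ∃ i k : Θ ⟶ T.N,
      i + k = j ≫ n ∧ lift i (j ≫ f) ≫ g ≪ j ≫ t := by
  intro r H
  -- The induction runs over initial segments: whenever `m + k = n` and the minimum up to `m` is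
  -- below `t`, the goal holds. The remainder `k` keeps every index that is found within the bound
  -- `n`.
  have key := induction (T := T.toNNO) (Γ := Δ)
    (all T.N fun k => (snd _ _ ≫ fst _ _ + k ≐ snd _ _ ≫ snd _ _ ≫ n) ⇛
      rlt (lift (snd _ _ ≫ fst _ _) (snd _ _ ≫ snd _ _ ≫ f) ≫ minimum g) (snd _ _ ≫ snd _ _ ≫ t) ⇛
        snd _ _ ≫ snd _ _ ≫ r) ?_ ?_ (𝟙 Δ) n
  · have h1 := holds_comp_all.1 key (𝟙 Δ) 0
    simp only [comp_imp, comp_eqq, comp_natAdd, lift_fst, lift_snd_assoc, comp_rlt, comp_lift_assoc,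
      Category.id_comp] at h1
    have h2 := h1.mp (by simp)
    exact h2.mp h
  · intro Δ' f'
    refine holds_comp_all.2 fun f'' k => ?_
    simp only [comp_imp, comp_eqq, comp_natAdd, lift_fst, lift_snd_assoc, comp_rlt, comp_lift_assoc]
    refine holds_imp.2 fun i hi => ?_
    rw [comp_imp]
    refine holds_imp.2 fun j hj => ?_
    rw [holds_comp_eqq] at hi
    have := H (j ≫ i ≫ f'' ≫ f') ⟨0, j ≫ i ≫ k, ?_, ?_⟩
    · simpa using this
    · simpa using congrArg (fun x => j ≫ x) hi
    · simp only [comp_rlt, comp_lift_assoc, comp_zero, minimum_zero, Category.assoc, lift_fst,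
        lift_snd_assoc] at hj ⊢
      exact hj
  · intro Δ' f' m hm
    refine holds_comp_all.2 fun f'' k => ?_
    simp only [comp_imp, comp_eqq, comp_natAdd, lift_fst, lift_snd_assoc, comp_rlt, comp_lift_assoc]
    refine holds_imp.2 fun i hi => ?_
    rw [comp_imp]
    refine holds_imp.2 fun j hj => ?_
    rw [holds_comp_eqq] at hi
    simp only [comp_rlt, comp_lift_assoc, comp_zero, minimum_succ, Category.assoc, comp_natAdd,
      comp_one, lift_fst, lift_snd_assoc, holds_rlt, comp_rmin] at hj hi
    refine (cov_of_rmin_slt (T := T) hj).holds fun l hl => ?_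
    rcases hl with hl | hl
    · rw [holds_comp_all] at hm
      have h1 := hm ((l ≫ j ≫ i) ≫ f'') (l ≫ j ≫ i ≫ k + 1)
      simp only [comp_imp, comp_eqq, comp_natAdd, lift_fst, lift_snd_assoc, comp_rlt,
        comp_lift_assoc, Category.assoc, comp_one] at h1
      simp only [comp_lift_assoc, Category.assoc] at hl
      have h2 := congrArg (fun x => l ≫ j ≫ x) hi
      simp only [comp_natAdd, comp_one] at h2
      have h3 := h1.mp ((holds_eqq _ _).2 (by rw [← h2]; ring))
      simpa using h3.mp hl
    · have := H (l ≫ j ≫ i ≫ f'' ≫ f') ⟨l ≫ j ≫ i ≫ f'' ≫ m + 1, l ≫ j ≫ i ≫ k, ?_, ?_⟩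
      · simpa using this
      · simpa using congrArg (fun x => l ≫ j ≫ x) hi
      · simpa using hl

theorem le_minimum {g : T.N ⊗ Γ ⟶ T.R} {Δ : E} {f : Δ ⟶ Γ} {n : Δ ⟶ T.N} {c : Δ ⟶ T.R}
    (h : ∀ {Θ : E} (j : Θ ⟶ Δ) (i k : Θ ⟶ T.N), i + k = j ≫ n → j ≫ c ≤ lift i (j ≫ f) ≫ g) :
    c ≤ lift n f ≫ minimum g := by
  refine le_iff.2 fun j hj => ?_
  rw [comp_lift_assoc] at hj
  refine (exists_of_minimum_slt hj).holds fun l ⟨i, k, hik, hi⟩ => ?_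
  rw [comp_fls]
  have := h (l ≫ j) i k (by rw [hik, Category.assoc])
  simp only [Category.assoc] at this hi
  exact (hi.trans_le this).fls

end SynthTopology

end Limits

end SynTop

end

/-! ### Metric spaces, and points of a complete space determined by their distances -/

noncomputable section

namespace SynTop

section Metric

variable {E : Type u} [Category.{v} E] [CartesianMonoidalCategory E] [MonoidalClosed E]
  [Limits.HasFiniteLimits E] [HasSubobjectClassifier E]

local postfix:max "⇧" => wk
local infix:45 " ≐ " => eqq
local infixr:35 " ⋏ " => and
local infixr:25 " ⇛ " => imp
local infix:20 " ⟺ " => iff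
local infix:50 " ∊ " => mem
local infixr:30 " ⋎ " => or

set_option linter.unusedSectionVars false
set_option linter.unusedSimpArgs false

open NNO

namespace SynthTopology

variable {T : SynthTopology E} {Γ X Y : E}

local infix:50 " ≪ " => Slt

theorem cut_injective {a b : Γ ⟶ T.R} (h : T.cut a = T.cut b) : a = b := Compr.ext h

theorem limit_unique {r δ : T.N ⊗ Γ ⟶ T.R} (hδ : Vanishing δ) {z z' : Γ ⟶ T.R}
    (h : ∀ {Δ : E} (f : Δ ⟶ Γ) (k : Δ ⟶ T.N),
      f ≫ z ≤ lift k f ≫ r + lift k f ≫ δ ∧ lift k f ≫ r ≤ f ≫ z + lift k f ≫ δ)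
    (h' : ∀ {Δ : E} (f : Δ ⟶ Γ) (k : Δ ⟶ T.N),
      f ≫ z' ≤ lift k f ≫ r + lift k f ≫ δ ∧ lift k f ≫ r ≤ f ≫ z' + lift k f ≫ δ) : z = z' :=
  le_antisymm
    (le_of_vanishing hδ fun f k => le_lin (add_le_add (h f k).1 (h' f k).2) (by abel))
    (le_of_vanishing hδ fun f k => le_lin (add_le_add (h' f k).1 (h f k).2) (by abel))

/-! ### Metric spaces -/

/-- The distance of two elements, as a real number. -/
def rd (d : X ⊗ X ⟶ T.R) (x y : Γ ⟶ X) : Γ ⟶ T.R := lift x y ≫ d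

@[simp]
theorem comp_rd {Δ : E} (f : Δ ⟶ Γ) (d : X ⊗ X ⟶ T.R) (x y : Γ ⟶ X) :
    f ≫ rd d x y = rd d (f ≫ x) (f ≫ y) := by
  rw [rd, rd, comp_lift_assoc]

variable {d : X ⊗ X ⟶ T.R}

theorem IsPseudometric.rd_self (hd : T.IsPseudometric d) (x : Γ ⟶ X) : rd d x x = 0 :=
  cut_injective ((hd.dist_self x).trans cut_zero.symm)

theorem IsPseudometric.rd_comm (hd : T.IsPseudometric d) (x y : Γ ⟶ X) : rd d x y = rd d y x :=
  cut_injective (hd.dist_comm x y)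

theorem IsPseudometric.rd_triangle (hd : T.IsPseudometric d) (x y z : Γ ⟶ X) :
    rd d x z ≤ rd d x y + rd d y z := by
  rw [le_def, cut_add]
  exact hd.triangle x y z

theorem IsPseudometric.mk' (h1 : ∀ {Γ : E} (x : Γ ⟶ X), rd d x x = 0)
    (h2 : ∀ {Γ : E} (x y : Γ ⟶ X), rd d x y = rd d y x)
    (h3 : ∀ {Γ : E} (x y z : Γ ⟶ X), rd d x z ≤ rd d x y + rd d y z) : T.IsPseudometric d where
  dist_self x := (congrArg T.cut (h1 x)).trans cut_zero
  dist_comm x y := congrArg T.cut (h2 x y)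
  triangle x y z := by
    rw [dist, dist, dist, ← cut_add]
    exact h3 x y z

theorem IsMetric.eq_of_rd (hd : T.IsMetric d) {x y : Γ ⟶ X} (h : rd d x y = 0) : x = y :=
  hd.eq_of_dist x y ((congrArg T.cut h).trans cut_zero)

theorem nonneg_of_add_self {a : Γ ⟶ T.R} (h : 0 ≤ a + a) : 0 ≤ a := by
  refine le_iff.2 fun f hf => ?_
  rw [comp_real_zero] at hf
  have h1 := comp_le h f
  rw [comp_real_zero, comp_radd] at h1
  have h2 : f ≫ a + f ≫ a ≪ 0 := hf.lin (le_lin hf.le (by abel))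
  exact (slt_of_le_of_slt h1 h2).fls

theorem IsPseudometric.rd_nonneg (hd : T.IsPseudometric d) (x y : Γ ⟶ X) : 0 ≤ rd d x y := by
  refine nonneg_of_add_self ?_
  have := hd.rd_triangle x y x
  rwa [hd.rd_self, hd.rd_comm y x] at this

theorem isIsometry_iff {e : Y ⊗ Y ⟶ T.R} {f : X ⟶ Y} : T.IsIsometry d e f ↔
    ∀ {Γ : E} (x y : Γ ⟶ X), rd e (x ≫ f) (y ≫ f) = rd d x y := Iff.rfl

theorem mem_image {f : X ⟶ Y} (g : Γ ⟶ 𝟙_ E) (y : Γ ⟶ Y) :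
    Holds (y ∊ g ≫ image f) ↔ Cov fun {Δ} (i : Δ ⟶ Γ) => ∃ x : Δ ⟶ X, x ≫ f = i ≫ y := by
  rw [image, mem_comp_sep]
  constructor
  · exact fun h => (cov_of_comp_ex h).mono fun i ⟨x, hx⟩ => ⟨x, by simpa using hx⟩
  · exact fun h => h.holds fun i ⟨x, hx⟩ => by
      rw [← Category.assoc]
      exact holds_comp_ex_intro x (by simpa using hx)

theorem lt_dist (x y : Γ ⟶ X) (r : Γ ⟶ T.R) :
    T.lt (T.dist d x y) (T.cut r) = rlt (rd d x y) r := rfl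

theorem lt_zeroCut (r : Γ ⟶ T.R) : T.lt (T.zeroCut Γ) (T.cut r) = rlt 0 r := by
  rw [← cut_zero]
  rfl

theorem holds_isDense {A : Γ ⟶ Pow X} : Holds (T.isDense d A) ↔
    ∀ {Δ : E} (f : Δ ⟶ Γ) (x : Δ ⟶ X) (r : Δ ⟶ T.R), 0 ≪ r →
      Cov fun {Θ} (g : Θ ⟶ Δ) => ∃ a : Θ ⟶ X, Holds (a ∊ (g ≫ f) ≫ A) ∧ rd d (g ≫ x) a ≪ g ≫ r := by
  simp only [isDense, lt_dist, lt_zeroCut]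
  rw [holds_all]
  constructor
  · intro h Δ f x r hr
    have := holds_comp_all.1 (h f x) (𝟙 Δ) r
    rw [comp_imp, comp_rlt, comp_real_zero, lift_fst] at this
    refine (cov_of_comp_ex (this.mp hr)).mono fun g ⟨a, ha⟩ => ⟨a, ?_⟩
    simpa [comp_lift] using ha
  · intro h Δ f x
    refine holds_comp_all.2 fun g r => ?_
    rw [comp_imp]
    refine holds_imp.2 fun i hi => ?_
    rw [comp_rlt, comp_rlt, comp_real_zero, comp_real_zero, lift_fst] at hi
    rw [← Category.assoc]
    refine (h (i ≫ g ≫ f) (i ≫ g ≫ x) _ hi).holds fun j ⟨a, ha⟩ => ?_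
    rw [← Category.assoc]
    refine holds_comp_ex_intro a ?_
    simpa [comp_lift] using ha

/-- A sequence of points is dense. -/
theorem exists_near {u : T.N ⟶ X} (hu : Holds (T.isDense d (image u))) (x : Γ ⟶ X) {e : Γ ⟶ T.R}
    (he : 0 ≪ e) : Cov fun {Δ} (f : Δ ⟶ Γ) => ∃ k : Δ ⟶ T.N, rd d (f ≫ x) (k ≫ u) ≪ f ≫ e :=
  (holds_isDense.1 hu (toUnit Γ) x e he).bind fun f ⟨a, ha, ha'⟩ =>
    ((mem_image _ _).1 ha).mono fun g ⟨k, hk⟩ => ⟨k, by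
      have := Slt.comp ha' g
      rw [comp_rd, ← hk] at this
      simpa using this⟩

/-! ### Points of a complete space given by their distances -/

/-- A sequence of real numbers that behaves like the distances of a point from the points of the
dense sequence `u`. -/
structure Pointlike (d : X ⊗ X ⟶ T.R) (u : T.N ⟶ X) (γ : Γ ⟶ (ihom T.N).obj T.R) : Prop where
  le_add : ∀ {Δ : E} (f : Δ ⟶ Γ) (k l : Δ ⟶ T.N),
    app (f ≫ γ) k ≤ rd d (k ≫ u) (l ≫ u) + app (f ≫ γ) l
  rd_le : ∀ {Δ : E} (f : Δ ⟶ Γ) (k l : Δ ⟶ T.N),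
    rd d (k ≫ u) (l ≫ u) ≤ app (f ≫ γ) k + app (f ≫ γ) l
  small : ∀ {Δ : E} (f : Δ ⟶ Γ) (e : Δ ⟶ T.R), 0 ≪ e →
    Cov fun {Θ} (g : Θ ⟶ Δ) => ∃ k : Θ ⟶ T.N, app (g ≫ f ≫ γ) k ≪ g ≫ e

/-- Completeness is a statement about objects, not about elements at a stage. Since being pointlike
is an internal property, the pointlike sequences form an object to which completeness can be
applied. -/
theorem exists_pointlike (d : X ⊗ X ⟶ T.R) (u : T.N ⟶ X) :
    ∃ φ : (ihom T.N).obj T.R ⟶ Om E, ∀ {Γ : E} (γ : Γ ⟶ (ihom T.N).obj T.R),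
      Holds (γ ≫ φ) ↔ Pointlike d u γ := by
  let A : T.N ⊗ T.N ⊗ (ihom T.N).obj T.R ⟶ T.R := app (snd _ _ ≫ snd _ _) (snd _ _ ≫ fst _ _)
  let B : T.N ⊗ T.N ⊗ (ihom T.N).obj T.R ⟶ T.R := app (snd _ _ ≫ snd _ _) (fst _ _)
  let D : T.N ⊗ T.N ⊗ (ihom T.N).obj T.R ⟶ T.R := rd d (snd _ _ ≫ fst _ _ ≫ u) (fst _ _ ≫ u)
  refine ⟨(all T.N fun _ => all T.N fun _ => neg (rlt (D + B) A) ⋏ neg (rlt (A + B) D)) ⋏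
    all T.R fun e => rlt 0 e ⇛ ex T.N fun k => rlt (app (snd _ _ ≫ snd _ _) k) e⇧, ?_⟩
  intro Γ γ
  rw [comp_and, holds_and, holds_comp_all, holds_comp_all]
  constructor
  · rintro ⟨h1, h2⟩
    have h3 : ∀ {Δ : E} (f : Δ ⟶ Γ) (k l : Δ ⟶ T.N),
        app (f ≫ γ) k ≤ rd d (k ≫ u) (l ≫ u) + app (f ≫ γ) l ∧
          rd d (k ≫ u) (l ≫ u) ≤ app (f ≫ γ) k + app (f ≫ γ) l := by
      intro Δ f k l
      have := holds_comp_all.1 (h1 f k) (𝟙 Δ) l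
      rw [comp_and, holds_and, holds_comp_neg_rlt, holds_comp_neg_rlt] at this
      simpa [A, B, D, comp_app] using this
    refine ⟨fun f k l => (h3 f k l).1, fun f k l => (h3 f k l).2, fun f e he => ?_⟩
    have := h2 f e
    rw [comp_imp, comp_rlt, comp_real_zero, lift_fst] at this
    refine (cov_of_comp_ex (this.mp he)).mono fun g ⟨k, hk⟩ => ⟨k, ?_⟩
    simpa [comp_app, comp_lift] using hk
  · intro h
    refine ⟨fun f k => holds_comp_all.2 fun g l => ?_, fun f e => ?_⟩
    · rw [comp_and, holds_and, holds_comp_neg_rlt, holds_comp_neg_rlt]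
      have := And.intro (h.le_add (g ≫ f) (g ≫ k) l) (h.rd_le (g ≫ f) (g ≫ k) l)
      simpa [A, B, D, comp_app] using this
    · rw [comp_imp]
      refine holds_imp.2 fun g hg => ?_
      rw [comp_rlt, comp_rlt, comp_real_zero, comp_real_zero, lift_fst] at hg
      rw [← Category.assoc]
      refine (h.small (g ≫ f) (g ≫ e) hg).holds fun i ⟨k, hk⟩ => ?_
      rw [← Category.assoc]
      refine holds_comp_ex_intro k ?_
      simpa [comp_app, comp_lift] using hk

theorem IsMetric.pointlike (hd : T.IsPseudometric d) {u : T.N ⟶ X}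
    (hu : Holds (T.isDense d (image u))) (x : Γ ⟶ X) :
    Pointlike d u (lam (rd d (fst T.N Γ ≫ u) (snd T.N Γ ≫ x))) where
  le_add f k l := by
    simpa [app_lam] using hd.rd_triangle _ _ _
  rd_le f k l := by
    rw [app_lam, app_lam]
    simp only [comp_rd, lift_fst_assoc, lift_snd_assoc]
    rw [hd.rd_comm (l ≫ u)]
    exact hd.rd_triangle _ _ _
  small f e he := (exists_near hu (f ≫ x) he).mono fun g ⟨k, hk⟩ => ⟨k, by
    rw [← Category.assoc, app_lam]
    simp only [comp_rd, lift_fst_assoc, lift_snd_assoc, Category.assoc]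
    rwa [hd.rd_comm]⟩

/-- In a complete space, every sequence of real numbers that behaves like the distances of a point
from the points of a dense sequence comes from a point. -/
theorem exists_point (hd : T.IsMetric d) (hc : T.IsComplete d) {u : T.N ⟶ X}
    (hu : Holds (T.isDense d (image u))) {γ : Γ ⟶ (ihom T.N).obj T.R} (hγ : Pointlike d u γ) :
    ∃ x : Γ ⟶ X, ∀ {Δ : E} (f : Δ ⟶ Γ) (k : Δ ⟶ T.N),
      rd d (k ≫ u) (f ≫ x) = app (f ≫ γ) k := by
  obtain ⟨φ, hφ⟩ := exists_pointlike d u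
  let Y : E := Compr φ
  have hY : ∀ {Δ : E} (y : Δ ⟶ Y), Pointlike d u (y ≫ incl φ) := fun y => (hφ _).1 (Compr.prop y)
  have hvan : ∀ {Δ : E} (y : Δ ⟶ Y), Vanishing (app (snd T.N Δ ≫ y ≫ incl φ) (fst T.N Δ)) := by
    intro Δ y Δ' f e he
    refine ((hY y).small f e he).mono fun g ⟨k, hk⟩ => ⟨k, ?_⟩
    simpa [comp_app] using hk
  -- As `u k` approaches the ideal point `y`, the number `z k` approaches the distance between `y`
  -- and `z`, with error `y k`. The distance is defined as this limit.
  obtain ⟨e, he⟩ : ∃ e : Y ⊗ Y ⟶ T.R, ∀ {Δ : E} (y z : Δ ⟶ Y) (k : Δ ⟶ T.N),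
      rd e y z ≤ app (z ≫ incl φ) k + app (y ≫ incl φ) k ∧
      app (z ≫ incl φ) k ≤ rd e y z + app (y ≫ incl φ) k := by
    have hr : ∀ {Δ : E} (f : Δ ⟶ Y ⊗ Y) (k l : Δ ⟶ T.N),
        app ((f ≫ snd _ _) ≫ incl φ) k ≤ app ((f ≫ snd _ _) ≫ incl φ) l +
          (app ((f ≫ fst _ _) ≫ incl φ) k + app ((f ≫ fst _ _) ≫ incl φ) l) := by
      intro Δ f k l
      have h1 := (hY (f ≫ snd _ _)).le_add (𝟙 _) k l
      have h2 := (hY (f ≫ fst _ _)).rd_le (𝟙 _) k l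
      rw [Category.id_comp] at h1 h2
      exact le_lin (add_le_add h1 h2) (by abel)
    obtain ⟨e, he⟩ := exists_limit (T := T) (Γ := Y ⊗ Y)
      (app (snd T.N _ ≫ snd _ _ ≫ incl φ) (fst T.N _))
      (app (snd T.N _ ≫ fst _ _ ≫ incl φ) (fst T.N _))
      (fun f k l => by simpa [comp_app] using hr f k l) (hvan (fst Y Y))
    refine ⟨e, fun y z k => ?_⟩
    simpa [comp_app, rd] using he (lift y z) k
  have hcomp : ∀ {Δ Θ : E} (f : Θ ⟶ Δ) (y : Δ ⟶ Y) (k : Θ ⟶ T.N),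
      lift k f ≫ app (snd T.N Δ ≫ y ≫ incl φ) (fst T.N Δ) = app ((f ≫ y) ≫ incl φ) k := by
    intro Δ Θ f y k
    simp [comp_app]
  have hle : ∀ {Δ : E} (y : Δ ⟶ Y) (a b : Δ ⟶ T.R),
      (∀ {Θ : E} (f : Θ ⟶ Δ) (k : Θ ⟶ T.N),
        f ≫ a ≤ f ≫ b + (app ((f ≫ y) ≫ incl φ) k + app ((f ≫ y) ≫ incl φ) k)) → a ≤ b := by
    intro Δ y a b h
    refine le_of_vanishing (hvan y) fun f k => ?_
    rw [hcomp]
    exact h f k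
  have hzero : ∀ {Δ : E} (y : Δ ⟶ Y), rd e y y = 0 := by
    intro Δ y
    refine le_antisymm (hle y _ _ fun f k => ?_) (le_lin (he y y 0).2 (by abel))
    rw [comp_rd, comp_real_zero, zero_add]
    exact (he _ _ k).1
  have hcommle : ∀ {Δ : E} (y z : Δ ⟶ Y), rd e z y ≤ rd e y z := by
    intro Δ y z
    refine hle y _ _ fun f k => ?_
    rw [comp_rd, comp_rd]
    exact le_lin (add_le_add (he (f ≫ z) (f ≫ y) k).1 (he (f ≫ y) (f ≫ z) k).2) (by abel)
  have hcomm : ∀ {Δ : E} (y z : Δ ⟶ Y), rd e y z = rd e z y := fun y z =>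
    le_antisymm (hcommle z y) (hcommle y z)
  have htri : ∀ {Δ : E} (x y z : Δ ⟶ Y), rd e x z ≤ rd e x y + rd e y z := by
    intro Δ x y z
    refine hle x _ _ fun f k => ?_
    rw [comp_rd, comp_radd, comp_rd, comp_rd]
    have h1 := (he (f ≫ x) (f ≫ z) k).1
    have h2 := (he (f ≫ y) (f ≫ z) k).2
    have h3 := (he (f ≫ x) (f ≫ y) k).2
    exact le_lin (add_le_add (add_le_add h1 h2) h3) (by abel)
  -- A point of `X` is sent to its sequence of distances. The retraction of this dense isometry,
  -- granted by completeness, realizes every pointlike sequence by a point.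
  let F : X ⟶ Y := Compr.mk (lam (rd d (fst T.N X ≫ u) (snd T.N X ≫ 𝟙 X)))
    ((hφ _).2 (IsMetric.pointlike hd.toIsPseudometric hu _))
  have hF : ∀ {Δ : E} (x : Δ ⟶ X) (k : Δ ⟶ T.N),
      app ((x ≫ F) ≫ incl φ) k = rd d (k ≫ u) x := by
    intro Δ x k
    simp [F, app_lam]
  have hiso : T.IsIsometry d e F := by
    refine isIsometry_iff.2 fun {Δ} x y => ?_
    refine limit_unique (hvan (x ≫ F)) (r := app (snd T.N Δ ≫ (y ≫ F) ≫ incl φ) (fst T.N Δ))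
      (fun f k => ?_) (fun f k => ?_)
    · rw [hcomp, hcomp, comp_rd]
      exact he _ _ k
    · rw [hcomp, hcomp, ← Category.assoc, ← Category.assoc, hF, hF, comp_rd,
        hd.rd_comm (k ≫ u) (f ≫ x)]
      refine ⟨?_, ?_⟩
      · rw [add_comm]
        exact hd.rd_triangle _ _ _
      · rw [add_comm, hd.rd_comm (f ≫ x) (k ≫ u)]
        exact hd.rd_triangle _ _ _
  -- Terms of a pointlike sequence are distances from images of terms of `u`. Both the density of
  -- `F` and the distances of the point obtained follow from this.
  have hnear : ∀ {Δ : E} (y : Δ ⟶ Y) (k : Δ ⟶ T.N),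
      rd e y ((k ≫ u) ≫ F) = app (y ≫ incl φ) k := by
    intro Δ y k
    refine le_antisymm ?_ (hle y _ _ fun f l => ?_)
    · have := (he y ((k ≫ u) ≫ F) k).1
      rwa [hF, hd.rd_self, zero_add] at this
    · have h1 := (he (f ≫ y) (((f ≫ k) ≫ u) ≫ F) l).2
      have h2 := (hY (f ≫ y)).le_add (𝟙 _) (f ≫ k) l
      rw [hF, hd.rd_comm] at h1
      rw [Category.id_comp] at h2
      simp only [comp_rd, comp_app, Category.assoc] at h1 h2 ⊢
      exact le_lin (add_le_add h1 h2) (by abel)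
  obtain ⟨h, ⟨hh, hFh⟩, -⟩ := hc e F (IsPseudometric.mk' hzero hcomm htri) hiso
    (holds_isDense.2 fun f y r hr => ((hY y).small (𝟙 _) r hr).mono fun g ⟨k, hk⟩ =>
      ⟨(k ≫ u) ≫ F, (mem_image _ _).2 (Cov.pure ⟨k ≫ u, by simp⟩), by
        rw [hnear]
        simpa using hk⟩)
  refine ⟨Compr.mk γ ((hφ _).2 hγ) ≫ h, fun f k => ?_⟩
  have h1 := isIsometry_iff.1 hh (f ≫ Compr.mk γ ((hφ _).2 hγ)) ((k ≫ u) ≫ F)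
  rw [hnear] at h1
  simp only [Category.assoc, Compr.mk_incl, hFh, Category.comp_id] at h1
  rw [hd.rd_comm]
  exact h1

/-- A dense isometry from a complete space to a metric space is invertible. -/
theorem isIso_of_isDense (hc : T.IsComplete d) {e : Y ⊗ Y ⟶ T.R} (he : T.IsMetric e) {f : X ⟶ Y}
    (hf : T.IsIsometry d e f) (hf' : Holds (T.isDense e (image f))) :
    ∃ g : Y ⟶ X, f ≫ g = 𝟙 X ∧ g ≫ f = 𝟙 Y := by
  obtain ⟨h, ⟨hh, hfh⟩, -⟩ := hc e f he.toIsPseudometric hf hf'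
  have key : ∀ {Γ : E} (y z : Γ ⟶ Y), y ≫ h = z ≫ h → y = z := fun y z hyz => he.eq_of_rd <| by
    have h1 := isIsometry_iff.1 hh y z
    rw [hyz, isIsometry_iff.1 hh, he.rd_self] at h1
    exact h1.symm
  exact ⟨h, hfh, key _ _ (by rw [Category.assoc, hfh, Category.comp_id, Category.id_comp])⟩

end SynthTopology

end Metric

end SynTop

end

/-! ### Extension of distance functions, and sequences in a Urysohn space with prescribed distances
-/

noncomputable section

namespace SynTop

section Extension

variable {E : Type u} [Category.{v} E] [CartesianMonoidalCategory E] [MonoidalClosed E]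
  [Limits.HasFiniteLimits E] [HasSubobjectClassifier E]

local postfix:max "⇧" => wk
local infix:45 " ≐ " => eqq
local infixr:35 " ⋏ " => and
local infixr:25 " ⇛ " => imp
local infix:20 " ⟺ " => iff
local infix:50 " ∊ " => mem
local infixr:30 " ⋎ " => or

set_option linter.unusedSectionVars false
set_option linter.unusedSimpArgs false

open NNO

namespace NNO

variable {T : NNO E} {Γ A : E}

/-- Two sequences can be interleaved. -/
theorem exists_interleave (x y : T.N ⊗ Γ ⟶ A) : ∃ p : T.N ⊗ Γ ⟶ A, ∀ {Δ : E} (f : Δ ⟶ Γ)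
    (i : Δ ⟶ T.N), lift (i + i) f ≫ p = lift i f ≫ x ∧ lift (i + i + 1) f ≫ p = lift i f ≫ y := by
  let S : E := (ihom T.N).obj A ⊗ (ihom T.N).obj A
  -- The state is a pair of streams; a step yields the second stream and the tail of the first.
  -- After `2 * i` steps the state consists of `x` and `y` from the index `i` on, and the heads of
  -- the first streams form the interleaved sequence.
  let tail : S ⟶ (ihom T.N).obj A := lam (app (snd T.N S ≫ fst _ _) (fst T.N S + 1))
  obtain ⟨r, h0, hs⟩ := exists_primrec (T := T) (A := S) (lift (lam x) (lam y))
    (fst S (T.N ⊗ Γ) ≫ lift (snd _ _) tail)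
  have key : ∀ {Δ : E} (f : Δ ⟶ Γ) (i : Δ ⟶ T.N), lift (i + i) f ≫ r =
      lift (lam (lift (snd T.N Δ ≫ i + fst T.N Δ) (snd T.N Δ ≫ f) ≫ x))
        (lam (lift (snd T.N Δ ≫ i + fst T.N Δ) (snd T.N Δ ≫ f) ≫ y)) := by
    intro Δ f i
    have := induction_eq (T := T) (Γ := Δ) (lift (fst _ _ + fst _ _) (snd _ _ ≫ f) ≫ r)
      (lift (lam (lift (snd T.N _ ≫ fst _ _ + fst T.N _) (snd T.N _ ≫ snd _ _ ≫ f) ≫ x))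
        (lam (lift (snd T.N _ ≫ fst _ _ + fst T.N _) (snd T.N _ ≫ snd _ _ ≫ f) ≫ y))) ?_ ?_ (𝟙 Δ) i
    · simpa only [comp_lift_assoc, comp_natAdd, lift_fst, lift_snd_assoc, Category.id_comp, comp_lift,
        comp_lam, whiskerLeft_fst, whiskerLeft_snd_assoc] using this
    · intro Θ g
      simp only [comp_lift_assoc, comp_natAdd, lift_fst, lift_snd_assoc, Category.id_comp, comp_lift,
        comp_lam, whiskerLeft_fst, whiskerLeft_snd_assoc, add_zero, zero_add, h0, comp_zero,
        SynthTopology.lift_fst_snd_comp]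
    · intro Θ g n hn
      simp only [comp_lift_assoc, comp_natAdd, lift_fst, lift_snd_assoc, Category.id_comp, comp_lift,
        comp_lam, whiskerLeft_fst, whiskerLeft_snd_assoc, comp_one] at hn ⊢
      rw [show n + 1 + (n + 1) = n + n + 1 + 1 by ring, hs, hs, hn]
      simp only [lift_fst_assoc, lift_snd, comp_lift, lift_snd_assoc, lift_fst, tail, comp_lam,
        comp_app, whiskerLeft_snd_assoc, comp_natAdd, whiskerLeft_fst, comp_one, app_lam]
      simp only [app_lam', comp_lift_assoc, whiskerLeft_snd_assoc, whiskerLeft_snd,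
        lift_whiskerLeft_assoc, comp_natAdd, lift_fst, lift_snd_assoc, Category.id_comp, whiskerLeft_fst]
      rw [show snd T.N Θ ≫ n + (fst T.N Θ + 1) = snd T.N Θ ≫ n + 1 + fst T.N Θ by ring]
  refine ⟨app (r ≫ fst _ _) (0 : _ ⟶ T.N), fun f i => ⟨?_, ?_⟩⟩
  · rw [comp_app, ← Category.assoc, key, lift_fst, comp_zero, app_lam']
    simp
  · rw [comp_app, ← Category.assoc, hs, key, comp_zero]
    simp [app_lam']

theorem eq_zero_of_add_eq_zero {i j : Γ ⟶ T.N} (h : i + j = 0) : i = 0 := by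
  refine (cov_of_or (eq_zero_or_pos i)).eq fun f hf => ?_
  rcases hf with hf | hf
  · exact (holds_comp_eqq _ _ _).1 hf
  · rw [comp_natLt, holds_natLt] at hf
    obtain ⟨k, hk⟩ := hf
    refine eq_of_fls (fls_of_add_one_eq_zero (m := k + f ≫ j) ?_) _ _
    have := congrArg (fun x => f ≫ x) h
    simp only [comp_natAdd, comp_zero] at this hk
    rw [← this, ← hk]
    ring

theorem le_or_eq_of_add_eq_add_one {i j n : Γ ⟶ T.N} (h : i + j = n + 1) :
    Cov fun {Δ} (f : Δ ⟶ Γ) => (∃ k, f ≫ i + k = f ≫ n) ∨ f ≫ i = f ≫ n + 1 :=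
  (cov_of_or (eq_zero_or_pos j)).mono fun f hf => by
    have := congrArg (fun x => f ≫ x) h
    simp only [comp_natAdd, comp_one] at this
    rcases hf with hf | hf
    · rw [holds_comp_eqq, comp_zero] at hf
      rw [hf, add_zero] at this
      exact Or.inr this
    · rw [comp_natLt, holds_natLt] at hf
      obtain ⟨k, hk⟩ := hf
      refine Or.inl ⟨k, add_right_cancel (b := 1) ?_⟩
      rw [← this, ← hk, comp_zero]
      ring

end NNO

namespace SynthTopology

variable {T : SynthTopology E} {Γ X : E} {d : X ⊗ X ⟶ T.R}

local infix:50 " ≪ " => Slt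

/-- The values at the points of `X` of the largest function that does not exceed `c m` at the point
`h m` and does not increase distances, where `m ≤ n`. -/
theorem exists_extension (hd : T.IsPseudometric d) (h : T.N ⊗ Γ ⟶ X) (c : T.N ⊗ Γ ⟶ T.R)
    (n : Γ ⟶ T.N)
    (h1 : ∀ {Δ : E} (f : Δ ⟶ Γ) (i i' j j' : Δ ⟶ T.N), i + i' = f ≫ n → j + j' = f ≫ n →
      lift i f ≫ c ≤ rd d (lift i f ≫ h) (lift j f ≫ h) + lift j f ≫ c)
    (h2 : ∀ {Δ : E} (f : Δ ⟶ Γ) (i i' j j' : Δ ⟶ T.N), i + i' = f ≫ n → j + j' = f ≫ n →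
      rd d (lift i f ≫ h) (lift j f ≫ h) ≤ lift i f ≫ c + lift j f ≫ c) :
    ∃ W : X ⊗ Γ ⟶ T.R, ∀ {Δ : E} (f : Δ ⟶ Γ),
      (∀ (y : Δ ⟶ X), 0 ≤ lift y f ≫ W) ∧
      (∀ (y y' : Δ ⟶ X), lift y f ≫ W ≤ rd d y y' + lift y' f ≫ W) ∧
      (∀ (y y' : Δ ⟶ X), rd d y y' ≤ lift y f ≫ W + lift y' f ≫ W) ∧
      (∀ (i i' : Δ ⟶ T.N), i + i' = f ≫ n → lift (lift i f ≫ h) f ≫ W = lift i f ≫ c) ∧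
      ∀ (y : Δ ⟶ X) (e : Δ ⟶ T.R), (∀ {Θ : E} (g : Θ ⟶ Δ) (i i' : Θ ⟶ T.N),
        i + i' = g ≫ f ≫ n → g ≫ e ≤ rd d (g ≫ y) (lift i (g ≫ f) ≫ h)) → e ≤ lift y f ≫ W := by
  -- The McShane formula: the value at `y` is the minimum over `m ≤ n` of `d(y, h m) + c m`.
  let G : T.N ⊗ (X ⊗ Γ) ⟶ T.R := rd d (snd _ _ ≫ fst _ _) (lift (fst _ _) (snd _ _ ≫ snd _ _) ≫ h) +
    lift (fst _ _) (snd _ _ ≫ snd _ _) ≫ c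
  let W : X ⊗ Γ ⟶ T.R := lift (snd X Γ ≫ n) (𝟙 _) ≫ minimum G
  have hG : ∀ {Δ : E} (f : Δ ⟶ Γ) (y : Δ ⟶ X) (i : Δ ⟶ T.N), lift i (lift y f) ≫ G =
      rd d y (lift i f ≫ h) + lift i f ≫ c := by
    intro Δ f y i
    simp [G]
  have hW : ∀ {Δ : E} (f : Δ ⟶ Γ) (y : Δ ⟶ X), lift y f ≫ W =
      lift (f ≫ n) (lift y f) ≫ minimum G := by
    intro Δ f y
    simp [W]
  have W1 : ∀ {Δ : E} (f : Δ ⟶ Γ) (y : Δ ⟶ X) (i i' : Δ ⟶ T.N), i + i' = f ≫ n →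
      lift y f ≫ W ≤ rd d y (lift i f ≫ h) + lift i f ≫ c := by
    intro Δ f y i i' hi
    rw [hW, ← hi, ← hG]
    exact minimum_le _ _ _ _
  have W2 : ∀ {Δ : E} (f : Δ ⟶ Γ) (y : Δ ⟶ X) (e : Δ ⟶ T.R), (∀ {Θ : E} (g : Θ ⟶ Δ)
      (i i' : Θ ⟶ T.N), i + i' = g ≫ f ≫ n →
        g ≫ e ≤ rd d (g ≫ y) (lift i (g ≫ f) ≫ h) + lift i (g ≫ f) ≫ c) → e ≤ lift y f ≫ W := by
    intro Δ f y e H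
    rw [hW]
    refine le_minimum fun g i i' hi => ?_
    rw [comp_lift, hG]
    exact H g i i' hi
  have hc : ∀ {Δ : E} (f : Δ ⟶ Γ) (i i' : Δ ⟶ T.N), i + i' = f ≫ n → 0 ≤ lift i f ≫ c := by
    intro Δ f i i' hi
    refine nonneg_of_add_self ?_
    have := h2 f i i' i i' hi hi
    rwa [hd.rd_self] at this
  refine ⟨W, fun f => ⟨fun y => W2 f y 0 fun g i i' hi => ?_, fun y y' => ?_, fun y y' => ?_,
    fun i i' hi => le_antisymm ?_ ?_, fun y e H => W2 f y e fun g i i' hi => ?_⟩⟩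
  · rw [comp_real_zero]
    exact add_nonneg (hd.rd_nonneg _ _) (hc _ i i' (by rw [hi, Category.assoc]))
  · have : lift y f ≫ W - rd d y y' ≤ lift y' f ≫ W := by
      refine W2 f y' _ fun g i i' hi => ?_
      have h3 := W1 (g ≫ f) (g ≫ y) i i' (by rw [hi, Category.assoc])
      have h4 := hd.rd_triangle (g ≫ y) (g ≫ y') (lift i (g ≫ f) ≫ h)
      rw [comp_rsub, comp_lift_assoc, comp_rd]
      exact le_lin (add_le_add h3 h4) (by abel)
    exact le_lin this (by abel)
  -- Both minima are estimated term by term. The path from `y` to `y'` through `h k` and `h i`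
  -- leaves `d(h k, h i) ≤ c k + c i`, which is the hypothesis `h2`.
  · have : rd d y y' - lift y f ≫ W ≤ lift y' f ≫ W := by
      refine W2 f y' _ fun g i i' hi => ?_
      have : rd d (g ≫ y) (g ≫ y') - rd d (g ≫ y') (lift i (g ≫ f) ≫ h) - lift i (g ≫ f) ≫ c ≤
          lift (g ≫ y) (g ≫ f) ≫ W := by
        refine W2 (g ≫ f) (g ≫ y) _ fun j k k' hk => ?_
        have h3 := hd.rd_triangle (j ≫ g ≫ y) (lift k (j ≫ g ≫ f) ≫ h) (j ≫ g ≫ y')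
        have h4 := hd.rd_triangle (lift k (j ≫ g ≫ f) ≫ h) (lift (j ≫ i) (j ≫ g ≫ f) ≫ h) (j ≫ g ≫ y')
        have h5 := h2 (j ≫ g ≫ f) k k' (j ≫ i) (j ≫ i') (by rw [hk]; simp)
          (by rw [← comp_natAdd, hi]; simp)
        rw [hd.rd_comm (lift (j ≫ i) (j ≫ g ≫ f) ≫ h)] at h4
        simp only [comp_rsub, comp_rd, comp_lift_assoc]
        exact le_lin (add_le_add (add_le_add h3 h4) h5) (by abel)
      rw [comp_rsub, comp_lift_assoc, comp_rd]
      exact le_lin this (by abel)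
    exact le_lin this (by abel)
  · have := W1 f (lift i f ≫ h) i i' hi
    rwa [hd.rd_self, zero_add] at this
  · refine W2 f _ _ fun g j j' hj => ?_
    have := h1 (g ≫ f) (g ≫ i) (g ≫ i') j j' (by rw [← comp_natAdd, hi]; simp) (by rw [hj]; simp)
    simpa using this
  -- Omitting the nonnegative summand `c i` compares the extension with the plain distances from the
  -- given points. This estimate later makes the sequence located.
  · exact (H g i i' hi).trans (le_add_of_nonneg_right (hc _ i i' (by rw [hi, Category.assoc])))

theorem le_zeroCut_cut (r : Γ ⟶ T.R) : T.le (T.zeroCut Γ) (T.cut r) = neg (rlt r 0) := by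
  rw [← cut_zero]
  rfl

theorem le_cut_add (a b : Γ ⟶ T.R) (x y : Γ ⟶ X) :
    T.le (T.cut a) (T.add (T.dist d x y) (T.cut b)) = neg (rlt (rd d x y + b) a) := by
  rw [dist, ← cut_add]
  rfl

theorem le_dist_add (a b : Γ ⟶ T.R) (x y : Γ ⟶ X) :
    T.le (T.dist d x y) (T.add (T.cut a) (T.cut b)) = neg (rlt (a + b) (rd d x y)) := by
  rw [← cut_add]
  rfl

/-- The sequence of the points `p k` and the numbers `w k`, for `k < l`. -/
theorem exists_perm (d : X ⊗ X ⟶ T.R) (p : T.N ⊗ Γ ⟶ X) (w : T.N ⊗ Γ ⟶ T.R) (l : Γ ⟶ T.N)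
    (h0 : ∀ {Δ : E} (f : Δ ⟶ Γ) (i : Δ ⟶ T.N), 0 ≤ lift i f ≫ w)
    (h1 : ∀ {Δ : E} (f : Δ ⟶ Γ) (i j : Δ ⟶ T.N),
      lift i f ≫ w ≤ rd d (lift i f ≫ p) (lift j f ≫ p) + lift j f ≫ w)
    (h2 : ∀ {Δ : E} (f : Δ ⟶ Γ) (i j : Δ ⟶ T.N),
      rd d (lift i f ≫ p) (lift j f ≫ p) ≤ lift i f ≫ w + lift j f ≫ w) :
    ∃ P : Γ ⟶ T.Perm d, ∀ {Δ : E} (f : Δ ⟶ Γ) (i i' : Δ ⟶ T.N), i + i' + 1 = f ≫ l →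
      Holds (lift i (lift (lift i f ≫ p) (lift i f ≫ w)) ∊
        (f ≫ P) ≫ incl (T.isPermissible d (𝟙 _))) := by
  let A : T.N ⊗ Γ ⟶ X ⊗ T.R := lift p w
  let G : Γ ⟶ Pow (T.N ⊗ (X ⊗ T.R)) := sep _ fun x =>
    T.natLt (x ≫ fst _ _) l⇧ ⋏ (x ≫ snd _ _ ≐ lift (x ≫ fst _ _) (snd _ _) ≫ A)
  have hG : ∀ {Δ : E} (f : Δ ⟶ Γ) (x : Δ ⟶ T.N ⊗ (X ⊗ T.R)), Holds (x ∊ f ≫ G) ↔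
      Holds (T.natLt (x ≫ fst _ _) (f ≫ l)) ∧ x ≫ snd _ _ = lift (x ≫ fst _ _) f ≫ A := by
    intro Δ f x
    rw [mem_comp_sep]
    simp
  have hfin : Holds (G ≫ T.isFinSeq (𝟙 _)) := by
    refine holds_comp_ex_intro l (holds_comp_all.2 fun f k => ?_)
    rw [comp_and, holds_and]
    constructor
    · rw [comp_imp]
      refine holds_imp.2 fun g hg => ?_
      simp only [comp_natLt, lift_fst, lift_snd_assoc] at hg
      rw [← Category.assoc]
      refine holds_comp_ex_intro (lift (g ≫ k) (g ≫ f) ≫ A) (holds_comp_all.2 fun i b => ?_)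
      rw [comp_iff, holds_iff]
      refine om_ext fun j => ?_
      simp only [comp_mem, comp_eqq, comp_lift, lift_snd_assoc, lift_fst, Category.assoc,
        Category.comp_id, comp_lift_assoc, lift_snd, holds_eqq]
      rw [show j ≫ i ≫ g ≫ f ≫ G = (j ≫ i ≫ g ≫ f) ≫ G by simp only [Category.assoc], hG]
      simp only [lift_fst, lift_snd, Category.assoc]
      refine ⟨fun h => h.2, fun h => ⟨?_, h⟩⟩
      simpa only [comp_natLt, Category.assoc, lift_fst, comp_lift_assoc] using (hg.comp i).comp j
    · refine holds_comp_all.2 fun g a => ?_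
      rw [comp_imp]
      refine holds_imp.2 fun i hi => ?_
      simp only [comp_mem, comp_lift, lift_snd_assoc, lift_fst, Category.assoc, comp_natLt,
        Category.comp_id, comp_lift_assoc, lift_snd] at hi ⊢
      rw [show i ≫ g ≫ f ≫ G = (i ≫ g ≫ f) ≫ G by simp only [Category.assoc], hG] at hi
      simpa using hi.1
  have hperm : Holds (G ≫ T.isPermissible d (𝟙 _)) := by
    simp only [isPermissible, le_zeroCut_cut, le_cut_add, le_dist_add]
    rw [comp_and, holds_and]
    refine ⟨hfin, holds_comp_all.2 fun f x => holds_comp_all.2 fun g y => ?_⟩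
    rw [comp_imp]
    refine holds_imp.2 fun i hi => ?_
    simp only [comp_and, comp_mem, comp_neg, comp_rlt, comp_radd, comp_rd, comp_real_zero, comp_lift,
      lift_snd_assoc, lift_fst, lift_fst_assoc, Category.assoc, Category.comp_id, comp_lift_assoc,
      lift_snd, holds_and] at hi ⊢
    rw [show i ≫ g ≫ f ≫ G = (i ≫ g ≫ f) ≫ G by simp only [Category.assoc], hG, hG] at hi
    obtain ⟨⟨-, hx⟩, -, hy⟩ := hi
    have hx1 : i ≫ g ≫ x ≫ snd _ _ ≫ fst _ _ = lift (i ≫ g ≫ x ≫ fst _ _) (i ≫ g ≫ f) ≫ p := by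
      simpa [A] using congrArg (fun z => z ≫ fst X T.R) hx
    have hx2 : i ≫ g ≫ x ≫ snd _ _ ≫ snd _ _ = lift (i ≫ g ≫ x ≫ fst _ _) (i ≫ g ≫ f) ≫ w := by
      simpa [A] using congrArg (fun z => z ≫ snd X T.R) hx
    have hy1 : i ≫ y ≫ snd _ _ ≫ fst _ _ = lift (i ≫ y ≫ fst _ _) (i ≫ g ≫ f) ≫ p := by
      simpa [A] using congrArg (fun z => z ≫ fst X T.R) hy
    have hy2 : i ≫ y ≫ snd _ _ ≫ snd _ _ = lift (i ≫ y ≫ fst _ _) (i ≫ g ≫ f) ≫ w := by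
      simpa [A] using congrArg (fun z => z ≫ snd X T.R) hy
    rw [hx1, hx2, hy1, hy2]
    exact ⟨h0 _ _, h1 _ _ _, h2 _ _ _⟩
  refine ⟨Compr.mk G hperm, fun f i i' hi => ?_⟩
  rw [Category.assoc, Compr.mk_incl, hG]
  refine ⟨?_, ?_⟩
  · rw [lift_fst, holds_natLt]
    exact ⟨i', hi⟩
  · simp [A, comp_lift]

/-- A point of a Urysohn space at prescribed distances from finitely many points, which is at the
greatest possible distance from the first points of the dense sequence. -/
theorem exists_next (U : T.UrysohnSpace) (h : T.N ⊗ Γ ⟶ U.carrier) (c : T.N ⊗ Γ ⟶ T.R) (n : Γ ⟶ T.N)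
    (h1 : ∀ {Δ : E} (f : Δ ⟶ Γ) (i i' j j' : Δ ⟶ T.N), i + i' = f ≫ n → j + j' = f ≫ n →
      lift i f ≫ c ≤ rd U.d (lift i f ≫ h) (lift j f ≫ h) + lift j f ≫ c)
    (h2 : ∀ {Δ : E} (f : Δ ⟶ Γ) (i i' j j' : Δ ⟶ T.N), i + i' = f ≫ n → j + j' = f ≫ n →
      rd U.d (lift i f ≫ h) (lift j f ≫ h) ≤ lift i f ≫ c + lift j f ≫ c) :
    ∃ z : Γ ⟶ U.carrier, ∀ {Δ : E} (f : Δ ⟶ Γ),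
      (∀ (i i' : Δ ⟶ T.N), i + i' = f ≫ n → rd U.d (f ≫ z) (lift i f ≫ h) = lift i f ≫ c) ∧
      ∀ (k k' : Δ ⟶ T.N) (e : Δ ⟶ T.R), k + k' = f ≫ n → (∀ {Θ : E} (g : Θ ⟶ Δ) (i i' : Θ ⟶ T.N),
        i + i' = g ≫ f ≫ n → g ≫ e ≤ rd U.d ((g ≫ k) ≫ U.u) (lift i (g ≫ f) ≫ h)) →
          e ≤ rd U.d (f ≫ z) (k ≫ U.u) := by
  obtain ⟨W, hW⟩ := exists_extension U.isMetric.toIsPseudometric h c n h1 h2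
  -- The first `2 * n + 2` terms of the interleaved sequence are `h 0, …, h n` and `u 0, …, u n`.
  -- The values of `W` may be prescribed at all of them, since `W` satisfies the required
  -- inequalities on the whole space.
  obtain ⟨p, hp⟩ := exists_interleave h (fst T.N Γ ≫ U.u)
  have hw : ∀ {Δ : E} (f : Δ ⟶ Γ) (i : Δ ⟶ T.N), lift i f ≫ lift p (snd _ _) ≫ W =
      lift (lift i f ≫ p) f ≫ W := by
    intro Δ f i
    rw [comp_lift_assoc, lift_snd]
  obtain ⟨P, hP⟩ := exists_perm U.d p (lift p (snd _ _) ≫ W) (n + n + 1 + 1)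
    (fun f i => by rw [hw]; exact (hW f).1 _)
    (fun f i j => by rw [hw, hw]; exact (hW f).2.1 _ _)
    (fun f i j => by rw [hw, hw]; exact (hW f).2.2.1 _ _)
  refine ⟨P ≫ U.ext, fun {Δ} f => ⟨fun i i' hi => ?_, fun k k' e hk H => ?_⟩⟩
  · have h3 := U.dist_ext _ _ _ _ (hP f (i + i) (i' + i' + 1) (by
      simp only [comp_natAdd, comp_one, ← hi]
      ring))
    rw [hw, (hp f i).1, (hW f).2.2.2.1 i i' hi] at h3
    rw [← Category.assoc]
    exact h3
  · have h3 := U.dist_ext _ _ _ _ (hP f (k + k + 1) (k' + k') (by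
      simp only [comp_natAdd, comp_one, ← hk]
      ring))
    rw [hw, (hp f k).2, lift_fst_assoc] at h3
    rw [← Category.assoc, show rd U.d ((f ≫ P) ≫ U.ext) (k ≫ U.u) = _ from h3]
    refine (hW f).2.2.2.2 _ _ fun g i i' hi => ?_
    rw [← Category.assoc]
    exact H g i i' hi

/-! ### The recursion -/

/-- The first `n + 1` members of a sequence of points have prescribed distances. -/
theorem exists_isometric_upTo (d : X ⊗ X ⟶ T.R) (D : T.N ⊗ T.N ⟶ T.R) :
    ∃ ψ : T.N ⊗ (ihom T.N).obj X ⟶ Om E, ∀ {Γ : E} (s : Γ ⟶ T.N ⊗ (ihom T.N).obj X),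
      Holds (s ≫ ψ) ↔ ∀ {Δ : E} (f : Δ ⟶ Γ) (i i' j j' : Δ ⟶ T.N),
        i + i' = f ≫ s ≫ fst _ _ → j + j' = f ≫ s ≫ fst _ _ →
          rd d (app (f ≫ s ≫ snd _ _) i) (app (f ≫ s ≫ snd _ _) j) = rd D i j := by
  refine ⟨all ((T.N ⊗ T.N) ⊗ (T.N ⊗ T.N)) fun w =>
    ((w ≫ fst _ _ ≫ fst _ _ + w ≫ fst _ _ ≫ snd _ _ ≐ snd _ _ ≫ fst _ _) ⋏
      (w ≫ snd _ _ ≫ fst _ _ + w ≫ snd _ _ ≫ snd _ _ ≐ snd _ _ ≫ fst _ _)) ⇛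
      (rd d (app (snd _ _ ≫ snd _ _) (w ≫ fst _ _ ≫ fst _ _))
        (app (snd _ _ ≫ snd _ _) (w ≫ snd _ _ ≫ fst _ _)) ≐
        rd D (w ≫ fst _ _ ≫ fst _ _) (w ≫ snd _ _ ≫ fst _ _)), fun s => ?_⟩
  rw [holds_comp_all]
  constructor
  · intro H Δ f i i' j j' hi hj
    have := H f (lift (lift i i') (lift j j'))
    simp only [comp_imp, comp_and, comp_eqq, comp_natAdd, comp_rd, comp_app, lift_fst, lift_snd,
      lift_fst_assoc, lift_snd_assoc, Category.assoc] at this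
    exact (holds_eqq _ _).1 (this.mp (by simpa using And.intro hi hj))
  · intro H Δ f w
    rw [comp_imp]
    refine holds_imp.2 fun g hg => ?_
    simp only [comp_and, comp_eqq, comp_natAdd, comp_rd, comp_app, lift_fst, lift_snd,
      lift_fst_assoc, lift_snd_assoc, Category.assoc, holds_and, holds_eqq] at hg ⊢
    have := H (g ≫ f) _ _ _ _ (by simpa using hg.1) (by simpa using hg.2)
    simpa using this

/-- Every pseudometric on the natural numbers is induced by a sequence of points of a Urysohn space.
The distances of a point of the dense sequence from the points of this sequence have a minimum. -/
theorem exists_embedding (U : T.UrysohnSpace) {D : T.N ⊗ T.N ⟶ T.R} (hD : T.IsPseudometric D) :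
    ∃ a : T.N ⟶ U.carrier,
      (∀ {Γ : E} (i j : Γ ⟶ T.N), rd U.d (i ≫ a) (j ≫ a) = rd D i j) ∧
      ∀ {Γ : E} (n k k' : Γ ⟶ T.N) (e : Γ ⟶ T.R), k + k' = n →
        (∀ {Δ : E} (g : Δ ⟶ Γ) (i i' : Δ ⟶ T.N), i + i' = g ≫ n →
          g ≫ e ≤ rd U.d ((g ≫ k) ≫ U.u) (i ≫ a)) → e ≤ rd U.d (k ≫ U.u) ((n + 1) ≫ a) := by
  have hd := U.isMetric.toIsPseudometric
  obtain ⟨ψ, hψ⟩ := exists_isometric_upTo U.d D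
  -- A state of the recursion is a number and a sequence whose terms up to that number have the
  -- right distances. The invariant is part of the state, because the next point can be constructed
  -- only from it.
  let n : Compr ψ ⟶ T.N := incl ψ ≫ fst _ _
  let h : T.N ⊗ Compr ψ ⟶ U.carrier := app (snd T.N (Compr ψ) ≫ incl ψ ≫ snd _ _) (fst T.N (Compr ψ))
  have hS : ∀ {Δ : E} (f : Δ ⟶ Compr ψ) (i i' j j' : Δ ⟶ T.N), i + i' = f ≫ n → j + j' = f ≫ n →
      rd U.d (lift i f ≫ h) (lift j f ≫ h) = rd D i j := by
    intro Δ f i i' j j' hi hj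
    have := (hψ _).1 (Compr.prop f) (𝟙 Δ) i i' j j' (by simpa using hi) (by simpa using hj)
    simpa [h, comp_app] using this
  -- Applied to the generic state, this makes the next point a function of the state, so no
  -- dependent choice is needed. The prescribed distances are those of the index `n + 1`.
  obtain ⟨z, hz⟩ := exists_next U h (rd D (fst T.N (Compr ψ)) (snd T.N (Compr ψ) ≫ n + 1)) n
    (fun f i i' j j' hi hj => by
      rw [hS f i i' j j' hi hj]
      simpa using hD.rd_triangle _ _ _)
    (fun f i i' j j' hi hj => by
      rw [hS f i i' j j' hi hj]
      simp only [comp_rd, lift_fst, lift_snd_assoc, comp_natAdd, comp_one]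
      rw [hD.rd_comm j]
      exact hD.rd_triangle _ _ _)
  -- The old terms are kept up to `n`, and all later terms are set to the new point; of the latter
  -- only the one at `n + 1` matters.
  obtain ⟨h', hh'⟩ := exists_ite (p := T.natLt (fst T.N (Compr ψ)) (snd T.N (Compr ψ) ≫ n + 1))
    (q := T.natLt (snd T.N (Compr ψ) ≫ n) (fst T.N (Compr ψ))) h (snd T.N (Compr ψ) ≫ z) (holds_lt_succ_or_lt _ _) (by
      intro Δ f h1 h2
      rw [comp_natLt, holds_natLt] at h1 h2
      obtain ⟨k, hk⟩ := h1
      obtain ⟨l, hl⟩ := h2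
      rw [← hl, comp_natAdd, comp_one] at hk
      exact fls_of_add_add_one_eq (m := f ≫ snd T.N (Compr ψ) ≫ n) (k := l + k)
        (add_right_cancel (b := 1) (by rw [← hk]; ring)))
  have h'le : ∀ {Δ : E} (f : Δ ⟶ Compr ψ) (i i' : Δ ⟶ T.N), i + i' = f ≫ n →
      lift i f ≫ h' = lift i f ≫ h := by
    intro Δ f i i' hi
    refine (hh' _).1 ?_
    rw [comp_natLt, holds_natLt]
    exact ⟨i', by simp [← hi]⟩
  have h'eq : ∀ {Δ : E} (f : Δ ⟶ Compr ψ), lift (f ≫ n + 1) f ≫ h' = f ≫ z := by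
    intro Δ f
    refine ((hh' _).2 ?_).trans (by rw [lift_snd_assoc])
    rw [comp_natLt, holds_natLt]
    exact ⟨0, by simp⟩
  have hnext : Holds (lift (n + 1) (lam h') ≫ ψ) := by
    refine (hψ _).2 fun f i i' j j' hi hj => ?_
    simp only [lift_fst, lift_snd, comp_natAdd, comp_one, app_lam] at hi hj ⊢
    refine (le_or_eq_of_add_eq_add_one hi).eq fun g hg => (le_or_eq_of_add_eq_add_one
      (show g ≫ j + g ≫ j' = g ≫ f ≫ n + 1 by
        rw [← comp_natAdd, hj, comp_natAdd, comp_one])).eq fun g' hg' => ?_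
    simp only [comp_rd, comp_lift_assoc]
    have hgi : (∃ k, g' ≫ g ≫ i + k = (g' ≫ g ≫ f) ≫ n) ∨ g' ≫ g ≫ i = (g' ≫ g ≫ f) ≫ n + 1 := by
      rcases hg with ⟨k, hk⟩ | hk
      · exact Or.inl ⟨g' ≫ k, by rw [← comp_natAdd, hk]; simp⟩
      · exact Or.inr (by rw [hk]; simp)
    have hgj : (∃ k, g' ≫ g ≫ j + k = (g' ≫ g ≫ f) ≫ n) ∨ g' ≫ g ≫ j = (g' ≫ g ≫ f) ≫ n + 1 := by
      simpa using hg'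
    clear hg hg'
    generalize g' ≫ g ≫ f = s at hgi hgj ⊢
    generalize g' ≫ g ≫ i = i at hgi ⊢
    generalize g' ≫ g ≫ j = j at hgj ⊢
    rcases hgi with ⟨k, hk⟩ | rfl <;> rcases hgj with ⟨l, hl⟩ | rfl
    · rw [h'le s i k hk, h'le s j l hl]
      exact hS s i k j l hk hl
    · rw [h'le s i k hk, h'eq, hd.rd_comm, (hz s).1 i k hk]
      simp
    · rw [h'le s j l hl, h'eq, (hz s).1 j l hl, hD.rd_comm]
      simp
    · rw [hd.rd_self, hD.rd_self]
  -- Only the term of index zero is constrained, so the constant sequence `u 0` can serve as the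
  -- start.
  have hstart : Holds (lift T.zero (lam (snd T.N (𝟙_ E) ≫ T.zero ≫ U.u)) ≫ ψ) := by
    refine (hψ _).2 fun f i i' j j' hi hj => ?_
    simp only [lift_fst, lift_snd, app_lam, lift_snd_assoc] at hi hj ⊢
    rw [toUnit_unique f (toUnit _)] at hi hj
    rw [eq_zero_of_add_eq_zero hi, eq_zero_of_add_eq_zero hj, hd.rd_self, hD.rd_self]
  let st : T.N ⟶ Compr ψ := T.recur (Compr.mk _ hstart) (Compr.mk _ hnext)
  have st_succ : ∀ {Γ : E} (m : Γ ⟶ T.N), (m + 1) ≫ st = (m ≫ st) ≫ Compr.mk _ hnext := by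
    intro Γ m
    rw [← comp_succ, Category.assoc, succ_recur, Category.assoc]
  have st_n : ∀ {Γ : E} (m : Γ ⟶ T.N), (m ≫ st) ≫ n = m := by
    intro Γ m
    have := induction_eq (T := T.toNNO) (Γ := Γ) ((fst _ _ ≫ st) ≫ n) (fst _ _) (fun f => ?_)
      (fun f m hm => ?_) (𝟙 Γ) m
    · simpa using this
    · simp only [Category.assoc, lift_fst_assoc, lift_fst]
      rw [← zero_def, Category.assoc]
      simp only [st, zero_recur_assoc, n, Compr.mk_incl_assoc, lift_fst]
    · simp only [Category.assoc, lift_fst_assoc, lift_fst] at hm ⊢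
      rw [← Category.assoc, st_succ]
      simp only [n, Category.assoc, Compr.mk_incl_assoc, lift_fst] at hm ⊢
      simp only [comp_natAdd, comp_one]
      rw [hm]
  have h_next : ∀ {Γ : E} (i : Γ ⟶ T.N) (s : Γ ⟶ Compr ψ),
      lift i (s ≫ Compr.mk _ hnext) ≫ h = lift i s ≫ h' := by
    intro Γ i s
    simp only [h, comp_app, lift_snd_assoc, lift_fst, Category.assoc, Compr.mk_incl_assoc, lift_snd]
    rw [app_lam]
  have st_h : ∀ {Γ : E} (i m : Γ ⟶ T.N) (k : Γ ⟶ T.N), i + k = m →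
      lift i ((m + 1) ≫ st) ≫ h = lift i (m ≫ st) ≫ h := by
    intro Γ i m k hi
    rw [st_succ, ← h'le (m ≫ st) i k (by rw [hi, st_n]), h_next]
  have st_eq : ∀ {Γ : E} (i k : Γ ⟶ T.N), lift i ((i + k) ≫ st) ≫ h = lift i (i ≫ st) ≫ h := by
    intro Γ i k
    have := induction_eq (T := T.toNNO) (Γ := Γ) (lift (snd _ _ ≫ i) ((snd _ _ ≫ i + fst _ _) ≫ st) ≫ h)
      (lift (snd _ _ ≫ i) (snd _ _ ≫ i ≫ st) ≫ h) (fun f => ?_) (fun f m hm => ?_) (𝟙 Γ) k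
    · simp only [comp_lift_assoc] at this
      rw [← Category.assoc (lift k (𝟙 Γ)) (snd T.N Γ ≫ i + fst T.N Γ)] at this
      simpa only [comp_natAdd, lift_fst, lift_snd_assoc, Category.id_comp] using this
    · simp only [comp_lift_assoc, lift_snd_assoc]
      rw [← Category.assoc]
      simp
    · simp only [comp_lift_assoc, lift_snd_assoc] at hm ⊢
      rw [← Category.assoc] at hm ⊢
      simp only [comp_natAdd, lift_fst, lift_snd_assoc] at hm ⊢
      rw [← hm, ← add_assoc]
      exact st_h _ _ m rfl
  -- Terms within the bound of a state never change afterwards, so the diagonal collects all of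
  -- them.
  let a : T.N ⟶ U.carrier := lift (𝟙 _) st ≫ h
  have ha : ∀ {Γ : E} (i k : Γ ⟶ T.N), lift i ((i + k) ≫ st) ≫ h = i ≫ a := by
    intro Γ i k
    rw [st_eq]
    simp [a]
  refine ⟨a, fun i j => ?_, fun n k k' e hk H => ?_⟩
  · rw [← ha i j, ← ha j i, add_comm j i]
    exact hS _ i j j i (by rw [st_n]) (by rw [st_n, add_comm])
  · have h1 := ha (n + 1) 0
    rw [add_zero, st_succ] at h1
    have h2 : lift (n + 1) ((n ≫ st) ≫ Compr.mk _ hnext) ≫ h = (n ≫ st) ≫ z := by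
      rw [← h'eq, st_n, h_next]
    rw [← h1, h2, hd.rd_comm]
    refine (hz _).2 k k' e (by rw [st_n, hk]) fun g i i' hi => ?_
    rw [Category.assoc, ← Category.assoc n, st_n] at hi
    have := H g i i' hi
    rwa [← ha i i', hi, Category.assoc g n st] at this

end SynthTopology

end Extension

end SynTop

end

/-! ### Distance from a sequence, and strongly located sets -/

noncomputable section

namespace SynTop

section Located

variable {E : Type u} [Category.{v} E] [CartesianMonoidalCategory E] [MonoidalClosed E]
  [Limits.HasFiniteLimits E] [HasSubobjectClassifier E]

local postfix:max "⇧" => wk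
local infix:45 " ≐ " => eqq
local infixr:35 " ⋏ " => and
local infixr:25 " ⇛ " => imp
local infix:20 " ⟺ " => iff
local infix:50 " ∊ " => mem
local infixr:30 " ⋎ " => or

set_option linter.unusedSectionVars false
set_option linter.unusedSimpArgs false

open NNO

namespace SynthTopology

variable {T : SynthTopology E} {Γ X : E} {d : X ⊗ X ⟶ T.R}

local infix:50 " ≪ " => Slt

theorem vanishing_rd {u : T.N ⟶ X} (hu : Holds (T.isDense d (image u)))
    (x : Γ ⟶ X) : Vanishing (rd d (snd T.N Γ ≫ x) (fst T.N Γ ≫ u)) := fun f e he =>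
  (exists_near hu (f ≫ x) he).mono fun g ⟨k, hk⟩ => ⟨k, by simpa using hk⟩

theorem eq_of_slt_iff {a b : Γ ⟶ T.R}
    (h : ∀ {Δ : E} (f : Δ ⟶ Γ) (t : Δ ⟶ T.R), f ≫ a ≪ t ↔ f ≫ b ≪ t) : a = b :=
  le_antisymm
    (le_iff_above.2 fun f q hq => slt_rat_iff.1 ((h f (rat q)).2 (slt_rat_iff.2 hq)))
    (le_iff_above.2 fun f q hq => slt_rat_iff.1 ((h f (rat q)).1 (slt_rat_iff.2 hq)))

/-- The distance from a sequence of points, provided that the distances of each point of a dense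
sequence from the points of the sequence have a minimum. -/
theorem exists_dist (hd : T.IsPseudometric d) {u : T.N ⟶ X} (hu : Holds (T.isDense d (image u)))
    (a : T.N ⟶ X)
    (h : ∀ {Γ : E} (n k k' : Γ ⟶ T.N) (e : Γ ⟶ T.R), k + k' = n →
      (∀ {Δ : E} (g : Δ ⟶ Γ) (i i' : Δ ⟶ T.N), i + i' = g ≫ n →
        g ≫ e ≤ rd d ((g ≫ k) ≫ u) (i ≫ a)) → e ≤ rd d (k ≫ u) ((n + 1) ≫ a)) :
    ∃ ρ : X ⟶ T.R, ∀ {Γ : E} (x : Γ ⟶ X),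
      (∀ m : Γ ⟶ T.N, x ≫ ρ ≤ rd d x (m ≫ a)) ∧
      ∀ t : Γ ⟶ T.R, x ≫ ρ ≪ t →
        Cov fun {Δ} (f : Δ ⟶ Γ) => ∃ m : Δ ⟶ T.N, rd d (f ≫ x) (m ≫ a) ≪ f ≫ t := by
  let G : T.N ⊗ T.N ⟶ T.R := rd d (snd _ _ ≫ u) (fst _ _ ≫ a)
  have hG : ∀ {Γ : E} (m k : Γ ⟶ T.N), lift m k ≫ G = rd d (k ≫ u) (m ≫ a) := by
    intro Γ m k
    simp [G]
  let μ : T.N ⟶ T.R := lift (𝟙 _) (𝟙 _) ≫ minimum G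
  have hμ : ∀ {Γ : E} (k : Γ ⟶ T.N), k ≫ μ = lift k k ≫ minimum G := by
    intro Γ k
    simp [μ]
  -- By hypothesis a term beyond the index `k` is at least as far from `u k` as the nearest
  -- preceding term, so the minimum up to `k` is final.
  have hstable : ∀ {Γ : E} (k j : Γ ⟶ T.N), k ≫ μ ≤ lift (k + j) k ≫ minimum G := by
    intro Γ k j
    have key := induction (T := T.toNNO) (Γ := Γ)
      (neg (rlt (lift (snd _ _ ≫ k + fst _ _) (snd _ _ ≫ k) ≫ minimum G) (snd _ _ ≫ k ≫ μ)))
      (fun f => ?_) (fun f j hj => ?_) (𝟙 Γ) j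
    · rw [holds_comp_neg_rlt] at key
      simpa using key
    · rw [holds_comp_neg_rlt]
      simp [hμ]
    · rw [holds_comp_neg_rlt] at hj ⊢
      simp only [lift_snd_assoc, comp_lift_assoc, comp_natAdd, lift_fst] at hj ⊢
      rw [← add_assoc, minimum_succ]
      refine le_rmin hj ?_
      rw [hG]
      refine h _ _ j _ rfl fun g i i' hi => ?_
      refine (comp_le hj g).trans ?_
      rw [comp_lift_assoc, ← hi, ← hG]
      exact minimum_le _ _ _ _
  have hμle : ∀ {Γ : E} (k m : Γ ⟶ T.N), k ≫ μ ≤ rd d (k ≫ u) (m ≫ a) := by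
    intro Γ k m
    refine le_of_cov (le_or_lt m k) fun f hf => ?_
    rw [comp_rd, ← Category.assoc, ← Category.assoc f k u, ← Category.assoc f m a, ← hG]
    rcases hf with ⟨i, hi⟩ | ⟨i, hi⟩
    · rw [hμ]
      nth_rw 1 [← hi]
      exact minimum_le _ _ _ _
    · refine (hstable _ (i + 1)).trans ?_
      rw [← add_assoc, hi]
      exact minimum_le_self _ _ _
  have hμlt : ∀ {Γ : E} (k : Γ ⟶ T.N) (t : Γ ⟶ T.R), k ≫ μ ≪ t → Cov fun {Δ} (f : Δ ⟶ Γ) =>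
      ∃ m : Δ ⟶ T.N, rd d (f ≫ k ≫ u) (m ≫ a) ≪ f ≫ t := by
    intro Γ k t ht
    rw [hμ] at ht
    refine (exists_of_minimum_slt ht).mono fun f ⟨m, _, _, hm⟩ => ⟨m, ?_⟩
    rw [hG] at hm
    simpa using hm
  have hlip : ∀ {Γ : E} (k l : Γ ⟶ T.N), k ≫ μ ≤ rd d (k ≫ u) (l ≫ u) + l ≫ μ := by
    intro Γ k l
    have : k ≫ μ - rd d (k ≫ u) (l ≫ u) ≤ l ≫ μ := by
      rw [hμ l]
      refine le_minimum fun g i i' hi => ?_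
      rw [hG, comp_rsub, comp_rd, ← Category.assoc g k μ]
      refine le_lin ((hμle (g ≫ k) i).trans (hd.rd_triangle _ ((g ≫ l) ≫ u) _)) ?_
      simp only [Category.assoc]
      abel
    exact le_lin this (by abel)
  have hvan : Vanishing (rd d (snd T.N X ≫ 𝟙 X) (fst T.N X ≫ u)) := vanishing_rd hu (𝟙 X)
  -- Along the dense sequence `μ` does not increase distances. It extends to a point `x` as a limit
  -- with error `d(x, u k)`.
  obtain ⟨ρ, hρ⟩ := exists_limit (fst T.N X ≫ μ) _ (fun f k l => by
    simp only [lift_fst_assoc, comp_rd, lift_snd_assoc, Category.comp_id, lift_snd]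
    have h1 := hd.rd_triangle (k ≫ u) f (l ≫ u)
    rw [hd.rd_comm (k ≫ u) f] at h1
    exact le_lin (add_le_add (hlip k l) h1) (by abel)) hvan
  simp only [lift_fst_assoc, comp_rd, lift_snd_assoc, Category.comp_id, lift_snd] at hρ
  refine ⟨ρ, fun x => ⟨fun m => ?_, fun t ht => ?_⟩⟩
  · refine le_of_vanishing (vanishing_rd hu x) fun f k => ?_
    simp only [comp_rd, lift_snd_assoc, lift_fst_assoc]
    rw [← Category.assoc f, ← Category.assoc f m]
    have h1 := hd.rd_triangle (k ≫ u) (f ≫ x) ((f ≫ m) ≫ a)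
    rw [hd.rd_comm (k ≫ u) (f ≫ x)] at h1
    exact le_lin (add_le_add (add_le_add (hρ (f ≫ x) k).1 (hμle k (f ≫ m))) h1) (by abel)
  · refine ht.exists_gap.bind fun f ⟨q, hq, hq'⟩ =>
      (exists_near hu (f ≫ x) hq).bind fun g ⟨k, hk⟩ => ?_
    have h1 : k ≫ μ ≪ g ≫ f ≫ t - rd d (g ≫ f ≫ x) (k ≫ u) := by
      refine (hq'.comp g).lin ?_
      have h2 := (hρ (g ≫ f ≫ x) k).2
      simp only [comp_radd, Category.assoc] at h2 ⊢
      exact le_lin (add_le_add (add_le_add h2 hk.le) hk.le) (by abel)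
    refine (hμlt k _ h1).mono fun j ⟨m, hm⟩ => ⟨m, hm.lin ?_⟩
    simp only [comp_rsub, comp_rd, Category.assoc]
    exact le_lin (hd.rd_triangle (j ≫ g ≫ f ≫ x) (j ≫ k ≫ u) (m ≫ a)) (by abel)

theorem holds_isDistTo {A : Γ ⟶ Pow X} {x : Γ ⟶ X} {r : Γ ⟶ T.R} : Holds (T.isDistTo d A x r) ↔
    ∀ {Δ : E} (f : Δ ⟶ Γ) (t : Δ ⟶ T.R), f ≫ r ≪ t ↔
      Cov fun {Θ} (g : Θ ⟶ Δ) => ∃ a : Θ ⟶ X, Holds (a ∊ (g ≫ f) ≫ A) ∧ rd d a (g ≫ f ≫ x) ≪ g ≫ t := by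
  have key : ∀ {Δ : E} (f : Δ ⟶ Γ) (t : Δ ⟶ T.R), Holds (lift t f ≫ ex X fun a =>
      a ∊ A⇧⇧ ⋏ rlt (rd d a x⇧⇧) (fst T.R Γ)⇧) ↔ Cov fun {Θ} (g : Θ ⟶ Δ) => ∃ a : Θ ⟶ X,
        Holds (a ∊ (g ≫ f) ≫ A) ∧ rd d a (g ≫ f ≫ x) ≪ g ≫ t := by
    intro Δ f t
    constructor
    · exact fun h => (cov_of_comp_ex h).mono fun g ⟨a, ha⟩ => ⟨a, by simpa [comp_lift] using ha⟩
    · refine fun h => h.holds fun g ⟨a, ha⟩ => ?_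
      rw [← Category.assoc]
      exact holds_comp_ex_intro a (by simpa [comp_lift] using ha)
  have hlt : ∀ {Δ : E} (a b : Δ ⟶ T.R), T.lt (T.cut a) (T.cut b) = rlt a b := fun _ _ => rfl
  have hrd : ∀ {Δ : E} (a b : Δ ⟶ X) (t : Δ ⟶ T.R), T.lt (T.dist d a b) (T.cut t) =
    rlt (rd d a b) t := fun _ _ _ => rfl
  simp only [isDistTo, hrd, hlt]
  rw [holds_all]
  constructor
  · intro h Δ f t
    have := h f t
    rw [comp_iff, holds_iff, comp_rlt, lift_fst, lift_snd_assoc] at this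
    rw [← key, ← this]
    rfl
  · intro h Δ f t
    rw [comp_iff, holds_iff]
    refine om_ext fun g => ?_
    rw [← Category.assoc, ← Category.assoc, comp_lift, comp_rlt, lift_fst, lift_snd_assoc, key]
    exact h (g ≫ f) (g ≫ t)

theorem isDistTo_unique {A : Γ ⟶ Pow X} {x : Γ ⟶ X} {r r' : Γ ⟶ T.R}
    (h : Holds (T.isDistTo d A x r)) (h' : Holds (T.isDistTo d A x r')) : r = r' :=
  eq_of_slt_iff fun f t => (holds_isDistTo.1 h f t).trans (holds_isDistTo.1 h' f t).symm

theorem comp_isDistTo {Δ : E} (f : Δ ⟶ Γ) (A : Γ ⟶ Pow X) (x : Γ ⟶ X) (r : Γ ⟶ T.R) :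
    f ≫ T.isDistTo d A x r = T.isDistTo d (f ≫ A) (f ≫ x) (f ≫ r) := by
  have hlt : ∀ {Δ : E} (a b : Δ ⟶ T.R), T.lt (T.cut a) (T.cut b) = rlt a b := fun _ _ => rfl
  have hrd : ∀ {Δ : E} (a b : Δ ⟶ X) (t : Δ ⟶ T.R), T.lt (T.dist d a b) (T.cut t) =
    rlt (rd d a b) t := fun _ _ _ => rfl
  simp only [isDistTo, hrd, hlt]
  rw [comp_all]
  refine all_congr ?_
  rw [comp_iff, comp_ex, comp_rlt]
  simp only [whiskerLeft_fst, whiskerLeft_snd_assoc, Category.assoc]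
  refine congrArg₂ _ rfl (ex_congr ?_)
  simp only [comp_and, comp_mem, comp_rlt, comp_rd, whiskerLeft_fst, whiskerLeft_snd_assoc,
    Category.assoc]

/-- The set of the points at the distance zero from a sequence of points is strongly located. -/
theorem isStronglyLocated_of_dist (hd : T.IsPseudometric d) {a : T.N ⟶ X} {ρ : X ⟶ T.R}
    (hρ : ∀ {Γ : E} (x : Γ ⟶ X), (∀ m : Γ ⟶ T.N, x ≫ ρ ≤ rd d x (m ≫ a)) ∧
      ∀ t : Γ ⟶ T.R, x ≫ ρ ≪ t →
        Cov fun {Δ} (f : Δ ⟶ Γ) => ∃ m : Δ ⟶ T.N, rd d (f ≫ x) (m ≫ a) ≪ f ≫ t) :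
    Holds (T.isStronglyLocated d (sep X fun x => (x ≫ ρ) ≐ (0 : X ⊗ 𝟙_ E ⟶ T.R))) := by
  set C : 𝟙_ E ⟶ Pow X := sep X fun x => (x ≫ ρ) ≐ (0 : X ⊗ 𝟙_ E ⟶ T.R) with hC
  have memC : ∀ {Γ : E} (g : Γ ⟶ 𝟙_ E) (x : Γ ⟶ X), Holds (x ∊ g ≫ C) ↔ x ≫ ρ = 0 := by
    intro Γ g x
    rw [hC, mem_comp_sep, holds_comp_eqq]
    simp
  have hnonneg : ∀ {Γ : E} (x : Γ ⟶ X), 0 ≤ x ≫ ρ := by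
    intro Γ x
    refine le_iff.2 fun f hf => ?_
    rw [← Category.assoc, comp_real_zero] at hf
    refine ((hρ _).2 _ hf).holds fun g ⟨m, hm⟩ => ?_
    rw [comp_real_zero] at hm
    rw [comp_fls]
    exact (slt_of_le_of_slt (hd.rd_nonneg _ _) hm).fls
  have hzero : ∀ {Γ : E} (m : Γ ⟶ T.N), (m ≫ a) ≫ ρ = 0 := by
    intro Γ m
    refine le_antisymm ?_ (hnonneg _)
    have := (hρ (m ≫ a)).1 m
    rwa [hd.rd_self] at this
  have hlip : ∀ {Γ : E} (x y : Γ ⟶ X), x ≫ ρ ≤ rd d x y + y ≫ ρ := by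
    intro Γ x y
    refine le_of_forall_pos fun f e he => ?_
    have h1 : f ≫ y ≫ ρ ≪ f ≫ y ≫ ρ + e := he.lin (le_of_eq (by abel))
    nth_rw 1 [← Category.assoc] at h1
    refine le_of_cov ((hρ _).2 _ h1) fun g ⟨m, hm⟩ => ?_
    have h2 := (hρ (g ≫ f ≫ x)).1 m
    have h3 := hd.rd_triangle (g ≫ f ≫ x) (g ≫ f ≫ y) (m ≫ a)
    have h4 := hm.le
    simp only [comp_radd, comp_rd, Category.assoc] at h2 h3 h4 ⊢
    exact le_lin (add_le_add (add_le_add h2 h3) h4) (by abel)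
  -- The terms of `a` belong to `C` and come as close to `x` as `ρ` says. No point of `C` is closer,
  -- because `ρ` vanishes on `C` and satisfies `hlip`.
  have hdist : ∀ {Γ : E} (g : Γ ⟶ 𝟙_ E) (x : Γ ⟶ X), Holds (T.isDistTo d (g ≫ C) x (x ≫ ρ)) := by
    intro Γ g x
    refine holds_isDistTo.2 fun f t => ⟨fun h => ?_, fun h => ?_⟩
    · rw [← Category.assoc] at h
      refine ((hρ _).2 _ h).mono fun i ⟨m, hm⟩ => ⟨m ≫ a, ?_, ?_⟩
      · rw [← Category.assoc, memC]
        exact hzero m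
      · rwa [hd.rd_comm]
    · refine slt_of_cov h fun i ⟨c, hc, hc'⟩ => ?_
      rw [← Category.assoc, memC] at hc
      have h1 := hlip (i ≫ f ≫ x) c
      rw [hc, add_zero, hd.rd_comm] at h1
      simpa using slt_of_le_of_slt h1 hc'
  rw [isStronglyLocated, holds_and]
  constructor
  · refine holds_all.2 fun f x => holds_comp_ex_intro (x ≫ ρ) ?_
    rw [comp_isDistTo]
    simpa using hdist f x
  · refine holds_all.2 fun f x => ?_
    rw [comp_iff, holds_iff]
    refine om_ext fun g => ?_
    rw [comp_mem, lift_fst, lift_snd_assoc, comp_mem, ← Category.assoc, memC]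
    constructor
    · intro h
      rw [← Category.assoc]
      refine holds_comp_ex_intro 0 ?_
      rw [comp_and, holds_and, comp_isDistTo]
      constructor
      · have := hdist (g ≫ f) (g ≫ x)
        rw [h] at this
        simpa [comp_lift] using this
      · rw [holds_comp_eqq, ← cut_zero, ← Category.assoc, ← Category.assoc, comp_real_zero,
          lift_fst]
    · intro h
      rw [← Category.assoc] at h
      have h' := cov_of_comp_ex h
      refine h'.eq fun i ⟨r, hr⟩ => ?_
      rw [comp_and, holds_and, comp_isDistTo] at hr
      obtain ⟨h1, h2⟩ := hr
      have h3 : r = 0 := by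
        rw [holds_comp_eqq, ← cut_zero] at h2
        simp only [cut, ← Category.assoc, comp_real_zero, lift_fst] at h2
        exact cut_injective h2
      have h4 := isDistTo_unique (hdist ((i ≫ g) ≫ f) (i ≫ g ≫ x)) (r' := r)
        (by simpa [comp_lift] using h1)
      rw [comp_real_zero, ← h3, ← h4]
      simp

end SynthTopology

end Located

end SynTop

end

/-! ### Partial elements: the set `X + 1` -/

noncomputable section

namespace SynTop

section Partial

variable {E : Type u} [Category.{v} E] [CartesianMonoidalCategory E] [MonoidalClosed E]
  [Limits.HasFiniteLimits E] [HasSubobjectClassifier E]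

local postfix:max "⇧" => wk
local infix:45 " ≐ " => eqq
local infixr:35 " ⋏ " => and
local infixr:25 " ⇛ " => imp
local infix:20 " ⟺ " => iff
local infix:50 " ∊ " => mem
local infixr:30 " ⋎ " => or

set_option linter.unusedSectionVars false
set_option linter.unusedSimpArgs false

variable {Γ Δ X A : E}

/-- The empty subset. -/
def emptySet (Γ X : E) : Γ ⟶ Pow X := sep X fun _ => fls _

@[simp]
theorem comp_emptySet (f : Δ ⟶ Γ) : f ≫ emptySet Γ X = emptySet Δ X :=
  pow_ext fun g x => by
    rw [emptySet, emptySet, ← Category.assoc, mem_comp_sep, mem_comp_sep, comp_fls, comp_fls]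

theorem fls_of_mem_emptySet {x : Γ ⟶ X} (h : Holds (x ∊ emptySet Γ X)) : Holds (fls Γ) := by
  rw [emptySet, mem_sep, comp_fls] at h
  exact h

/-- The property of being either empty or a singleton. -/
def isPartial (X : E) : Pow X ⟶ Om E :=
  (𝟙 (Pow X) ≐ emptySet _ X) ⋎ ex X fun x => (𝟙 (Pow X))⇧ ≐ (x ≫ singleton X)

theorem holds_comp_isPartial (S : Γ ⟶ Pow X) : Holds (S ≫ isPartial X) ↔
    Cov fun {Δ} (f : Δ ⟶ Γ) => f ≫ S = emptySet Δ X ∨ ∃ x : Δ ⟶ X, f ≫ S = x ≫ singleton X := by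
  rw [isPartial, comp_or]
  constructor
  · intro h
    refine (cov_of_or h).bind fun f hf => ?_
    rcases hf with hf | hf
    · refine Cov.pure (Or.inl ?_)
      rw [← Category.assoc, holds_comp_eqq] at hf
      simpa using hf
    · rw [← Category.assoc] at hf
      refine (cov_of_comp_ex hf).mono fun g ⟨x, hx⟩ => Or.inr ⟨x, ?_⟩
      simpa using hx
  · refine fun h => h.holds fun f hf => ?_
    rw [comp_or]
    rcases hf with hf | ⟨x, hx⟩
    · refine holds_or_left ?_
      rw [← Category.assoc, holds_comp_eqq]
      simpa using hf
    · refine holds_or_right ?_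
      rw [← Category.assoc]
      refine holds_comp_ex_intro x ?_
      simpa using hx

/-- The object of partial elements of `X`, that is, of subsets of `X` which are either empty or a
singleton. -/
abbrev Part (X : E) : E := Compr (isPartial X)

namespace Part

/-- The undefined partial element. -/
def none (Γ X : E) : Γ ⟶ Part X :=
  Compr.mk (emptySet Γ X) ((holds_comp_isPartial _).2 (Cov.pure (Or.inl (by simp))))

/-- The inclusion of the elements into the partial elements. -/
def some (X : E) : X ⟶ Part X :=
  Compr.mk (singleton X) ((holds_comp_isPartial _).2 (Cov.pure (Or.inr ⟨𝟙 X, by simp⟩)))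

@[simp]
theorem comp_none (f : Δ ⟶ Γ) : f ≫ none Γ X = none Δ X :=
  Compr.ext (by simp [none])

theorem cases (p : Γ ⟶ Part X) :
    Cov fun {Δ} (f : Δ ⟶ Γ) => f ≫ p = none Δ X ∨ ∃ x : Δ ⟶ X, f ≫ p = x ≫ some X :=
  ((holds_comp_isPartial _).1 (Compr.prop p)).mono fun f hf => by
    refine hf.imp (fun h => Compr.ext ?_) (fun ⟨x, hx⟩ => ⟨x, Compr.ext ?_⟩)
    · simpa [none] using h
    · simpa [some] using hx

theorem some_inj {x y : Γ ⟶ X} (h : x ≫ some X = y ≫ some X) : x = y := by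
  have : x ≫ singleton X = y ≫ singleton X := by
    simpa [some] using congrArg (· ≫ incl (isPartial X)) h
  exact (cancel_mono (singleton X)).1 this

theorem fls_of_eq {x : Γ ⟶ X} (h : x ≫ some X = none Γ X) : Holds (fls Γ) := by
  have : x ≫ singleton X = emptySet Γ X := by
    simpa [some, none] using congrArg (· ≫ incl (isPartial X)) h
  exact fls_of_mem_emptySet (this ▸ (mem_singleton x x).2 rfl)

/-- Definition by cases on a partial element. -/
theorem exists_rec (a : Γ ⟶ A) (b : X ⊗ Γ ⟶ A) : ∃ h : Part X ⊗ Γ ⟶ A,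
    (∀ {Δ : E} (f : Δ ⟶ Γ), lift (none Δ X) f ≫ h = f ≫ a) ∧
    ∀ {Δ : E} (x : Δ ⟶ X) (f : Δ ⟶ Γ), lift (x ≫ some X) f ≫ h = lift x f ≫ b := by
  -- The graph of the desired function. The two cases exclude each other and `Part.some` is
  -- injective, so unique choice applies.
  let φ : A ⊗ (Part X ⊗ Γ) ⟶ Om E :=
    (snd _ _ ≫ fst _ _ ≐ none _ X ⋏ fst _ _ ≐ (snd _ _ ≫ snd _ _ ≫ a)) ⋎
    ex X fun x => (snd _ _ ≫ snd _ _ ≫ fst _ _) ≐ (x ≫ some X) ⋏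
      (snd _ _ ≫ fst _ _) ≐ (lift x (snd _ _ ≫ snd _ _ ≫ snd _ _) ≫ b)
  have hφ : ∀ {Δ : E} (z : Δ ⟶ A) (p : Δ ⟶ Part X) (f : Δ ⟶ Γ), Holds (lift z (lift p f) ≫ φ) ↔
      Cov fun {Θ} (g : Θ ⟶ Δ) => (g ≫ p = none Θ X ∧ g ≫ z = g ≫ f ≫ a) ∨
        ∃ x : Θ ⟶ X, g ≫ p = x ≫ some X ∧ g ≫ z = lift x (g ≫ f) ≫ b := by
    intro Δ z p f
    simp only [φ, comp_or, comp_and]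
    constructor
    · intro h
      refine (cov_of_or h).bind fun g hg => ?_
      rcases hg with hg | hg
      · refine Cov.pure (Or.inl ?_)
        simpa [holds_and] using hg
      · rw [← Category.assoc] at hg
        refine (cov_of_comp_ex hg).mono fun i ⟨x, hx⟩ => Or.inr ⟨x, ?_⟩
        simpa [holds_and, comp_lift_assoc] using hx
    · refine fun h => h.holds fun g hg => ?_
      rw [comp_or]
      rcases hg with hg | ⟨x, hx⟩
      · refine holds_or_left ?_
        simpa [holds_and] using hg
      · refine holds_or_right ?_
        rw [← Category.assoc]
        refine holds_comp_ex_intro x ?_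
        simpa [holds_and, comp_lift_assoc] using hx
  have hnone : ∀ {Δ : E} (z : Δ ⟶ A) (f : Δ ⟶ Γ), Holds (lift z (lift (none _ X) f) ≫ φ) →
      z = f ≫ a := by
    intro Δ z f h
    refine ((hφ _ _ _).1 h).eq fun g hg => ?_
    rcases hg with hg | ⟨y, hy, _⟩
    · exact hg.2
    · rw [comp_none] at hy
      exact eq_of_fls (fls_of_eq hy.symm) _ _
  have hsome : ∀ {Δ : E} (z : Δ ⟶ A) (x : Δ ⟶ X) (f : Δ ⟶ Γ),
      Holds (lift z (lift (x ≫ some X) f) ≫ φ) → z = lift x f ≫ b := by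
    intro Δ z x f h
    refine ((hφ _ _ _).1 h).eq fun g hg => ?_
    rcases hg with ⟨hg, _⟩ | ⟨y, hy, hy'⟩
    · rw [← Category.assoc] at hg
      exact eq_of_fls (fls_of_eq hg) _ _
    · rw [← Category.assoc] at hy
      rw [hy', ← some_inj hy, comp_lift_assoc]
  have hpair : ∀ {Δ : E} (f : Δ ⟶ Part X ⊗ Γ), f = lift (f ≫ fst _ _) (f ≫ snd _ _) := by
    intro Δ f
    ext <;> simp
  have key : ∃ h : Part X ⊗ Γ ⟶ A, Holds (lift h (𝟙 _) ≫ φ) := by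
    refine exists_of_unique φ ?_ ?_
    · refine (cases (fst (Part X) Γ)).mono fun f hf => ?_
      rcases hf with hf | ⟨x, hx⟩
      · refine ⟨f ≫ snd _ _ ≫ a, ?_⟩
        rw [hpair f, hφ]
        refine Cov.pure (Or.inl ?_)
        simpa using hf
      · refine ⟨lift x (f ≫ snd _ _) ≫ b, ?_⟩
        rw [hpair f, hφ]
        refine Cov.pure (Or.inr ⟨x, ?_⟩)
        simpa using hx
    · intro Δ f y z hy hz
      refine (cases (f ≫ fst _ _)).eq fun g hg => ?_
      have hy' := hy.comp g
      have hz' := hz.comp g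
      rw [comp_lift_assoc, hpair (g ≫ f), Category.assoc] at hy' hz'
      rcases hg with hg | ⟨x, hx⟩
      · rw [hg] at hy' hz'
        rw [hnone _ _ hy', hnone _ _ hz']
      · rw [hx] at hy' hz'
        rw [hsome _ _ _ hy', hsome _ _ _ hz']
  obtain ⟨h, hh⟩ := key
  have hh' : ∀ {Δ : E} (f : Δ ⟶ Part X ⊗ Γ), Holds (lift (f ≫ h) f ≫ φ) := fun f => by
    have := hh.comp f
    rwa [comp_lift_assoc, Category.comp_id] at this
  exact ⟨h, fun f => hnone _ _ (hh' _), fun x f => hsome _ _ _ (hh' _)⟩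

end Part

end Partial

end SynTop

end

/-! ### Adjoining a base point to a space that may be empty -/

noncomputable section

namespace SynTop

section BasePoint

variable {E : Type u} [Category.{v} E] [CartesianMonoidalCategory E] [MonoidalClosed E]
  [Limits.HasFiniteLimits E] [HasSubobjectClassifier E]

local postfix:max "⇧" => wk
local infix:45 " ≐ " => eqq
local infixr:35 " ⋏ " => and
local infixr:25 " ⇛ " => imp
local infix:20 " ⟺ " => iff
local infix:50 " ∊ " => mem
local infixr:30 " ⋎ " => or

set_option linter.unusedSectionVars false
set_option linter.unusedSimpArgs false

open NNO

namespace SynthTopology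

variable {T : SynthTopology E} {Γ X : E} {d : X ⊗ X ⟶ T.R}

local infix:50 " ≪ " => Slt

open SynTop.Part in
/-- A constant map `X ⟶ X`, defined by searching for the first defined term of a sequence of partial
elements. -/
theorem exists_constant (T : SynthTopology E) {s : T.N ⟶ Part X}
    (hs : ∀ {Γ : E} (_ : Γ ⟶ X), Cov fun {Δ} (_ : Δ ⟶ Γ) =>
      ∃ (n : Δ ⟶ T.N) (y : Δ ⟶ X), n ≫ s = y ≫ some X) :
    ∃ c : X ⟶ X, ∀ {Γ : E} (x y : Γ ⟶ X), x ≫ c = y ≫ c := by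
  -- A left-biased alternative. The term `p n` below is the first defined term of `s` of index less
  -- than `n`, if there is one, and it is kept from then on.
  obtain ⟨orElse, ho, ho'⟩ := exists_rec (𝟙 (Part X)) (fst X (Part X) ≫ some X)
  obtain ⟨p', h0, h1⟩ := exists_primrec (T := T.toNNO) (Part.none (𝟙_ E) X)
    (lift (fst _ _) (snd _ _ ≫ fst _ _ ≫ s) ≫ orElse)
  let p : T.N ⟶ Part X := lift (𝟙 _) (toUnit _) ≫ p'
  have hp : ∀ {Γ : E} (n : Γ ⟶ T.N), n ≫ p = lift n (toUnit _) ≫ p' := by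
    intro Γ n
    simp [p, comp_lift_assoc]
  have hsucc : ∀ {Γ : E} (n : Γ ⟶ T.N), (n + 1) ≫ p = lift (n ≫ p) (n ≫ s) ≫ orElse := by
    intro Γ n
    rw [hp, h1, hp]
    simp [comp_lift_assoc]
  clear_value p
  have hstep : ∀ {Γ : E} (n : Γ ⟶ T.N) (x : Γ ⟶ X), n ≫ p = x ≫ some X →
      (n + 1) ≫ p = x ≫ some X := by
    intro Γ n x h
    rw [hsucc, h, ho']
    simp
  have hstable : ∀ {Γ : E} (n k : Γ ⟶ T.N) (x : Γ ⟶ X), n ≫ p = x ≫ some X →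
      (n + k) ≫ p = x ≫ some X := by
    intro Γ n k x h
    have := induction_eq (T := T.toNNO) (Γ := Γ) ((snd _ _ ≫ n + fst _ _) ≫ p)
      (snd _ _ ≫ x ≫ some X) (fun f => ?_) (fun f k hk => ?_) (𝟙 Γ) k
    · rw [← Category.assoc] at this
      simpa using this
    · rw [← Category.assoc]
      simpa using congrArg (f ≫ ·) h
    · rw [← Category.assoc] at hk ⊢
      simp only [comp_natAdd, lift_fst, lift_snd_assoc, Category.assoc] at hk ⊢
      rw [← Category.assoc] at hk ⊢
      rw [← add_assoc]
      exact hstep _ _ hk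
  have huniq : ∀ {Γ : E} (n m : Γ ⟶ T.N) (x y : Γ ⟶ X), n ≫ p = x ≫ some X →
      m ≫ p = y ≫ some X → x = y := by
    intro Γ n m x y hx hy
    refine (le_or_lt n m).eq fun f hf => some_inj ?_
    have hx' : (f ≫ n) ≫ p = (f ≫ x) ≫ some X := by simp [hx]
    have hy' : (f ≫ m) ≫ p = (f ≫ y) ≫ some X := by simp [hy]
    rcases hf with ⟨k, hk⟩ | ⟨k, hk⟩
    · rw [← hstable _ k _ hx', hk, hy']
    · rw [← hstable _ (k + 1) _ hy', ← add_assoc, hk, hx']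
  -- The first variable is the result of the search. The second is an arbitrary point of `X`, whose
  -- presence at the stage guarantees that the search succeeds.
  let φ : X ⊗ X ⟶ Om E := ex T.N fun n => (n ≫ p) ≐ (snd _ _ ≫ fst _ _ ≫ some X)
  have hφ : ∀ {Δ : E} (x y : Δ ⟶ X), Holds (lift x y ≫ φ) ↔ Cov fun {Θ} (g : Θ ⟶ Δ) =>
      ∃ n : Θ ⟶ T.N, n ≫ p = (g ≫ x) ≫ some X := by
    intro Δ x y
    constructor
    · intro h
      refine (cov_of_comp_ex h).mono fun g ⟨n, hn⟩ => ⟨n, ?_⟩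
      simpa [comp_lift] using hn
    · refine fun h => h.holds fun g ⟨n, hn⟩ => ?_
      rw [← Category.assoc]
      refine holds_comp_ex_intro n ?_
      simpa [comp_lift] using hn
  have hφ' : ∀ {Δ : E} (x y y' : Δ ⟶ X), Holds (lift x y ≫ φ) → ∀ {x' : Δ ⟶ X},
      Holds (lift x' y' ≫ φ) → x = x' := by
    intro Δ x y y' h x' h'
    refine ((hφ _ _).1 h).eq fun f ⟨n, hn⟩ => ?_
    have h'' := h'.comp f
    rw [comp_lift_assoc] at h''
    refine ((hφ _ _).1 h'').eq fun g ⟨m, hm⟩ => ?_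
    have hn' : (g ≫ n) ≫ p = (g ≫ f ≫ x) ≫ some X := by simp [hn]
    exact huniq _ _ _ _ hn' hm
  have key : ∃ c : X ⟶ X, Holds (lift c (𝟙 X) ≫ φ) := by
    refine exists_of_unique φ ?_ fun f x y hx hy => hφ' x f f hx hy
    refine (hs (𝟙 X)).bind fun f ⟨n, y, hy⟩ => (cases (n ≫ p)).mono fun g hg => ?_
    rcases hg with hg | ⟨x, hx⟩
    · refine ⟨g ≫ y, (hφ _ _).2 (Cov.pure ⟨g ≫ n + 1, ?_⟩)⟩
      rw [hsucc, Category.assoc, hg, ho]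
      simp [hy]
    · exact ⟨x, (hφ _ _).2 (Cov.pure ⟨g ≫ n, by simpa using hx⟩)⟩
  obtain ⟨c, hc⟩ := key
  refine ⟨c, fun x y => ?_⟩
  have hx := hc.comp x
  have hy := hc.comp y
  rw [comp_lift_assoc] at hx hy
  exact hφ' _ _ _ hx hy

/-- The extension of a pseudometric to the partial elements; the undefined partial element lies at
the distance `x ≫ w` from `x`. -/
theorem exists_extend (hd : T.IsPseudometric d) (w : X ⟶ T.R)
    (hw : ∀ {Γ : E} (x y : Γ ⟶ X), x ≫ w ≤ rd d x y + y ≫ w)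
    (hw' : ∀ {Γ : E} (x y : Γ ⟶ X), rd d x y ≤ x ≫ w + y ≫ w) :
    ∃ D : Part X ⊗ Part X ⟶ T.R, T.IsPseudometric D ∧
      (∀ {Γ : E} (x y : Γ ⟶ X), rd D (x ≫ Part.some X) (y ≫ Part.some X) = rd d x y) ∧
      ∀ {Γ : E} (x : Γ ⟶ X), rd D (x ≫ Part.some X) (Part.none Γ X) = x ≫ w := by
  obtain ⟨v, hv, hv'⟩ := Part.exists_rec (0 : 𝟙_ E ⟶ T.R) (fst X (𝟙_ E) ≫ w)
  obtain ⟨v₁, hv₁, hv₁'⟩ := Part.exists_rec w d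
  obtain ⟨D, hD, hD'⟩ := Part.exists_rec (lift (𝟙 _) (toUnit _) ≫ v)
    (lift (snd X (Part X)) (fst _ _) ≫ v₁)
  have hnn : ∀ Γ : E, rd D (Part.none Γ X) (Part.none Γ X) = 0 := by
    intro Γ
    rw [rd, hD, comp_lift_assoc, Category.comp_id, hv, comp_real_zero]
  have hns : ∀ {Γ : E} (x : Γ ⟶ X), rd D (Part.none Γ X) (x ≫ Part.some X) = x ≫ w := by
    intro Γ x
    rw [rd, hD, comp_lift_assoc, Category.comp_id, hv']
    simp
  have hsn : ∀ {Γ : E} (x : Γ ⟶ X), rd D (x ≫ Part.some X) (Part.none Γ X) = x ≫ w := by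
    intro Γ x
    rw [rd, hD', comp_lift_assoc, lift_fst, lift_snd, hv₁]
  have hss : ∀ {Γ : E} (x y : Γ ⟶ X), rd D (x ≫ Part.some X) (y ≫ Part.some X) = rd d x y := by
    intro Γ x y
    rw [rd, hD', comp_lift_assoc, lift_fst, lift_snd, hv₁', ← rd, hd.rd_comm]
  have hw0 : ∀ {Γ : E} (x : Γ ⟶ X), 0 ≤ x ≫ w := by
    intro Γ x
    refine nonneg_of_add_self ?_
    rw [← hd.rd_self x]
    exact hw' x x
  refine ⟨D, .mk' (fun p => ?_) (fun p q => ?_) (fun p q r => ?_), hss, hsn⟩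
  · refine (Part.cases p).eq fun f hf => ?_
    rw [comp_rd, comp_real_zero]
    rcases hf with hf | ⟨x, hf⟩ <;> rw [hf]
    · exact hnn _
    · rw [hss, hd.rd_self]
  · refine (Part.cases p).eq fun f hf => (Part.cases (f ≫ q)).eq fun g hg => ?_
    rw [comp_rd, comp_rd, comp_rd, comp_rd]
    rcases hg with hg | ⟨y, hg⟩ <;> rcases hf with hf | ⟨x, hf⟩ <;> rw [hg, hf]
    · simp [hns, hsn]
    · rw [← Category.assoc, hns, hsn]
    · rw [Part.comp_none, hns, hsn]
    · rw [← Category.assoc, hss, hss, hd.rd_comm]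
  · refine le_of_cov (Part.cases p) fun f hf => le_of_cov (Part.cases (f ≫ q)) fun g hg =>
      le_of_cov (Part.cases (g ≫ f ≫ r)) fun i hi => ?_
    simp only [comp_radd, comp_rd]
    rcases hi with hi | ⟨z, hi⟩ <;> rcases hg with hg | ⟨y, hg⟩ <;>
      rcases hf with hf | ⟨x, hf⟩ <;> rw [hi, hg, hf] <;>
      simp only [Part.comp_none, ← Category.assoc, hnn, hns, hsn, hss]
    · simp
    · simp
    · exact add_nonneg (hw0 _) (hw0 _)
    · exact hw _ _
    · simp
    · exact hw' _ _
    · rw [hd.rd_comm, add_comm]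
      exact hw _ _
    · exact hd.rd_triangle _ _ _

/-- A value that is empty or a singleton is an element of `Part X`. Density is recast in terms of
the indices of defined terms, so that centers of balls can be enumerated by numbers. -/
theorem IsSeparating.exists_seq {S : T.N ⟶ Pow X} (hS : T.IsSeparating d S) :
    ∃ s : T.N ⟶ Part X, ∀ {Γ : E} (x : Γ ⟶ X) (e : Γ ⟶ T.R), 0 ≪ e →
      Cov fun {Δ} (f : Δ ⟶ Γ) => ∃ (n : Δ ⟶ T.N) (y : Δ ⟶ X), n ≫ s = y ≫ Part.some X ∧
        rd d (f ≫ x) y ≪ f ≫ e := by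
  have hpart : Holds (S ≫ isPartial X) := by
    rw [holds_comp_isPartial]
    have h1 := holds_all.1 hS.empty_or_singleton (toUnit _) (𝟙 T.N)
    rw [comp_or] at h1
    refine (cov_of_or h1).bind fun f hf => ?_
    rcases hf with hf | hf
    · refine Cov.pure (Or.inl ?_)
      rw [Category.id_comp]
      refine pow_ext fun g x => ⟨fun h => ?_, fun h => ?_⟩
      · rw [← Category.assoc, holds_comp_all] at hf
        have h2 := hf g x
        rw [comp_neg] at h2
        refine holds_fls (h2.absurd ?_) _
        simpa using h
      · rw [comp_emptySet] at h
        exact holds_fls (fls_of_mem_emptySet h) _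
    · rw [← Category.assoc] at hf
      refine (cov_of_comp_ex hf).mono fun g ⟨x, hx⟩ => Or.inr ⟨x, pow_ext fun i y => ?_⟩
      have h2 := holds_comp_all.1 hx i y
      rw [comp_iff, holds_iff, comp_eqq] at h2
      rw [← Category.assoc i x, mem_singleton, ← holds_eqq]
      have h3 : (y ∊ i ≫ g ≫ f ≫ S) = (y ≐ i ≫ x) := by simpa using h2
      rw [← h3, Category.assoc]
  refine ⟨Compr.mk S hpart, fun x e he => ?_⟩
  refine (holds_isDense.1 hS.dense (toUnit _) x e he).bind fun f ⟨y, hy, hy'⟩ => ?_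
  rw [mem_comp_sep] at hy
  refine (cov_of_comp_ex hy).mono fun g ⟨n, hn⟩ => ⟨n, g ≫ y, Compr.ext ?_, by simpa using hy'.comp g⟩
  have h4 : Holds (g ≫ y ∊ n ≫ S) := by simpa using hn
  have h5 := (holds_comp_isPartial (n ≫ S)).1 (by simpa using hpart.comp n)
  simp only [Category.assoc, Compr.mk_incl, Part.some]
  refine h5.eq fun i hi => ?_
  have h6 := h4.comp i
  rw [comp_mem] at h6
  rcases hi with hi | ⟨z, hz⟩
  · rw [hi] at h6
    exact eq_of_fls (fls_of_mem_emptySet h6) _ _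
  · rw [hz, mem_singleton] at h6
    rw [hz, ← h6]
    simp

/-- A separable metric space can be enlarged by one point to a pseudometric space with a sequence of
partial elements whose first term is the additional point. -/
theorem IsSeparating.exists_based {S : T.N ⟶ Pow X} (hd : T.IsPseudometric d)
    (hS : T.IsSeparating d S) (b : 𝟙_ E ⟶ T.R) (hb : 0 ≪ b) :
    ∃ (D : Part X ⊗ Part X ⟶ T.R) (s : T.N ⟶ Part X), T.IsPseudometric D ∧
      (∀ {Γ : E} (x y : Γ ⟶ X), rd D (x ≫ Part.some X) (y ≫ Part.some X) = rd d x y) ∧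
      (∀ {Γ : E} (x : Γ ⟶ X), toUnit Γ ≫ b ≤ rd D (x ≫ Part.some X) (Part.none Γ X)) ∧
      (∀ Γ : E, (0 : Γ ⟶ T.N) ≫ s = Part.none Γ X) ∧
      ∀ {Γ : E} (x : Γ ⟶ X) (e : Γ ⟶ T.R), 0 ≪ e →
        Cov fun {Δ} (f : Δ ⟶ Γ) => ∃ (n : Δ ⟶ T.N) (y : Δ ⟶ X), n ≫ s = y ≫ Part.some X ∧
          rd d (f ≫ x) y ≪ f ≫ e := by
  obtain ⟨s, hs⟩ := hS.exists_seq
  have hb' : ∀ Γ : E, 0 ≪ toUnit Γ ≫ b := fun Γ => by simpa using hb.comp (toUnit Γ)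
  -- The value of `c` serves as a distinguished point of `X`, although it is not decided whether `X`
  -- has points.
  obtain ⟨c, hc⟩ := exists_constant T fun {Γ} x => (hs x _ (hb' Γ)).mono
    fun f ⟨n, y, hy, _⟩ => ⟨n, y, hy⟩
  -- The additional point is attached to the value of `c` by an edge of length `b`, so it keeps the
  -- distance `b` from all of `X`.
  let w : X ⟶ T.R := toUnit X ≫ b + rd d (𝟙 X) c
  have hw : ∀ {Γ : E} (x : Γ ⟶ X), x ≫ w = toUnit Γ ≫ b + rd d x (x ≫ c) := by
    intro Γ x
    simp [w]
  obtain ⟨D, hD, hD', hDw⟩ := exists_extend hd w (fun x y => by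
      rw [hw, hw, hc y x]
      exact le_lin (hd.rd_triangle x y (x ≫ c)) (by abel)) (fun {Γ} x y => by
      rw [hw, hw, hc y x, hd.rd_comm y]
      exact le_lin (add_le_add (add_le_add (hd.rd_triangle x (x ≫ c) y) (hb' Γ).le) (hb' Γ).le)
        (by abel))
  -- The sequence is shifted by one, so that the additional point has the known index zero.
  obtain ⟨s', h0, h1⟩ := exists_primrec (T := T.toNNO) (Part.none (𝟙_ E) X)
    (snd (Part X) (T.N ⊗ 𝟙_ E) ≫ fst _ _ ≫ s)
  refine ⟨D, lift (𝟙 _) (toUnit _) ≫ s', hD, hD', fun {Γ} x => ?_, fun Γ => ?_, fun x e he =>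
    (hs x e he).mono fun f ⟨n, y, hy, hy'⟩ => ⟨n + 1, y, ?_, hy'⟩⟩
  · rw [hDw, hw]
    exact le_lin (hd.rd_nonneg x (x ≫ c)) (by abel)
  · rw [comp_lift_assoc, Category.comp_id, h0]
    simp
  · rw [comp_lift_assoc, Category.comp_id, h1]
    simpa using hy

end SynthTopology

end BasePoint

end SynTop

end

/-! ### Embedding a complete separable space into a Urysohn space -/

noncomputable section

namespace SynTop

section Embedding

variable {E : Type u} [Category.{v} E] [CartesianMonoidalCategory E] [MonoidalClosed E]
  [Limits.HasFiniteLimits E] [HasSubobjectClassifier E]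

local postfix:max "⇧" => wk
local infix:45 " ≐ " => eqq
local infixr:35 " ⋏ " => and
local infixr:25 " ⇛ " => imp
local infix:20 " ⟺ " => iff
local infix:50 " ∊ " => mem
local infixr:30 " ⋎ " => or

set_option linter.unusedSectionVars false
set_option linter.unusedSimpArgs false

open NNO

namespace SynthTopology

variable {T : SynthTopology E} {Γ X Y : E} {d : X ⊗ X ⟶ T.R}

local infix:50 " ≪ " => Slt

/-- For `2 * q < a`, cotransitivity yields `q < b`, so that `q` will do, or `b < 2 * q`, so that `b`
itself will do. -/
theorem exists_pos_le {a b : Γ ⟶ T.R} (ha : 0 ≪ a) (hb : 0 ≪ b) :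
    Cov fun {Δ} (f : Δ ⟶ Γ) => ∃ e : Δ ⟶ T.R, 0 ≪ e ∧ e ≤ f ≫ a ∧ e ≤ f ≫ b := by
  refine ha.exists_gap.bind fun f ⟨q, hq, hqa⟩ => ?_
  rw [comp_real_zero, zero_add] at hqa
  have h : rat q ≪ rat q + rat q := hq.lin (le_of_eq (by abel))
  refine (h.cov_cotrans (f ≫ b)).mono fun g hg => ?_
  simp only [comp_radd] at hg
  rcases hg with hg | hg
  · refine ⟨g ≫ rat q, by simpa using hq.comp g, ?_, by simpa using hg.le⟩
    simpa using comp_le (h.trans hqa).le g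
  · refine ⟨g ≫ f ≫ b, by simpa using hb.comp (g ≫ f), ?_, by simp⟩
    have := comp_le hqa.le g
    rw [comp_radd] at this
    simpa using hg.le.trans this

/-- A sequence of points in a complete space that satisfies a Cauchy condition converges. -/
theorem exists_limit_point (hd : T.IsMetric d) (hc : T.IsComplete d) {u : T.N ⟶ X}
    (hu : Holds (T.isDense d (image u))) (a : T.N ⊗ Γ ⟶ X) {δ : T.N ⊗ Γ ⟶ T.R} (hδ : Vanishing δ)
    (h : ∀ {Δ : E} (f : Δ ⟶ Γ) (k l : Δ ⟶ T.N),
      rd d (lift k f ≫ a) (lift l f ≫ a) ≤ lift k f ≫ δ + lift l f ≫ δ) :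
    ∃ z : Γ ⟶ X, ∀ {Δ : E} (f : Δ ⟶ Γ) (k : Δ ⟶ T.N),
      rd d (f ≫ z) (lift k f ≫ a) ≤ lift k f ≫ δ := by
  -- The distances of the future limit from the points `u k` are obtained as limits of the distances
  -- of the terms of `a`. They form a pointlike sequence, which determines a point.
  obtain ⟨γ, hγ⟩ := exists_limit
    (rd d (snd T.N (T.N ⊗ Γ) ≫ fst _ _ ≫ u) (lift (fst _ _) (snd _ _ ≫ snd _ _) ≫ a))
    (lift (fst _ _) (snd _ _ ≫ snd _ _) ≫ δ) (fun f m l => by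
      simp only [comp_rd, lift_snd_assoc, comp_lift_assoc, lift_fst]
      have h1 := hd.rd_triangle (f ≫ fst _ _ ≫ u) (lift l (f ≫ snd _ _) ≫ a)
        (lift m (f ≫ snd _ _) ≫ a)
      exact le_lin (add_le_add h1 (h (f ≫ snd _ _) l m)) (by abel))
    (fun f e he => (hδ (f ≫ snd _ _) e he).mono fun g ⟨k, hk⟩ => ⟨k, by
      simpa [comp_lift_assoc] using hk⟩)
  have hγ' : ∀ {Δ : E} (f : Δ ⟶ Γ) (k m : Δ ⟶ T.N),
      lift k f ≫ γ ≤ rd d (k ≫ u) (lift m f ≫ a) + lift m f ≫ δ ∧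
        rd d (k ≫ u) (lift m f ≫ a) ≤ lift k f ≫ γ + lift m f ≫ δ := by
    intro Δ f k m
    simpa [comp_lift_assoc] using hγ (lift k f) m
  have hpoint : Pointlike d u (lam γ) := by
    constructor
    · intro Δ f k l
      rw [app_lam, app_lam]
      refine le_of_vanishing (δ := lift (fst _ _) (snd _ _ ≫ f) ≫ δ)
        (fun f' e he => (hδ (f' ≫ f) e he).mono fun g ⟨k, hk⟩ => ⟨k, by
          simpa [comp_lift_assoc] using hk⟩) fun g m => ?_
      simp only [comp_radd, comp_rd, comp_lift_assoc, lift_fst, lift_snd_assoc]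
      have h1 := (hγ' (g ≫ f) (g ≫ k) m).1
      have h2 := (hγ' (g ≫ f) (g ≫ l) m).2
      have h3 := hd.rd_triangle ((g ≫ k) ≫ u) ((g ≫ l) ≫ u) (lift m (g ≫ f) ≫ a)
      simp only [Category.assoc] at h1 h2 h3
      exact le_lin (add_le_add (add_le_add h1 h2) h3) (by abel)
    · intro Δ f k l
      rw [app_lam, app_lam]
      refine le_of_vanishing (δ := lift (fst _ _) (snd _ _ ≫ f) ≫ δ)
        (fun f' e he => (hδ (f' ≫ f) e he).mono fun g ⟨k, hk⟩ => ⟨k, by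
          simpa [comp_lift_assoc] using hk⟩) fun g m => ?_
      simp only [comp_radd, comp_rd, comp_lift_assoc, lift_fst, lift_snd_assoc]
      have h1 := (hγ' (g ≫ f) (g ≫ k) m).2
      have h2 := (hγ' (g ≫ f) (g ≫ l) m).2
      have h3 := hd.rd_triangle ((g ≫ k) ≫ u) (lift m (g ≫ f) ≫ a) ((g ≫ l) ≫ u)
      rw [hd.rd_comm (lift m (g ≫ f) ≫ a)] at h3
      simp only [Category.assoc] at h1 h2 h3
      exact le_lin (add_le_add (add_le_add h1 h2) h3) (by abel)
    · intro Δ f e he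
      refine he.exists_gap.bind fun i ⟨q, hq, hqe⟩ =>
        (hδ (i ≫ f) _ hq).bind fun j ⟨m, hm⟩ =>
          (exists_near hu (lift m (j ≫ i ≫ f) ≫ a) (e := j ≫ rat q)
            (by simpa using hq.comp j)).mono fun g ⟨k, hk⟩ => ⟨k, ?_⟩
      simp only [Category.assoc]
      rw [show g ≫ j ≫ i ≫ f ≫ lam γ = (g ≫ j ≫ i ≫ f) ≫ lam γ by simp only [Category.assoc],
        app_lam]
      refine slt_of_le_of_slt (hγ' (g ≫ j ≫ i ≫ f) k (g ≫ m)).1 ?_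
      have h1 := hm.comp g
      have h2 := hqe.comp (g ≫ j)
      rw [hd.rd_comm] at hk
      simp only [comp_lift_assoc, comp_radd, comp_real_zero, zero_add, Category.assoc] at h1 h2 hk ⊢
      refine hk.lin ?_
      exact le_lin (add_le_add h1.le h2.le) (by abel)
  obtain ⟨z, hz⟩ := exists_point hd hc hu hpoint
  refine ⟨z, fun f m => le_of_vanishing (vanishing_rd hu (f ≫ z)) fun g k => ?_⟩
  have h1 := hz (g ≫ f) k
  rw [app_lam] at h1
  have h2 := (hγ' (g ≫ f) k (g ≫ m)).2
  have h3 := hd.rd_triangle ((g ≫ f) ≫ z) (k ≫ u) (lift (g ≫ m) (g ≫ f) ≫ a)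
  rw [← h1] at h2
  rw [hd.rd_comm _ (k ≫ u)] at h3
  simp only [comp_rd, comp_lift_assoc, lift_snd_assoc, lift_fst_assoc, Category.assoc] at h2 h3 ⊢
  rw [hd.rd_comm _ (k ≫ u)]
  exact le_lin (add_le_add h2 h3) (by abel)

/-- A map into a complete space that is isometric on a sequence extends isometrically to the points
which can be approximated by terms of the sequence. -/
theorem exists_isometric_extension (hd : T.IsMetric d) (hc : T.IsComplete d) {u : T.N ⟶ X}
    (hu : Holds (T.isDense d (image u))) {D : Y ⊗ Y ⟶ T.R} (hD : T.IsPseudometric D)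
    {s : T.N ⟶ Y} {a : T.N ⟶ X}
    (ha : ∀ {Γ : E} (i j : Γ ⟶ T.N), rd d (i ≫ a) (j ≫ a) = rd D (i ≫ s) (j ≫ s)) (y : Γ ⟶ Y)
    (hy : Vanishing (rd D (snd T.N Γ ≫ y) (fst T.N Γ ≫ s))) :
    ∃ z : Γ ⟶ X, ∀ {Δ : E} (f : Δ ⟶ Γ) (k : Δ ⟶ T.N),
      rd d (f ≫ z) (k ≫ a) = rd D (f ≫ y) (k ≫ s) := by
  obtain ⟨z, hz⟩ := exists_limit_point hd hc hu (fst T.N Γ ≫ a) hy (fun f k l => by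
    simp only [lift_fst_assoc, comp_rd, lift_snd_assoc]
    rw [ha, hD.rd_comm (f ≫ y)]
    exact hD.rd_triangle _ _ _)
  simp only [lift_fst_assoc, comp_rd, lift_snd_assoc] at hz
  have hy' : ∀ {Δ : E} (f : Δ ⟶ Γ), Vanishing (rd D (snd T.N Δ ≫ f ≫ y) (fst T.N Δ ≫ s)) := by
    intro Δ f Δ' f' e he
    refine (hy (f' ≫ f) e he).mono fun g ⟨k, hk⟩ => ⟨k, ?_⟩
    simpa using hk
  refine ⟨z, fun f k => le_antisymm (hz f k) (le_of_vanishing (hy' f) fun g m => ?_)⟩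
  have h1 := hz (g ≫ f) m
  have h2 := hd.rd_triangle (m ≫ a) ((g ≫ f) ≫ z) ((g ≫ k) ≫ a)
  have h3 := hD.rd_triangle ((g ≫ f) ≫ y) (m ≫ s) ((g ≫ k) ≫ s)
  rw [ha, hd.rd_comm (m ≫ a)] at h2
  simp only [comp_rd, lift_snd_assoc, lift_fst_assoc, Category.assoc] at h1 h2 h3 ⊢
  exact le_lin (add_le_add (add_le_add h1 h2) h3) (by abel)

/-- A complete separable metric space embeds into a Urysohn space as the part of a strongly located
subset which lies outside a ball. -/
theorem CMS.exists_embedding (X : T.CMS) (U : T.UrysohnSpace) :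
    ∃ (i : X.carrier ⟶ U.carrier) (C : 𝟙_ E ⟶ Pow U.carrier) (κ : U.carrier ⟶ T.R)
      (h b : 𝟙_ E ⟶ T.R), T.IsIsometry X.d U.d i ∧ Holds (T.isStronglyLocated U.d C) ∧ h ≪ b ∧
      (∀ {Γ : E} (g : Γ ⟶ 𝟙_ E) (x : Γ ⟶ X.carrier), Holds (x ≫ i ∊ g ≫ C)) ∧
      (∀ {Γ : E} (x : Γ ⟶ X.carrier), toUnit Γ ≫ b ≤ (x ≫ i) ≫ κ) ∧
      ∀ {Γ : E} (g : Γ ⟶ 𝟙_ E) (y : Γ ⟶ U.carrier), Holds (y ∊ g ≫ C) → toUnit Γ ≫ h ≪ y ≫ κ →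
        ∃ x : Γ ⟶ X.carrier, x ≫ i = y := by
  have hU := U.isMetric
  -- The two radii will be `h = q` and `b = 2 * q`.
  obtain ⟨q, hq⟩ := exists_pos (T := T) (𝟙_ E)
  have hqq : rat q ≪ rat q + rat q := hq.lin (le_of_eq (by abel))
  obtain ⟨D, s, hD, hDd, hDb, hs0, hs⟩ := X.isSeparating.exists_based X.isMetric.toIsPseudometric
    (rat q + rat q) (hq.trans hqq)
  -- Distinct indices may present the same point, in particular those of all undefined terms, so the
  -- numbers carry only a pseudometric.
  have hpull : T.IsPseudometric (rd D (fst T.N T.N ≫ s) (snd T.N T.N ≫ s)) := by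
    have h1 : ∀ {Γ : E} (m n : Γ ⟶ T.N),
        rd (rd D (fst T.N T.N ≫ s) (snd T.N T.N ≫ s)) m n = rd D (m ≫ s) (n ≫ s) := by
      intro Γ m n
      rw [rd, comp_rd, lift_fst_assoc, lift_snd_assoc]
    refine .mk' (fun p => ?_) (fun p q => ?_) (fun p q r => ?_)
    · rw [h1, hD.rd_self]
    · rw [h1, h1, hD.rd_comm]
    · rw [h1, h1, h1]
      exact hD.rd_triangle _ _ _
  obtain ⟨a, ha, ha'⟩ := SynthTopology.exists_embedding U hpull
  have ha : ∀ {Γ : E} (i j : Γ ⟶ T.N), rd U.d (i ≫ a) (j ≫ a) = rd D (i ≫ s) (j ≫ s) := by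
    intro Γ m n
    rw [ha, rd, comp_rd, lift_fst_assoc, lift_snd_assoc]
  obtain ⟨ρ, hρ⟩ := exists_dist hU.toIsPseudometric U.isDense_u a ha'
  have hvan : ∀ {Γ : E} (x : Γ ⟶ X.carrier),
      Vanishing (rd D (snd T.N Γ ≫ x ≫ Part.some _) (fst T.N Γ ≫ s)) := by
    intro Γ x Δ f e he
    refine (hs (f ≫ x) e he).mono fun g ⟨n, y, hn, hy⟩ => ⟨n, ?_⟩
    simp only [comp_rd, lift_snd_assoc, lift_fst_assoc, hn]
    rw [← hDd] at hy
    simpa using hy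
  have hvan' : Vanishing (rd D (snd T.N X.carrier ≫ 𝟙 _ ≫ Part.some _) (fst T.N X.carrier ≫ s)) :=
    hvan (𝟙 _)
  rw [Category.id_comp] at hvan'
  obtain ⟨i, hi⟩ := exists_isometric_extension hU U.isComplete U.isDense_u hD ha
    (Part.some X.carrier) hvan'
  have hiso : T.IsIsometry X.d U.d i := by
    intro Γ x y
    change rd U.d (x ≫ i) (y ≫ i) = rd X.d x y
    rw [← hDd]
    have hx : ∀ {Δ : E} (f : Δ ⟶ Γ) (m : Δ ⟶ T.N) (x : Γ ⟶ X.carrier),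
        rd D (f ≫ x ≫ Part.some X.carrier) (m ≫ s) = rd U.d (f ≫ x ≫ i) (m ≫ a) := by
      intro Δ f m x
      have := hi (f ≫ x) m
      simpa using this.symm
    refine le_antisymm (le_of_vanishing (hvan y) fun f m => ?_)
      (le_of_vanishing (hvan y) fun f m => ?_)
    · simp only [comp_rd, lift_snd_assoc, lift_fst_assoc]
      have h1 := hU.rd_triangle (f ≫ x ≫ i) (m ≫ a) (f ≫ y ≫ i)
      have h2 := hD.rd_triangle (f ≫ x ≫ Part.some _) (f ≫ y ≫ Part.some _) (m ≫ s)
      rw [hU.rd_comm (m ≫ a), ← hx, ← hx] at h1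
      exact le_lin (add_le_add h1 h2) (by abel)
    · simp only [comp_rd, lift_snd_assoc, lift_fst_assoc]
      have h1 := hD.rd_triangle (f ≫ x ≫ Part.some _) (m ≫ s) (f ≫ y ≫ Part.some _)
      have h2 := hU.rd_triangle (f ≫ x ≫ i) (f ≫ y ≫ i) (m ≫ a)
      rw [hD.rd_comm (m ≫ s)] at h1
      rw [← hx, ← hx] at h2
      exact le_lin (add_le_add h1 h2) (by abel)
  have hnonneg : ∀ {Γ : E} (y : Γ ⟶ U.carrier), 0 ≤ y ≫ ρ := by
    intro Γ y
    refine le_iff.2 fun f hf => ?_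
    rw [← Category.assoc, comp_real_zero] at hf
    refine ((hρ _).2 _ hf).holds fun g ⟨m, hm⟩ => ?_
    rw [comp_real_zero] at hm
    rw [comp_fls]
    exact (slt_of_le_of_slt (hU.rd_nonneg _ _) hm).fls
  have hzero : ∀ {Γ : E} (x : Γ ⟶ X.carrier), (x ≫ i) ≫ ρ = 0 := by
    intro Γ x
    refine le_antisymm (le_of_vanishing (hvan x) fun f m => ?_) (hnonneg _)
    have h1 := (hρ (f ≫ x ≫ i)).1 m
    have h2 := hi (f ≫ x) m
    have h3 := hD.rd_nonneg (f ≫ x ≫ Part.some _) (m ≫ s)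
    simp only [comp_rd, lift_snd_assoc, lift_fst_assoc, Category.assoc, comp_real_zero] at h1 h2 h3 ⊢
    rw [h2] at h1
    exact le_lin (add_le_add h1 h3) (by abel)
  -- The term of index zero represents the additional point, so `κ` is the distance from it.
  let κ : U.carrier ⟶ T.R := rd U.d (𝟙 _) ((0 : U.carrier ⟶ T.N) ≫ a)
  have hκ : ∀ {Γ : E} (y : Γ ⟶ U.carrier), y ≫ κ = rd U.d y ((0 : Γ ⟶ T.N) ≫ a) := by
    intro Γ y
    simp only [κ, comp_rd, comp_zero_assoc, Category.comp_id]
  have hκb : ∀ {Γ : E} (x : Γ ⟶ X.carrier), toUnit Γ ≫ (rat q + rat q) ≤ (x ≫ i) ≫ κ := by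
    intro Γ x
    rw [hκ, hi, hs0]
    exact hDb x
  clear_value κ
  have memC : ∀ {Γ : E} (g : Γ ⟶ 𝟙_ E) (y : Γ ⟶ U.carrier),
      Holds (y ∊ g ≫ sep U.carrier fun x => (x ≫ ρ) ≐ (0 : U.carrier ⊗ 𝟙_ E ⟶ T.R)) ↔
        y ≫ ρ = 0 := by
    intro Γ g y
    rw [mem_comp_sep, holds_comp_eqq]
    simp
  -- The part of the located set at a distance greater than `q` from the additional point; it turns
  -- out to be the image of `X`.
  let ψ : U.carrier ⟶ Om E := (ρ ≐ 0) ⋏ rlt (toUnit _ ≫ rat q) κ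
  have hψ : ∀ {Γ : E} (y : Γ ⟶ U.carrier), Holds (y ≫ ψ) ↔
      y ≫ ρ = 0 ∧ toUnit Γ ≫ rat q ≪ y ≫ κ := by
    intro Γ y
    simp only [ψ, comp_and, holds_and, holds_comp_eqq, comp_rlt, comp_real_zero, comp_toUnit_assoc]
    rfl
  clear_value ψ
  have hiψ : Holds (i ≫ ψ) := by
    rw [hψ]
    have h1 := hzero (𝟙 X.carrier)
    have h2 := hκb (𝟙 X.carrier)
    rw [Category.id_comp] at h1 h2
    refine ⟨h1, (?_ : _ ≪ _).trans_le h2⟩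
    simpa using hqq.comp (toUnit X.carrier)
  let e : Compr ψ ⊗ Compr ψ ⟶ T.R := rd U.d (fst _ _ ≫ incl ψ) (snd _ _ ≫ incl ψ)
  have he : ∀ {Γ : E} (y z : Γ ⟶ Compr ψ), rd e y z = rd U.d (y ≫ incl ψ) (z ≫ incl ψ) := by
    intro Γ y z
    rw [rd, comp_rd, lift_fst_assoc, lift_snd_assoc]
  clear_value e
  have heM : T.IsMetric e :=
    { toIsPseudometric := .mk' (fun p => by rw [he, hU.rd_self])
        (fun p q => by rw [he, he, hU.rd_comm])
        (fun p q r => by rw [he, he, he]; exact hU.rd_triangle _ _ _)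
      eq_of_dist := fun x y hxy => by
        refine Compr.ext (hU.eq_of_rd ?_)
        rw [← he]
        exact cut_injective (hxy.trans cut_zero.symm) }
  have hdense : Holds (T.isDense e (image (Compr.mk i hiψ))) := by
    refine holds_isDense.2 fun f z t ht => ?_
    have hz := (hψ _).1 (Compr.prop z)
    -- Approximation to within `κ(z) - q` keeps clear of the additional point.
    have ht' : 0 ≪ (z ≫ incl ψ) ≫ κ - toUnit _ ≫ rat q := hz.2.lin (le_of_eq (by abel))
    refine (exists_pos_le ht ht').bind fun g ⟨r, hr, hrt, hrκ⟩ => ?_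
    have hz0 : (g ≫ z ≫ incl ψ) ≫ ρ ≪ r := by
      rw [Category.assoc, hz.1]
      simpa using hr
    refine ((hρ _).2 _ hz0).bind fun j ⟨m, hm⟩ => (Part.cases (m ≫ s)).mono fun k hk => ?_
    have hm' := hm.comp k
    rcases hk with hk | ⟨x, hx⟩
    -- An undefined term is at distance zero from the additional point, which would give `κ(z) <
    -- κ(z) - q`.
    · have h1 := hU.rd_triangle (k ≫ j ≫ g ≫ z ≫ incl ψ) (k ≫ m ≫ a) ((0 : _ ⟶ T.N) ≫ a)
      have h2 := ha (k ≫ m) 0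
      rw [Category.assoc, Category.assoc, hk, hs0, hD.rd_self] at h2
      rw [h2, ← hκ] at h1
      have h3 := comp_le hrκ (k ≫ j)
      have h4 := (hq.comp (k ≫ toUnit _)).le
      simp only [comp_rd, comp_rsub, Category.assoc, comp_real_zero, comp_toUnit_assoc]
        at h1 h3 h4 hm'
      have h5 := (hm'.lin (a := k ≫ j ≫ g ≫ z ≫ incl ψ ≫ κ) (b := k ≫ j ≫ g ≫ z ≫ incl ψ ≫ κ)
        (le_lin (add_le_add (add_le_add h1 h3) h4) (by abel))).fls
      exact ⟨k ≫ j ≫ g ≫ z, holds_fls h5 _, holds_fls h5 _⟩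
    · refine ⟨x ≫ Compr.mk i hiψ, ?_, ?_⟩
      · rw [mem_image]
        exact Cov.pure ⟨x, by simp⟩
      · have h1 := hU.rd_triangle (k ≫ j ≫ g ≫ z ≫ incl ψ) (k ≫ m ≫ a) (x ≫ i)
        have h2 := hi x (k ≫ m)
        rw [Category.assoc, Category.assoc, hx, hD.rd_self] at h2
        rw [hU.rd_comm (k ≫ m ≫ a), h2] at h1
        have h3 := comp_le hrt (k ≫ j)
        rw [he]
        simp only [comp_rd, Category.assoc, Compr.mk_incl] at h1 h3 hm' ⊢
        exact hm'.lin (le_lin (add_le_add h1 h3) (by abel))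
  -- Completeness of `X` leaves no room for further points in the part cut out by `ψ`.
  obtain ⟨g, hg, hg'⟩ := isIso_of_isDense X.isComplete heM (f := Compr.mk i hiψ) (fun x y => by
    change rd e (x ≫ _) (y ≫ _) = _
    rw [he, Category.assoc, Category.assoc, Compr.mk_incl]
    exact hiso x y) hdense
  refine ⟨i, _, κ, rat q, rat q + rat q, hiso, isStronglyLocated_of_dist hU.toIsPseudometric hρ, hqq,
    fun g x => (memC g _).2 (hzero x), hκb, fun f y hy hy' => ?_⟩
  have hy₁ : Holds (y ≫ ψ) := (hψ y).2 ⟨(memC f y).1 hy, hy'⟩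
  refine ⟨Compr.mk y hy₁ ≫ g, ?_⟩
  have h1 := congrArg (fun t => Compr.mk y hy₁ ≫ t ≫ incl ψ) hg'
  simpa using h1

end SynthTopology

end Embedding

end SynTop

end

/-! ### Open and subovert subsets, subspaces and metrization at stages -/

noncomputable section

namespace SynTop

section Metrized

variable {E : Type u} [Category.{v} E] [CartesianMonoidalCategory E] [MonoidalClosed E]
  [Limits.HasFiniteLimits E] [HasSubobjectClassifier E]

local postfix:max "⇧" => wk
local infix:45 " ≐ " => eqq
local infixr:35 " ⋏ " => and
local infixr:25 " ⇛ " => imp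
local infix:20 " ⟺ " => iff
local infix:50 " ∊ " => mem
local infixr:30 " ⋎ " => or

set_option linter.unusedSectionVars false
set_option linter.unusedSimpArgs false

namespace SynthTopology

variable {T : SynthTopology E} {Γ Δ X Y : E} {d : X ⊗ X ⟶ T.R}

local infix:50 " ≪ " => Slt

theorem holds_comp_ex {f : Δ ⟶ Γ} {φ : (X ⊗ Γ ⟶ X) → (X ⊗ Γ ⟶ Om E)} : Holds (f ≫ ex X φ) ↔
    Cov fun {Θ} (g : Θ ⟶ Δ) => ∃ x : Θ ⟶ X, Holds (lift x (g ≫ f) ≫ φ (fst X Γ)) :=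
  ⟨cov_of_comp_ex, fun h => h.holds fun g ⟨x, hx⟩ => by
    rw [← Category.assoc]
    exact holds_comp_ex_intro x hx⟩

theorem holds_isOpen {V : Γ ⟶ Pow X} : Holds (T.isOpen V) ↔
    ∀ {Δ : E} (f : Δ ⟶ Γ) (x : Δ ⟶ X), Holds (T.op (x ∊ f ≫ V)) := by
  have key : ∀ {Δ : E} (f : Δ ⟶ Γ) (x : Δ ⟶ X),
      lift x f ≫ T.op (fst X Γ ∊ V⇧) = T.op (x ∊ f ≫ V) := by
    intro Δ f x
    rw [op, ← Category.assoc, comp_mem, lift_fst, lift_snd_assoc]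
  simp only [isOpen, holds_all, key]

theorem comp_isOpen (f : Δ ⟶ Γ) (V : Γ ⟶ Pow X) : f ≫ T.isOpen V = T.isOpen (f ≫ V) :=
  om_ext fun g => by
    rw [← Category.assoc]
    have : ∀ {Θ Γ : E} (f : Θ ⟶ Γ) (V : Γ ⟶ Pow X), Holds (f ≫ T.isOpen V) ↔
        ∀ {Θ' : E} (i : Θ' ⟶ Θ) (x : Θ' ⟶ X), Holds (T.op (x ∊ i ≫ f ≫ V)) := by
      intro Θ Γ f V
      rw [isOpen, holds_comp_all]
      refine forall_congr' fun Θ' => forall_congr' fun i => forall_congr' fun x => ?_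
      rw [op, ← Category.assoc, comp_mem, lift_fst, lift_snd_assoc, Category.assoc]
    rw [this, this]
    simp only [Category.assoc]

theorem holds_comp_isSubovert {f : Δ ⟶ Γ} {A : Γ ⟶ Pow X} : Holds (f ≫ T.isSubovert A) ↔
    ∀ {Θ : E} (g : Θ ⟶ Δ) (V : Θ ⟶ Pow X), Holds (T.isOpen V) →
      Holds (T.op (ex X fun x => x ∊ (g ≫ f ≫ A)⇧ ⋏ x ∊ V⇧)) := by
  have key : ∀ {Θ : E} (f : Θ ⟶ Γ) (V : Θ ⟶ Pow X), lift V f ≫ (T.isOpen (fst (Pow X) Γ) ⇛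
      T.op (ex X fun x => x ∊ A⇧⇧ ⋏ x ∊ (fst (Pow X) Γ)⇧)) =
        (T.isOpen V ⇛ T.op (ex X fun x => x ∊ (f ≫ A)⇧ ⋏ x ∊ V⇧)) := by
    intro Θ f V
    rw [comp_imp, comp_isOpen, lift_fst, op, ← Category.assoc, comp_ex]
    refine congrArg (fun p => imp (T.isOpen V) (T.op p)) (ex_congr ?_)
    simp only [comp_and, comp_mem, whiskerLeft_fst, whiskerLeft_snd_assoc, lift_fst, lift_snd_assoc]
  rw [isSubovert, holds_comp_all]
  constructor
  · intro h Θ g V hV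
    have := h g V
    rw [key, Category.assoc] at this
    exact this.mp hV
  · intro h Θ g V
    rw [key, holds_imp]
    intro Θ' k hk
    rw [comp_isOpen] at hk
    have := h (k ≫ g) (k ≫ V) hk
    rw [op, ← Category.assoc, comp_ex]
    convert this using 2
    refine ex_congr ?_
    simp only [comp_and, comp_mem, whiskerLeft_fst, whiskerLeft_snd_assoc, Category.assoc]

theorem holds_isSubovert {A : Γ ⟶ Pow X} : Holds (T.isSubovert A) ↔
    ∀ {Δ : E} (f : Δ ⟶ Γ) (V : Δ ⟶ Pow X), Holds (T.isOpen V) →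
      Holds (T.op (ex X fun x => x ∊ (f ≫ A)⇧ ⋏ x ∊ V⇧)) := by
  simpa using holds_comp_isSubovert (f := 𝟙 Γ) (A := A)

theorem comp_isSubovert (f : Δ ⟶ Γ) (A : Γ ⟶ Pow X) :
    f ≫ T.isSubovert A = T.isSubovert (f ≫ A) :=
  om_ext fun g => by
    rw [← Category.assoc, holds_comp_isSubovert, holds_comp_isSubovert]
    simp only [Category.assoc]

/-- An open truth value depending on a parameter defines an open subset at the stage `Γ`, against
which subovertness of `A` can be tested. -/
theorem op_ex_of_isSubovert {A : Γ ⟶ Pow X} (hA : Holds (T.isSubovert A)) {φ : X ⊗ Γ ⟶ Om E}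
    (hφ : Holds (T.op φ)) : Holds (T.op (ex X fun x => x ∊ A⇧ ⋏ φ)) := by
  have := holds_isSubovert.1 hA (𝟙 Γ) (sep X fun _ => φ) (holds_isOpen.2 fun f x => by
    rw [mem_comp_sep, op, Category.assoc]
    exact hφ.comp _)
  convert this using 2
  refine ex_congr ?_
  rw [mem_comp_sep, Category.id_comp, lift_fst_snd, Category.id_comp]

/-- A metric space is metrized if and only if every open subset, at every stage, is locally the union
of a subovert family of balls. -/
theorem holds_isMetrized : Holds (T.isMetrized d) ↔
    ∀ {Γ : E} (V : Γ ⟶ Pow X), Holds (T.isOpen V) → Cov fun {Δ} (f : Δ ⟶ Γ) =>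
      ∃ A : Δ ⟶ Pow (X ⊗ T.R), Holds (T.isSubovert A) ∧
        ∀ {Θ : E} (g : Θ ⟶ Δ) (y : Θ ⟶ X), Holds (y ∊ g ≫ f ≫ V) ↔
          Cov fun {Θ'} (k : Θ' ⟶ Θ) => ∃ (x : Θ' ⟶ X) (r : Θ' ⟶ T.R),
            Holds (lift x r ∊ (k ≫ g) ≫ A) ∧ rd d x (k ≫ y) ≪ r := by
  have hball : ∀ {Γ Θ : E} (V : Γ ⟶ Pow X) (f : Γ ⟶ 𝟙_ E) (A : Γ ⟶ Pow (X ⊗ T.R)) (g : Θ ⟶ Γ)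
      (y : Θ ⟶ X), Holds (lift y (g ≫ lift A (lift V f)) ≫ ex (X ⊗ T.R) fun p =>
        p ∊ (fst (Pow (X ⊗ T.R)) (Pow X ⊗ 𝟙_ E))⇧⇧ ⋏
          rlt (rd d (p ≫ fst _ _) (fst X (Pow (X ⊗ T.R) ⊗ Pow X ⊗ 𝟙_ E))⇧) (p ≫ snd _ _)) ↔
        Cov fun {Θ'} (k : Θ' ⟶ Θ) => ∃ (x : Θ' ⟶ X) (r : Θ' ⟶ T.R),
          Holds (lift x r ∊ (k ≫ g) ≫ A) ∧ rd d x (k ≫ y) ≪ r := by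
    intro Γ Θ V f A g y
    rw [holds_comp_ex]
    constructor
    · refine fun h => h.mono fun k ⟨p, hp⟩ => ⟨p ≫ fst _ _, p ≫ snd _ _, ?_⟩
      have hpp : p = lift (p ≫ fst _ _) (p ≫ snd _ _) := by ext <;> simp
      rw [← hpp]
      simpa [comp_lift, holds_and] using hp
    · refine fun h => h.mono fun k ⟨x, r, hx⟩ => ⟨lift x r, ?_⟩
      simpa [comp_lift, holds_and] using hx
  have key : ∀ {Γ : E} (V : Γ ⟶ Pow X) (f : Γ ⟶ 𝟙_ E) (A : Γ ⟶ Pow (X ⊗ T.R)),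
      Holds (lift A (lift V f) ≫ (T.isSubovert (fst (Pow (X ⊗ T.R)) (Pow X ⊗ 𝟙_ E)) ⋏
        all X fun y => y ∊ (fst (Pow X) (𝟙_ E))⇧⇧ ⟺ ex (X ⊗ T.R) fun p =>
          p ∊ (fst (Pow (X ⊗ T.R)) (Pow X ⊗ 𝟙_ E))⇧⇧ ⋏ rlt (rd d (p ≫ fst _ _) y⇧) (p ≫ snd _ _))) ↔
        Holds (T.isSubovert A) ∧ ∀ {Θ : E} (g : Θ ⟶ Γ) (y : Θ ⟶ X), Holds (y ∊ g ≫ V) ↔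
          Cov fun {Θ'} (k : Θ' ⟶ Θ) => ∃ (x : Θ' ⟶ X) (r : Θ' ⟶ T.R),
            Holds (lift x r ∊ (k ≫ g) ≫ A) ∧ rd d x (k ≫ y) ≪ r := by
    intro Γ V f A
    rw [comp_and, holds_and, comp_isSubovert, lift_fst, holds_comp_all]
    refine and_congr_right fun _ => ⟨fun h Θ g y => ?_, fun h Θ g y => ?_⟩
    · have := h g y
      rw [comp_iff, holds_iff] at this
      rw [← hball V f A g y, ← this, comp_mem]
      simp
    · rw [comp_iff, holds_iff]
      refine om_ext fun k => ?_
      rw [← Category.assoc, ← Category.assoc, comp_lift, ← Category.assoc, hball, comp_mem]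
      have := h (k ≫ g) (k ≫ y)
      simpa using this
  rw [isMetrized, holds_all]
  constructor
  · intro h Γ V hV
    have h1 := h (toUnit Γ) V
    rw [comp_imp, comp_isOpen, lift_fst] at h1
    refine (cov_of_comp_ex (h1.mp hV)).mono fun f ⟨A, hA⟩ => ⟨A, ?_⟩
    rw [comp_lift] at hA
    have h2 := (key _ _ _).1 hA
    refine ⟨h2.1, fun g y => ?_⟩
    rw [← h2.2 g y]
  · intro h Γ f V
    rw [comp_imp, comp_isOpen, lift_fst, holds_imp]
    intro Δ g hV
    rw [comp_isOpen] at hV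
    refine (h _ hV).holds fun k ⟨A, hA, hA'⟩ => ?_
    rw [← Category.assoc, ← Category.assoc]
    refine holds_comp_ex_intro A ?_
    rw [comp_lift]
    refine (key _ _ _).2 ⟨hA, fun i y => ?_⟩
    rw [← hA' i y]
    simp only [Category.assoc]

/-- An open subset of a subspace is locally the trace of an open subset. -/
theorem exists_isOpen_of_isSubspace {C : 𝟙_ E ⟶ Pow X} (hC : Holds (T.isSubspace C))
    {B : Γ ⟶ Pow X}
    (hB : ∀ {Δ : E} (f : Δ ⟶ Γ) (x : Δ ⟶ X), Holds (x ∊ f ≫ B) → Holds (x ∊ toUnit Δ ≫ C))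
    (hB' : ∀ {Δ : E} (f : Δ ⟶ Γ) (x : Δ ⟶ X), Holds (x ∊ toUnit Δ ≫ C) → Holds (T.op (x ∊ f ≫ B))) :
    Cov fun {Δ} (f : Δ ⟶ Γ) => ∃ V : Δ ⟶ Pow X, Holds (T.isOpen V) ∧
      ∀ {Θ : E} (g : Θ ⟶ Δ) (x : Θ ⟶ X), Holds (x ∊ toUnit Θ ≫ C) →
        (Holds (x ∊ g ≫ f ≫ B) ↔ Holds (x ∊ g ≫ V)) := by
  have h1 := holds_all.1 hC (toUnit Γ) B
  rw [comp_imp] at h1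
  refine (cov_of_comp_ex (h1.mp ?_)).mono fun f ⟨V, hV⟩ => ⟨V, ?_⟩
  · rw [comp_and, holds_and]
    constructor
    · refine holds_comp_all.2 fun f x => ?_
      rw [comp_imp, comp_mem, comp_mem, holds_imp]
      intro Θ g hg
      have h2 := hB (g ≫ f) (g ≫ x) (by simpa using hg)
      simpa using h2
    · refine holds_comp_all.2 fun f x => ?_
      rw [comp_imp, holds_imp]
      intro Θ g hg
      have h2 := hB' (g ≫ f) (g ≫ x) (by simpa using hg)
      rw [← Category.assoc, op, ← Category.assoc, comp_mem]
      simpa using h2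
  · rw [comp_and, holds_and, comp_isOpen, lift_fst] at hV
    refine ⟨hV.1, fun g x hx => ?_⟩
    have h2 := holds_comp_all.1 hV.2 g x
    rw [comp_iff, holds_iff] at h2
    have h3 : (x ∊ g ≫ f ≫ B) = (x ∊ toUnit _ ≫ C ⋏ x ∊ g ≫ V) := by simpa using h2
    rw [h3, holds_and]
    exact and_iff_right hx

/-- By cases on `p`, the statement is either false, hence open, or a single instance of `φ`. So one
may quantify over the value of a partial element without overtness of `X`. -/
theorem op_ex_part (p : Γ ⟶ Part X) {φ : X ⊗ Γ ⟶ Om E} (hφ : Holds (T.op φ)) :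
    Holds (T.op (ex X fun x => (x ≫ Part.some X) ≐ p⇧ ⋏ φ)) := by
  refine (Part.cases p).holds fun f hf => ?_
  rw [op, ← Category.assoc]
  rcases hf with hf | ⟨x, hx⟩
  · refine op_of_neg (holds_neg.2 fun g hg => ?_)
    rw [← Category.assoc] at hg
    rw [← comp_fls g]
    refine (cov_of_comp_ex hg).holds fun k ⟨y, hy⟩ => ?_
    rw [comp_and, holds_and, holds_comp_eqq] at hy
    have : y ≫ Part.some X = Part.none _ X := by simpa [hf] using hy.1
    exact holds_fls (Part.fls_of_eq this) _
  · have : (f ≫ ex X fun x => (x ≫ Part.some X) ≐ p⇧ ⋏ φ) = lift x f ≫ φ := by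
      refine om_ext fun g => ?_
      rw [← Category.assoc, holds_comp_ex]
      constructor
      · refine fun h => h.holds fun k ⟨y, hy⟩ => ?_
        rw [comp_and, holds_and, holds_comp_eqq] at hy
        have h1 : y ≫ Part.some X = (k ≫ g ≫ x) ≫ Part.some X := by simpa [hx] using hy.1
        have h2 := hy.2
        rw [Part.some_inj h1] at h2
        simpa [comp_lift_assoc] using h2
      · refine fun h => Cov.pure ⟨g ≫ x, ?_⟩
        rw [comp_and, holds_and, holds_comp_eqq]
        refine ⟨by simp [hx], ?_⟩
        simpa [comp_lift_assoc] using h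
    rw [this, Category.assoc]
    exact hφ.comp _

end SynthTopology

end Metrized

end SynTop

end

/-! ### Pulling back subovert families of balls -/

noncomputable section

namespace SynTop

section Balls

variable {E : Type u} [Category.{v} E] [CartesianMonoidalCategory E] [MonoidalClosed E]
  [Limits.HasFiniteLimits E] [HasSubobjectClassifier E]

local postfix:max "⇧" => wk
local infix:45 " ≐ " => eqq
local infixr:35 " ⋏ " => and
local infixr:25 " ⇛ " => imp
local infix:20 " ⟺ " => iff
local infix:50 " ∊ " => mem
local infixr:30 " ⋎ " => or

set_option linter.unusedSectionVars false
set_option linter.unusedSimpArgs false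

open NNO

namespace SynthTopology

variable {T : SynthTopology E} {Γ Δ X Y : E} {d : X ⊗ X ⟶ T.R}

local infix:50 " ≪ " => Slt

/-- Given a subovert family of balls in `Y` and a map `i : X ⟶ Y`, the balls of `X` with a rational
radius, centered at a term of a sequence, whose image lies in a ball of the family by virtue of the
triangle inequality form a subovert family. -/
theorem exists_isSubovert {e : Y ⊗ Y ⟶ T.R} (s : T.N ⟶ Part X) (i : X ⟶ Y) {A : Γ ⟶ Pow (Y ⊗ T.R)}
    (hA : Holds (T.isSubovert A)) :
    ∃ A' : Γ ⟶ Pow (X ⊗ T.R), Holds (T.isSubovert A') ∧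
      ∀ {Δ : E} (f : Δ ⟶ Γ) (x : Δ ⟶ X) (r : Δ ⟶ T.R), Holds (lift x r ∊ f ≫ A') ↔
        Cov fun {Θ} (g : Θ ⟶ Δ) => ∃ (m : Θ ⟶ T.N) (q : Θ ⟶ T.Q) (y : Θ ⟶ Y) (t : Θ ⟶ T.R),
          m ≫ s = (g ≫ x) ≫ Part.some X ∧ g ≫ r = rat q ∧ Holds (lift y t ∊ (g ≫ f) ≫ A) ∧
            rd e y ((g ≫ x) ≫ i) + rat q ≪ t := by
  -- the condition that relates a radius, a center and a ball of the given family
  let P : (Y ⊗ T.R) ⊗ (T.Q ⊗ X) ⊗ Γ ⟶ Om E :=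
    rlt (rd e (fst _ _ ≫ fst _ _) (snd _ _ ≫ fst _ _ ≫ snd _ _ ≫ i) +
      rat (snd _ _ ≫ fst _ _ ≫ fst _ _)) (fst _ _ ≫ snd _ _)
  let p : (T.Q ⊗ X) ⊗ Γ ⟶ Om E := ex (Y ⊗ T.R) fun w => w ∊ (snd _ _ ≫ A)⇧ ⋏ P
  have hp : ∀ {Δ : E} (f : Δ ⟶ Γ) (q : Δ ⟶ T.Q) (x : Δ ⟶ X), Holds (lift (lift q x) f ≫ p) ↔
      Cov fun {Θ} (g : Θ ⟶ Δ) => ∃ (y : Θ ⟶ Y) (t : Θ ⟶ T.R), Holds (lift y t ∊ (g ≫ f) ≫ A) ∧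
        rd e y ((g ≫ x) ≫ i) + rat (g ≫ q) ≪ t := by
    intro Δ f q x
    rw [holds_comp_ex]
    constructor
    · refine fun h => h.mono fun k ⟨w, hw⟩ => ⟨w ≫ fst _ _, w ≫ snd _ _, ?_⟩
      have hww : w = lift (w ≫ fst _ _) (w ≫ snd _ _) := by ext <;> simp
      rw [← hww]
      simpa [comp_lift, holds_and, P, comp_rat] using hw
    · refine fun h => h.mono fun k ⟨y, t, hy⟩ => ⟨lift y t, ?_⟩
      simpa [comp_lift, holds_and, P, comp_rat] using hy
  have hpo : Holds (T.op p) :=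
    op_ex_of_isSubovert (by rw [← comp_isSubovert]; exact hA.comp _) (op_rlt _ _)
  clear_value p
  let ψ : T.N ⊗ T.Q ⊗ (X ⊗ T.R) ⊗ Γ ⟶ Om E :=
    (fst _ _ ≫ s) ≐ (snd _ _ ≫ snd _ _ ≫ fst _ _ ≫ fst _ _ ≫ Part.some X) ⋏
      (snd _ _ ≫ snd _ _ ≫ fst _ _ ≫ snd _ _) ≐ rat (snd _ _ ≫ fst _ _) ⋏
        lift (lift (snd _ _ ≫ fst _ _) (snd _ _ ≫ snd _ _ ≫ fst _ _ ≫ fst _ _))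
          (snd _ _ ≫ snd _ _ ≫ snd _ _) ≫ p
  let A' : Γ ⟶ Pow (X ⊗ T.R) := sep (X ⊗ T.R) fun _ => ex T.Q fun _ => ex T.N fun _ => ψ
  have hA' : ∀ {Δ : E} (f : Δ ⟶ Γ) (x : Δ ⟶ X) (r : Δ ⟶ T.R), Holds (lift x r ∊ f ≫ A') ↔
      Cov fun {Θ} (g : Θ ⟶ Δ) => ∃ (m : Θ ⟶ T.N) (q : Θ ⟶ T.Q), m ≫ s = (g ≫ x) ≫ Part.some X ∧
        g ≫ r = rat q ∧ Holds (lift (lift q (g ≫ x)) (g ≫ f) ≫ p) := by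
    intro Δ f x r
    rw [mem_comp_sep, holds_comp_ex]
    constructor
    · refine fun h => h.bind fun g ⟨q, hq⟩ => (cov_of_comp_ex hq).mono fun k ⟨m, hm⟩ =>
        ⟨m, k ≫ q, ?_⟩
      simpa [ψ, comp_lift, comp_lift_assoc, holds_and, comp_rat] using hm
    · refine fun h => h.mono fun g ⟨m, q, h⟩ => ⟨q, holds_comp_ex_intro m ?_⟩
      simpa [ψ, comp_lift, comp_lift_assoc, holds_and, comp_rat] using h
  clear_value A'
  refine ⟨A', ?_, fun f x r => ?_⟩
  · refine holds_isSubovert.2 fun {Δ} f V hV => ?_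
    let φ : X ⊗ T.Q ⊗ T.N ⊗ Δ ⟶ Om E :=
      lift (lift (snd _ _ ≫ fst _ _) (fst _ _)) (snd _ _ ≫ snd _ _ ≫ snd _ _ ≫ f) ≫ p ⋏
        lift (fst _ _) (rat (snd _ _ ≫ fst _ _)) ∊ (snd _ _ ≫ snd _ _ ≫ snd _ _ ≫ V)
    have hφ : Holds (T.op φ) := by
      refine T.open_and _ _ ?_ ?_
      · rw [Category.assoc]
        exact hpo.comp _
      · have hV' : Holds (T.isOpen (snd X _ ≫ snd T.Q _ ≫ snd T.N Δ ≫ V)) := by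
          simp only [← comp_isOpen]
          exact ((hV.comp _).comp _).comp _
        simpa using holds_isOpen.1 hV' (𝟙 _) (lift (fst _ _) (rat (snd _ _ ≫ fst _ _)))
    -- The set `X ⊗ T.R` need not be overt. A ball of the new family is given by an index, a
    -- rational radius and at most one center belonging to the index, so the quantifier reduces to
    -- the overt sets `T.N` and `T.Q` and to `op_ex_part`.
    have h1 := op_ex_nat (φ := fun _ => ex T.Q fun _ => ex X fun x =>
      (x ≫ Part.some X) ≐ (snd T.Q (T.N ⊗ Δ) ≫ fst T.N Δ ≫ s)⇧ ⋏ φ) (op_ex_rat (op_ex_part _ hφ))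
    convert h1 using 2
    refine om_ext fun {Δ'} g => ?_
    rw [holds_comp_ex, holds_comp_ex]
    constructor
    · refine fun h => h.bind fun k ⟨w, hw⟩ => ?_
      have hww : w = lift (w ≫ fst _ _) (w ≫ snd _ _) := by ext <;> simp
      have h2 : Holds (w ∊ (k ≫ g ≫ f) ≫ A') ∧ Holds (w ∊ (k ≫ g) ≫ V) := by
        simpa [holds_and] using hw
      rw [hww, hA', ← hww] at h2
      refine h2.1.mono fun j ⟨m, q, h3, h4, h5⟩ =>
        ⟨m, holds_comp_ex_intro q (holds_comp_ex_intro (j ≫ w ≫ fst _ _) ?_)⟩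
      have h6 : lift (j ≫ w ≫ fst _ _) (rat q) = j ≫ w := by
        rw [← h4]
        ext <;> simp
      have h7 := h2.2.comp j
      rw [comp_mem, ← h6] at h7
      simp only [φ, comp_and, holds_and, holds_comp_eqq, comp_mem, comp_lift, comp_lift_assoc, comp_rat,
        lift_fst, lift_snd, lift_fst_assoc, lift_snd_assoc, Category.assoc] at h3 h5 h7 ⊢
      exact ⟨h3.symm, h5, h7⟩
    · refine fun h => h.bind fun k ⟨m, hm⟩ => (cov_of_comp_ex hm).bind fun j ⟨q, hq⟩ =>
        (cov_of_comp_ex hq).mono fun l ⟨x, hx⟩ => ⟨lift x (rat (l ≫ q)), ?_⟩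
      simp only [φ, comp_and, holds_and, holds_comp_eqq, comp_mem, comp_lift, comp_lift_assoc, comp_rat,
        lift_fst, lift_snd, lift_fst_assoc, lift_snd_assoc, Category.assoc] at hx ⊢
      refine ⟨?_, hx.2.2⟩
      have h8 := (hA' ((l ≫ j ≫ k ≫ g) ≫ f) x (rat (l ≫ q))).2
        (Cov.pure ⟨l ≫ j ≫ m, l ≫ q, by simpa using hx.1.symm, by simp, by simpa using hx.2.1⟩)
      simpa using h8
  · rw [hA']
    constructor
    · refine fun h => h.bind fun g ⟨m, q, h1, h2, h3⟩ => ((hp _ _ _).1 h3).mono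
        fun k ⟨y, t, h4, h5⟩ => ⟨k ≫ m, k ≫ q, y, t, ?_, ?_, ?_, ?_⟩
      · simp [h1]
      · simp [h2, comp_rat]
      · simpa using h4
      · simpa using h5
    · refine fun h => h.mono fun g ⟨m, q, y, t, h1, h2, h3, h4⟩ => ⟨m, q, h1, h2, ?_⟩
      exact (hp _ _ _).2 (Cov.pure ⟨y, t, by simpa using h3, by simpa using h4⟩)

end SynthTopology

end Balls

end SynTop

end

/-! ### Extending open subsets to the Urysohn space and transferring metrization -/

noncomputable section

namespace SynTop

section Preimage

variable {E : Type u} [Category.{v} E] [CartesianMonoidalCategory E] [MonoidalClosed E]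
  [Limits.HasFiniteLimits E] [HasSubobjectClassifier E]

local postfix:max "⇧" => wk
local infix:45 " ≐ " => eqq
local infixr:35 " ⋏ " => and
local infixr:25 " ⇛ " => imp
local infix:20 " ⟺ " => iff
local infix:50 " ∊ " => mem
local infixr:30 " ⋎ " => or

set_option linter.unusedSectionVars false
set_option linter.unusedSimpArgs false

open NNO

namespace SynthTopology

variable {T : SynthTopology E} {Γ X : E} {d : X ⊗ X ⟶ T.R}

local infix:50 " ≪ " => Slt

/-- An open subset of a complete separable metric space `X` is locally the preimage of an open subset
of a given Urysohn space under an isometry, provided that strongly located subsets are subspaces. -/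
theorem CMS.exists_isometry (U : T.UrysohnSpace)
    (hsub : ∀ C : 𝟙_ E ⟶ Pow U.carrier, Holds (T.isStronglyLocated U.d C) → Holds (T.isSubspace C))
    (X : T.CMS) :
    ∃ i : X.carrier ⟶ U.carrier, T.IsIsometry X.d U.d i ∧
      ∀ {Γ : E} (V : Γ ⟶ Pow X.carrier), Holds (T.isOpen V) → Cov fun {Δ} (f : Δ ⟶ Γ) =>
        ∃ W : Δ ⟶ Pow U.carrier, Holds (T.isOpen W) ∧ ∀ {Θ : E} (g : Θ ⟶ Δ) (x : Θ ⟶ X.carrier),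
          Holds (x ∊ g ≫ f ≫ V) ↔ Holds (x ≫ i ∊ g ≫ W) := by
  obtain ⟨i, C, κ, h, b, hi, hC, hhb, hiC, hib, hCi⟩ := X.exists_embedding U
  refine ⟨i, hi, fun {Γ} V hV => ?_⟩
  have hinj : ∀ {Δ : E} {x y : Δ ⟶ X.carrier}, x ≫ i = y ≫ i → x = y := by
    intro Δ x y hxy
    refine X.isMetric.eq_of_rd ?_
    rw [rd, ← hi, hxy]
    exact U.isMetric.rd_self _
  let B : Γ ⟶ Pow U.carrier := sep U.carrier fun y => ex X.carrier fun x => x ∊ V⇧⇧ ⋏ (x ≫ i) ≐ y⇧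
  have hB : ∀ {Δ : E} (f : Δ ⟶ Γ) (y : Δ ⟶ U.carrier), Holds (y ∊ f ≫ B) ↔
      Cov fun {Θ} (g : Θ ⟶ Δ) => ∃ x : Θ ⟶ X.carrier, Holds (x ∊ (g ≫ f) ≫ V) ∧ x ≫ i = g ≫ y := by
    intro Δ f y
    rw [mem_comp_sep, holds_comp_ex]
    constructor
    · refine fun h => h.mono fun g ⟨x, hx⟩ => ⟨x, ?_⟩
      simpa [holds_and, comp_lift] using hx
    · refine fun h => h.mono fun g ⟨x, hx⟩ => ⟨x, ?_⟩
      simpa [holds_and, comp_lift] using hx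
  clear_value B
  have hBi : ∀ {Δ : E} (f : Δ ⟶ Γ) (x : Δ ⟶ X.carrier), (x ≫ i ∊ f ≫ B) = (x ∊ f ≫ V) := by
    intro Δ f x
    refine om_ext fun g => ?_
    rw [comp_mem, comp_mem, ← Category.assoc g f, ← Category.assoc g f, hB]
    constructor
    · refine fun h => h.holds fun k ⟨y, hy, hy'⟩ => ?_
      have : y = k ≫ g ≫ x := hinj (by simpa using hy')
      rw [comp_mem, ← this]
      simpa using hy
    · exact fun h => Cov.pure ⟨g ≫ x, by simpa using h, by simp⟩
  refine (exists_isOpen_of_isSubspace (hsub C hC) (B := B) (fun f y hy => ?_)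
    (fun {Δ} f y hy => ?_)).mono fun f ⟨W, hW, hW'⟩ => ⟨W, hW, fun g x => ?_⟩
  · refine ((hB _ _).1 hy).holds fun g ⟨x, _, hx⟩ => ?_
    rw [comp_mem, ← hx]
    simpa using hiC (toUnit _) x
  · have hhb' : toUnit Δ ≫ h ≪ toUnit Δ ≫ b := hhb.comp (toUnit Δ)
    -- A point of `C` beyond the radius `h` is an image point, where membership in `B` amounts to
    -- membership in `V`. A point nearer than `b` is not an image point, so membership in `B` is
    -- false there. Both truth values are open.
    refine (hhb'.cov_cotrans (y ≫ κ)).holds fun g hg => ?_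
    rw [op, ← Category.assoc, comp_mem, ← Category.assoc]
    rcases hg with hg | hg
    · obtain ⟨x, hx⟩ := hCi (toUnit _) (g ≫ y) (by simpa using hy.comp g) (by simpa using hg)
      rw [← hx, hBi]
      exact holds_isOpen.1 hV _ _
    · refine op_of_neg (holds_neg.2 fun k hk => ?_)
      rw [comp_mem, ← Category.assoc k (g ≫ f), hB] at hk
      refine hk.holds fun l ⟨x, _, hx⟩ => ?_
      have h1 := hib x
      have h2 := hg.comp (l ≫ k)
      rw [hx] at h1
      simp only [Category.assoc, comp_toUnit_assoc] at h1 h2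
      rw [comp_fls]
      exact (slt_of_le_of_slt h1 h2).fls
  · rw [← hW' g _ (by simpa using hiC (toUnit _) x), ← Category.assoc g f B, hBi, Category.assoc]

/-- A space which embeds isometrically into a metrized space such that open subsets are locally
preimages of open subsets is metrized if it has a dense sequence of partial elements. -/
theorem isMetrized_of_isometry {Y : E} {e : Y ⊗ Y ⟶ T.R} (he : T.IsPseudometric e)
    (hd : T.IsPseudometric d) (hY : Holds (T.isMetrized e)) {s : T.N ⟶ Part X}
    (hs : ∀ {Γ : E} (x : Γ ⟶ X) (r : Γ ⟶ T.R), 0 ≪ r → Cov fun {Δ} (f : Δ ⟶ Γ) =>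
      ∃ (n : Δ ⟶ T.N) (y : Δ ⟶ X), n ≫ s = y ≫ Part.some X ∧ rd d (f ≫ x) y ≪ f ≫ r)
    {i : X ⟶ Y} (hi : T.IsIsometry d e i)
    (hopen : ∀ {Γ : E} (V : Γ ⟶ Pow X), Holds (T.isOpen V) → Cov fun {Δ} (f : Δ ⟶ Γ) =>
      ∃ W : Δ ⟶ Pow Y, Holds (T.isOpen W) ∧ ∀ {Θ : E} (g : Θ ⟶ Δ) (x : Θ ⟶ X),
        Holds (x ∊ g ≫ f ≫ V) ↔ Holds (x ≫ i ∊ g ≫ W)) :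
    Holds (T.isMetrized d) := by
  have hi' : ∀ {Γ : E} (x y : Γ ⟶ X), rd e (x ≫ i) (y ≫ i) = rd d x y := hi
  refine holds_isMetrized.2 fun V hV => (hopen V hV).bind fun f ⟨W, hW, hVW⟩ =>
    (holds_isMetrized.1 hY W hW).mono fun g ⟨A, hA, hWA⟩ => ?_
  obtain ⟨A', hA', hmem⟩ := exists_isSubovert (e := e) s i hA
  refine ⟨A', hA', fun k y => ?_⟩
  rw [Category.assoc, ← Category.assoc k, hVW, Category.assoc, hWA]
  constructor
  -- If `d(w, i y) + 2 * q < t` and the center `x` satisfies `d(y, x) < q`, then `d(w, i x) + q <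
  -- t`. So the ball of radius `q` about `x` belongs to the new family, and it contains `y`.
  · refine fun h => h.bind fun l ⟨w, t, hw, hwt⟩ => hwt.exists_gap.bind fun m ⟨q, hq, hqt⟩ =>
      (hs (m ≫ l ≫ y) _ hq).mono fun n ⟨j, x, hj, hx⟩ => ⟨x, n ≫ rat q, ?_, ?_⟩
    · refine (hmem _ _ _).2 (Cov.pure ⟨j, n ≫ q, n ≫ m ≫ w, n ≫ m ≫ t, by simpa using hj,
        by simp [comp_rat], ?_, ?_⟩)
      · simpa using (hw.comp m).comp n
      · have h1 := hqt.comp n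
        have h2 := he.rd_triangle (n ≫ m ≫ w) (n ≫ m ≫ l ≫ y ≫ i) (x ≫ i)
        have h3 := hi' (n ≫ m ≫ l ≫ y) x
        simp only [Category.assoc, Category.id_comp, comp_radd, comp_rd, comp_rat] at h1 h2 h3 hx ⊢
        rw [h3] at h2
        exact h1.lin (le_lin (add_le_add h2 hx.le) (by abel))
    · rw [hd.rd_comm]
      simpa using hx
  · refine fun h => h.bind fun l ⟨x, r, hx, hxr⟩ => ((hmem _ _ _).1 hx).mono
      fun m ⟨j, q, w, t, _, hr, hw, hwt⟩ => ⟨w, t, by simpa using hw, ?_⟩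
    have h1 := hxr.comp m
    rw [hr] at h1
    have h2 := he.rd_triangle w ((m ≫ x) ≫ i) (m ≫ l ≫ y ≫ i)
    have h3 := hi' (m ≫ x) (m ≫ l ≫ y)
    simp only [Category.assoc, comp_rd] at h1 h2 h3 hwt ⊢
    rw [h3] at h2
    exact hwt.lin (le_lin (add_le_add h2 h1.le) (by abel))

end SynthTopology

end Preimage

end SynTop

end

/-! ### The theorem on complete separable metric spaces -/

theorem theorem4p56 {E : Type u} [Category.{v} E] [CartesianMonoidalCategory E] [MonoidalClosed E]
    [Limits.HasFiniteLimits E] [HasSubobjectClassifier E] (T : SynTop.SynthTopology E)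
    -- strongly located subsets of metric spaces are subspaces
    (hsub : ∀ (Y : E) (d : Y ⊗ Y ⟶ T.R), T.IsMetric d → ∀ A : 𝟙_ E ⟶ SynTop.Pow Y,
      SynTop.Holds (T.isStronglyLocated d A) → SynTop.Holds (T.isSubspace A))
    -- some Urysohn space is metrized
    (U : T.UrysohnSpace) (hU : SynTop.Holds (T.isMetrized U.d))
    (X : T.CMS) :
    SynTop.Holds (T.isMetrized X.d) := by
  obtain ⟨i, hi, hopen⟩ := SynTop.SynthTopology.CMS.exists_isometry U
    (fun C => hsub U.carrier U.d U.isMetric C) X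
  obtain ⟨s, hs⟩ := X.isSeparating.exists_seq
  exact SynTop.SynthTopology.isMetrized_of_isometry U.isMetric.toIsPseudometric
    X.isMetric.toIsPseudometric hU hs hi hopen
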